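/- **Conventions.** Let $M$ be a smooth 8-manifold with a ${\rm Spin}(7)$ structure, i.e. a smooth 4-form $\Phi$ that at each point is a Cayley form, with the metric $g$ it determines; the sign is such that $\Phi_{ijpq}\Phi_{ab}{}^{pq}=6g_{ia}g_{jb}-6g_{ib}g_{ja}-4\Phi_{ijab}$. Indices are raised with $g$, $\nabla$ is the Levi-Civita connection, brackets denote (anti)symmetrisation with weight one, $R_{ab}$ is the Ricci tensor (positive on round spheres), $R=g^{ab}R_{ab}$, and $|t|^2=t_{abc}t^{abc}$ for 3-forms. Put $J_2(\beta)_{ij}=\tfrac12\Phi_{ij}{}^{pq}\beta_{pq}$, $\Lambda^2_7=\{J_2=-3\}$, $J_3(t)_{ijk}=\tfrac32\Phi_{[ij}{}^{pq}t_{k]pq}$, $\pi_{48}=\tfrac67({\mathbb I}+\tfrac16J_3)$, $J_4(\sigma)_{ijkl}=3\Phi_{[ij}{}^{pq}\sigma_{kl]pq}$; $\Lambda^4_1,\Lambda^4_7,\Lambda^4_{27},\Lambda^4_{35}$ are the eigenspaces of $J_4$ for $-12,-6,2,0$, with projections $\pi_1,\pi_7,\pi_{27},\pi_{35}$, and $\pi_{1+7+35}={\mathbb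 I}-\pi_{27}$. **Torsion.** There is exactly one 3-form $T$ with $\nabla_a\Phi_{bcde}=4T_{a[b}{}^p\Phi_{|p|cde]}$. It is smooth. Put $T_{a;ij}=\tfrac14T_{aij}-\tfrac18\Phi_{ij}{}^{kl}T_{akl}$. **Projection.** At each point put $V=S^2\oplus\Lambda^2_7$, of dimension $36+7=43$. For a 4-form $\sigma$, the contraction $c(\sigma)_{ab}=\Phi_b{}^{pqr}\sigma_{apqr}$ lies in $V$, every element of $V$ is of this form, and $\pi_{1+7+35}\sigma=0\iff c(\sigma)=0$. Moreover $\pi_1\sigma+\pi_{35}\sigma=0\iff c(\sigma)_{(ab)}=0$, and $\pi_7\sigma=0\iff c(\sigma)_{[ab]}=0$. **General $\kappa$.** For $\kappa,\Lambda\in{\mathbb R}$ and a smooth 3-form $C$ (in the theory, the auxiliary field), the field equation is $\pi_{1+7+35}E=0$, where, with $Y=\Phi^{ijkl}C_{ij}{}^pC_{klp}$, $$E_{abcd}=\partial_{[a}C_{bcd]}-\tfrac32C_{[ab}{}^pC_{cd]p}-\tfrac18\Phi^{ijkl}C_{ij[a}C_{|kle|}\Phi^e{}_{bcd]}+\tfrac{3}{224}Y\Phi_{abcd}-\tfrac1{168}\Phi_{abcd}\big(\Phi^{ijkl}\partial_iC_{jkl}-\tfrac32Y+\kappa|C|^2+\Lambda\big).$$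 Let $E'$ be $E$ with the last two terms replaced by $\tfrac1{56}Y\Phi_{abcd}+\tfrac1{168}(\Lambda+\kappa|C|^2)\Phi_{abcd}$. Then at each point $\pi_{1+7+35}E=0\iff\pi_{1+7+35}E'=0\iff c(E')=0$, and $$c(E')_{ab}=\tfrac14\Phi_b{}^{pqr}\nabla_aC_{pqr}-\tfrac34\Phi_b{}^{pqr}\nabla_rC_{apq}-\tfrac32\Phi_b{}^{pqr}C_{ap}{}^sC_{qrs}-\tfrac34\Phi^{pqrs}C_{apq}C_{brs}+\tfrac14g_{ab}\big(\Lambda+\kappa|C|^2+\tfrac34Y\big)\in V.$$ In this formula $\nabla$ may be replaced by $\partial$. **The case $\kappa=0$, $C=T$, $\Lambda=2\lambda$.** With $Y=\Phi^{ijkl}T_{ij}{}^pT_{klp}$ and $(TT)_{ab}=\Phi^{ijkl}T_{ija}T_{klb}-\tfrac17g_{ab}Y$ we have $E'_{abcd}=\partial_{[a}T_{bcd]}-\tfrac32T_{[ab}{}^pT_{cd]p}-\tfrac18(TT)_{[a|e|}\Phi^e{}_{bcd]}+\tfrac\lambda{84}\Phi_{abcd}$. Its projection vanishes iff $F_{ab}=0$,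 where (with $\nabla$ again replaceable by $\partial$) $$F_{ab}=c(E')_{ab}=\tfrac14\Phi_b{}^{pqr}\nabla_aT_{pqr}-\tfrac34\Phi_b{}^{pqr}\nabla_rT_{apq}-\tfrac32\Phi_b{}^{pqr}T_{ap}{}^sT_{qrs}-\tfrac34\Phi^{pqrs}T_{apq}T_{brs}+\tfrac12g_{ab}\big(\lambda+\tfrac38Y\big).$$ At every point: 1. $F_{[ab]}\in\Lambda^2_7$, and $F_{[ab]}=0\iff\nabla^rT_{r;ab}=0$. 2. $g^{ab}F_{ab}=0\iff R=\tfrac76|\pi_{48}T|^2+4\lambda$. 3. $F_{(ab)}=0\iff 3R_{ab}=-\Phi_{(a}{}^{pqr}\nabla_{b)}T_{pqr}+3T_a{}^{pq}T_{bpq}-\tfrac32\Phi^{pqrs}T_{apq}T_{brs}+\tfrac38g_{ab}Y+\lambda g_{ab}.$ **Independence.** The 43 equations $F_{ab}=0$ are independent, and $F$ is not automatically symmetric: for every $\lambda$, every element of $V$ at $0\in{\mathbb R}^8$ (with respect to the standard Cayley form $\Phi_0$ and the Euclidean metric $\delta$) is the value $F(0)$ for some ${\rm Spin}(7)$ structure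 on a neighbourhood of $0$ with $\Phi(0)=\Phi_0$, $g(0)=\delta$; and $V$ contains non-symmetric elements. **Solutions need not be Einstein.** There are a non-empty open $U\subset{\mathbb R}^8$ and a ${\rm Spin}(7)$ structure on $U$ solving the $\kappa=0$ field equations (with $\lambda=0$) such that at no point of $U$ the Ricci tensor is a multiple of $g$. -/

import Mathlib

open scoped Manifold ContDiff

noncomputable section

namespace Spin7

/-- The model space `ℝ⁸`. -/
abbrev E8 := EuclideanSpace ℝ (Fin 8)

/-- Components of tensors of rank 2, 3, 4 (all index positions are explicit in the formulas). -/
abbrev T2 := Fin 8 → Fin 8 → ℝ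
abbrev T3 := Fin 8 → Fin 8 → Fin 8 → ℝ
abbrev T4 := Fin 8 → Fin 8 → Fin 8 → Fin 8 → ℝ

/-! ### Pointwise algebra -/

/-- Totally antisymmetric rank 3 components, i.e. components of a 3-form. -/
def IsAlt3 (t : T3) : Prop :=
  (∀ a b c, t b a c = -t a b c) ∧ (∀ a b c, t a c b = -t a b c)

/-- Totally antisymmetric rank 4 components, i.e. components of a 4-form. -/
def IsAlt4 (t : T4) : Prop :=
  (∀ a b c d, t b a c d = -t a b c d) ∧ (∀ a b c d, t a c b d = -t a b c d) ∧
    (∀ a b c d, t a b d c = -t a b c d)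

/-- Antisymmetrisation `t_{[abcd]}` with weight one. -/
def alt4 (t : T4) : T4 := fun a b c d =>
  (1 / 24 : ℝ) * ∑ σ : Equiv.Perm (Fin 4), ((Equiv.Perm.sign σ : ℤ) : ℝ) *
    t (![a, b, c, d] (σ 0)) (![a, b, c, d] (σ 1)) (![a, b, c, d] (σ 2)) (![a, b, c, d] (σ 3))

/-- The fourteen terms of the standard Cayley form on `ℝ⁸`. -/
def cayleyTerms : List (ℤ × (Fin 4 → Fin 8)) :=
  [(-1, ![0, 1, 2, 3]), (-1, ![0, 1, 4, 5]), (-1, ![0, 1, 6, 7]), (-1, ![0, 2, 4, 6]),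
   (1, ![0, 2, 5, 7]), (1, ![0, 3, 4, 7]), (1, ![0, 3, 5, 6]), (1, ![1, 2, 4, 7]),
   (1, ![1, 2, 5, 6]), (1, ![1, 3, 4, 6]), (-1, ![1, 3, 5, 7]), (-1, ![2, 3, 4, 5]),
   (-1, ![2, 3, 6, 7]), (-1, ![4, 5, 6, 7])]

/-- The standard Cayley form, the sum of `± e^i ∧ e^j ∧ e^k ∧ e^l` over `cayleyTerms`. The overall
sign is the one for which `Φ_{ijpq} Φ_{abpq} = 6 δ_{ia} δ_{jb} - 6 δ_{ib} δ_{ja} - 4 Φ_{ijab}`. -/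
def cayley0 : T4 := fun i j k l =>
  (((cayleyTerms.map fun t =>
    t.1 * Matrix.det (Matrix.of fun m n : Fin 4 =>
      if t.2 m = ![i, j, k, l] n then (1 : ℤ) else 0)).sum : ℤ) : ℝ)

/-- The Euclidean metric of `ℝ⁸`. -/
def delta : T2 := fun i j => if i = j then 1 else 0

/-- The rows of `A` are a coframe in which the 4-form `φ` is the standard Cayley form and the
metric `γ` is the Euclidean one. As the stabiliser `Spin(7)` of the standard Cayley form lies in
`SO(8)`, this makes `γ` the metric determined by `φ`. -/
def IsAdapted (A : Matrix (Fin 8) (Fin 8) ℝ) (φ : T4) (γ : T2) : Prop :=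
  A.det ≠ 0 ∧ (∀ i j, γ i j = ∑ m, A m i * A m j) ∧
    ∀ i j k l, φ i j k l =
      ∑ m, ∑ n, ∑ p, ∑ q, A m i * A n j * A p k * A q l * cayley0 m n p q

/-- The inverse metric `g^{ij}`. -/
def ginv (γ : T2) : T2 := fun i j => (Matrix.of γ)⁻¹ i j

/-- `Φ^p{}_{bcd}` -/
def phiU (γ : T2) (φ : T4) : T4 := fun p b c d => ∑ p', ginv γ p p' * φ p' b c d

/-- `Φ_{ij}{}^{pq}` -/
def phiUU (γ : T2) (φ : T4) : T4 := fun i j p q =>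
  ∑ p', ∑ q', ginv γ p p' * ginv γ q q' * φ i j p' q'

/-- `Φ_b{}^{pqr}` -/
def phiUUU (γ : T2) (φ : T4) : T4 := fun b p q r =>
  ∑ p', ∑ q', ∑ r', ginv γ p p' * ginv γ q q' * ginv γ r r' * φ b p' q' r'

/-- `Φ^{pqrs}` -/
def phiUUUU (γ : T2) (φ : T4) : T4 := fun p q r s =>
  ∑ p', ginv γ p p' * phiUUU γ φ p' q r s

/-- `J₂(β)_{ij} = ½ Φ_{ij}{}^{ab} β_{ab}` -/
def J2 (γ : T2) (φ : T4) (β : T2) : T2 := fun i j =>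
  (1 / 2 : ℝ) * ∑ a, ∑ b, phiUU γ φ i j a b * β a b

/-- `J₃(t)_{ijk} = ½ (Φ_{ij}{}^{pq} t_{kpq} + Φ_{jk}{}^{pq} t_{ipq} + Φ_{ki}{}^{pq} t_{jpq})` -/
def J3 (γ : T2) (φ : T4) (t : T3) : T3 := fun i j k =>
  (1 / 2 : ℝ) * ∑ p, ∑ q, (phiUU γ φ i j p q * t k p q + phiUU γ φ j k p q * t i p q
    + phiUU γ φ k i p q * t j p q)

/-- `J₄(σ)_{ijkl} = 3 Φ_{[ij}{}^{pq} σ_{kl]pq}`, with eigenvalues `-12, -6, 2, 0` on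
`Λ⁴_1, Λ⁴_7, Λ⁴_27, Λ⁴_35`. -/
def J4 (γ : T2) (φ : T4) (σ : T4) : T4 :=
  alt4 fun i j k l => 3 * ∑ p, ∑ q, phiUU γ φ i j p q * σ k l p q

/-- `π₄₈ = (6/7) (1 + J₃/6)`, the projection of 3-forms onto `Λ³_48`. -/
def proj48 (γ : T2) (φ : T4) (t : T3) : T3 := (6 / 7 : ℝ) • (t + (1 / 6 : ℝ) • J3 γ φ t)

/-- The projections of 4-forms onto the eigenspaces of `J₄`, as Lagrange polynomials in `J₄`:
`π₁ = -J₄(J₄+6)(J₄-2)/1008`, `π₇ = J₄(J₄+12)(J₄-2)/288`, `π₂₇ = J₄(J₄+12)(J₄+6)/224`,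
`π₃₅ = -(J₄+12)(J₄+6)(J₄-2)/144`. -/
def proj1 (γ : T2) (φ : T4) (σ : T4) : T4 :=
  (-1 / 1008 : ℝ) • (J4 γ φ (J4 γ φ (J4 γ φ σ)) + (4 : ℝ) • J4 γ φ (J4 γ φ σ)
    - (12 : ℝ) • J4 γ φ σ)
def proj7 (γ : T2) (φ : T4) (σ : T4) : T4 :=
  (1 / 288 : ℝ) • (J4 γ φ (J4 γ φ (J4 γ φ σ)) + (10 : ℝ) • J4 γ φ (J4 γ φ σ)
    - (24 : ℝ) • J4 γ φ σ)
def proj27 (γ : T2) (φ : T4) (σ : T4) : T4 :=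
  (1 / 224 : ℝ) • (J4 γ φ (J4 γ φ (J4 γ φ σ)) + (18 : ℝ) • J4 γ φ (J4 γ φ σ)
    + (72 : ℝ) • J4 γ φ σ)
def proj35 (γ : T2) (φ : T4) (σ : T4) : T4 :=
  (-1 / 144 : ℝ) • (J4 γ φ (J4 γ φ (J4 γ φ σ)) + (16 : ℝ) • J4 γ φ (J4 γ φ σ)
    + (36 : ℝ) • J4 γ φ σ - (144 : ℝ) • σ)

/-- The projection onto `Λ⁴_{1+7+35}`, the complement of `Λ⁴_27`. -/
def projTangent (γ : T2) (φ : T4) (σ : T4) : T4 := σ - proj27 γ φ σ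

/-- The contraction `Φ_b{}^{pqr} σ_{apqr}`. -/
def contract (γ : T2) (φ : T4) (σ : T4) : T2 := fun a b =>
  ∑ p, ∑ q, ∑ r, phiUUU γ φ b p q r * σ a p q r

/-- `B_{(ab)}` and `B_{[ab]}`. -/
def symPart (B : T2) : T2 := fun a b => (1 / 2 : ℝ) * (B a b + B b a)
def skewPart (B : T2) : T2 := fun a b => (1 / 2 : ℝ) * (B a b - B b a)

/-- The trace `g^{ab} B_{ab}`. -/
def trace (γ : T2) (B : T2) : ℝ := ∑ a, ∑ b, ginv γ a b * B a b

/-- The symmetric rank 2 tensors. -/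
def symTensors : Submodule ℝ T2 where
  carrier := {B | ∀ a b, B a b = B b a}
  add_mem' := fun {x y} hx hy a b => by
    simp only [Pi.add_apply]; rw [hx a b, hy a b]
  zero_mem' := fun _ _ => rfl
  smul_mem' := fun c x hx a b => by
    simp only [Pi.smul_apply]; rw [hx a b]

/-- `Λ²_7`: the 2-forms with `J₂ β = -3 β`. -/
def Lambda2_7 (γ : T2) (φ : T4) : Submodule ℝ T2 where
  carrier := {β | (∀ a b, β b a = -β a b) ∧ ∀ a b, J2 γ φ β a b = -3 * β a b}
  add_mem' := fun {x y} hx hy => by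
    refine ⟨fun a b => ?_, fun a b => ?_⟩
    · simp only [Pi.add_apply]; rw [hx.1 a b, hy.1 a b]; ring
    · have h : J2 γ φ (x + y) a b = J2 γ φ x a b + J2 γ φ y a b := by
        simp only [J2, Pi.add_apply, mul_add, Finset.sum_add_distrib]
      rw [h, hx.2, hy.2]; simp only [Pi.add_apply]; ring
  zero_mem' := by
    refine ⟨fun a b => by simp, fun a b => by simp [J2]⟩
  smul_mem' := fun c x hx => by
    refine ⟨fun a b => ?_, fun a b => ?_⟩
    · simp only [Pi.smul_apply, smul_eq_mul]; rw [hx.1 a b]; ring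
    · have h : J2 γ φ (c • x) a b = c * J2 γ φ x a b := by
        simp only [J2, Pi.smul_apply, smul_eq_mul, Finset.mul_sum]
        refine Finset.sum_congr rfl fun i _ => Finset.sum_congr rfl fun j _ => ?_
        ring
      rw [h, hx.2]; simp only [Pi.smul_apply, smul_eq_mul]; ring

/-- The rank 2 tensors whose antisymmetric part lies in `Λ²_7` (and whose symmetric part is
arbitrary). -/
def valueSpace (γ : T2) (φ : T4) : Submodule ℝ T2 := symTensors ⊔ Lambda2_7 γ φ

/-- `t_{ab}{}^p t_{cdp}` -/
def quad (γ : T2) (t : T3) : T4 := fun a b c d =>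
  ∑ p, ∑ q, ginv γ p q * t a b p * t c d q

/-- `Φ^{ijkl} t_{ija} t_{klb}` -/
def quadSym (γ : T2) (φ : T4) (t : T3) : T2 := fun a b =>
  ∑ i, ∑ j, ∑ k, ∑ l, phiUUUU γ φ i j k l * t i j a * t k l b

/-- `Φ^{ijkl} t_{ij}{}^p t_{klp}` -/
def quadScalar (γ : T2) (φ : T4) (t : T3) : ℝ :=
  ∑ i, ∑ j, ∑ k, ∑ l, phiUUUU γ φ i j k l * quad γ t i j k l

/-- `t_a{}^{pq} t_{bpq}` -/
def sqTensor (γ : T2) (t : T3) : T2 := fun a b =>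
  ∑ p, ∑ q, ∑ p', ∑ q', ginv γ p p' * ginv γ q q' * t a p q * t b p' q'

/-- `|t|² = t_{abc} t^{abc}` (sum over all indices, no factor `1/3!`). -/
def normSq (γ : T2) (t : T3) : ℝ := trace γ (sqTensor γ t)

/-! ### Differential operators in a coordinate domain -/

/-- The partial derivative `∂_a f`. -/
def pd (a : Fin 8) (f : E8 → ℝ) (x : E8) : ℝ := fderiv ℝ f x (EuclideanSpace.single a 1)

/-- `∂_a t_{bcd}` -/
def partial3 (t : E8 → T3) (x : E8) : T4 := fun a b c d => pd a (fun y => t y b c d) x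

/-- The Christoffel symbols `Γ^k_{ij}` of the Levi-Civita connection. -/
def christoffel (g : E8 → T2) (x : E8) : T3 := fun k i j =>
  (1 / 2 : ℝ) * ∑ l, ginv (g x) k l *
    (pd i (fun y => g y j l) x + pd j (fun y => g y i l) x - pd l (fun y => g y i j) x)

/-- The covariant derivative `∇_a t_{bcd}`. -/
def nabla3 (g : E8 → T2) (t : E8 → T3) (x : E8) : T4 := fun a b c d =>
  pd a (fun y => t y b c d) x - ∑ p, (christoffel g x p a b * t x p c d
    + christoffel g x p a c * t x b p d + christoffel g x p a d * t x b c p)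

/-- The covariant derivative `∇_a φ_{bcde}`. -/
def nabla4 (g : E8 → T2) (φ : E8 → T4) (x : E8) (a : Fin 8) : T4 := fun b c d e =>
  pd a (fun y => φ y b c d e) x - ∑ p, (christoffel g x p a b * φ x p c d e
    + christoffel g x p a c * φ x b p d e + christoffel g x p a d * φ x b c p e
    + christoffel g x p a e * φ x b c d p)

/-- The Ricci tensor, `R_{bc} = ∂_k Γ^k_{cb} - ∂_c Γ^k_{kb} + Γ^k_{km} Γ^m_{cb} - Γ^k_{cm} Γ^m_{kb}`
(positive on round spheres). -/
def ricci (g : E8 → T2) (x : E8) : T2 := fun b c =>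
  ∑ k, (pd k (fun y => christoffel g y k c b) x - pd c (fun y => christoffel g y k k b) x
    + ∑ m, (christoffel g x k k m * christoffel g x m c b
      - christoffel g x k c m * christoffel g x m k b))

/-- The scalar curvature. -/
def scalarCurvature (g : E8 → T2) (x : E8) : ℝ := trace (g x) (ricci g x)

/-! ### Spin(7) structures and their torsion -/

/-- On `U`, `Φ` is a smooth 4-form which at every point is a Cayley form, and `g` is the
(smooth Riemannian) metric determined by `Φ`. -/
def IsSpin7On (U : Set E8) (Φ : E8 → T4) (g : E8 → T2) : Prop :=
  ContDiffOn ℝ ∞ Φ U ∧ ContDiffOn ℝ ∞ g U ∧ ∀ x ∈ U, ∃ A, IsAdapted A (Φ x) (g x)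

/-- `t` is the value at `x` of the torsion 3-form: it is totally antisymmetric and
`∇_a Φ_{bcde} = 4 t_{a[b}{}^p Φ_{|p|cde]}`. -/
def IsTorsionAt (Φ : E8 → T4) (g : E8 → T2) (x : E8) (t : T3) : Prop :=
  IsAlt3 t ∧ ∀ a b c d e, nabla4 g Φ x a b c d e =
    alt4 (fun b c d e => 4 * ∑ p, t a b p * phiU (g x) (Φ x) p c d e) b c d e

/-- The torsion viewed in `Λ¹ ⊗ Λ²_7`: `T_{a;ij} = ¼ T_{aij} - ⅛ Φ_{ij}{}^{kl} T_{akl}`. -/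
def torsion7 (Φ : E8 → T4) (g : E8 → T2) (T : E8 → T3) (x : E8) : T3 := fun a i j =>
  (1 / 4 : ℝ) * T x a i j - (1 / 8 : ℝ) * ∑ k, ∑ l, phiUU (g x) (Φ x) i j k l * T x a k l

/-- The divergence `∇^r T_{r;ab}`. -/
def divTorsion7 (Φ : E8 → T4) (g : E8 → T2) (T : E8 → T3) (x : E8) : T2 := fun a b =>
  ∑ r, ∑ s, ginv (g x) r s * nabla3 g (torsion7 Φ g T) x s r a b

/-- Components in the chart `e` of a 4-form on a manifold. -/
def chart4 {M : Type*} [TopologicalSpace M] [ChartedSpace E8 M]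
    (e : OpenPartialHomeomorph M E8)
    (w : ∀ x : M, (TangentSpace (𝓡 8) x) [⋀^Fin 4]→ₗ[ℝ] ℝ) (y : E8) : T4 := fun i j k l =>
  w (e.symm y) fun m =>
    mfderiv (𝓡 8) (𝓡 8) e.symm y (EuclideanSpace.single (![i, j, k, l] m) (1 : ℝ))

/-- Components in the chart `e` of a field of bilinear forms on a manifold. -/
def chart2 {M : Type*} [TopologicalSpace M] [ChartedSpace E8 M]
    (e : OpenPartialHomeomorph M E8)
    (b : ∀ x : M, TangentSpace (𝓡 8) x →ₗ[ℝ] TangentSpace (𝓡 8) x →ₗ[ℝ] ℝ) (y : E8) : T2 :=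
  fun i j => b (e.symm y) (mfderiv (𝓡 8) (𝓡 8) e.symm y (EuclideanSpace.single i (1 : ℝ)))
    (mfderiv (𝓡 8) (𝓡 8) e.symm y (EuclideanSpace.single j (1 : ℝ)))

/-- A `Spin(7)` structure on an 8-manifold: a Cayley 4-form together with the metric that it
determines. -/
structure Spin7Structure (M : Type*) [TopologicalSpace M] [ChartedSpace E8 M] where
  form : ∀ x : M, (TangentSpace (𝓡 8) x) [⋀^Fin 4]→ₗ[ℝ] ℝ
  metric : ∀ x : M, TangentSpace (𝓡 8) x →ₗ[ℝ] TangentSpace (𝓡 8) x →ₗ[ℝ] ℝ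
  isSpin7 : ∀ e ∈ atlas E8 M, IsSpin7On e.target (chart4 e form) (chart2 e metric)

/-! ### The field equations -/

/-- The 4-form `E_{abcd}` of the field equations with parameters `κ` and `Λ`:
`∂_{[a}C_{bcd]} - (3/2) C_{[ab}{}^p C_{cd]p} - (1/8) Φ^{ijkl} C_{ij[a} C_{|kle|} Φ^e{}_{bcd]}`
`+ (3/224) Φ^{ijkl} C_{ij}{}^p C_{klp} Φ_{abcd}`
`- (1/168) Φ_{abcd} (Φ^{ijkl} (∂_i C_{jkl} - (3/2) C_{ij}{}^p C_{klp}) + κ |C|² + Λ)`. -/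
def eulerForm (κ Λ : ℝ) (Φ : E8 → T4) (g : E8 → T2) (C : E8 → T3) (x : E8) : T4 :=
  alt4 (fun a b c d => partial3 C x a b c d - (3 / 2 : ℝ) * quad (g x) (C x) a b c d
      - (1 / 8 : ℝ) * ∑ e, quadSym (g x) (Φ x) (C x) a e * phiU (g x) (Φ x) e b c d)
    + ((3 / 224 : ℝ) * quadScalar (g x) (Φ x) (C x)
      - (1 / 168 : ℝ) * ((∑ i, ∑ j, ∑ k, ∑ l, phiUUUU (g x) (Φ x) i j k l *
          (partial3 C x i j k l - (3 / 2 : ℝ) * quad (g x) (C x) i j k l))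
        + κ * normSq (g x) (C x) + Λ)) • Φ x

/-- The 4-form `E'_{abcd}`, obtained from `E_{abcd}` by simplifying the multiple of `Φ` with the
help of the trace of the equations:
`∂_{[a}C_{bcd]} - (3/2) C_{[ab}{}^p C_{cd]p} - (1/8) Φ^{ijkl} C_{ij[a} C_{|kle|} Φ^e{}_{bcd]}`
`+ (1/56) Φ_{abcd} Φ^{ijkl} C_{ij}{}^p C_{klp} + (1/168) Φ_{abcd} (Λ + κ |C|²)`. -/
def eulerForm' (κ Λ : ℝ) (Φ : E8 → T4) (g : E8 → T2) (C : E8 → T3) (x : E8) : T4 :=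
  alt4 (fun a b c d => partial3 C x a b c d - (3 / 2 : ℝ) * quad (g x) (C x) a b c d
      - (1 / 8 : ℝ) * ∑ e, quadSym (g x) (Φ x) (C x) a e * phiU (g x) (Φ x) e b c d)
    + ((1 / 56 : ℝ) * quadScalar (g x) (Φ x) (C x)
      + (1 / 168 : ℝ) * (Λ + κ * normSq (g x) (C x))) • Φ x

/-- The tensor
`¼ Φ_b{}^{pqr} D_a C_{pqr} - ¾ Φ_b{}^{pqr} D_r C_{apq} - (3/2) Φ_b{}^{pqr} C_{ap}{}^s C_{qrs}`
`- ¾ Φ^{pqrs} C_{apq} C_{brs} + ¼ g_{ab} (Λ + κ |C|² + ¾ Φ^{pqrs} C_{pq}{}^t C_{rst})`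
where `D_{abcd}` is the array of first derivatives `D_a C_{bcd}` of `C`. -/
def fieldTensor (κ Λ : ℝ) (γ : T2) (φ : T4) (C : T3) (D : T4) : T2 := fun a b =>
  (1 / 4 : ℝ) * (∑ p, ∑ q, ∑ r, phiUUU γ φ b p q r * D a p q r)
  - (3 / 4 : ℝ) * (∑ p, ∑ q, ∑ r, phiUUU γ φ b p q r * D r a p q)
  - (3 / 2 : ℝ) * (∑ p, ∑ q, ∑ r, phiUUU γ φ b p q r * quad γ C a p q r)
  - (3 / 4 : ℝ) * (∑ p, ∑ q, ∑ r, ∑ s, phiUUUU γ φ p q r s * C a p q * C b r s)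
  + (1 / 4 : ℝ) * γ a b * (Λ + κ * normSq γ C + (3 / 4 : ℝ) * quadScalar γ φ C)

/-- For `κ = 0` and `C = T`, the symmetric tensor
`(TT)_{ab} = Φ^{ijkl} T_{ija} T_{klb} - (1/7) g_{ab} Φ^{ijkl} T_{ij}{}^p T_{klp}`. -/
def quadTT (γ : T2) (φ : T4) (t : T3) : T2 := fun a b =>
  quadSym γ φ t a b - (1 / 7 : ℝ) * γ a b * quadScalar γ φ t

/-- For `κ = 0` and `C = T`, the 4-form
`∂_{[a}T_{bcd]} - (3/2) T_{[ab}{}^p T_{cd]p} - (1/8) (TT)_{[a|e|} Φ^e{}_{bcd]} + (λ/84) Φ_{abcd}`. -/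
def torsionForm (lam : ℝ) (Φ : E8 → T4) (g : E8 → T2) (T : E8 → T3) (x : E8) : T4 :=
  alt4 (fun a b c d => partial3 T x a b c d - (3 / 2 : ℝ) * quad (g x) (T x) a b c d
      - (1 / 8 : ℝ) * ∑ e, quadTT (g x) (Φ x) (T x) a e * phiU (g x) (Φ x) e b c d)
    + (lam / 84) • Φ x

/-- For `κ = 0` and `C = T`, the tensor
`¼ Φ_b{}^{pqr} D_a T_{pqr} - ¾ Φ_b{}^{pqr} D_r T_{apq} - (3/2) Φ_b{}^{pqr} T_{ap}{}^s T_{qrs}`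
`- ¾ Φ^{pqrs} T_{apq} T_{brs} + ½ g_{ab} (λ + (3/8) Φ^{pqrs} T_{pq}{}^t T_{rst})`
where `D_{abcd}` is the array of first derivatives `D_a T_{bcd}` of `T`. -/
def torsionFieldTensor (lam : ℝ) (γ : T2) (φ : T4) (T : T3) (D : T4) : T2 := fun a b =>
  (1 / 4 : ℝ) * (∑ p, ∑ q, ∑ r, phiUUU γ φ b p q r * D a p q r)
  - (3 / 4 : ℝ) * (∑ p, ∑ q, ∑ r, phiUUU γ φ b p q r * D r a p q)
  - (3 / 2 : ℝ) * (∑ p, ∑ q, ∑ r, phiUUU γ φ b p q r * quad γ T a p q r)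
  - (3 / 4 : ℝ) * (∑ p, ∑ q, ∑ r, ∑ s, phiUUUU γ φ p q r s * T a p q * T b r s)
  + (1 / 2 : ℝ) * γ a b * (lam + (3 / 8 : ℝ) * quadScalar γ φ T)

/-- The right-hand side of the Ricci equation: `3 R_{ab}` is to be equal to
`- Φ_{(a}{}^{pqr} ∇_{b)} T_{pqr} + 3 T_a{}^{pq} T_{bpq} - (3/2) Φ^{pqrs} T_{apq} T_{brs}`
`+ (3/8) g_{ab} Φ^{ijkl} T_{ij}{}^p T_{klp} + λ g_{ab}`. -/
def ricciSource (lam : ℝ) (Φ : E8 → T4) (g : E8 → T2) (T : E8 → T3) (x : E8) : T2 := fun a b =>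
  -symPart (fun a b => ∑ p, ∑ q, ∑ r, phiUUU (g x) (Φ x) a p q r * nabla3 g T x b p q r) a b
  + 3 * sqTensor (g x) (T x) a b
  - (3 / 2 : ℝ) *
    (∑ p, ∑ q, ∑ r, ∑ s, phiUUUU (g x) (Φ x) p q r s * T x a p q * T x b r s)
  + (3 / 8 : ℝ) * g x a b * quadScalar (g x) (Φ x) (T x) + lam * g x a b

end Spin7

end

open Spin7

/-! Every claim is pointwise and is proved in a frame where Φ is the standard Cayley form and g is
Euclidean; `IsFrame` and the maps `pull1` to `pull4` carry tensors to such a frame and back.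

**Algebra.** Everything rests on the contraction of two Cayley forms over one index,
`cayley0_contract1`, which is checked on increasing indices in integer arithmetic. It yields the two
compositions of the contraction con : Λ⁴ → S² ⊕ Λ²_7 with its adjoint ι: con ∘ ι = 6 + (9/2) δ tr −
6 J₂ (`con_iota`) and ι ∘ con = 6 − 3 J₄ (`iota_con`). Hence con has kernel Λ⁴_27 and is onto S² ⊕
Λ²_7, and under con the operator J₄ acts by −12 on the trace, by 0 on the trace-free symmetric part
and by −6 on the antisymmetric part. Projecting a 4-form away from Λ⁴_27 is therefore the same as
contracting it, and `con_form0` contracts the field equation. The forms E and E' differ by a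
multiple of Φ proportional to the trace of the contracted equation, so they have equivalent
projections (`projTangent_sub_trace`). Only the antisymmetrised derivative of C enters, so ∂ and ∇
may be exchanged.

**Torsion.** Differentiating J₄Φ = −12Φ in a frame that is parallel at a point gives ∇_aΦ ∈ Λ⁴_7
(`J40_pd`). The map sending a 3-form t to the collection ι(t_a) is injective
(`eq_zero_of_iota_eq_zero`). It is also onto Λ¹ ⊗ Λ⁴_7, because antisymmetrisation is injective on
Λ¹ ⊗ Λ²_7 (`eq_zero_of_cyc_eq_zero`). The inverse is explicit (`torsionOf`), which makes T smooth.

**Curvature.** The connection Γ + T preserves both g and Φ, so its curvature K takes values in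
Λ²_21, where J₂ = 1. On the other hand K is the Riemann tensor plus terms in ∇T and T²
(`lower_spinCurv`). The trace K_{fabf} is computed twice: directly it contains the Ricci tensor,
while after replacing K by J₂K the Riemann tensor drops out by the first Bianchi identity. Comparing
the results expresses the Ricci tensor through T and ∇T (`ricci_formula`). Its symmetric part and
its trace are the claims on F_{(ab)} and on the scalar curvature. Its antisymmetric part vanishes
because the Ricci tensor is symmetric; together with `J20_con` this turns F_{[ab]} into −2 ∇^r
T_{r;ab} (`skew_field0`, `div_part7`).

**Independence.** For the coframe 1 + ½ h(y,y) + ½ |y|² N with h symmetric and N ∈ Λ²_7, the torsion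
vanishes at the origin and F(0) = 2h + ((3/2) tr h + λ/2) δ + 16 N. This takes every value in S² ⊕
Λ²_7.

**Non-Einstein solution.** On an open part of S³ × ℝ⁵ with the invariant coframe, the torsion is a
constant multiple of the volume form of S³ and is parallel. The quadratic terms of F vanish, whereas
the Ricci tensor is half the projection onto the three sphere directions. -/

noncomputable section
namespace Spin7

/-! ### The standard Cayley form in integer arithmetic -/

/-- A totally antisymmetric array of rank 3 is determined by its entries with increasing indices. -/
theorem IsAlt3.eq_zero_of_lt {t : T3} (ht : IsAlt3 t)
    (h : ∀ a b c, a < b → b < c → t a b c = 0) : t = 0 := by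
  have e1 : ∀ a c, t a a c = 0 := fun a c => by have := ht.1 a a c; linarith
  have e2 : ∀ a b, t a b b = 0 := fun a b => by have := ht.2 a b b; linarith
  have k : ∀ a b c, b < c → t a b c = 0 := by
    intro a b c hbc
    rcases lt_trichotomy a b with hab | rfl | hab
    · exact h _ _ _ hab hbc
    · exact e1 _ _
    · rw [ht.1 b a c, neg_eq_zero]
      rcases lt_trichotomy a c with hac | rfl | hac
      · exact h _ _ _ hab hac
      · exact e2 _ _
      · rw [ht.2, h _ _ _ hbc hac, neg_zero]
  funext a b c
  rcases lt_trichotomy b c with hbc | rfl | hbc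
  · exact k _ _ _ hbc
  · exact e2 _ _
  · rw [ht.2, k _ _ _ hbc, neg_zero]; rfl

/-- A totally antisymmetric array of rank 4 is determined by its entries with increasing indices. -/
theorem IsAlt4.eq_zero_of_lt {t : T4} (ht : IsAlt4 t)
    (h : ∀ a b c d, a < b → b < c → c < d → t a b c d = 0) : t = 0 := by
  obtain ⟨h1, h2, h3⟩ := ht
  have e1 : ∀ a c d, t a a c d = 0 := fun a c d => by have := h1 a a c d; linarith
  have e2 : ∀ a b d, t a b b d = 0 := fun a b d => by have := h2 a b b d; linarith
  have e3 : ∀ a b c, t a b c c = 0 := fun a b c => by have := h3 a b c c; linarith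
  have k : ∀ a b c d, b < c → c < d → t a b c d = 0 := by
    intro a b c d hbc hcd
    rcases lt_trichotomy a b with hab | rfl | hab
    · exact h _ _ _ _ hab hbc hcd
    · exact e1 _ _ _
    rw [h1 b a c, neg_eq_zero]
    rcases lt_trichotomy a c with hac | rfl | hac
    · exact h _ _ _ _ hab hac hcd
    · exact e2 _ _ _
    rw [h2, neg_eq_zero]
    rcases lt_trichotomy a d with had | rfl | had
    · exact h _ _ _ _ hbc hac had
    · exact e3 _ _ _
    · rw [h3, h _ _ _ _ hbc hcd had, neg_zero]
  funext a
  exact IsAlt3.eq_zero_of_lt ⟨fun b c d => h2 a b c d, fun b c d => h3 a b c d⟩ (k a)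

/-- The components of the standard Cayley form as integers: `Φ_{ijkl}` vanishes unless
`l` is the bitwise sum of `i`, `j` and `k`, and the signs are stored in base four. -/
def cayleyInt (i j k l : Fin 8) : ℤ :=
  -- The fourteen terms of the Cayley form are the affine planes of 𝔽₂³, whose four points have
  -- bitwise sum zero. The stored digit is the component plus one.
  if Nat.xor (Nat.xor i j) k = l then
    (((59923070217929980556645268679070704711429331130520139746287564718660817389216811889057941874958259555864625649963409386023670563480001247118232570527774092333607251837495136612862936269657235266724663417451989219509203491697642207046829858879919677429765260396557978788362544853526600312853303507919181272405
      >>> (2 * (64 * i.val + 8 * j.val + k.val))) % 4 : ℕ) : ℤ) - 1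
  else 0

theorem cayleyInt_swap :
    (∀ a b c d, cayleyInt b a c d = -cayleyInt a b c d) ∧
    (∀ a b c d, cayleyInt a c b d = -cayleyInt a b c d) ∧
    (∀ a b c d, cayleyInt a b d c = -cayleyInt a b c d) := by
  refine ⟨?_, ?_, ?_⟩ <;> decide +kernel

/-- Laplace expansion along the first row, iterated. Each 0/1 entry becomes a condition guarding the
minor below it, so that kernel evaluation abandons a branch at the first mismatch. -/
theorem det_indicator (t v : Fin 4 → Fin 8) :
    Matrix.det (Matrix.of fun m n : Fin 4 => if t m = v n then (1 : ℤ) else 0) =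
      ∑ i : Fin 4, (-1) ^ (i : ℕ) * if t 0 = v i then
        (∑ j : Fin 3, (-1) ^ (j : ℕ) * if t 1 = v (i.succAbove j) then
          (∑ k : Fin 2, (-1) ^ (k : ℕ) * if t 2 = v (i.succAbove (j.succAbove k)) then
            (if t 3 = v (i.succAbove (j.succAbove (k.succAbove 0))) then 1 else 0) else 0) else 0)
          else 0 := by
  rw [Matrix.det_succ_row_zero]
  refine Finset.sum_congr rfl fun i _ => ?_
  rw [Matrix.det_succ_row_zero, Matrix.of_apply, mul_assoc, ite_mul, one_mul, zero_mul]
  congr 2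
  refine Finset.sum_congr rfl fun j _ => ?_
  rw [Matrix.det_succ_row_zero, Matrix.submatrix_apply, Matrix.of_apply, mul_assoc, ite_mul,
    one_mul, zero_mul]
  congr 2
  refine Finset.sum_congr rfl fun k _ => ?_
  rw [Matrix.det_fin_one, Matrix.submatrix_apply, Matrix.submatrix_apply, Matrix.of_apply,
    mul_assoc, ite_mul, one_mul, zero_mul]
  rfl

theorem det_indicator_swap (t v w : Fin 4 → Fin 8) (σ : Equiv.Perm (Fin 4))
    (hσ : Equiv.Perm.sign σ = -1) (hw : ∀ n, w n = v (σ n)) :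
    Matrix.det (Matrix.of fun m n : Fin 4 => if t m = w n then (1 : ℤ) else 0) =
      -Matrix.det (Matrix.of fun m n : Fin 4 => if t m = v n then (1 : ℤ) else 0) := by
  have := Matrix.det_permute' σ (Matrix.of fun m n : Fin 4 => if t m = v n then (1 : ℤ) else 0)
  rw [hσ] at this
  simp only [Units.val_neg, Units.val_one, Int.cast_neg, Int.cast_one, neg_mul, one_mul] at this
  rw [← this]
  congr 1
  ext m n
  simp [hw]

/-- An odd permutation of the indices permutes the columns of each of the fourteen determinants. -/
theorem cayley0_swap {i j k l i' j' k' l' : Fin 8} (σ : Equiv.Perm (Fin 4))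
    (hσ : Equiv.Perm.sign σ = -1) (hw : ∀ n, ![i', j', k', l'] n = ![i, j, k, l] (σ n)) :
    cayley0 i' j' k' l' = -cayley0 i j k l := by
  have h : ∀ t : Fin 4 → Fin 8, _ := fun t => det_indicator_swap t _ _ σ hσ hw
  have hl : ∀ (L : List (ℤ × (Fin 4 → Fin 8))) (f : ℤ × (Fin 4 → Fin 8) → ℤ),
      (L.map fun t => -f t).sum = -(L.map f).sum := fun L f => by
    induction L with
    | nil => rfl
    | cons a L ih => simp only [List.map_cons, List.sum_cons, ih]; ring
  simp only [cayley0, h, mul_neg, hl, Int.cast_neg]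

theorem isAlt4_cayley0 : IsAlt4 cayley0 := by
  refine ⟨fun a b c d => ?_, fun a b c d => ?_, fun a b c d => ?_⟩
  · exact cayley0_swap (Equiv.swap 0 1) (Equiv.Perm.sign_swap (by decide))
      (fun n => by fin_cases n <;> rfl)
  · exact cayley0_swap (Equiv.swap 1 2) (Equiv.Perm.sign_swap (by decide))
      (fun n => by fin_cases n <;> rfl)
  · exact cayley0_swap (Equiv.swap 2 3) (Equiv.Perm.sign_swap (by decide))
      (fun n => by fin_cases n <;> rfl)

/-- Each inequality stands before the next quantifier, so that only the 70 increasing quadruples are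
evaluated; antisymmetry supplies the others. -/
theorem cayley_sum_eq : ∀ i j, i < j → ∀ k, j < k → ∀ l, k < l →
    (cayleyTerms.map fun t => t.1 *
      ∑ i' : Fin 4, (-1) ^ (i' : ℕ) * if t.2 0 = ![i, j, k, l] i' then
        (∑ j' : Fin 3, (-1) ^ (j' : ℕ) * if t.2 1 = ![i, j, k, l] (i'.succAbove j') then
          (∑ k' : Fin 2, (-1) ^ (k' : ℕ) *
            if t.2 2 = ![i, j, k, l] (i'.succAbove (j'.succAbove k')) then
            (if t.2 3 = ![i, j, k, l] (i'.succAbove (j'.succAbove (k'.succAbove 0)))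
              then (1 : ℤ) else 0) else 0) else 0)
          else 0).sum = cayleyInt i j k l := by
  decide +kernel

theorem cayley0_eq (i j k l : Fin 8) : cayley0 i j k l = (cayleyInt i j k l : ℝ) := by
  obtain ⟨h1, h2, h3⟩ := isAlt4_cayley0
  obtain ⟨k1, k2, k3⟩ := cayleyInt_swap
  have h : IsAlt4 fun i j k l => cayley0 i j k l - (cayleyInt i j k l : ℝ) := by
    refine ⟨fun a b c d => ?_, fun a b c d => ?_, fun a b c d => ?_⟩
    · simp only [h1 a b c d, k1 a b c d]; push_cast; ring
    · simp only [h2 a b c d, k2 a b c d]; push_cast; ring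
    · simp only [h3 a b c d, k3 a b c d]; push_cast; ring
  have := h.eq_zero_of_lt fun a b c d hab hbc hcd => by
    rw [← cayley_sum_eq a b hab c hbc d hcd, sub_eq_zero]
    simp only [cayley0, det_indicator]
  exact sub_eq_zero.1 (congrFun (congrFun (congrFun (congrFun this i) j) k) l)

/-! ### Contractions of two Cayley forms -/

/-- For increasing triples only one of the six products of three deltas in the general contraction
can be nonzero, so the others are not listed. -/
theorem cayleyInt_mul : ∀ j k, j < k → ∀ l, k < l → ∀ p q, p < q → ∀ r, q < r →
    ∑ e, cayleyInt e j k l * cayleyInt e p q r =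
      (if j = p ∧ k = q ∧ l = r then 1 else 0)
      - ((if j = p then cayleyInt k l q r else 0) + (if j = q then cayleyInt k l r p else 0)
        + (if j = r then cayleyInt k l p q else 0) + (if k = p then cayleyInt l j q r else 0)
        + (if k = q then cayleyInt l j r p else 0) + (if k = r then cayleyInt l j p q else 0)
        + (if l = p then cayleyInt j k q r else 0) + (if l = q then cayleyInt j k r p else 0)
        + (if l = r then cayleyInt j k p q else 0)) := by
  decide +kernel

theorem delta_comm (i j : Fin 8) : delta i j = delta j i := by simp [delta, eq_comm]

theorem sum_delta_mul (i : Fin 8) (f : Fin 8 → ℝ) : ∑ j, delta i j * f j = f i := by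
  simp [delta]

theorem sum_delta_mul' (i : Fin 8) (f : Fin 8 → ℝ) : ∑ j, delta j i * f j = f i := by
  simp [delta]

theorem sum_mul_delta (i : Fin 8) (f : Fin 8 → ℝ) : ∑ j, f j * delta i j = f i := by
  simp [delta]

theorem sum_mul_delta' (i : Fin 8) (f : Fin 8 → ℝ) : ∑ j, f j * delta j i = f i := by
  simp [delta]

/-- The contraction of two Cayley forms over one index. -/
theorem cayley0_contract1 (j k l p q r : Fin 8) :
    ∑ e, cayley0 e j k l * cayley0 e p q r =
      delta j p * delta k q * delta l r + delta j q * delta k r * delta l p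
      + delta j r * delta k p * delta l q - delta j p * delta k r * delta l q
      - delta j q * delta k p * delta l r - delta j r * delta k q * delta l p
      - (delta j p * cayley0 k l q r + delta j q * cayley0 k l r p + delta j r * cayley0 k l p q
        + delta k p * cayley0 l j q r + delta k q * cayley0 l j r p + delta k r * cayley0 l j p q
        + delta l p * cayley0 j k q r + delta l q * cayley0 j k r p
        + delta l r * cayley0 j k p q) := by
  obtain ⟨h1, h2, h3⟩ := isAlt4_cayley0
  let F : Fin 8 → Fin 8 → Fin 8 → Fin 8 → Fin 8 → Fin 8 → ℝ := fun j k l p q r =>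
    ∑ e, cayley0 e j k l * cayley0 e p q r -
      (delta j p * delta k q * delta l r + delta j q * delta k r * delta l p
      + delta j r * delta k p * delta l q - delta j p * delta k r * delta l q
      - delta j q * delta k p * delta l r - delta j r * delta k q * delta l p
      - (delta j p * cayley0 k l q r + delta j q * cayley0 k l r p + delta j r * cayley0 k l p q
        + delta k p * cayley0 l j q r + delta k q * cayley0 l j r p + delta k r * cayley0 l j p q
        + delta l p * cayley0 j k q r + delta l q * cayley0 j k r p
        + delta l r * cayley0 j k p q))
  -- The difference of the two sides is antisymmetric in each triple, so increasing triples suffice.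
  have A : ∀ j k l, IsAlt3 fun p q r => F j k l p q r := by
    refine fun j k l => ⟨fun p q r => ?_, fun p q r => ?_⟩
    · have e : ∀ e, cayley0 e q p r = -cayley0 e p q r := fun e => h2 e p q r
      simp only [F, e, mul_neg, Finset.sum_neg_distrib]
      rw [h3 k l p r, h3 l j p r, h3 j k p r, h3 k l r q, h3 l j r q, h3 j k r q, h3 k l p q,
        h3 l j p q, h3 j k p q]
      ring
    · have e : ∀ e, cayley0 e p r q = -cayley0 e p q r := fun e => h3 e p q r
      simp only [F, e, mul_neg, Finset.sum_neg_distrib]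
      rw [h3 k l q r, h3 l j q r, h3 j k q r, h3 k l p q, h3 l j p q, h3 j k p q, h3 k l r p,
        h3 l j r p, h3 j k r p]
      ring
  have C : ∀ p q r, IsAlt3 fun j k l => F j k l p q r := by
    refine fun p q r => ⟨fun j k l => ?_, fun j k l => ?_⟩
    · have e : ∀ e, cayley0 e k j l = -cayley0 e j k l := fun e => h2 e j k l
      simp only [F, e, neg_mul, Finset.sum_neg_distrib]
      rw [h1 l j, h1 l j, h1 l j, h1 k l, h1 k l, h1 k l, h1 j k, h1 j k, h1 j k]
      ring
    · have e : ∀ e, cayley0 e j l k = -cayley0 e j k l := fun e => h3 e j k l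
      simp only [F, e, neg_mul, Finset.sum_neg_distrib]
      rw [h1 l j, h1 l j, h1 l j, h1 k l, h1 k l, h1 k l, h1 j k, h1 j k, h1 j k]
      ring
  have B : ∀ j k l, j < k → k < l → ∀ p q r, F j k l p q r = 0 := by
    intro j k l hjk hkl p q r
    refine congrFun (congrFun (congrFun ((A j k l).eq_zero_of_lt fun p q r hpq hqr => ?_) p) q) r
    have := cayleyInt_mul j k hjk l hkl p q hpq r hqr
    have hh := congrArg (fun z : ℤ => (z : ℝ)) this
    push_cast at hh
    simp only [← cayley0_eq] at hh
    -- Each of these products would match increasing indices with indices in a different order.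
    have n1 : delta j q * delta k p = 0 := by
      by_cases x : j = q <;> by_cases y : k = p <;> simp [delta, x, y]
      omega
    have n2 : delta j r * delta k q = 0 := by
      by_cases x : j = r <;> by_cases y : k = q <;> simp [delta, x, y]
      omega
    have n3 : delta k r * delta l q = 0 := by
      by_cases x : k = r <;> by_cases y : l = q <;> simp [delta, x, y]
      omega
    have n4 : delta k r * delta l p = 0 := by
      by_cases x : k = r <;> by_cases y : l = p <;> simp [delta, x, y]
      omega
    have n5 : delta k p * delta l q * delta j r = 0 := by
      by_cases x : k = p <;> by_cases y : l = q <;> by_cases z : j = r <;>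
        simp [delta, x, y, z]
      omega
    have n0 : delta j p * delta k q * delta l r = if j = p ∧ k = q ∧ l = r then 1 else 0 := by
      by_cases x : j = p <;> by_cases y : k = q <;> by_cases z : l = r <;>
        simp [delta, x, y, z]
    simp only [F]
    rw [hh, ← n0]
    have d : ∀ (a b : Fin 8) (x : ℝ), (if a = b then x else 0) = delta a b * x := fun a b x => by
      simp [delta]
    simp only [d]
    linear_combination (-delta j q) * n4 - n5 + delta j p * n3 + delta l r * n1 + delta l p * n2
  exact sub_eq_zero.1 (congrFun (congrFun (congrFun ((C p q r).eq_zero_of_lt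
    fun j k l hjk hkl => B j k l hjk hkl p q r) j) k) l)

/-! ### Antisymmetrisation -/

/-- Iterating `Equiv.Perm.decomposeFin` turns a sum over the symmetric group into a sum over 4 · 3 ·
2 choices that can be evaluated one by one. -/
theorem sum_perm_four (F : Equiv.Perm (Fin 4) → ℝ) :
    ∑ σ, F σ = ∑ p : Fin 4, ∑ q : Fin 3, ∑ r : Fin 2, F (Equiv.Perm.decomposeFin.symm
      (p, Equiv.Perm.decomposeFin.symm (q, Equiv.Perm.decomposeFin.symm (r, 1)))) := by
  rw [← Equiv.Perm.decomposeFin.symm.sum_comp, Fintype.sum_prod_type]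
  refine Finset.sum_congr rfl fun p _ => ?_
  rw [← Equiv.Perm.decomposeFin.symm.sum_comp, Fintype.sum_prod_type]
  refine Finset.sum_congr rfl fun q _ => ?_
  rw [← Equiv.Perm.decomposeFin.symm.sum_comp, Fintype.sum_prod_type]
  refine Finset.sum_congr rfl fun r _ => ?_
  rw [Fintype.sum_unique]
  rfl

theorem alt4_apply (t : T4) (a b c d : Fin 8) : alt4 t a b c d = (1 / 24 : ℝ) *
    (t a b c d - t a b d c - t a c b d + t a c d b + t a d b c - t a d c b
      - t b a c d + t b a d c + t b c a d - t b c d a - t b d a c + t b d c a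
      + t c a b d - t c a d b - t c b a d + t c b d a + t c d a b - t c d b a
      - t d a b c + t d a c b + t d b a c - t d b c a - t d c a b + t d c b a) := by
  -- The table follows the order of `Equiv.Perm.decomposeFin`, in which `p` is the image of 0.
  have key : ∀ (p : Fin 4) (q : Fin 3) (r : Fin 2),
      (fun σ : Equiv.Perm (Fin 4) => t (![a, b, c, d] (σ 0)) (![a, b, c, d] (σ 1))
        (![a, b, c, d] (σ 2)) (![a, b, c, d] (σ 3))) (Equiv.Perm.decomposeFin.symm
      (p, Equiv.Perm.decomposeFin.symm (q, Equiv.Perm.decomposeFin.symm (r, 1)))) =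
      (![![![t a b c d, t a b d c], ![t a c b d, t a c d b], ![t a d c b, t a d b c]],
      ![![t b a c d, t b a d c], ![t b c a d, t b c d a], ![t b d c a, t b d a c]],
      ![![t c b a d, t c b d a], ![t c a b d, t c a d b], ![t c d a b, t c d b a]],
      ![![t d b c a, t d b a c], ![t d c b a, t d c a b], ![t d a c b, t d a b c]]] : Fin 4 → Fin 3 → Fin 2 → ℝ) p q r := by
    intro p q r
    fin_cases p <;> fin_cases q <;> fin_cases r <;> rfl
  unfold alt4
  rw [sum_perm_four]
  simp only [Equiv.Perm.decomposeFin.symm_sign, Equiv.Perm.sign_one] at key ⊢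
  simp only [key]
  simp [Fin.sum_univ_succ]
  ring

theorem isAlt4_alt4 (t : T4) : IsAlt4 (alt4 t) := by
  refine ⟨fun a b c d => ?_, fun a b c d => ?_, fun a b c d => ?_⟩ <;>
  · simp only [alt4_apply]; ring

/-! ### Contraction identities for the standard Cayley form -/

theorem cayley0_swap01 (a b c d : Fin 8) : cayley0 b a c d = -cayley0 a b c d :=
  isAlt4_cayley0.1 a b c d

theorem cayley0_swap12 (a b c d : Fin 8) : cayley0 a c b d = -cayley0 a b c d :=
  isAlt4_cayley0.2.1 a b c d

theorem cayley0_swap23 (a b c d : Fin 8) : cayley0 a b d c = -cayley0 a b c d :=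
  isAlt4_cayley0.2.2 a b c d

theorem cayley0_pair (a b c d : Fin 8) : cayley0 a b c d = cayley0 c d a b := by
  rw [cayley0_swap12 a c b d, cayley0_swap01 c a b d, cayley0_swap23 c a d b,
    cayley0_swap12 c d a b]; ring

theorem cayley0_rot (a b c d : Fin 8) : cayley0 a b c d = -cayley0 b c d a := by
  rw [cayley0_swap01 b a c d, cayley0_swap12 b c a d, cayley0_swap23 b c d a]; ring

theorem isAlt3_cayley0 (a : Fin 8) : IsAlt3 (cayley0 a) :=
  ⟨fun b c d => cayley0_swap12 a b c d, fun b c d => cayley0_swap23 a b c d⟩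

theorem cayley0_eq_zero12 (a b d : Fin 8) : cayley0 a b b d = 0 := by
  have := cayley0_swap12 a b b d; linarith

theorem cayley0_eq_zero13 (a b d : Fin 8) : cayley0 a b d b = 0 := by
  rw [cayley0_swap23, cayley0_eq_zero12, neg_zero]

theorem cayley0_eq_zero03 (a b d : Fin 8) : cayley0 a b d a = 0 := by
  have := cayley0_swap23 b d a a
  rw [cayley0_rot]; linarith

theorem cayley0_eq_zero02 (a b d : Fin 8) : cayley0 a b a d = 0 := by
  rw [cayley0_swap23, cayley0_eq_zero03, neg_zero]

/-- The contraction of two Cayley forms over two indices. -/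
theorem cayley0_contract2 (k l q r : Fin 8) :
    ∑ e, ∑ f, cayley0 e f k l * cayley0 e f q r =
      6 * delta k q * delta l r - 6 * delta k r * delta l q - 4 * cayley0 k l q r := by
  rw [Finset.sum_comm]
  simp only [cayley0_contract1, Finset.sum_sub_distrib, Finset.sum_add_distrib]
  simp only [mul_assoc, ← Finset.mul_sum, sum_delta_mul, sum_delta_mul']
  simp [delta, cayley0_eq_zero13, cayley0_eq_zero12, cayley0_eq_zero03, cayley0_eq_zero02]
  rw [cayley0_swap23 k l q r, cayley0_swap01 k l q r]
  split_ifs <;> ring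

theorem cayley0_contract2' (k l q r : Fin 8) :
    ∑ e, ∑ f, cayley0 k l e f * cayley0 q r e f =
      6 * delta k q * delta l r - 6 * delta k r * delta l q - 4 * cayley0 k l q r := by
  rw [← cayley0_contract2]
  exact Finset.sum_congr rfl fun e _ => Finset.sum_congr rfl fun f _ => by
    rw [cayley0_pair k l, cayley0_pair q r]

/-- The contraction of two Cayley forms over three indices. -/
theorem cayley0_contract3 (a b : Fin 8) :
    ∑ p, ∑ q, ∑ r, cayley0 a p q r * cayley0 b p q r = 42 * delta a b := by
  have h : ∀ p, ∑ q, ∑ r, cayley0 a p q r * cayley0 b p q r =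
      6 * delta a b * delta p p - 6 * delta a p * delta p b - 4 * cayley0 a p b p :=
    fun p => cayley0_contract2' _ _ _ _
  simp only [h, Finset.sum_sub_distrib, cayley0_eq_zero13, mul_assoc, ← Finset.mul_sum,
    sum_delta_mul]
  simp [delta]; split_ifs <;> norm_num

/-! ### The standard operators -/

/-- The contraction with the standard Cayley form. -/
def con (s : T4) : T2 := fun a b => ∑ p, ∑ q, ∑ r, cayley0 b p q r * s a p q r

/-- `J₂` for the standard Cayley form. -/
def J20 (B : T2) : T2 := fun i j => (1 / 2 : ℝ) * ∑ a, ∑ b, cayley0 i j a b * B a b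

/-- `J₃` for the standard Cayley form. -/
def J30 (t : T3) : T3 := fun i j k =>
  (1 / 2 : ℝ) * ∑ p, ∑ q, (cayley0 i j p q * t k p q + cayley0 j k p q * t i p q
    + cayley0 k i p q * t j p q)

/-- `J₄` for the standard Cayley form. -/
def J40 (s : T4) : T4 :=
  alt4 fun i j k l => 3 * ∑ p, ∑ q, cayley0 i j p q * s k l p q

/-- The map from rank 2 tensors to 4-forms given by the standard Cayley form. -/
def iota (B : T2) : T4 := alt4 fun a b c d => ∑ e, B a e * cayley0 e b c d

/-- The Euclidean trace. -/
def tr0 (B : T2) : ℝ := ∑ a, B a a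

/-- The contraction `Φ_b^{rpq} D_{r,apq}`. -/
def conMid (D : T4) : T2 := fun a b => ∑ r, ∑ p, ∑ q, cayley0 b r p q * D r a p q

theorem J30_apply (t : T3) (i j k : Fin 8) :
    J30 t i j k = J20 (t k) i j + J20 (t i) j k + J20 (t j) k i := by
  simp only [J30, J20, Finset.sum_add_distrib]; ring

theorem sum_alt3_swap12 {u : T3} (hu : IsAlt3 u) (g : T3) :
    ∑ p, ∑ q, ∑ r, u p q r * g q p r = -∑ p, ∑ q, ∑ r, u p q r * g p q r := by
  rw [Finset.sum_comm]
  simp only [← Finset.sum_neg_distrib]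
  refine Finset.sum_congr rfl fun p _ => Finset.sum_congr rfl fun q _ =>
    Finset.sum_congr rfl fun r _ => ?_
  rw [hu.1 p q r]; ring

theorem sum_alt3_swap23 {u : T3} (hu : IsAlt3 u) (g : T3) :
    ∑ p, ∑ q, ∑ r, u p q r * g p r q = -∑ p, ∑ q, ∑ r, u p q r * g p q r := by
  simp only [← Finset.sum_neg_distrib]
  refine Finset.sum_congr rfl fun p _ => ?_
  rw [Finset.sum_comm]
  refine Finset.sum_congr rfl fun q _ => Finset.sum_congr rfl fun r _ => ?_
  rw [hu.2 p q r]; ring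

theorem alt3_eq_zero12 {t : T3} (ht : IsAlt3 t) (a b : Fin 8) : t a a b = 0 := by
  have := ht.1 a a b; linarith

theorem alt3_eq_zero23 {t : T3} (ht : IsAlt3 t) (a b : Fin 8) : t a b b = 0 := by
  have := ht.2 a b b; linarith

theorem alt3_rot {t : T3} (ht : IsAlt3 t) (a b c : Fin 8) : t a b c = t b c a := by
  rw [ht.2 b a c, ht.1 a b c]; ring

/-- In `cayley0_contract1` the six triple products of deltas give 6t by antisymmetry. The nine mixed
terms come in threes, one three for each index carried by a delta, and give −6 J₃t. -/
theorem cayley0_wedge (t : T3) (ht : IsAlt3 t) (j k l : Fin 8) :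
    ∑ e, cayley0 e j k l * ∑ p, ∑ q, ∑ r, cayley0 e p q r * t p q r =
      6 * t j k l - 6 * J30 t j k l := by
  have : ∑ e, cayley0 e j k l * ∑ p, ∑ q, ∑ r, cayley0 e p q r * t p q r =
    ∑ p, ∑ q, ∑ r, (∑ e, cayley0 e j k l * cayley0 e p q r) * t p q r := by
    simp only [Finset.mul_sum, Finset.sum_mul]
    rw [Finset.sum_comm]
    refine Finset.sum_congr rfl fun p _ => ?_
    rw [Finset.sum_comm]
    refine Finset.sum_congr rfl fun q _ => ?_
    rw [Finset.sum_comm]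
    simp only [mul_assoc]
  rw [this]
  simp only [cayley0_contract1, sub_mul, add_mul, Finset.sum_sub_distrib, Finset.sum_add_distrib]
  simp only [mul_assoc, ← Finset.mul_sum, sum_delta_mul]
  have h1 : ∀ k l j, ∑ x, ∑ i, cayley0 k l i x * t x j i = ∑ p, ∑ q, cayley0 k l p q * t j p q :=
    fun k l j => Finset.sum_congr rfl fun p _ => Finset.sum_congr rfl fun q _ => by
      rw [cayley0_swap23 k l p q, ht.1 j p q]; ring
  have h2 : ∀ k l j, ∑ x, ∑ i, cayley0 k l x i * t x i j = ∑ p, ∑ q, cayley0 k l p q * t j p q :=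
    fun k l j => Finset.sum_congr rfl fun p _ => Finset.sum_congr rfl fun q _ => by
      rw [alt3_rot ht j p q]
  simp only [h1, h2, J30_apply, J20]
  have a1 := alt3_rot ht l j k
  have a2 := alt3_rot ht j k l
  have a3 := alt3_rot ht l k j
  have a4 := ht.1 j k l
  have a5 := ht.2 j k l
  linarith

/-- A totally antisymmetric array in its last three slots antisymmetrises in four terms. -/
theorem alt4_of_alt3 {f : T4} (hf : ∀ a, IsAlt3 (f a)) (a b c d : Fin 8) :
    alt4 f a b c d = (1 / 4 : ℝ) * (f a b c d - f b a c d - f c b a d - f d b c a) := by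
  have h : ∀ x a b c, f x b a c = -f x a b c ∧ f x a c b = -f x a b c ∧ f x b c a = f x a b c ∧
      f x c a b = f x a b c ∧ f x c b a = - f x a b c := fun x a b c =>
    ⟨(hf x).1 a b c, (hf x).2 a b c, (alt3_rot (hf x) a b c).symm, alt3_rot (hf x) c a b, by
      rw [(hf x).1 b c a, ← alt3_rot (hf x) a b c]⟩
  obtain ⟨a1, a2, a3, a4, a5⟩ := h a b c d
  obtain ⟨b1, b2, b3, b4, b5⟩ := h b a c d
  obtain ⟨c1, c2, c3, c4, c5⟩ := h c b a d
  obtain ⟨d1, d2, d3, d4, d5⟩ := h d b c a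
  rw [alt4_apply]
  linarith

/-- The six terms are the ways to split four indices into a first and a second pair. -/
theorem alt4_of_pair {N : T4} (h1 : ∀ a b c d, N b a c d = -N a b c d)
    (h2 : ∀ a b c d, N a b d c = -N a b c d) (a b c d : Fin 8) :
    alt4 N a b c d = (1 / 6 : ℝ) * (N a b c d + N c d a b - N a c b d - N b d a c
      + N a d b c + N b c a d) := by
  have h : ∀ a b c d, N b a c d = -N a b c d ∧ N a b d c = -N a b c d ∧ N b a d c = N a b c d :=
    fun a b c d => ⟨h1 _ _ _ _, h2 _ _ _ _, by rw [h1, h2, neg_neg]⟩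
  obtain ⟨a1, a2, a3⟩ := h a b c d
  obtain ⟨b1, b2, b3⟩ := h c d a b
  obtain ⟨c1, c2, c3⟩ := h a c b d
  obtain ⟨d1, d2, d3⟩ := h b d a c
  obtain ⟨e1, e2, e3⟩ := h a d b c
  obtain ⟨f1, f2, f3⟩ := h b c a d
  rw [alt4_apply]
  linarith

theorem alt4_eq_self {s : T4} (hs : IsAlt4 s) : alt4 s = s := by
  funext a b c d
  rw [alt4_of_alt3 (fun a => ⟨hs.2.1 a, hs.2.2 a⟩), hs.1 a b c d, hs.1 b c a d, hs.2.1 b a c d,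
    hs.1 a b c d, hs.1 b d c a, hs.2.1 b c d a, hs.2.2 b c a d, hs.2.1 b a c d, hs.1 a b c d]
  ring

theorem iota_apply (B : T2) (a b c d : Fin 8) : iota B a b c d =
    (1 / 4 : ℝ) * (∑ e, B a e * cayley0 e b c d - ∑ e, B b e * cayley0 e a c d
      - ∑ e, B c e * cayley0 e b a d - ∑ e, B d e * cayley0 e b c a) := by
  refine alt4_of_alt3 (fun a => ⟨fun b c d => ?_, fun b c d => ?_⟩) a b c d
  · simp only [cayley0_swap12 _ b c d, mul_neg, Finset.sum_neg_distrib]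
  · simp only [cayley0_swap23 _ b c d, mul_neg, Finset.sum_neg_distrib]

/-- The contraction of `ι(B)` with the Cayley form. -/
theorem con_iota (B : T2) (a b : Fin 8) :
    con (iota B) a b = 6 * B a b + (9 / 2) * tr0 B * delta a b - 6 * J20 B a b := by
  -- Of the four terms of ι(B), the one with B on the free index is a triple contraction. The other
  -- three are double contractions and coincide by antisymmetry (`e3`, `e4`).
  have e1 : ∑ p, ∑ q, ∑ r, cayley0 b p q r * ∑ e, B a e * cayley0 e p q r = 42 * B a b := by
    have : ∑ p, ∑ q, ∑ r, cayley0 b p q r * ∑ e, B a e * cayley0 e p q r =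
        ∑ e, B a e * ∑ p, ∑ q, ∑ r, cayley0 b p q r * cayley0 e p q r := by
      simp only [Finset.mul_sum]
      symm
      rw [Finset.sum_comm]
      refine Finset.sum_congr rfl fun p _ => ?_
      rw [Finset.sum_comm]
      refine Finset.sum_congr rfl fun q _ => ?_
      rw [Finset.sum_comm]
      exact Finset.sum_congr rfl fun r _ => Finset.sum_congr rfl fun e _ => by ring
    rw [this]
    simp only [cayley0_contract3]
    rw [← sum_mul_delta b (fun e => 42 * B a e)]
    exact Finset.sum_congr rfl fun e _ => by ring
  have e2 : ∑ p, ∑ q, ∑ r, cayley0 b p q r * ∑ e, B p e * cayley0 e a q r =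
      6 * B a b - 6 * tr0 B * delta a b + 8 * J20 B a b := by
    have : ∑ p, ∑ q, ∑ r, cayley0 b p q r * ∑ e, B p e * cayley0 e a q r =
        ∑ p, ∑ e, B p e * ∑ q, ∑ r, cayley0 b p q r * cayley0 e a q r := by
      refine Finset.sum_congr rfl fun p _ => ?_
      simp only [Finset.mul_sum]
      symm
      rw [Finset.sum_comm]
      refine Finset.sum_congr rfl fun q _ => ?_
      rw [Finset.sum_comm]
      exact Finset.sum_congr rfl fun r _ => Finset.sum_congr rfl fun e _ => by ring
    rw [this]
    simp only [cayley0_contract2', mul_sub, Finset.sum_sub_distrib]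
    have f1 : ∑ p, ∑ e, B p e * (6 * delta b e * delta p a) = 6 * B a b := by
      rw [← sum_delta_mul' a (fun p => 6 * B p b)]
      refine Finset.sum_congr rfl fun p _ => ?_
      rw [← sum_delta_mul b (fun e => delta p a * (6 * B p e)), ]
      exact Finset.sum_congr rfl fun e _ => by ring
    have f2 : ∑ p, ∑ e, B p e * (6 * delta b a * delta p e) = 6 * tr0 B * delta a b := by
      rw [delta_comm a b, tr0, mul_assoc, Finset.sum_mul, Finset.mul_sum]
      refine Finset.sum_congr rfl fun p _ => ?_
      rw [← sum_delta_mul p (fun e => 6 * (B p e * delta b a)), ]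
      exact Finset.sum_congr rfl fun e _ => by ring
    have f3 : ∑ p, ∑ e, B p e * (4 * cayley0 b p e a) = -8 * J20 B a b := by
      rw [J20]
      simp only [Finset.mul_sum]
      refine Finset.sum_congr rfl fun p _ => Finset.sum_congr rfl fun e _ => ?_
      rw [cayley0_rot a b p e]; ring
    rw [f1, f2, f3]; ring
  have e3 : ∑ p, ∑ q, ∑ r, cayley0 b p q r * ∑ e, B q e * cayley0 e p a r =
      ∑ p, ∑ q, ∑ r, cayley0 b p q r * ∑ e, B p e * cayley0 e a q r := by
    have := sum_alt3_swap12 (isAlt3_cayley0 b) fun p q r => ∑ e, B p e * cayley0 e a q r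
    rw [eq_neg_iff_add_eq_zero, add_comm, ← eq_neg_iff_add_eq_zero] at this
    rw [this]
    simp only [← Finset.sum_neg_distrib]
    refine Finset.sum_congr rfl fun p _ => Finset.sum_congr rfl fun q _ =>
      Finset.sum_congr rfl fun r _ => ?_
    simp only [cayley0_swap12 _ a p r, mul_neg, Finset.sum_neg_distrib]
  have e4 : ∑ p, ∑ q, ∑ r, cayley0 b p q r * ∑ e, B r e * cayley0 e p q a =
      ∑ p, ∑ q, ∑ r, cayley0 b p q r * ∑ e, B q e * cayley0 e p a r := by
    have := sum_alt3_swap23 (isAlt3_cayley0 b) fun p q r => ∑ e, B q e * cayley0 e p a r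
    rw [eq_neg_iff_add_eq_zero, add_comm, ← eq_neg_iff_add_eq_zero] at this
    rw [this]
    simp only [← Finset.sum_neg_distrib]
    refine Finset.sum_congr rfl fun p _ => Finset.sum_congr rfl fun q _ =>
      Finset.sum_congr rfl fun r _ => ?_
    simp only [cayley0_swap23 _ p a q, mul_neg, Finset.sum_neg_distrib]
  have : con (iota B) a b = (1 / 4 : ℝ) *
      (∑ p, ∑ q, ∑ r, cayley0 b p q r * ∑ e, B a e * cayley0 e p q r
      - ∑ p, ∑ q, ∑ r, cayley0 b p q r * ∑ e, B p e * cayley0 e a q r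
      - ∑ p, ∑ q, ∑ r, cayley0 b p q r * ∑ e, B q e * cayley0 e p a r
      - ∑ p, ∑ q, ∑ r, cayley0 b p q r * ∑ e, B r e * cayley0 e p q a) := by
    simp only [con, iota_apply, ← Finset.sum_sub_distrib]
    rw [Finset.mul_sum]
    refine Finset.sum_congr rfl fun p _ => ?_
    rw [Finset.mul_sum]
    refine Finset.sum_congr rfl fun q _ => ?_
    rw [Finset.mul_sum]
    refine Finset.sum_congr rfl fun r _ => ?_
    simp only [Finset.sum_sub_distrib]
    ring
  rw [this, e4, e3, e2, e1]
  ring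

theorem IsAlt4.alt3 {s : T4} (hs : IsAlt4 s) (a : Fin 8) : IsAlt3 (s a) :=
  ⟨hs.2.1 a, hs.2.2 a⟩

/-- `ι ∘ con = 6 - 3 J₄` on 4-forms. -/
theorem iota_con {s : T4} (hs : IsAlt4 s) : iota (con s) = (6 : ℝ) • s - (3 : ℝ) • J40 s := by
  funext a b c d
  -- Each of the four terms of ι(con s) is governed by `cayley0_wedge` for the 3-form obtained by
  -- fixing one index of s. The twelve resulting J₂ pieces pair up into the six terms of J₄.
  have e : ∀ x j k l, ∑ e, con s x e * cayley0 e j k l = 6 * s x j k l - 6 * J30 (s x) j k l := by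
    intro x j k l
    rw [← cayley0_wedge _ (hs.alt3 x)]
    exact Finset.sum_congr rfl fun e _ => by rw [mul_comm]; rfl
  have hJ : J40 s a b c d = _ := alt4_of_pair (N := fun i j k l =>
    3 * ∑ p, ∑ q, cayley0 i j p q * s k l p q)
    (fun a b c d => by simp only [cayley0_swap01 a b, neg_mul, Finset.sum_neg_distrib, mul_neg])
    (fun a b c d => by simp only [hs.1 c d, mul_neg, Finset.sum_neg_distrib]) a b c d
  simp only [Pi.sub_apply, Pi.smul_apply, smul_eq_mul, hJ, iota_apply, e, J30_apply, J20]
  have n1 : ∀ a b c d, ∑ p, ∑ q, cayley0 b a p q * s c d p q =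
      -∑ p, ∑ q, cayley0 a b p q * s c d p q := fun a b c d => by
    simp only [cayley0_swap01 a b, neg_mul, Finset.sum_neg_distrib]
  have n2 : ∀ a b c d, ∑ p, ∑ q, cayley0 a b p q * s d c p q =
      -∑ p, ∑ q, cayley0 a b p q * s c d p q := fun a b c d => by
    simp only [hs.1 c d, mul_neg, Finset.sum_neg_distrib]
  have s1 := hs.1 a b c d
  have s2 : s c b a d = - s a b c d := by
    rw [hs.1 b c a d, hs.2.1 b a c d, hs.1 a b c d]; ring
  have s3 : s d b c a = - s a b c d := by
    rw [hs.1 b d c a, hs.2.1 b c d a, hs.2.2 b c a d, hs.2.1 b a c d, hs.1 a b c d]; ring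
  have f1 := n1 b d a c
  have f2 := n2 c d a b
  have f3 := n1 a d b c
  have f4 := n1 a b c d
  have f5 := n2 a d b c
  have f6 := n1 b d c a
  have f7 := n2 b d a c
  have f8 := n2 b c a d
  have f9 := n1 a c d b
  have g1 := n2 a c b d
  have g2 := n2 a b c d
  linarith

theorem con_add (s t : T4) : con (s + t) = con s + con t := by
  funext a b; simp [con, mul_add, Finset.sum_add_distrib]

theorem con_smul (x : ℝ) (s : T4) : con (x • s) = x • con s := by
  funext a b
  simp only [con, Pi.smul_apply, smul_eq_mul, Finset.mul_sum]
  exact Finset.sum_congr rfl fun _ _ => Finset.sum_congr rfl fun _ _ =>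
    Finset.sum_congr rfl fun _ _ => by ring

theorem con_sub (s t : T4) : con (s - t) = con s - con t := by
  funext a b; simp [con, mul_sub, Finset.sum_sub_distrib]

theorem con_zero : con 0 = 0 := by
  funext a b; simp [con]

theorem iota_add (s t : T2) : iota (s + t) = iota s + iota t := by
  funext a b c d; simp [iota_apply, add_mul, Finset.sum_add_distrib]; ring

theorem iota_smul (x : ℝ) (s : T2) : iota (x • s) = x • iota s := by
  funext a b c d; simp only [iota_apply, Pi.smul_apply, smul_eq_mul, mul_assoc, ← Finset.mul_sum]
  ring

theorem iota_sub (s t : T2) : iota (s - t) = iota s - iota t := by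
  funext a b c d; simp [iota_apply, sub_mul, Finset.sum_sub_distrib]; ring

theorem iota_zero : iota 0 = 0 := by
  funext a b c d; simp [iota_apply]

theorem isAlt4_iota (B : T2) : IsAlt4 (iota B) := isAlt4_alt4 _

theorem alt4_add (s t : T4) : alt4 (s + t) = alt4 s + alt4 t := by
  funext a b c d; simp [alt4_apply]; ring

theorem alt4_smul (x : ℝ) (s : T4) : alt4 (x • s) = x • alt4 s := by
  funext a b c d; simp [alt4_apply]; ring

theorem J40_add (s t : T4) : J40 (s + t) = J40 s + J40 t := by
  simp only [J40, ← alt4_add]; congr 1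
  funext a b c d; simp [mul_add, Finset.sum_add_distrib]

theorem J40_smul (x : ℝ) (s : T4) : J40 (x • s) = x • J40 s := by
  simp only [J40, ← alt4_smul]; congr 1
  funext a b c d
  simp only [Pi.smul_apply, smul_eq_mul, Finset.mul_sum]
  exact Finset.sum_congr rfl fun _ _ => Finset.sum_congr rfl fun _ _ => by ring

theorem J40_zero : J40 0 = 0 := by simpa using J40_smul 0 0

theorem isAlt4_J40 (s : T4) : IsAlt4 (J40 s) := isAlt4_alt4 _

theorem IsAlt4.add {s t : T4} (hs : IsAlt4 s) (ht : IsAlt4 t) : IsAlt4 (s + t) :=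
  ⟨fun a b c d => by simp only [Pi.add_apply, hs.1 a b c d, ht.1 a b c d]; ring,
    fun a b c d => by simp only [Pi.add_apply, hs.2.1 a b c d, ht.2.1 a b c d]; ring,
    fun a b c d => by simp only [Pi.add_apply, hs.2.2 a b c d, ht.2.2 a b c d]; ring⟩

theorem IsAlt4.smul {s : T4} (hs : IsAlt4 s) (x : ℝ) : IsAlt4 (x • s) :=
  ⟨fun a b c d => by simp only [Pi.smul_apply, smul_eq_mul, hs.1 a b c d]; ring,
    fun a b c d => by simp only [Pi.smul_apply, smul_eq_mul, hs.2.1 a b c d]; ring,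
    fun a b c d => by simp only [Pi.smul_apply, smul_eq_mul, hs.2.2 a b c d]; ring⟩

theorem J20_skew (B : T2) (a b : Fin 8) : J20 B b a = -J20 B a b := by
  simp only [J20, cayley0_swap01 a b, neg_mul, Finset.sum_neg_distrib, mul_neg]

theorem J20_add (s t : T2) : J20 (s + t) = J20 s + J20 t := by
  funext a b; simp [J20, mul_add, Finset.sum_add_distrib]

theorem J20_smul (x : ℝ) (s : T2) : J20 (x • s) = x • J20 s := by
  funext a b
  simp only [J20, Pi.smul_apply, smul_eq_mul, Finset.mul_sum]
  exact Finset.sum_congr rfl fun _ _ => Finset.sum_congr rfl fun _ _ => by ring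

theorem J20_sub (s t : T2) : J20 (s - t) = J20 s - J20 t := by
  funext a b; simp [J20, mul_sub, Finset.sum_sub_distrib]

theorem J20_transpose (B : T2) (i j : Fin 8) : J20 (fun a b => B b a) i j = -J20 B i j := by
  simp only [J20]
  rw [Finset.sum_comm, ← mul_neg]
  simp only [← Finset.sum_neg_distrib]
  congr 1
  refine Finset.sum_congr rfl fun _ _ => Finset.sum_congr rfl fun _ _ => ?_
  rw [cayley0_swap23]; ring

theorem J20_skewPart (B : T2) : J20 (skewPart B) = J20 B := by
  have : skewPart B = (1 / 2 : ℝ) • (B - fun a b => B b a) := rfl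
  rw [this, J20_smul, J20_sub]
  funext i j
  simp only [Pi.smul_apply, Pi.sub_apply, smul_eq_mul, J20_transpose]; ring

theorem J20_J20 {B : T2} (hB : ∀ a b, B b a = -B a b) (i j : Fin 8) :
    J20 (J20 B) i j = 3 * B i j - 2 * J20 B i j := by
  have h : J20 (J20 B) i j = (1 / 4 : ℝ) * ∑ p, ∑ q,
      (∑ a, ∑ b, cayley0 i j a b * cayley0 p q a b) * B p q := by
    simp only [J20, Finset.mul_sum, Finset.sum_mul]
    have : ∀ f : Fin 8 → Fin 8 → Fin 8 → Fin 8 → ℝ, ∑ a, ∑ b, ∑ p, ∑ q, f a b p q =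
        ∑ p, ∑ q, ∑ a, ∑ b, f a b p q := fun f => by
      calc _ = ∑ a, ∑ p, ∑ b, ∑ q, f a b p q :=
            Finset.sum_congr rfl fun _ _ => Finset.sum_comm
        _ = ∑ p, ∑ a, ∑ b, ∑ q, f a b p q := Finset.sum_comm
        _ = ∑ p, ∑ a, ∑ q, ∑ b, f a b p q := Finset.sum_congr rfl fun _ _ =>
            Finset.sum_congr rfl fun _ _ => Finset.sum_comm
        _ = _ := Finset.sum_congr rfl fun _ _ => Finset.sum_comm
    rw [this]
    refine Finset.sum_congr rfl fun p _ => Finset.sum_congr rfl fun q _ =>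
      Finset.sum_congr rfl fun a _ => Finset.sum_congr rfl fun b _ => ?_
    rw [cayley0_pair a b p q]; ring
  rw [h]
  simp only [cayley0_contract2', sub_mul, Finset.sum_sub_distrib, mul_assoc, ← Finset.mul_sum,
    sum_delta_mul, J20]
  rw [hB i j]; ring

/-- `J₂` of the contraction of a derivative of a 3-form. -/
theorem J20_con {D : T4} (hD : ∀ a, IsAlt3 (D a)) (a b : Fin 8) :
    J20 (con D) a b = -3 * ∑ e, D e e a b + 3 * J20 (fun i j => ∑ e, D e e i j) a b
      + (3 / 2) * (conMid D a b - conMid D b a) := by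
  have h : J20 (con D) a b = -(1 / 2 : ℝ) * ∑ e, ∑ f, cayley0 f a b e *
      ∑ p, ∑ q, ∑ r, cayley0 f p q r * D e p q r := by
    simp only [J20, con]
    rw [neg_mul, ← mul_neg, ← Finset.sum_neg_distrib]
    congr 1
    refine Finset.sum_congr rfl fun e _ => ?_
    rw [← Finset.sum_neg_distrib]
    refine Finset.sum_congr rfl fun f _ => ?_
    rw [cayley0_rot f a b e]; ring
  rw [h]
  -- Summed over the derivative index e, the wedge identity yields the divergence, its image under
  -- J₂ and two copies of `conMid`.
  have h1 : ∀ e, ∑ f, cayley0 f a b e * ∑ p, ∑ q, ∑ r, cayley0 f p q r * D e p q r =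
      6 * D e e a b - 3 * ∑ p, ∑ q, cayley0 a b p q * D e e p q
      - 3 * ∑ p, ∑ q, cayley0 b e p q * D e a p q
      + 3 * ∑ p, ∑ q, cayley0 a e p q * D e b p q := by
    intro e
    rw [cayley0_wedge _ (hD e), J30_apply, J20, J20, J20, alt3_rot (hD e) e a b]
    simp only [cayley0_swap01 a e, neg_mul, Finset.sum_neg_distrib]
    ring
  have h2 : J20 (fun i j => ∑ e, D e e i j) a b =
      (1 / 2 : ℝ) * ∑ e, ∑ p, ∑ q, cayley0 a b p q * D e e p q := by
    rw [J20]
    congr 1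
    simp only [Finset.mul_sum]
    calc _ = ∑ p, ∑ e, ∑ q, cayley0 a b p q * D e e p q :=
          Finset.sum_congr rfl fun _ _ => Finset.sum_comm
      _ = _ := Finset.sum_comm
  have h3 : ∑ e, ∑ f, cayley0 f a b e * ∑ p, ∑ q, ∑ r, cayley0 f p q r * D e p q r =
      6 * ∑ e, D e e a b - 3 * ∑ e, ∑ p, ∑ q, cayley0 a b p q * D e e p q
      - 3 * conMid D a b + 3 * conMid D b a := by
    rw [Finset.sum_congr rfl fun e _ => h1 e, Finset.sum_add_distrib, Finset.sum_sub_distrib,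
      Finset.sum_sub_distrib, ← Finset.mul_sum, ← Finset.mul_sum, ← Finset.mul_sum,
      ← Finset.mul_sum]
    rfl
  rw [h3, h2]
  ring

/-- For a 4-form the divergence terms of `J20_con` vanish and `conMid` is minus `con`. Since J₂
ignores symmetric parts, this places the antisymmetric part of the contraction in Λ²_7. -/
theorem J20_con_alt {s : T4} (hs : IsAlt4 s) (a b : Fin 8) :
    J20 (con s) a b = -3 * skewPart (con s) a b := by
  rw [J20_con hs.alt3]
  have h : ∀ a b, conMid s a b = -con s a b := fun a b => by
    simp only [conMid, con, ← Finset.sum_neg_distrib]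
    exact Finset.sum_congr rfl fun p _ => Finset.sum_congr rfl fun q _ =>
      Finset.sum_congr rfl fun r _ => by rw [hs.1 a p]; ring
  have h0 : ∀ e a b, s e e a b = 0 := fun e a b => by have := hs.1 e e a b; linarith
  simp only [h0, h, skewPart, J20]
  simp only [Finset.sum_const_zero, mul_zero]
  ring

theorem tr0_smul_delta (x : ℝ) : tr0 (fun a b => x * delta a b) = 8 * x := by
  simp [tr0, delta]

/-- The composition con ∘ ι ∘ con is computed in two ways, by `iota_con` and by `con_iota`. On
contractions J₄ thus acts by −12 on the trace, by 0 on the trace-free symmetric part and by −6 on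
the antisymmetric part. -/
theorem con_J40 {s : T4} (hs : IsAlt4 s) (a b : Fin 8) :
    con (J40 s) a b = -(3 / 2) * tr0 (con s) * delta a b - 6 * skewPart (con s) a b := by
  have h := congrArg con (iota_con hs)
  rw [con_sub, con_smul, con_smul] at h
  have := congrFun (congrFun h a) b
  simp only [con_iota, Pi.sub_apply, Pi.smul_apply, smul_eq_mul, J20_con_alt hs] at this
  linarith

/-- Immediate from ι ∘ con = 6 − 3 J₄: the kernel of the contraction lies in Λ⁴_27. -/
theorem J40_eq_of_con_eq_zero {s : T4} (hs : IsAlt4 s) (h : con s = 0) : J40 s = (2 : ℝ) • s := by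
  have := iota_con hs
  rw [h, iota_zero] at this
  funext a b c d
  have := congrFun (congrFun (congrFun (congrFun this a) b) c) d
  simp only [Pi.sub_apply, Pi.smul_apply, smul_eq_mul, Pi.zero_apply] at this ⊢
  linarith

theorem tr0_con_J40 {s : T4} (hs : IsAlt4 s) : tr0 (con (J40 s)) = -12 * tr0 (con s) := by
  have : tr0 (con (J40 s)) = tr0 (fun a b => -(3 / 2) * tr0 (con s) * delta a b) := by
    simp only [tr0]
    refine Finset.sum_congr rfl fun a _ => ?_
    rw [con_J40 hs, skewPart]; simp [tr0]
  rw [this, tr0_smul_delta]; ring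

theorem skewPart_con_J40 {s : T4} (hs : IsAlt4 s) (a b : Fin 8) :
    skewPart (con (J40 s)) a b = -6 * skewPart (con s) a b := by
  rw [skewPart, con_J40 hs, con_J40 hs, delta_comm b a]
  simp only [skewPart]; ring

/-! ### The projections for the standard Cayley form -/

def p1 (s : T4) : T4 := (-1 / 1008 : ℝ) • (J40 (J40 (J40 s)) + (4 : ℝ) • J40 (J40 s)
    - (12 : ℝ) • J40 s)
def p7 (s : T4) : T4 := (1 / 288 : ℝ) • (J40 (J40 (J40 s)) + (10 : ℝ) • J40 (J40 s)
    - (24 : ℝ) • J40 s)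
def p27 (s : T4) : T4 := (1 / 224 : ℝ) • (J40 (J40 (J40 s)) + (18 : ℝ) • J40 (J40 s)
    + (72 : ℝ) • J40 s)
def p35 (s : T4) : T4 := (-1 / 144 : ℝ) • (J40 (J40 (J40 s)) + (16 : ℝ) • J40 (J40 s)
    + (36 : ℝ) • J40 s - (144 : ℝ) • s)

theorem con_J40_2 {s : T4} (hs : IsAlt4 s) (a b : Fin 8) :
    con (J40 (J40 s)) a b = 18 * tr0 (con s) * delta a b + 36 * skewPart (con s) a b := by
  rw [con_J40 (isAlt4_J40 s), tr0_con_J40 hs, skewPart_con_J40 hs]; ring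

theorem con_J40_3 {s : T4} (hs : IsAlt4 s) (a b : Fin 8) :
    con (J40 (J40 (J40 s))) a b =
      -216 * tr0 (con s) * delta a b - 216 * skewPart (con s) a b := by
  rw [con_J40_2 (isAlt4_J40 s), tr0_con_J40 hs, skewPart_con_J40 hs]; ring

theorem symPart_add_skewPart (B : T2) (a b : Fin 8) : symPart B a b + skewPart B a b = B a b := by
  simp only [symPart, skewPart]; ring

/-- The cubic defining π₂₇ vanishes at −12, −6 and 0, the only eigenvalues of J₄ visible after
contraction. On the kernel of the contraction J₄ = 2, where the cubic equals 1. -/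
theorem sub_p27_eq_zero_iff {s : T4} (hs : IsAlt4 s) : s - p27 s = 0 ↔ con s = 0 := by
  constructor
  · intro h
    rw [sub_eq_zero.1 h]
    funext a b
    simp only [p27, con_smul, con_add, Pi.smul_apply, Pi.add_apply, smul_eq_mul, con_J40_3 hs,
      con_J40_2 hs, con_J40 hs, Pi.zero_apply]
    ring
  · intro h
    have e := J40_eq_of_con_eq_zero hs h
    simp only [p27, e, J40_smul, smul_smul, ← add_smul]
    norm_num

theorem p1_add_p35_eq_zero_iff {s : T4} (hs : IsAlt4 s) :
    p1 s + p35 s = 0 ↔ symPart (con s) = 0 := by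
  constructor
  · intro h
    have h := congrArg con h
    funext a b
    have := congrFun (congrFun h a) b
    simp only [p1, p35, con_smul, con_add, con_sub, con_zero, Pi.smul_apply, Pi.add_apply,
      Pi.sub_apply, smul_eq_mul, con_J40_3 hs, con_J40_2 hs, con_J40 hs, Pi.zero_apply] at this
    have h2 := symPart_add_skewPart (con s) a b
    simp only [Pi.zero_apply]
    linarith
  · intro h
    have h0 : tr0 (con s) = 0 := by
      have : ∀ a, con s a a = 0 := fun a => by
        have := congrFun (congrFun h a) a
        simp only [symPart, Pi.zero_apply] at this; linarith
      simp [tr0, this]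
    -- When con s is antisymmetric, (J₄ + 6)s has zero contraction, so (J₄ − 2)(J₄ + 6)s = 0. This
    -- quadratic is a factor of both cubics.
    have e := J40_eq_of_con_eq_zero ((isAlt4_J40 s).add (hs.smul 6)) (by
      funext a b
      have h2 := symPart_add_skewPart (con s) a b
      have h3 := congrFun (congrFun h a) b
      simp only [con_smul, con_add, Pi.smul_apply, Pi.add_apply, smul_eq_mul, con_J40 hs, h0,
        Pi.zero_apply] at h3 ⊢
      linarith)
    have e2 : J40 (J40 s) = (12 : ℝ) • s - (4 : ℝ) • J40 s := by
      rw [J40_add, J40_smul] at e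
      rw [eq_sub_of_add_eq e]; module
    have e3 : J40 (J40 (J40 s)) = (12 : ℝ) • J40 s - (4 : ℝ) • J40 (J40 s) := by
      conv_lhs => rw [e2]
      rw [sub_eq_add_neg, ← neg_smul, J40_add, J40_smul, J40_smul]; module
    rw [p1, p35, e3, e2]
    module

theorem p7_eq_zero_iff {s : T4} (hs : IsAlt4 s) : p7 s = 0 ↔ skewPart (con s) = 0 := by
  constructor
  · intro h
    have h := congrArg con h
    funext a b
    have := congrFun (congrFun h a) b
    simp only [p7, con_smul, con_add, con_sub, con_zero, Pi.smul_apply, Pi.add_apply,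
      Pi.sub_apply, smul_eq_mul, con_J40_3 hs, con_J40_2 hs, con_J40 hs, Pi.zero_apply] at this
    simp only [Pi.zero_apply]
    linarith
  · intro h
    -- A symmetric contraction carries only the eigenvalues −12 and 0, so J₄(J₄ + 12)s has zero
    -- contraction and is annihilated by J₄ − 2.
    have e := J40_eq_of_con_eq_zero ((isAlt4_J40 (J40 s)).add ((isAlt4_J40 s).smul 12)) (by
      funext a b
      have h3 := congrFun (congrFun h a) b
      simp only [con_smul, con_add, Pi.smul_apply, Pi.add_apply, smul_eq_mul, con_J40 hs,
        con_J40_2 hs, Pi.zero_apply] at h3 ⊢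
      rw [h3]; ring)
    rw [J40_add, J40_smul] at e
    rw [p7, eq_sub_of_add_eq e]
    module

/-! ### Adjointness and injectivity -/

theorem sum_swap02 (f : Fin 8 → Fin 8 → Fin 8 → ℝ) :
    ∑ a, ∑ b, ∑ c, f a b c = ∑ a, ∑ b, ∑ c, f c b a := by
  calc _ = ∑ b, ∑ a, ∑ c, f a b c := Finset.sum_comm
    _ = ∑ b, ∑ c, ∑ a, f a b c := Finset.sum_congr rfl fun _ _ => Finset.sum_comm
    _ = _ := Finset.sum_comm

/-- This is the adjointness of ι and con: antisymmetrisation can be dropped against the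
antisymmetric s. -/
theorem sum_iota_mul (B : T2) {s : T4} (hs : IsAlt4 s) :
    ∑ a, ∑ b, ∑ c, ∑ d, iota B a b c d * s a b c d = ∑ a, ∑ e, B a e * con s a e := by
  let f : T4 := fun a b c d => ∑ e, B a e * cayley0 e b c d
  have h0 : ∑ a, ∑ b, ∑ c, ∑ d, f a b c d * s a b c d = ∑ a, ∑ e, B a e * con s a e := by
    refine Finset.sum_congr rfl fun a _ => ?_
    simp only [f, con, Finset.sum_mul, Finset.mul_sum]
    symm
    rw [Finset.sum_comm]
    refine Finset.sum_congr rfl fun b _ => ?_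
    rw [Finset.sum_comm]
    refine Finset.sum_congr rfl fun c _ => ?_
    rw [Finset.sum_comm]
    exact Finset.sum_congr rfl fun d _ => Finset.sum_congr rfl fun e _ => by ring
  have h1 : ∑ a, ∑ b, ∑ c, ∑ d, f b a c d * s a b c d =
      -∑ a, ∑ b, ∑ c, ∑ d, f a b c d * s a b c d := by
    rw [Finset.sum_comm]
    simp only [← Finset.sum_neg_distrib]
    exact Finset.sum_congr rfl fun a _ => Finset.sum_congr rfl fun b _ =>
      Finset.sum_congr rfl fun c _ => Finset.sum_congr rfl fun d _ => by rw [hs.1 a b c d]; ring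
  have h2 : ∑ a, ∑ b, ∑ c, ∑ d, f c b a d * s a b c d =
      -∑ a, ∑ b, ∑ c, ∑ d, f a b c d * s a b c d := by
    rw [sum_swap02]
    simp only [← Finset.sum_neg_distrib]
    exact Finset.sum_congr rfl fun a _ => Finset.sum_congr rfl fun b _ =>
      Finset.sum_congr rfl fun c _ => Finset.sum_congr rfl fun d _ => by
        rw [hs.1 b c a d, hs.2.1 b a c d, hs.1 a b c d]; ring
  have h3 : ∑ a, ∑ b, ∑ c, ∑ d, f d b c a * s a b c d =
      -∑ a, ∑ b, ∑ c, ∑ d, f a b c d * s a b c d := by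
    have h : ∑ a, ∑ b, ∑ c, ∑ d, f d b c a * s a b c d =
        -∑ a, ∑ b, ∑ c, ∑ d, f c b a d * (-s a b c d) := by
      simp only [← Finset.sum_neg_distrib]
      refine Finset.sum_congr rfl fun a _ => Finset.sum_congr rfl fun b _ => ?_
      rw [Finset.sum_comm]
      refine Finset.sum_congr rfl fun c _ => Finset.sum_congr rfl fun d _ => ?_
      simp only [f, cayley0_swap23 _ b a d, mul_neg, Finset.sum_neg_distrib, hs.2.2 a b c d]; ring
    rw [h]
    simp only [mul_neg, Finset.sum_neg_distrib, neg_neg]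
    exact h2
  have h : ∀ a b c d, iota B a b c d * s a b c d = (1 / 4 : ℝ) * (f a b c d * s a b c d
      - f b a c d * s a b c d - f c b a d * s a b c d - f d b c a * s a b c d) := fun a b c d => by
    rw [iota_apply]; ring
  simp only [h, ← Finset.mul_sum, Finset.sum_sub_distrib, h1, h2, h3, h0]
  ring

theorem sum4_sq_eq_zero {s : T4} (h : ∑ a, ∑ b, ∑ c, ∑ d, s a b c d * s a b c d = 0) : s = 0 := by
  have n : ∀ a b c d, 0 ≤ s a b c d * s a b c d := fun a b c d => mul_self_nonneg _
  funext a b c d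
  rw [Finset.sum_eq_zero_iff_of_nonneg fun a _ => Finset.sum_nonneg fun b _ =>
    Finset.sum_nonneg fun c _ => Finset.sum_nonneg fun d _ => n a b c d] at h
  have h := h a (Finset.mem_univ _)
  rw [Finset.sum_eq_zero_iff_of_nonneg fun b _ =>
    Finset.sum_nonneg fun c _ => Finset.sum_nonneg fun d _ => n a b c d] at h
  have h := h b (Finset.mem_univ _)
  rw [Finset.sum_eq_zero_iff_of_nonneg fun c _ => Finset.sum_nonneg fun d _ => n a b c d] at h
  have h := h c (Finset.mem_univ _)
  rw [Finset.sum_eq_zero_iff_of_nonneg fun d _ => n a b c d] at h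
  exact mul_self_eq_zero.1 (h d (Finset.mem_univ _))

theorem tr0_skew {B : T2} (hB : ∀ a b, B b a = -B a b) : tr0 B = 0 := by
  have : ∀ a, B a a = 0 := fun a => by have := hB a a; linarith
  simp [tr0, this]

/-- `ι` vanishes on `Λ²_21`. -/
theorem iota_eq_zero {B : T2} (hB : ∀ a b, B b a = -B a b) (h : J20 B = B) : iota B = 0 := by
  apply sum4_sq_eq_zero
  -- Here |ι(B)|² = ⟨B, con ι(B)⟩, and con ι(B) = 6(B − J₂B) = 0.
  rw [sum_iota_mul B (isAlt4_iota B)]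
  simp [con_iota, h, tr0_skew hB]

/-- On 2-forms ι sees only the Λ²_7 component, which is a quarter of B − J₂B. -/
theorem iota_congr {B B' : T2} (hB : ∀ a b, B b a = -B a b) (hB' : ∀ a b, B' b a = -B' a b)
    (h : B - J20 B = B' - J20 B') : iota B = iota B' := by
  rw [← sub_eq_zero, ← iota_sub]
  refine iota_eq_zero (fun a b => ?_) ?_
  · simp only [Pi.sub_apply, hB a b, hB' a b]; ring
  · rw [J20_sub, sub_eq_sub_iff_sub_eq_sub, ← neg_sub, ← neg_sub (B') , h]

/-- The contraction of two Cayley forms over one index, applied to a 2-form. -/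
theorem cayley0_contract1_two {B : T2} (hB : ∀ a b, B b a = -B a b) (j k l a : Fin 8) :
    ∑ e, cayley0 e j k l * J20 B e a =
      delta j a * (B k l - J20 B k l) + delta k a * (B l j - J20 B l j)
        + delta l a * (B j k - J20 B j k) + ∑ s, cayley0 k l a s * B j s
        + ∑ s, cayley0 l j a s * B k s + ∑ s, cayley0 j k a s * B l s := by
  have : ∑ e, cayley0 e j k l * J20 B e a =
      (1 / 2 : ℝ) * ∑ r, ∑ s, (∑ e, cayley0 e j k l * cayley0 e a r s) * B r s := by
    simp only [J20, Finset.mul_sum, Finset.sum_mul]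
    rw [Finset.sum_comm]
    refine Finset.sum_congr rfl fun r _ => ?_
    rw [Finset.sum_comm]
    exact Finset.sum_congr rfl fun s _ => Finset.sum_congr rfl fun e _ => by ring
  rw [this]
  simp only [cayley0_contract1, sub_mul, add_mul, Finset.sum_sub_distrib, Finset.sum_add_distrib]
  simp only [mul_assoc, mul_left_comm _ (delta _ a), ← Finset.mul_sum, sum_delta_mul]
  have h1 : ∀ k l j, ∑ i, cayley0 k l i a * B j i = -∑ s, cayley0 k l a s * B j s := fun k l j => by
    simp only [cayley0_swap23 k l a, neg_mul, Finset.sum_neg_distrib]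
  have h2 : ∀ k l j, ∑ i, cayley0 k l a i * B i j = -∑ s, cayley0 k l a s * B j s := fun k l j => by
    simp only [hB j, mul_neg, Finset.sum_neg_distrib]
  simp only [h1, h2, J20, hB k l, hB l j, hB j k]
  ring

theorem sum_alt3_rot {u : T3} (hu : IsAlt3 u) (g : T3) :
    ∑ p, ∑ q, ∑ r, u p q r * g q r p = ∑ p, ∑ q, ∑ r, u p q r * g p q r := by
  have := sum_alt3_swap12 hu fun p q r => g p r q
  rw [this, sum_alt3_swap23 hu, neg_neg]

/-- A tensor in `Λ¹ ⊗ Λ²_7` whose total antisymmetrisation vanishes is zero. -/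
theorem eq_zero_of_cyc_eq_zero {C : T3} (hC : ∀ a b c, C a c b = -C a b c)
    (hJ : ∀ a, J20 (C a) = (-3 : ℝ) • C a) (hcyc : ∀ a b c, C a b c + C b c a + C c a b = 0) :
    C = 0 := by
  have hJ' : ∀ a i j, ∑ p, ∑ q, cayley0 i j p q * C a p q = -6 * C a i j := fun a i j => by
    have := congrFun (congrFun (hJ a) i) j
    simp only [J20, Pi.smul_apply, smul_eq_mul] at this
    linarith
  have half : ∀ (i j : Fin 8) (G : Fin 8 → Fin 8 → ℝ),
      ∑ p, ∑ q, cayley0 i j p q * G p q =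
      (1 / 2 : ℝ) * ∑ p, ∑ q, cayley0 i j p q * (G p q - G q p) := fun i j G => by
    have : ∑ p, ∑ q, cayley0 i j p q * G q p = -∑ p, ∑ q, cayley0 i j p q * G p q := by
      rw [Finset.sum_comm]
      simp only [← Finset.sum_neg_distrib]
      exact Finset.sum_congr rfl fun _ _ => Finset.sum_congr rfl fun _ _ => by
        rw [cayley0_swap23]; ring
    simp only [mul_sub, Finset.sum_sub_distrib, this]; ring
  -- Because C takes values in Λ²_7, its trace is a multiple of Φ contracted with all three indices
  -- of C. Such a contraction depends only on the cyclic sum.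
  have hw : ∀ s, ∑ p, C p p s = 0 := by
    intro s
    have e : -6 * ∑ p, C p p s = ∑ p, ∑ q, ∑ r, cayley0 s p q r * -C p q r := by
      rw [Finset.mul_sum]
      refine Finset.sum_congr rfl fun p _ => ?_
      rw [← hJ']
      refine Finset.sum_congr rfl fun q _ => Finset.sum_congr rfl fun r _ => ?_
      rw [cayley0_swap01 s p]; ring
    have c1 := sum_alt3_rot (isAlt3_cayley0 s) fun p q r => -C p q r
    have c2 := sum_alt3_rot (isAlt3_cayley0 s) fun p q r => -C q r p
    have c3 : ∑ p, ∑ q, ∑ r, cayley0 s p q r * -C p q r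
        + ∑ p, ∑ q, ∑ r, cayley0 s p q r * -C q r p
        + ∑ p, ∑ q, ∑ r, cayley0 s p q r * -C r p q = 0 := by
      simp only [← Finset.sum_add_distrib]
      refine Finset.sum_eq_zero fun p _ => Finset.sum_eq_zero fun q _ =>
        Finset.sum_eq_zero fun r _ => ?_
      linear_combination -cayley0 s p q r * hcyc p q r
    linarith
  funext a k l
  -- Summing over p gives 9 C_{akl} = 4 C_{akl} + 3 C_{kla} + 3 C_{lak}. The cyclic hypothesis turns
  -- the right side into C_{akl}, so C = 0.
  have W := fun p => cayley0_contract1_two (fun i j => hC p i j) p k l a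
  simp only [hJ, Pi.smul_apply, smul_eq_mul] at W
  have W' := Finset.sum_congr (s₁ := Finset.univ) rfl fun p _ => W p
  simp only [Finset.sum_add_distrib] at W'
  have l1 : ∑ p, ∑ e, cayley0 e p k l * (-3 * C p e a) = 9 * C a k l := by
    have := half k l fun e p => C p e a
    have h2 : ∀ e p, C p e a - C e p a = C a e p := fun e p => by
      have := hcyc p e a; rw [hC e p a, hC a e p] at this; linarith
    simp only [h2, hJ'] at this
    rw [Finset.sum_comm]
    have h3 : ∑ e, ∑ p, cayley0 e p k l * (-3 * C p e a) =
      -3 * ∑ e, ∑ p, cayley0 k l e p * C p e a := by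
      simp only [Finset.mul_sum]
      exact Finset.sum_congr rfl fun _ _ => Finset.sum_congr rfl fun _ _ => by
        rw [cayley0_pair k l]; ring
    rw [h3, this]; ring
  have r1 : ∑ p, delta p a * (C p k l - -3 * C p k l) = 4 * C a k l := by
    rw [sum_delta_mul' a fun p => C p k l - -3 * C p k l]; ring
  have r2 : ∑ p, delta k a * (C p l p - -3 * C p l p) = 0 := by
    have h : ∀ p, delta k a * (C p l p - -3 * C p l p) = -4 * delta k a * C p p l := fun p => by
      rw [hC p p l]; ring
    simp only [h, ← Finset.mul_sum, hw, mul_zero]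
  have r3 : ∑ p, delta l a * (C p p k - -3 * C p p k) = 0 := by
    have h : ∀ p, delta l a * (C p p k - -3 * C p p k) = 4 * delta l a * C p p k := fun p => by ring
    simp only [h, ← Finset.mul_sum, hw, mul_zero]
  have r4 : ∑ p, ∑ s, cayley0 k l a s * C p p s = 0 := by
    rw [Finset.sum_comm]; simp only [← Finset.mul_sum, hw, mul_zero, Finset.sum_const_zero]
  have u : ∀ k l, ∑ p, ∑ s, cayley0 l p a s * C p k s = 3 * C k l a := by
    intro k l
    have := half l a fun p s => C p k s
    have h2 : ∀ p s, C p k s - C s k p = C k p s := fun p s => by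
      have := hcyc p k s; rw [hC s k p, hC k p s] at this; linarith
    simp only [h2, hJ'] at this
    have h3 : ∑ p, ∑ s, cayley0 l p a s * C p k s = -∑ p, ∑ s, cayley0 l a p s * C p k s := by
      simp only [← Finset.sum_neg_distrib]
      exact Finset.sum_congr rfl fun _ _ => Finset.sum_congr rfl fun _ _ => by
        rw [cayley0_swap12]; ring
    rw [h3, this]; ring
  have r5 : ∑ p, ∑ s, cayley0 p k a s * C p l s = -(3 * C l k a) := by
    rw [← u l k]
    simp only [← Finset.sum_neg_distrib]
    exact Finset.sum_congr rfl fun _ _ => Finset.sum_congr rfl fun _ _ => by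
        rw [cayley0_swap01]; ring
  rw [l1, r1, r2, r3, r4, u, r5] at W'
  have h1 := hcyc a k l
  have h2 := hC l k a
  simp only [Pi.zero_apply]
  linarith

/-! ### 3-forms -/

theorem isAlt3_J30 (t : T3) : IsAlt3 (J30 t) := by
  refine ⟨fun a b c => ?_, fun a b c => ?_⟩
  · rw [J30_apply, J30_apply, J20_skew (t c) a b, J20_skew (t b) c a, J20_skew (t a) b c]; ring
  · rw [J30_apply, J30_apply, J20_skew (t c) a b, J20_skew (t b) c a, J20_skew (t a) b c]; ring

theorem J30_add (s t : T3) : J30 (s + t) = J30 s + J30 t := by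
  funext a b c; simp only [J30_apply, Pi.add_apply, J20_add]; ring

theorem J30_smul (x : ℝ) (s : T3) : J30 (x • s) = x • J30 s := by
  funext a b c; simp only [J30_apply, Pi.smul_apply, J20_smul, smul_eq_mul]; ring

theorem IsAlt3.add {s t : T3} (hs : IsAlt3 s) (ht : IsAlt3 t) : IsAlt3 (s + t) :=
  ⟨fun a b c => by simp only [Pi.add_apply, hs.1 a b c, ht.1 a b c]; ring,
    fun a b c => by simp only [Pi.add_apply, hs.2 a b c, ht.2 a b c]; ring⟩

theorem IsAlt3.smul {s : T3} (hs : IsAlt3 s) (x : ℝ) : IsAlt3 (x • s) :=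
  ⟨fun a b c => by simp only [Pi.smul_apply, smul_eq_mul, hs.1 a b c]; ring,
    fun a b c => by simp only [Pi.smul_apply, smul_eq_mul, hs.2 a b c]; ring⟩

/-- The double contraction gives −2 for each of the three J₂ terms, and the delta terms cancel in
the cyclic sum. Contractions of Φ with a vector are thus the eigenspace −6. -/
theorem J30_vector (w : Fin 8 → ℝ) (i j k : Fin 8) :
    J30 (fun a b c => ∑ e, cayley0 e a b c * w e) i j k =
      -6 * ∑ e, cayley0 e i j k * w e := by
  have h : ∀ i j k, J20 (fun b c => ∑ e, cayley0 e k b c * w e) i j =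
      3 * delta j k * w i - 3 * delta i k * w j - 2 * ∑ e, cayley0 e i j k * w e := by
    intro i j k
    have : J20 (fun b c => ∑ e, cayley0 e k b c * w e) i j =
        (1 / 2 : ℝ) * ∑ e, (∑ p, ∑ q, cayley0 i j p q * cayley0 e k p q) * w e := by
      simp only [J20, Finset.mul_sum, Finset.sum_mul]
      symm
      rw [Finset.sum_comm]
      refine Finset.sum_congr rfl fun p _ => ?_
      rw [Finset.sum_comm]
      exact Finset.sum_congr rfl fun q _ => Finset.sum_congr rfl fun e _ => by ring
    rw [this]
    simp only [cayley0_contract2', sub_mul, Finset.sum_sub_distrib]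
    have e1 : ∑ e, 6 * delta i e * delta j k * w e = 6 * delta j k * w i := by
      rw [← sum_delta_mul i fun e => 6 * delta j k * w e]
      exact Finset.sum_congr rfl fun e _ => by ring
    have e2 : ∑ e, 6 * delta i k * delta j e * w e = 6 * delta i k * w j := by
      rw [← sum_delta_mul j fun e => 6 * delta i k * w e]
      exact Finset.sum_congr rfl fun e _ => by ring
    have e3 : ∑ e, 4 * cayley0 i j e k * w e = 4 * ∑ e, cayley0 e i j k * w e := by
      rw [Finset.mul_sum]
      refine Finset.sum_congr rfl fun e _ => ?_
      rw [cayley0_swap12 i e j k, cayley0_swap01 e i j k]; ring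
    rw [e1, e2, e3]; ring
  have r : ∀ i j k, ∑ e, cayley0 e j k i * w e = ∑ e, cayley0 e i j k * w e := fun i j k =>
    Finset.sum_congr rfl fun e _ => by rw [cayley0_swap23 e j i k, cayley0_swap12 e i j k]; ring
  rw [J30_apply, h, h, h, r i j k, ← r k i j, delta_comm j i, delta_comm k j, delta_comm k i]
  ring

/-- By `cayley0_wedge`, t − J₃t is the contraction of Φ with a vector, on which J₃ = −6. Hence (J₃ −
1)(J₃ + 6) = 0. -/
theorem J30_J30 {t : T3} (ht : IsAlt3 t) : J30 (J30 t) = (6 : ℝ) • t - (5 : ℝ) • J30 t := by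
  have h : J30 t = t + (-1 / 6 : ℝ) • fun a b c =>
      ∑ e, cayley0 e a b c * ∑ p, ∑ q, ∑ r, cayley0 e p q r * t p q r := by
    funext a b c
    simp only [Pi.add_apply, Pi.smul_apply, smul_eq_mul, cayley0_wedge t ht]; ring
  conv_lhs => rw [h]
  rw [J30_add, J30_smul]
  funext a b c
  simp only [Pi.add_apply, Pi.sub_apply, Pi.smul_apply, smul_eq_mul]
  rw [J30_vector, cayley0_wedge t ht]
  ring

/-- The inner product of rank 3 tensors. -/
def ip3 (s t : T3) : ℝ := ∑ i, ∑ j, ∑ k, s i j k * t i j k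

theorem ip3_add_right (s t u : T3) : ip3 s (t + u) = ip3 s t + ip3 s u := by
  simp [ip3, mul_add, Finset.sum_add_distrib]

theorem ip3_smul_right (x : ℝ) (s t : T3) : ip3 s (x • t) = x * ip3 s t := by
  simp only [ip3, Pi.smul_apply, smul_eq_mul, Finset.mul_sum]
  exact Finset.sum_congr rfl fun _ _ => Finset.sum_congr rfl fun _ _ =>
    Finset.sum_congr rfl fun _ _ => by ring

theorem ip3_comm (s t : T3) : ip3 s t = ip3 t s := by
  simp only [ip3, mul_comm]

theorem sum_rot (f : Fin 8 → Fin 8 → Fin 8 → ℝ) :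
    ∑ a, ∑ b, ∑ c, f a b c = ∑ a, ∑ b, ∑ c, f b c a := by
  symm
  rw [Finset.sum_comm]
  exact Finset.sum_congr rfl fun _ _ => Finset.sum_comm

/-- The three J₂ terms of J₃ contribute equally because s is cyclically symmetric. -/
theorem ip3_J30 {s : T3} (hs : IsAlt3 s) (t : T3) :
    ip3 s (J30 t) = 3 * ∑ k, ∑ i, ∑ j, s k i j * J20 (t k) i j := by
  have h1 : ∑ i, ∑ j, ∑ k, s i j k * J20 (t k) i j = ∑ k, ∑ i, ∑ j, s k i j * J20 (t k) i j := by
    rw [sum_rot]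
    simp only [← alt3_rot hs]
  have h2 : ∑ i, ∑ j, ∑ k, s i j k * J20 (t j) k i = ∑ k, ∑ i, ∑ j, s k i j * J20 (t k) i j := by
    rw [← h1, sum_rot]
    exact Finset.sum_congr rfl fun a _ => Finset.sum_congr rfl fun b _ =>
      Finset.sum_congr rfl fun c _ => by rw [alt3_rot hs a b c]
  simp only [ip3, J30_apply, mul_add, Finset.sum_add_distrib, h1, h2]
  ring

theorem sum_mul_J20 (B B' : T2) :
    ∑ i, ∑ j, B i j * J20 B' i j = ∑ i, ∑ j, B' i j * J20 B i j := by
  simp only [J20, Finset.mul_sum]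
  calc _ = ∑ i, ∑ a, ∑ j, ∑ b, B i j * (1 / 2 * (cayley0 i j a b * B' a b)) :=
        Finset.sum_congr rfl fun _ _ => Finset.sum_comm
    _ = ∑ a, ∑ i, ∑ j, ∑ b, B i j * (1 / 2 * (cayley0 i j a b * B' a b)) := Finset.sum_comm
    _ = ∑ a, ∑ i, ∑ b, ∑ j, B i j * (1 / 2 * (cayley0 i j a b * B' a b)) :=
        Finset.sum_congr rfl fun _ _ => Finset.sum_congr rfl fun _ _ => Finset.sum_comm
    _ = ∑ a, ∑ b, ∑ i, ∑ j, B i j * (1 / 2 * (cayley0 i j a b * B' a b)) :=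
        Finset.sum_congr rfl fun _ _ => Finset.sum_comm
    _ = _ := Finset.sum_congr rfl fun a _ => Finset.sum_congr rfl fun b _ =>
        Finset.sum_congr rfl fun i _ => Finset.sum_congr rfl fun j _ => by
          rw [cayley0_pair]; ring

theorem ip3_J30_comm {s t : T3} (hs : IsAlt3 s) (ht : IsAlt3 t) :
    ip3 s (J30 t) = ip3 t (J30 s) := by
  rw [ip3_J30 hs, ip3_J30 ht]
  congr 1
  exact Finset.sum_congr rfl fun k _ => sum_mul_J20 _ _

/-- The norm of the projection to `Λ³_48`. -/
theorem ip3_proj48 {t : T3} (ht : IsAlt3 t) :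
    ip3 ((6 / 7 : ℝ) • (t + (1 / 6 : ℝ) • J30 t)) ((6 / 7 : ℝ) • (t + (1 / 6 : ℝ) • J30 t)) =
      (6 / 7) * ip3 t t + (1 / 7) * ip3 t (J30 t) := by
  have e : ip3 (J30 t) (J30 t) = 6 * ip3 t t - 5 * ip3 t (J30 t) := by
    rw [ip3_J30_comm (isAlt3_J30 t) ht, J30_J30 ht, sub_eq_add_neg, ← neg_smul, ip3_add_right,
      ip3_smul_right, ip3_smul_right]; ring
  have c : ip3 (J30 t) t = ip3 t (J30 t) := ip3_comm _ _
  rw [ip3_smul_right, ip3_add_right, ip3_smul_right, ip3_comm _ t, ip3_comm _ (J30 t),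
    ip3_smul_right, ip3_smul_right, ip3_add_right, ip3_add_right, ip3_smul_right, ip3_smul_right,
    e, c]
  ring

/-! ### The torsion as a linear problem -/

/-- This is the uniqueness of the torsion. Vanishing of ι forces J₂t_a = t_a, hence J₃t = 3t, and
the full contraction of t with Φ vanishes. Then `cayley0_wedge` reads 0 = 6t − 18t. -/
theorem eq_zero_of_iota_eq_zero {t : T3} (ht : IsAlt3 t) (h : ∀ a, iota (t a) = 0) : t = 0 := by
  have hJ : ∀ a, J20 (t a) = t a := by
    intro a
    funext i j
    have := con_iota (t a) i j
    rw [h a, con_zero, tr0_skew (ht.2 a), Pi.zero_apply, Pi.zero_apply] at this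
    linarith
  have h3 : J30 t = (3 : ℝ) • t := by
    funext i j k
    rw [J30_apply, hJ, hJ, hJ]
    simp only [Pi.smul_apply, smul_eq_mul]
    have h1 := alt3_rot ht i j k
    have h2 := alt3_rot ht k i j
    linarith
  have hw : ∀ e, ∑ p, ∑ q, ∑ r, cayley0 e p q r * t p q r = 0 := by
    intro e
    have : ∀ p, ∑ q, ∑ r, cayley0 e p q r * t p q r = 0 := by
      intro p
      have := congrFun (congrFun (hJ p) e) p
      rw [J20, ht.2 p p e, alt3_eq_zero12 ht] at this
      linarith
    simp [this]
  funext i j k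
  have := cayley0_wedge t ht i j k
  simp only [hw, mul_zero, Finset.sum_const_zero, h3, Pi.smul_apply, smul_eq_mul] at this
  simp only [Pi.zero_apply]
  linarith

/-- The 3-form whose components in `Λ¹ ⊗ Λ²_7` are `C / 96`. -/
def torsionOf (C : T3) : T3 := (1 / 54 : ℝ) • (fun a b c => C a b c + C b c a + C c a b)
  + (1 / 432 : ℝ) • J30 fun a b c => C a b c + C b c a + C c a b

theorem isAlt3_cyc {C : T3} (hC : ∀ a b c, C a c b = -C a b c) :
    IsAlt3 fun a b c => C a b c + C b c a + C c a b := by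
  refine ⟨fun a b c => ?_, fun a b c => ?_⟩
  · simp only [hC c a b, hC a b c, hC b c a]; ring
  · simp only [hC a b c, hC b c a, hC c a b]; ring

theorem isAlt3_torsionOf {C : T3} (hC : ∀ a b c, C a c b = -C a b c) : IsAlt3 (torsionOf C) :=
  ((isAlt3_cyc hC).smul _).add ((isAlt3_J30 _).smul _)

/-- The cyclic sum of the desired equation is (3 − J₃)T = cyc(C)/24. The coefficients of `torsionOf`
solve it: they act as 1/48 where J₃ = 1 and as 1/216 where J₃ = −6. The remaining error lies in Λ¹ ⊗
Λ²_7 and has zero cyclic sum, so it vanishes. -/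
theorem torsionOf_sub_J20 {C : T3} (hC : ∀ a b c, C a c b = -C a b c)
    (hJ : ∀ a, J20 (C a) = (-3 : ℝ) • C a) (a : Fin 8) :
    torsionOf C a - J20 (torsionOf C a) = (1 / 24 : ℝ) • C a := by
  have hT := isAlt3_torsionOf hC
  set T := torsionOf C with hTdef
  let D : T3 := fun a b c => 24 * (T a b c - J20 (T a) b c) - C a b c
  have hD : D = 0 := by
    refine eq_zero_of_cyc_eq_zero (fun a b c => ?_) (fun a => ?_) (fun a b c => ?_)
    · simp only [D, hT.2 a b c, J20_skew (T a) b c, hC a b c]; ring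
    · have h1 : D a = (24 : ℝ) • (T a - J20 (T a)) - C a := rfl
      rw [h1, J20_sub, J20_smul, J20_sub, hJ]
      funext i j
      simp only [Pi.smul_apply, Pi.sub_apply, smul_eq_mul, J20_J20 (hT.2 a)]
      ring
    · have h1 : D a b c + D b c a + D c a b = 72 * T a b c - 24 * J30 T a b c
          - (C a b c + C b c a + C c a b) := by
        simp only [D, J30_apply]
        rw [← alt3_rot hT a b c, alt3_rot hT c a b]; ring
      have h2 : J30 T a b c = (1 / 72 : ℝ) * (C a b c + C b c a + C c a b)
          + (1 / 144) * J30 (fun a b c => C a b c + C b c a + C c a b) a b c := by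
        rw [hTdef, torsionOf, J30_add, J30_smul, J30_smul, J30_J30 (isAlt3_cyc hC)]
        simp only [Pi.smul_apply, Pi.sub_apply, Pi.add_apply, smul_eq_mul]
        ring
      rw [h1, h2, hTdef, torsionOf]
      simp only [Pi.smul_apply, Pi.add_apply, smul_eq_mul]
      ring
  funext b c
  have := congrFun (congrFun (congrFun hD a) b) c
  simp only [D, Pi.zero_apply, Pi.smul_apply, Pi.sub_apply, smul_eq_mul] at this ⊢
  linarith

/-- By `con_J40` the eigenvalue −6 is incompatible with a nonzero trace or trace-free symmetric part
of the contraction. -/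
theorem con_skew_of_J40 {s : T4} (hs : IsAlt4 s) (h : J40 s = (-6 : ℝ) • s) (i j : Fin 8) :
    con s j i = -con s i j := by
  have h1 := con_J40 hs i j
  have h2 := con_J40 hs j i
  have h3 := tr0_con_J40 hs
  rw [h, con_smul] at h1 h2 h3
  have h4 : tr0 ((-6 : ℝ) • con s) = -6 * tr0 (con s) := by
    simp [tr0, Finset.mul_sum]
  rw [h4] at h3
  have h5 : tr0 (con s) = 0 := by linarith
  simp only [h5, Pi.smul_apply, smul_eq_mul, skewPart] at h1 h2
  linarith

/-- A tensor in `Λ¹ ⊗ Λ⁴_7` comes from a 3-form. -/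
theorem iota_torsionOf {s : Fin 8 → T4} (hs : ∀ a, IsAlt4 (s a))
    (h : ∀ a, J40 (s a) = (-6 : ℝ) • s a) (a : Fin 8) :
    (4 : ℝ) • iota (torsionOf (fun a => con (s a)) a) = s a := by
  have hc : ∀ a i j, con (s a) j i = -con (s a) i j := fun a => con_skew_of_J40 (hs a) (h a)
  have hJ : ∀ a, J20 (con (s a)) = (-3 : ℝ) • con (s a) := by
    intro a
    funext i j
    rw [J20_con_alt (hs a), skewPart, hc a i j]
    simp only [Pi.smul_apply, smul_eq_mul]; ring
  -- The factor 1/96 comes from ι(con s) = 6s − 3 J₄s = 24s on Λ⁴_7, together with the 4 in the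
  -- torsion equation.
  have e1 : iota (torsionOf (fun a => con (s a)) a) = iota ((1 / 96 : ℝ) • con (s a)) := by
    refine iota_congr (fun i j => (isAlt3_torsionOf (fun a b c => hc a b c)).2 a i j)
      (fun i j => ?_) ?_
    · simp only [Pi.smul_apply, smul_eq_mul, hc a i j]; ring
    · rw [torsionOf_sub_J20 (fun a b c => hc a b c) hJ, J20_smul, hJ]
      module
  rw [e1, iota_smul, iota_con (hs a), h a]
  module

/-! ### Components in a frame -/

/-- The components of a tensor in the frame given by the columns of `E`. -/
def pull1 (E : Matrix (Fin 8) (Fin 8) ℝ) (u : Fin 8 → ℝ) : Fin 8 → ℝ := fun m => ∑ i, E i m * u i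
-- Nesting over the first index lets statements in each rank reduce to the rank below.
def pull2 (E : Matrix (Fin 8) (Fin 8) ℝ) (t : T2) : T2 := fun m n => ∑ i, E i m * pull1 E (t i) n
def pull3 (E : Matrix (Fin 8) (Fin 8) ℝ) (t : T3) : T3 := fun m n p =>
  ∑ i, E i m * pull2 E (t i) n p
def pull4 (E : Matrix (Fin 8) (Fin 8) ℝ) (t : T4) : T4 := fun m n p q =>
  ∑ i, E i m * pull3 E (t i) n p q

/-! ### Linearity and index permutations of pullbacks -/

section Linear

variable (E : Matrix (Fin 8) (Fin 8) ℝ) {ι : Type*} [Fintype ι]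

theorem pull1_sum (f : ι → Fin 8 → ℝ) (m : Fin 8) :
    pull1 E (fun i => ∑ x, f x i) m = ∑ x, pull1 E (f x) m := by
  simp only [pull1, Finset.mul_sum]; exact Finset.sum_comm
theorem pull2_sum (f : ι → T2) (m n : Fin 8) :
    pull2 E (fun i j => ∑ x, f x i j) m n = ∑ x, pull2 E (f x) m n := by
  simp only [pull2, pull1_sum, Finset.mul_sum]; exact Finset.sum_comm
theorem pull3_sum (f : ι → T3) (m n p : Fin 8) :
    pull3 E (fun i j k => ∑ x, f x i j k) m n p = ∑ x, pull3 E (f x) m n p := by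
  simp only [pull3, pull2_sum, Finset.mul_sum]; exact Finset.sum_comm
theorem pull4_sum (f : ι → T4) (m n p q : Fin 8) :
    pull4 E (fun i j k l => ∑ x, f x i j k l) m n p q = ∑ x, pull4 E (f x) m n p q := by
  simp only [pull4, pull3_sum, Finset.mul_sum]; exact Finset.sum_comm

theorem pull1_add (s t : Fin 8 → ℝ) : pull1 E (s + t) = pull1 E s + pull1 E t := by
  funext m; simp [pull1, mul_add, Finset.sum_add_distrib]
theorem pull2_add (s t : T2) : pull2 E (s + t) = pull2 E s + pull2 E t := by
  funext m n; simp [pull2, pull1_add, mul_add, Finset.sum_add_distrib]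
theorem pull3_add (s t : T3) : pull3 E (s + t) = pull3 E s + pull3 E t := by
  funext m n p; simp [pull3, pull2_add, mul_add, Finset.sum_add_distrib]
theorem pull4_add (s t : T4) : pull4 E (s + t) = pull4 E s + pull4 E t := by
  funext m n p q; simp [pull4, pull3_add, mul_add, Finset.sum_add_distrib]

theorem pull1_smul (x : ℝ) (t : Fin 8 → ℝ) : pull1 E (x • t) = x • pull1 E t := by
  funext m; simp only [pull1, Pi.smul_apply, smul_eq_mul, Finset.mul_sum, mul_left_comm x]
theorem pull2_smul (x : ℝ) (t : T2) : pull2 E (x • t) = x • pull2 E t := by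
  funext m n
  simp only [pull2, Pi.smul_apply, smul_eq_mul, Finset.mul_sum, mul_left_comm x, pull1_smul]
theorem pull3_smul (x : ℝ) (t : T3) : pull3 E (x • t) = x • pull3 E t := by
  funext m n p
  simp only [pull3, Pi.smul_apply, smul_eq_mul, Finset.mul_sum, mul_left_comm x, pull2_smul]
theorem pull4_smul (x : ℝ) (t : T4) : pull4 E (x • t) = x • pull4 E t := by
  funext m n p q
  simp only [pull4, Pi.smul_apply, smul_eq_mul, Finset.mul_sum, mul_left_comm x, pull3_smul]

theorem pull2_sub (s t : T2) : pull2 E (s - t) = pull2 E s - pull2 E t := by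
  rw [sub_eq_add_neg, ← neg_one_smul ℝ t, pull2_add, pull2_smul]; module
theorem pull4_sub (s t : T4) : pull4 E (s - t) = pull4 E s - pull4 E t := by
  rw [sub_eq_add_neg, ← neg_one_smul ℝ t, pull4_add, pull4_smul]; module
theorem pull2_zero : pull2 E 0 = 0 := by simpa using pull2_smul E 0 0
theorem pull3_zero : pull3 E 0 = 0 := by simpa using pull3_smul E 0 0
theorem pull4_zero : pull4 E 0 = 0 := by simpa using pull4_smul E 0 0

theorem pull1_mul (x : ℝ) (f : Fin 8 → ℝ) (m : Fin 8) :
    pull1 E (fun i => x * f i) m = x * pull1 E f m :=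
  congrFun (pull1_smul E x f) m
theorem pull2_mul (x : ℝ) (f : T2) (m n : Fin 8) :
    pull2 E (fun i j => x * f i j) m n = x * pull2 E f m n :=
  congrFun (congrFun (pull2_smul E x f) m) n
theorem pull2_outer (u v : Fin 8 → ℝ) (m n : Fin 8) :
    pull2 E (fun i j => u i * v j) m n = pull1 E u m * pull1 E v n := by
  simp only [pull2, pull1_mul]
  rw [show pull1 E u m = ∑ i, E i m * u i from rfl, Finset.sum_mul]
  simp only [mul_assoc]
theorem pull4_outer (u v : T2) (m n p q : Fin 8) :
    pull4 E (fun i j k l => u i j * v k l) m n p q = pull2 E u m n * pull2 E v p q := by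
  simp only [pull4, pull3, pull2_mul]
  rw [show pull2 E u m n = ∑ i, E i m * ∑ j, E j n * u i j from rfl]
  simp only [Finset.sum_mul, mul_assoc]

/-! Pulling back commutes with permutations of the indices. -/

theorem pull2_swap (t : T2) (m n : Fin 8) :
    pull2 E (fun i j => t j i) m n = pull2 E t n m := by
  simp only [pull2, pull1, Finset.mul_sum]
  rw [Finset.sum_comm]
  exact Finset.sum_congr rfl fun _ _ => Finset.sum_congr rfl fun _ _ => by ring
theorem pull3_swap12 (t : T3) (m n p : Fin 8) :
    pull3 E (fun i j k => t i k j) m n p = pull3 E t m p n := by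
  simp only [pull3, pull2_swap]
theorem pull3_swap01 (t : T3) (m n p : Fin 8) :
    pull3 E (fun i j k => t j i k) m n p = pull3 E t n m p := by
  simp only [pull3, pull2, Finset.mul_sum]
  rw [Finset.sum_comm]
  exact Finset.sum_congr rfl fun _ _ => Finset.sum_congr rfl fun _ _ => by ring
theorem pull3_rot (t : T3) (m n p : Fin 8) :
    pull3 E (fun i j k => t k i j) m n p = pull3 E t p m n := by
  rw [pull3_swap12 E (fun i j k => t j i k), pull3_swap01]

def sw01 (t : T4) : T4 := fun a b c d => t b a c d
def sw12 (t : T4) : T4 := fun a b c d => t a c b d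
def sw23 (t : T4) : T4 := fun a b c d => t a b d c

theorem pull4_sw01 (t : T4) : pull4 E (sw01 t) = sw01 (pull4 E t) := by
  funext a b c d
  simp only [sw01, pull4, pull3, Finset.mul_sum]
  rw [Finset.sum_comm]
  refine Finset.sum_congr rfl fun i _ => Finset.sum_congr rfl fun j _ => ?_
  change E j a * (E i b * pull2 E (t i j) c d) = _
  ring
theorem pull4_sw12 (t : T4) : pull4 E (sw12 t) = sw12 (pull4 E t) := by
  funext a b c d
  simp only [sw12, pull4]
  exact Finset.sum_congr rfl fun i _ => congrArg (E i a * ·) (pull3_swap01 E (t i) b c d)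
theorem pull4_sw23 (t : T4) : pull4 E (sw23 t) = sw23 (pull4 E t) := by
  funext a b c d
  simp only [sw23, pull4]
  exact Finset.sum_congr rfl fun i _ => congrArg (E i a * ·) (pull3_swap12 E (t i) b c d)

/-- Only adjacent transpositions occur, so that compatibility of antisymmetrisation with pullback
needs just three cases. -/
theorem alt4_eq_sw (t : T4) : alt4 t = (1 / 24 : ℝ) • (t - sw23 t - sw12 t + sw12 (sw23 t) + sw23 (sw12 t) - sw12 (sw23 (sw12 t)) - sw01 t
      + sw23 (sw01 t) + sw01 (sw12 t) - sw01 (sw12 (sw23 t)) - sw23 (sw01 (sw12 t))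
      + sw01 (sw12 (sw23 (sw12 t))) + sw12 (sw01 t) - sw12 (sw23 (sw01 t))
      - sw01 (sw12 (sw01 t)) + sw01 (sw12 (sw23 (sw01 t)))
      + sw12 (sw23 (sw01 (sw12 t))) - sw01 (sw12 (sw23 (sw01 (sw12 t))))
      - sw23 (sw12 (sw01 t)) + sw12 (sw23 (sw12 (sw01 t)))
      + sw23 (sw01 (sw12 (sw01 t))) - sw01 (sw12 (sw23 (sw12 (sw01 t))))
      - sw12 (sw23 (sw01 (sw12 (sw01 t))))
      + sw01 (sw12 (sw23 (sw01 (sw12 (sw01 t)))))) := by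
  funext a b c d
  rw [alt4_apply]
  rfl

theorem pull4_alt4 (t : T4) : pull4 E (alt4 t) = alt4 (pull4 E t) := by
  simp only [alt4_eq_sw, pull4_smul, pull4_add, pull4_sub, pull4_sw01, pull4_sw12, pull4_sw23]

end Linear

theorem pull1_one (u : Fin 8 → ℝ) : pull1 1 u = u := by
  funext m; simp [pull1, Matrix.one_apply]
theorem pull2_one (t : T2) : pull2 1 t = t := by
  funext m n; simp only [pull2, pull1_one]; simp [Matrix.one_apply]
theorem pull3_one (t : T3) : pull3 1 t = t := by
  funext m n p; simp only [pull3, pull2_one]; simp [Matrix.one_apply]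
theorem pull4_one (t : T4) : pull4 1 t = t := by
  funext m n p q; simp only [pull4, pull3_one]; simp [Matrix.one_apply]

/-! ### Functoriality of pullbacks -/

section Comp

variable (A E : Matrix (Fin 8) (Fin 8) ℝ)

theorem sum_mul_matrix (m : Fin 8) (x : Fin 8 → ℝ) :
    ∑ i, A i m * ∑ j, E j i * x j = ∑ j, (E * A) j m * x j := by
  simp only [Matrix.mul_apply, Finset.mul_sum, Finset.sum_mul]
  rw [Finset.sum_comm]
  exact Finset.sum_congr rfl fun _ _ => Finset.sum_congr rfl fun _ _ => by ring
theorem pull1_pull1 (u : Fin 8 → ℝ) : pull1 A (pull1 E u) = pull1 (E * A) u := by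
  funext m; exact sum_mul_matrix A E m u
theorem pull2_pull2 (t : T2) : pull2 A (pull2 E t) = pull2 (E * A) t := by
  funext m n
  have h : ∀ i, pull1 A (pull2 E t i) n = ∑ j, E j i * pull1 (E * A) (t j) n := fun i => by
    rw [show pull2 E t i = fun n => ∑ j, E j i * pull1 E (t j) n from rfl, pull1_sum]
    simp only [pull1_mul, pull1_pull1]
  simp only [pull2, h]
  exact sum_mul_matrix A E m _
theorem pull2_mul' (x : ℝ) (f : T2) : pull2 E (fun i j => x * f i j) = x • pull2 E f :=
  pull2_smul E x f
theorem pull3_mul' (x : ℝ) (f : T3) : pull3 E (fun i j k => x * f i j k) = x • pull3 E f :=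
  pull3_smul E x f
theorem pull3_pull3 (t : T3) : pull3 A (pull3 E t) = pull3 (E * A) t := by
  funext m n p
  have h : ∀ i, pull2 A (pull3 E t i) n p = ∑ j, E j i * pull2 (E * A) (t j) n p := fun i => by
    rw [show pull3 E t i = fun n p => ∑ j, E j i * pull2 E (t j) n p from rfl, pull2_sum]
    simp only [pull2_mul', pull2_pull2, Pi.smul_apply, smul_eq_mul]
  simp only [pull3, h]
  exact sum_mul_matrix A E m _
theorem pull4_pull4 (t : T4) : pull4 A (pull4 E t) = pull4 (E * A) t := by
  funext m n p q
  have h : ∀ i, pull3 A (pull4 E t i) n p q = ∑ j, E j i * pull3 (E * A) (t j) n p q := fun i => by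
    rw [show pull4 E t i = fun n p q => ∑ j, E j i * pull3 E (t j) n p q from rfl, pull3_sum]
    simp only [pull3_mul', pull3_pull3, Pi.smul_apply, smul_eq_mul]
  simp only [pull4, h]
  exact sum_mul_matrix A E m _

end Comp

/-- The columns of `E` are a frame in which `φ` and `γ` are standard, and the rows of `A` are the
dual coframe. -/
structure IsFrame (A E : Matrix (Fin 8) (Fin 8) ℝ) (φ : T4) (γ : T2) : Prop where
  mul_eq_one : A * E = 1
  mul_eq_one' : E * A = 1
  ginv_eq : ∀ p q, ginv γ p q = ∑ m, E p m * E q m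
  metric_eq : pull2 E γ = delta
  form_eq : pull4 E φ = cayley0

theorem isAdapted_iff {A : Matrix (Fin 8) (Fin 8) ℝ} {φ : T4} {γ : T2} :
    IsAdapted A φ γ ↔ A.det ≠ 0 ∧ γ = pull2 A delta ∧ φ = pull4 A cayley0 := by
  refine and_congr Iff.rfl (and_congr ?_ ?_)
  · rw [funext_iff]
    refine forall_congr' fun i => ?_
    rw [funext_iff]
    refine forall_congr' fun j => ?_
    simp only [pull2, pull1, sum_mul_delta]
  · have : ∀ i j k l, ∑ m, ∑ n, ∑ p, ∑ q, A m i * A n j * A p k * A q l * cayley0 m n p q =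
        pull4 A cayley0 i j k l := fun i j k l => by
      simp only [pull4, pull3, pull2, pull1, Finset.mul_sum, mul_assoc]
    simp only [this]
    exact ⟨fun h => by funext i j k l; exact h i j k l, fun h i j k l => by rw [h]⟩

/-- The metric matrix is AᵀA, so its inverse is A⁻¹ times its transpose, which is the formula for
`ginv` in terms of the frame. -/
theorem IsAdapted.isFrame {A : Matrix (Fin 8) (Fin 8) ℝ} {φ : T4} {γ : T2}
    (h : IsAdapted A φ γ) : IsFrame A A⁻¹ φ γ := by
  obtain ⟨hd, hγ, hφ⟩ := isAdapted_iff.1 h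
  have hu : IsUnit A.det := isUnit_iff_ne_zero.2 hd
  have h1 := Matrix.mul_nonsing_inv A hu
  refine ⟨h1, Matrix.nonsing_inv_mul A hu, fun p q => ?_, ?_, ?_⟩
  · have : Matrix.of γ = A.transpose * A := by
      ext i j
      simp [Matrix.mul_apply, h.2.1 i j]
    rw [ginv, this, Matrix.mul_inv_rev, ← Matrix.transpose_nonsing_inv]
    exact Matrix.mul_apply
  · rw [hγ, pull2_pull2, h1, pull2_one]
  · rw [hφ, pull4_pull4, h1, pull4_one]

/-- Pulling back by an invertible matrix preserves adapted pairs. -/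
theorem IsAdapted.pull {A : Matrix (Fin 8) (Fin 8) ℝ} {φ : T4} {γ : T2}
    (h : IsAdapted A φ γ) (B : Matrix (Fin 8) (Fin 8) ℝ) (hB : B.det ≠ 0) :
    IsAdapted (A * B) (pull4 B φ) (pull2 B γ) := by
  obtain ⟨hd, hγ, hφ⟩ := isAdapted_iff.1 h
  refine isAdapted_iff.2 ⟨?_, ?_, ?_⟩
  · rw [Matrix.det_mul]; exact mul_ne_zero hd hB
  · rw [hγ, pull2_pull2]
  · rw [hφ, pull4_pull4]

theorem isFrame_one : IsFrame 1 1 cayley0 delta := by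
  have : IsAdapted 1 cayley0 delta := isAdapted_iff.2
    ⟨by simp, (pull2_one _).symm, (pull4_one _).symm⟩
  simpa using this.isFrame

/-! ### Raising indices in a frame -/

namespace IsFrame

variable {A E : Matrix (Fin 8) (Fin 8) ℝ} {φ : T4} {γ : T2} (h : IsFrame A E φ γ)
include h

theorem pull2_inj {s t : T2} (hst : pull2 E s = pull2 E t) : s = t := by
  have := congrArg (pull2 A) hst
  rwa [pull2_pull2, pull2_pull2, h.mul_eq_one', pull2_one, pull2_one] at this
theorem pull3_inj {s t : T3} (hst : pull3 E s = pull3 E t) : s = t := by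
  have := congrArg (pull3 A) hst
  rwa [pull3_pull3, pull3_pull3, h.mul_eq_one', pull3_one, pull3_one] at this
theorem pull4_inj {s t : T4} (hst : pull4 E s = pull4 E t) : s = t := by
  have := congrArg (pull4 A) hst
  rwa [pull4_pull4, pull4_pull4, h.mul_eq_one', pull4_one, pull4_one] at this

theorem ginv_comm (p q : Fin 8) : ginv γ p q = ginv γ q p := by
  rw [h.ginv_eq, h.ginv_eq]; exact Finset.sum_congr rfl fun _ _ => mul_comm _ _

/-- The inverse metric is the sum of the squares of the frame vectors, so contracting with it is
summing products of frame components. -/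
theorem raise1 (u v : Fin 8 → ℝ) :
    ∑ p, (∑ p', ginv γ p p' * u p') * v p = ∑ m, pull1 E u m * pull1 E v m := by
  simp only [h.ginv_eq, pull1, Finset.sum_mul, Finset.mul_sum]
  calc _ = ∑ p, ∑ m, ∑ p', E p m * E p' m * u p' * v p :=
        Finset.sum_congr rfl fun _ _ => Finset.sum_comm
    _ = ∑ m, ∑ p, ∑ p', E p m * E p' m * u p' * v p := Finset.sum_comm
    _ = _ := Finset.sum_congr rfl fun _ _ => Finset.sum_congr rfl fun _ _ =>
        Finset.sum_congr rfl fun _ _ => by ring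

theorem raise2 (u v : T2) :
    ∑ p, ∑ q, (∑ p', ∑ q', ginv γ p p' * ginv γ q q' * u p' q') * v p q =
      ∑ m, ∑ n, pull2 E u m n * pull2 E v m n := by
  have e1 : ∀ p q, ∑ p', ∑ q', ginv γ p p' * ginv γ q q' * u p' q' =
      ∑ q', ginv γ q q' * ∑ p', ginv γ p p' * u p' q' := fun p q => by
    simp only [Finset.mul_sum]; rw [Finset.sum_comm]
    exact Finset.sum_congr rfl fun _ _ => Finset.sum_congr rfl fun _ _ => by ring
  have e2 : ∀ p, ∑ q, (∑ q', ginv γ q q' * ∑ p', ginv γ p p' * u p' q') * v p q =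
      ∑ n, (∑ p', ginv γ p p' * pull1 E (u p') n) * pull1 E (v p) n := fun p => by
    rw [h.raise1]
    refine Finset.sum_congr rfl fun n _ => ?_
    rw [pull1_sum]; simp only [pull1_mul]
  simp only [e1, e2]
  rw [Finset.sum_comm]
  simp only [h.raise1 (fun p => pull1 E (u p) _) (fun p => pull1 E (v p) _)]
  rw [Finset.sum_comm]
  rfl

theorem raise3 (u v : T3) :
    ∑ p, ∑ q, ∑ r, (∑ p', ∑ q', ∑ r', ginv γ p p' * ginv γ q q' * ginv γ r r' * u p' q' r')
      * v p q r = ∑ m, ∑ n, ∑ k, pull3 E u m n k * pull3 E v m n k := by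
  have e1 : ∀ p q r, ∑ p', ∑ q', ∑ r', ginv γ p p' * ginv γ q q' * ginv γ r r' * u p' q' r' =
      ∑ q', ∑ r', ginv γ q q' * ginv γ r r' * ∑ p', ginv γ p p' * u p' q' r' := fun p q r => by
    simp only [Finset.mul_sum]
    rw [Finset.sum_comm]
    refine Finset.sum_congr rfl fun _ _ => ?_
    rw [Finset.sum_comm]
    exact Finset.sum_congr rfl fun _ _ => Finset.sum_congr rfl fun _ _ => by ring
  have e2 : ∀ p, ∑ q, ∑ r, (∑ q', ∑ r', ginv γ q q' * ginv γ r r' *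
      ∑ p', ginv γ p p' * u p' q' r') * v p q r =
      ∑ n, ∑ k, (∑ p', ginv γ p p' * pull2 E (u p') n k) * pull2 E (v p) n k := fun p => by
    rw [h.raise2]
    refine Finset.sum_congr rfl fun n _ => Finset.sum_congr rfl fun k _ => ?_
    rw [pull2_sum]; simp only [pull2_mul]
  simp only [e1, e2]
  calc _ = ∑ n, ∑ p, ∑ k, (∑ p', ginv γ p p' * pull2 E (u p') n k) * pull2 E (v p) n k :=
        Finset.sum_comm
    _ = ∑ n, ∑ k, ∑ p, (∑ p', ginv γ p p' * pull2 E (u p') n k) * pull2 E (v p) n k :=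
        Finset.sum_congr rfl fun _ _ => Finset.sum_comm
    _ = ∑ n, ∑ k, ∑ m, pull3 E u m n k * pull3 E v m n k :=
        Finset.sum_congr rfl fun n _ => Finset.sum_congr rfl fun k _ =>
          h.raise1 (fun p => pull2 E (u p) n k) (fun p => pull2 E (v p) n k)
    _ = _ := ((sum_rot _).trans (sum_rot _)).symm

theorem raise4 (u v : T4) :
    ∑ p, ∑ q, ∑ r, ∑ s, phiUUUU γ u p q r s * v p q r s =
      ∑ m, ∑ n, ∑ k, ∑ l, pull4 E u m n k l * pull4 E v m n k l := by
  have e2 : ∀ p, ∑ q, ∑ r, ∑ s, phiUUUU γ u p q r s * v p q r s =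
      ∑ n, ∑ k, ∑ l, (∑ p', ginv γ p p' * pull3 E (u p') n k l) * pull3 E (v p) n k l := fun p => by
    have e3 : ∀ n k l, ∑ p', ginv γ p p' * pull3 E (u p') n k l =
        pull3 E (fun q r s => ∑ p', ginv γ p p' * u p' q r s) n k l := fun n k l => by
      rw [pull3_sum]; simp only [pull3_mul', Pi.smul_apply, smul_eq_mul]
    simp only [e3]
    rw [← h.raise3]
    refine Finset.sum_congr rfl fun q _ => Finset.sum_congr rfl fun r _ =>
      Finset.sum_congr rfl fun s _ => congrArg (· * _) ?_
    simp only [phiUUUU, phiUUU, Finset.mul_sum]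
    rw [Finset.sum_comm]
    refine Finset.sum_congr rfl fun _ _ => ?_
    rw [Finset.sum_comm]
    refine Finset.sum_congr rfl fun _ _ => ?_
    rw [Finset.sum_comm]
    exact Finset.sum_congr rfl fun _ _ => Finset.sum_congr rfl fun _ _ => by ring
  simp only [e2]
  calc _ = ∑ n, ∑ p, ∑ k, ∑ l, (∑ p', ginv γ p p' * pull3 E (u p') n k l) * pull3 E (v p) n k l :=
        Finset.sum_comm
    _ = ∑ n, ∑ k, ∑ p, ∑ l, (∑ p', ginv γ p p' * pull3 E (u p') n k l) * pull3 E (v p) n k l :=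
        Finset.sum_congr rfl fun _ _ => Finset.sum_comm
    _ = ∑ n, ∑ k, ∑ l, ∑ p, (∑ p', ginv γ p p' * pull3 E (u p') n k l) * pull3 E (v p) n k l :=
        Finset.sum_congr rfl fun _ _ => Finset.sum_congr rfl fun _ _ => Finset.sum_comm
    _ = ∑ n, ∑ k, ∑ l, ∑ m, pull4 E u m n k l * pull4 E v m n k l :=
        Finset.sum_congr rfl fun n _ => Finset.sum_congr rfl fun k _ =>
          Finset.sum_congr rfl fun l _ =>
          h.raise1 (fun p => pull3 E (u p) n k l) (fun p => pull3 E (v p) n k l)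
    _ = ∑ n, ∑ k, ∑ m, ∑ l, pull4 E u m n k l * pull4 E v m n k l :=
        Finset.sum_congr rfl fun _ _ => Finset.sum_congr rfl fun _ _ => Finset.sum_comm
    _ = ∑ n, ∑ m, ∑ k, ∑ l, pull4 E u m n k l * pull4 E v m n k l :=
        Finset.sum_congr rfl fun _ _ => Finset.sum_comm
    _ = _ := Finset.sum_comm

end IsFrame

section Outer

variable (E : Matrix (Fin 8) (Fin 8) ℝ)

theorem pull3_outer (u : T2) (v : Fin 8 → ℝ) (m n p : Fin 8) :
    pull3 E (fun i j k => u i j * v k) m n p = pull2 E u m n * pull1 E v p := by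
  have : ∀ i, pull2 E (fun j k => u i j * v k) n p = pull1 E (u i) n * pull1 E v p := fun i =>
    pull2_outer E (u i) v n p
  simp only [pull3, this]
  simp only [pull2, Finset.sum_mul, mul_assoc]

theorem pull4_outer13 (u : Fin 8 → ℝ) (v : T3) (m n p q : Fin 8) :
    pull4 E (fun i j k l => u i * v j k l) m n p q = pull1 E u m * pull3 E v n p q := by
  simp only [pull4, pull3_mul', Pi.smul_apply, smul_eq_mul, pull1, Finset.sum_mul, mul_assoc]

theorem pull3_last (t : T3) (m n p : Fin 8) :
    pull1 E (fun a => pull2 E (fun i j => t i j a) m n) p = pull3 E t m n p :=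
  (pull3_rot E (fun a i j => t i j a) m n p).symm

theorem pull1_pull3 (t : T4) (m n p q : Fin 8) :
    pull3 E (fun b c d => pull1 E (fun e => t e b c d) m) n p q = pull4 E t m n p q := by
  simp only [pull1, pull4]
  rw [pull3_sum]
  simp only [pull3_mul', Pi.smul_apply, smul_eq_mul]

theorem pull3_mid (t : T4) (a m n p : Fin 8) :
    pull1 E (fun a => pull3 E (fun p q r => t r a p q) m n p) a = pull4 E t p a m n := by
  have : ∀ a, pull3 E (fun p q r => t r a p q) m n p = ∑ r, E r p * pull2 E (t r a) m n :=
    fun a => pull3_rot E (fun r p q => t r a p q) m n p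
  simp only [this]
  simp only [pull1, pull4, pull3, Finset.mul_sum]
  rw [Finset.sum_comm]
  exact Finset.sum_congr rfl fun _ _ => Finset.sum_congr rfl fun _ _ =>
    by ring

end Outer

/-- `t_{abp} t_{cdp}` -/
def quad0 (t : T3) : T4 := fun a b c d => ∑ m, t a b m * t c d m
/-- `Φ_{ijkl} t_{ija} t_{klb}` -/
def quadSym0 (t : T3) : T2 := fun a b =>
  ∑ i, ∑ j, ∑ k, ∑ l, cayley0 i j k l * (t i j a * t k l b)
/-- `Φ_{ijkl} t_{ijp} t_{klp}` -/
def quadScalar0 (t : T3) : ℝ := ∑ i, ∑ j, ∑ k, ∑ l, cayley0 i j k l * quad0 t i j k l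
/-- `t_{apq} t_{bpq}` -/
def sq0 (t : T3) : T2 := fun a b => ∑ p, ∑ q, t a p q * t b p q
/-- `Φ_{pqrs} t_{apq} t_{brs}` -/
def cross0 (t : T3) : T2 := fun a b =>
  ∑ p, ∑ q, ∑ r, ∑ s, cayley0 p q r s * (t a p q * t b r s)

/-! ### The tensor operations in frame components -/

namespace IsFrame

variable {A E : Matrix (Fin 8) (Fin 8) ℝ} {φ : T4} {γ : T2} (h : IsFrame A E φ γ)
include h

/-- The pattern for the contractions that follow: the raised contraction is a sum of products of
frame components, and pullback is multiplicative on outer products. -/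
theorem pull_contract (s : T4) : pull2 E (contract γ φ s) = con (pull4 E s) := by
  have : contract γ φ s = fun a b => ∑ p, ∑ q, ∑ r,
      pull3 E (s a) p q r * pull3 E (φ b) p q r := by
    funext a b
    simp only [contract, phiUUU, h.raise3]
    exact Finset.sum_congr rfl fun _ _ => Finset.sum_congr rfl fun _ _ =>
      Finset.sum_congr rfl fun _ _ => mul_comm _ _
  funext m n
  rw [this, pull2_sum]
  simp only [pull2_sum, con, ← h.form_eq]
  refine Finset.sum_congr rfl fun p _ => Finset.sum_congr rfl fun q _ =>
      Finset.sum_congr rfl fun r _ => ?_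
  rw [pull2_outer, mul_comm]; rfl

theorem J2_apply (B : T2) (i j : Fin 8) : J2 γ φ B i j =
    (1 / 2 : ℝ) * ∑ a, ∑ b, pull2 E (φ i j) a b * pull2 E B a b := by
  simp only [J2, phiUU, h.raise2]

theorem pull_J2 (B : T2) : pull2 E (J2 γ φ B) = J20 (pull2 E B) := by
  have : J2 γ φ B = (1 / 2 : ℝ) • fun i j => ∑ a, ∑ b, pull2 E B a b * pull2 E (φ i j) a b := by
    funext i j
    rw [h.J2_apply]
    simp only [Pi.smul_apply, smul_eq_mul, mul_comm (pull2 E B _ _)]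
  funext m n
  rw [this, pull2_smul, Pi.smul_apply, Pi.smul_apply, smul_eq_mul, pull2_sum]
  simp only [pull2_sum, pull2_mul, J20, ← h.form_eq]
  refine congrArg _ (Finset.sum_congr rfl fun p _ => Finset.sum_congr rfl fun q _ => ?_)
  rw [mul_comm]; rfl

theorem pull_J2_last (t : T3) (m n p : Fin 8) :
    pull3 E (fun i j k => J2 γ φ (t k) i j) m n p = J20 (pull3 E t p) m n := by
  have : (fun i j k => J2 γ φ (t k) i j) = (1 / 2 : ℝ) • fun i j k => ∑ a, ∑ b,
      pull2 E (φ i j) a b * pull2 E (t k) a b := by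
    funext i j k; rw [h.J2_apply]; rfl
  rw [this, pull3_smul, Pi.smul_apply, Pi.smul_apply, Pi.smul_apply, smul_eq_mul, pull3_sum]
  simp only [pull3_sum, pull3_outer, J20, ← h.form_eq]
  rfl

theorem pull_J3 (t : T3) : pull3 E (J3 γ φ t) = J30 (pull3 E t) := by
  have e : J3 γ φ t = (fun i j k => J2 γ φ (t k) i j) + (fun i j k => J2 γ φ (t i) j k) +
      fun i j k => J2 γ φ (t j) k i := by
    funext i j k
    simp only [J3, J2, Pi.add_apply, Finset.sum_add_distrib, mul_add]
  funext m n p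
  rw [e, pull3_add, pull3_add, Pi.add_apply, Pi.add_apply, Pi.add_apply, Pi.add_apply,
    Pi.add_apply, Pi.add_apply, h.pull_J2_last, J30_apply]
  congr 1
  · congr 1
    rw [← h.pull_J2_last]
    exact (pull3_rot E (fun i j k => J2 γ φ (t j) k i) m n p).trans
      (pull3_rot E (fun i j k => J2 γ φ (t k) i j) p m n)
  · rw [← h.pull_J2_last]
    exact pull3_rot E _ m n p

theorem pull_J4 (s : T4) : pull4 E (J4 γ φ s) = J40 (pull4 E s) := by
  rw [J4, pull4_alt4, J40]
  congr 1
  have : (fun i j k l => 3 * ∑ p, ∑ q, phiUU γ φ i j p q * s k l p q) = (3 : ℝ) •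
      fun i j k l => ∑ p, ∑ q, pull2 E (φ i j) p q * pull2 E (s k l) p q := by
    funext i j k l
    simp only [phiUU, h.raise2]; rfl
  funext m n p q
  rw [this, pull4_smul, Pi.smul_apply, Pi.smul_apply, Pi.smul_apply, Pi.smul_apply, smul_eq_mul,
    pull4_sum]
  simp only [pull4_sum, pull4_outer, ← h.form_eq]
  rfl

theorem pull_proj1 (s : T4) : pull4 E (proj1 γ φ s) = p1 (pull4 E s) := by
  simp only [proj1, p1, pull4_smul, pull4_add, pull4_sub, h.pull_J4]
theorem pull_proj7 (s : T4) : pull4 E (proj7 γ φ s) = p7 (pull4 E s) := by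
  simp only [proj7, p7, pull4_smul, pull4_add, pull4_sub, h.pull_J4]
theorem pull_proj27 (s : T4) : pull4 E (proj27 γ φ s) = p27 (pull4 E s) := by
  simp only [proj27, p27, pull4_smul, pull4_add, h.pull_J4]
theorem pull_proj35 (s : T4) : pull4 E (proj35 γ φ s) = p35 (pull4 E s) := by
  simp only [proj35, p35, pull4_smul, pull4_add, pull4_sub, h.pull_J4]
theorem pull_proj48 (t : T3) : pull3 E (proj48 γ φ t) =
    (6 / 7 : ℝ) • (pull3 E t + (1 / 6 : ℝ) • J30 (pull3 E t)) := by
  simp only [proj48, pull3_smul, pull3_add, h.pull_J3]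

theorem pull_sum_phiU (S : T2) :
    pull4 E (fun a b c d => ∑ e, S a e * phiU γ φ e b c d) =
      fun a b c d => ∑ e, pull2 E S a e * cayley0 e b c d := by
  have : (fun a b c d => ∑ e, S a e * phiU γ φ e b c d) = fun a b c d => ∑ m,
      pull1 E (S a) m * pull1 E (fun e => φ e b c d) m := by
    funext a b c d
    simp only [phiU, mul_comm (S a _), h.raise1 (fun e => φ e b c d) (S a),
      mul_comm (pull1 E (S a) _)]
  funext m n p q
  rw [this, pull4_sum]
  simp only [pull4_outer13, ← h.form_eq, pull1_pull3]
  rfl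

theorem pull_quad (t : T3) : pull4 E (quad γ t) = quad0 (pull3 E t) := by
  have : quad γ t = fun a b c d => ∑ m, pull1 E (t a b) m * pull1 E (t c d) m := by
    funext a b c d
    simp only [mul_comm (pull1 E (t a b) _), ← h.raise1 (t c d) (t a b)]
    simp only [quad, Finset.sum_mul]
    exact Finset.sum_congr rfl fun _ _ => Finset.sum_congr rfl fun _ _ => by ring
  funext m n p q
  rw [this, pull4_sum]
  simp only [pull4_outer]
  rfl

theorem pull_quadSym (t : T3) : pull2 E (quadSym γ φ t) = quadSym0 (pull3 E t) := by
  have : quadSym γ φ t = fun a b => ∑ i, ∑ j, ∑ k, ∑ l, cayley0 i j k l *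
      (pull2 E (fun i j => t i j a) i j * pull2 E (fun i j => t i j b) k l) := by
    funext a b
    simp only [quadSym, mul_assoc]
    rw [h.raise4 φ (fun i j k l => t i j a * t k l b)]
    simp only [pull4_outer, h.form_eq]
  funext m n
  rw [this, pull2_sum]
  simp only [pull2_sum, pull2_mul, pull2_outer, pull3_last]
  rfl

theorem pull_cross (t : T3) : pull2 E (fun a b => ∑ p, ∑ q, ∑ r, ∑ s,
    phiUUUU γ φ p q r s * t a p q * t b r s) = cross0 (pull3 E t) := by
  have : (fun a b => ∑ p, ∑ q, ∑ r, ∑ s, phiUUUU γ φ p q r s * t a p q * t b r s) =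
      fun a b => ∑ i, ∑ j, ∑ k, ∑ l, cayley0 i j k l *
      (pull2 E (t a) i j * pull2 E (t b) k l) := by
    funext a b
    simp only [mul_assoc]
    rw [h.raise4 φ (fun i j k l => t a i j * t b k l)]
    simp only [pull4_outer, h.form_eq]
  funext m n
  rw [this, pull2_sum]
  simp only [pull2_sum, pull2_mul, pull2_outer]
  rfl

theorem sum_phiUUUU (s : T4) : ∑ i, ∑ j, ∑ k, ∑ l, phiUUUU γ φ i j k l * s i j k l =
    ∑ i, ∑ j, ∑ k, ∑ l, cayley0 i j k l * pull4 E s i j k l := by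
  rw [h.raise4, h.form_eq]

theorem quadScalar_eq (t : T3) : quadScalar γ φ t = quadScalar0 (pull3 E t) := by
  rw [quadScalar, h.sum_phiUUUU, h.pull_quad, quadScalar0]

theorem pull_mid (D : T4) : pull2 E (fun a b => ∑ p, ∑ q, ∑ r,
    phiUUU γ φ b p q r * D r a p q) = conMid (pull4 E D) := by
  have : (fun a b => ∑ p, ∑ q, ∑ r, phiUUU γ φ b p q r * D r a p q) = fun a b =>
      ∑ p, ∑ q, ∑ r, pull3 E (fun p q r => D r a p q) p q r * pull3 E (φ b) p q r := by
    funext a b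
    simp only [phiUUU]
    rw [h.raise3 (φ b) (fun p q r => D r a p q)]
    exact Finset.sum_congr rfl fun _ _ => Finset.sum_congr rfl fun _ _ =>
      Finset.sum_congr rfl fun _ _ => mul_comm _ _
  funext m n
  rw [this, pull2_sum]
  simp only [pull2_sum]
  rw [sum_rot, conMid]
  refine Finset.sum_congr rfl fun p _ => Finset.sum_congr rfl fun q _ =>
      Finset.sum_congr rfl fun r _ => ?_
  rw [pull2_outer, pull3_mid, mul_comm]
  congr 1
  change pull4 E φ n q r p = _
  rw [h.form_eq, cayley0_swap23 n q p r, cayley0_swap12 n p q r, neg_neg]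

theorem pull_sqTensor (t : T3) : pull2 E (sqTensor γ t) = sq0 (pull3 E t) := by
  have : sqTensor γ t = fun a b => ∑ p, ∑ q, pull2 E (t a) p q * pull2 E (t b) p q := by
    funext a b
    simp only [mul_comm (pull2 E (t a) _ _), ← h.raise2 (t b) (t a)]
    simp only [sqTensor, Finset.sum_mul]
    exact Finset.sum_congr rfl fun _ _ => Finset.sum_congr rfl fun _ _ =>
      Finset.sum_congr rfl fun _ _ => Finset.sum_congr rfl fun _ _ => by ring
  funext m n
  rw [this, pull2_sum]
  simp only [pull2_sum, pull2_outer]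
  rfl

theorem trace_eq (B : T2) : trace γ B = tr0 (pull2 E B) := by
  simp only [trace, h.ginv_eq, tr0, pull2, pull1, Finset.sum_mul, Finset.mul_sum]
  calc _ = ∑ a, ∑ m, ∑ b, E a m * E b m * B a b :=
        Finset.sum_congr rfl fun _ _ => Finset.sum_comm
    _ = ∑ m, ∑ a, ∑ b, E a m * E b m * B a b := Finset.sum_comm
    _ = _ := Finset.sum_congr rfl fun _ _ => Finset.sum_congr rfl fun _ _ =>
        Finset.sum_congr rfl fun _ _ => by ring

theorem normSq_eq (t : T3) : normSq γ t = ip3 (pull3 E t) (pull3 E t) := by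
  rw [normSq, h.trace_eq, h.pull_sqTensor]; rfl

end IsFrame

section Pull

variable (E : Matrix (Fin 8) (Fin 8) ℝ)

theorem pull2_symPart (B : T2) : pull2 E (symPart B) = symPart (pull2 E B) := by
  have : symPart B = (1 / 2 : ℝ) • (B + fun a b => B b a) := rfl
  rw [this, pull2_smul, pull2_add]
  funext a b
  simp only [Pi.smul_apply, Pi.add_apply, pull2_swap, smul_eq_mul, symPart]
theorem pull2_skewPart (B : T2) : pull2 E (skewPart B) = skewPart (pull2 E B) := by
  have : skewPart B = (1 / 2 : ℝ) • (B - fun a b => B b a) := rfl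
  rw [this, pull2_smul, pull2_sub]
  funext a b
  simp only [Pi.smul_apply, Pi.sub_apply, pull2_swap, smul_eq_mul, skewPart]
theorem pull2_skew {B : T2} (hB : ∀ a b, B b a = -B a b) (a b : Fin 8) :
    pull2 E B b a = -pull2 E B a b := by
  have : (fun a b => B b a) = (-1 : ℝ) • B := by funext a b; rw [hB]; simp
  rw [← pull2_swap, this, pull2_smul]; simp
theorem IsAlt3.pull {t : T3} (ht : IsAlt3 t) : IsAlt3 (pull3 E t) := by
  have e1 : (fun a b c => t b a c) = (-1 : ℝ) • t := by funext a b c; rw [ht.1]; simp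
  have e2 : (fun a b c => t a c b) = (-1 : ℝ) • t := by funext a b c; rw [ht.2]; simp
  refine ⟨fun a b c => ?_, fun a b c => ?_⟩
  · rw [← pull3_swap01, e1, pull3_smul]; simp
  · rw [← pull3_swap12, e2, pull3_smul]; simp
theorem IsAlt4.pull {t : T4} (ht : IsAlt4 t) : IsAlt4 (pull4 E t) := by
  rw [← alt4_eq_self ht, pull4_alt4]; exact isAlt4_alt4 _
theorem pull3_alt3 {t : T4} (ht : ∀ a, IsAlt3 (t a)) (a : Fin 8) : IsAlt3 (pull4 E t a) := by
  refine ⟨fun b c d => ?_, fun b c d => ?_⟩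
  · simp only [pull4, fun i => ((ht i).pull E).1 b c d, mul_neg, Finset.sum_neg_distrib]
  · simp only [pull4, fun i => ((ht i).pull E).2 b c d, mul_neg, Finset.sum_neg_distrib]

end Pull

/-! ### Dimension counts -/

theorem finrank_symTensors : Module.finrank ℝ symTensors = 36 := by
  let e : symTensors ≃ₗ[ℝ] (Sym2 (Fin 8) → ℝ) :=
    { toFun := fun B => Sym2.lift ⟨fun a b => B.1 a b, B.2⟩
      invFun := fun f => ⟨fun a b => f s(a, b), fun a b => congrArg f Sym2.eq_swap⟩
      left_inv := fun B => by ext; rfl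
      right_inv := fun f => by
        funext z; induction z with | _ a b => rfl
      map_add' := fun B C => by
        funext z; induction z with | _ a b => rfl
      map_smul' := fun x B => by
        funext z; induction z with | _ a b => rfl }
  rw [e.finrank_eq, Module.finrank_fintype_fun_eq_card, Sym2.card, Fintype.card_fin]
  rfl

/-- The 2-form `e⁰ ∧ v`. -/
def wedgeZero (v : Fin 7 → ℝ) : T2 := fun i j =>
  Fin.cases (Fin.cases 0 v j) (fun i' => Fin.cases (-v i') (fun _ => 0) j) i

theorem wedgeZero_skew (v : Fin 7 → ℝ) (i j : Fin 8) : wedgeZero v j i = -wedgeZero v i j := by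
  cases i using Fin.cases <;> cases j using Fin.cases <;> simp [wedgeZero]

/-- All components of e⁰ ∧ v have an index 0, and Φ_{0iab} vanishes when a or b is 0. -/
theorem J20_wedgeZero (v : Fin 7 → ℝ) (i : Fin 8) : J20 (wedgeZero v) 0 i = 0 := by
  rw [J20, Finset.sum_eq_zero, mul_zero]
  intro a _
  refine Finset.sum_eq_zero fun b _ => ?_
  cases a using Fin.cases with
  | zero => rw [cayley0_eq_zero02, zero_mul]
  | succ a =>
    cases b using Fin.cases with
    | zero => rw [cayley0_eq_zero03, zero_mul]
    | succ b => simp [wedgeZero]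

/-- In `cayley0_contract1_two` with j = a = 0, every term involves the zeroth row or column except
B_{kl} − J₂B_{kl} = 4 B_{kl}. -/
theorem eq_zero_of_J20_eq {B : T2} (hB : ∀ a b, B b a = -B a b) (h : J20 B = (-3 : ℝ) • B)
    (h0 : ∀ i : Fin 7, B 0 i.succ = 0) : B = 0 := by
  have h1 : ∀ i, B 0 i = 0 := fun i => by
    cases i using Fin.cases with
    | zero => have := hB 0 0; linarith
    | succ i => exact h0 i
  have h2 : ∀ i, B i 0 = 0 := fun i => by rw [hB 0 i, h1, neg_zero]
  funext k l
  have := cayley0_contract1_two hB 0 k l 0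
  simp only [h, Pi.smul_apply, smul_eq_mul, h1, h2, mul_zero, Finset.sum_const_zero,
    cayley0_eq_zero12, cayley0_eq_zero02, zero_mul] at this
  simp only [delta, if_true, sub_self, mul_zero, add_zero, one_mul] at this
  simp only [Pi.zero_apply]
  linarith

namespace IsFrame

variable {A E : Matrix (Fin 8) (Fin 8) ℝ} {φ : T4} {γ : T2} (h : IsFrame A E φ γ)
include h

theorem pull2_eq_zero_iff {B : T2} : pull2 E B = 0 ↔ B = 0 :=
  ⟨fun hB => h.pull2_inj (hB.trans (pull2_zero E).symm), fun hB => by rw [hB, pull2_zero]⟩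
theorem pull4_eq_zero_iff {B : T4} : pull4 E B = 0 ↔ B = 0 :=
  ⟨fun hB => h.pull4_inj (hB.trans (pull4_zero E).symm), fun hB => by rw [hB, pull4_zero]⟩
theorem pull2_pull2_inv (B : T2) : pull2 E (pull2 A B) = B := by
  rw [pull2_pull2, h.mul_eq_one, pull2_one]
theorem pull4_pull4_inv (B : T4) : pull4 E (pull4 A B) = B := by
  rw [pull4_pull4, h.mul_eq_one, pull4_one]

theorem skew_of_pull2 {B : T2} (hB : ∀ a b, pull2 E B b a = -pull2 E B a b) (a b : Fin 8) :
    B b a = -B a b := by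
  have h1 := pull2_skew A hB
  rw [pull2_pull2, h.mul_eq_one', pull2_one] at h1
  exact h1 a b

theorem mem_Lambda2_7_iff {B : T2} : B ∈ Lambda2_7 γ φ ↔
    (∀ a b, pull2 E B b a = -pull2 E B a b) ∧ J20 (pull2 E B) = (-3 : ℝ) • pull2 E B := by
  have : (∀ a b, J2 γ φ B a b = -3 * B a b) ↔ J20 (pull2 E B) = (-3 : ℝ) • pull2 E B := by
    rw [← h.pull_J2, ← pull2_smul]
    exact ⟨fun hB => congrArg _ (by funext a b; exact hB a b), fun hB a b =>
      congrFun (congrFun (h.pull2_inj hB) a) b⟩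
  change (∀ a b, B b a = -B a b) ∧ (∀ a b, J2 γ φ B a b = -3 * B a b) ↔ _
  rw [this]
  exact and_congr ⟨fun hB => pull2_skew E hB, h.skew_of_pull2⟩ Iff.rfl

theorem finrank_Lambda2_7 : Module.finrank ℝ (Lambda2_7 γ φ) = 7 := by
  let f : Lambda2_7 γ φ →ₗ[ℝ] (Fin 7 → ℝ) :=
    { toFun := fun B i => pull2 E B.1 0 i.succ
      map_add' := fun B C => by
        funext i; simp [pull2_add]
      map_smul' := fun x B => by
        funext i; simp [pull2_smul] }
  have hf : Function.Bijective f := by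
    constructor
    · refine (injective_iff_map_eq_zero f).2 fun B hB => Subtype.ext ?_
      have h1 := h.mem_Lambda2_7_iff.1 B.2
      exact h.pull2_eq_zero_iff.1 (eq_zero_of_J20_eq h1.1 h1.2 fun i => congrFun hB i)
    · intro v
      -- The witness is four times the Λ²_7 component of e⁰ ∧ v; by `J20_wedgeZero` its zeroth row
      -- is still v.
      have e := h.pull2_pull2_inv (wedgeZero v - J20 (wedgeZero v))
      refine ⟨⟨pull2 A (wedgeZero v - J20 (wedgeZero v)), h.mem_Lambda2_7_iff.2 ?_⟩, ?_⟩
      · rw [e]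
        refine ⟨fun a b => ?_, ?_⟩
        · simp only [Pi.sub_apply]; rw [wedgeZero_skew v a b, J20_skew _ a b]; ring
        · rw [J20_sub]; funext i j
          simp only [Pi.sub_apply, Pi.smul_apply, smul_eq_mul, J20_J20 (wedgeZero_skew v)]
          ring
      · funext i
        change pull2 E (pull2 A (wedgeZero v - J20 (wedgeZero v))) 0 i.succ = v i
        rw [e, Pi.sub_apply, Pi.sub_apply, J20_wedgeZero, sub_zero]
        simp [wedgeZero]
  rw [(LinearEquiv.ofBijective f hf).finrank_eq, Module.finrank_fin_fun]

end IsFrame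

theorem disjoint_symTensors (γ : T2) (φ : T4) : symTensors ⊓ Lambda2_7 γ φ = ⊥ := by
  rw [eq_bot_iff]
  rintro B ⟨h1, h2⟩
  rw [Submodule.mem_bot]
  funext a b
  have e1 := h1 a b
  have e2 := h2.1 a b
  simp only [Pi.zero_apply]
  linarith

theorem IsFrame.finrank_valueSpace {A E : Matrix (Fin 8) (Fin 8) ℝ} {φ : T4} {γ : T2}
    (h : IsFrame A E φ γ) : Module.finrank ℝ (valueSpace γ φ) = 43 := by
  have := Submodule.finrank_sup_add_finrank_inf_eq symTensors (Lambda2_7 γ φ)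
  rw [disjoint_symTensors, finrank_bot, finrank_symTensors, h.finrank_Lambda2_7] at this
  exact this

theorem skewPart_skew (B : T2) (a b : Fin 8) : skewPart B b a = -skewPart B a b := by
  simp only [skewPart]; ring

theorem mem_valueSpace_iff {γ : T2} {φ : T4} {B : T2} :
    B ∈ valueSpace γ φ ↔ skewPart B ∈ Lambda2_7 γ φ := by
  constructor
  · intro hB
    obtain ⟨S, hS, N, hN, rfl⟩ := Submodule.mem_sup.1 hB
    have : skewPart (S + N) = N := by
      funext a b
      have e1 := hS a b
      have e2 := hN.1 a b
      simp only [skewPart, Pi.add_apply]; linarith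
    rwa [this]
  · intro hB
    have : B = symPart B + skewPart B := by
      funext a b; exact (symPart_add_skewPart B a b).symm
    rw [this]
    exact Submodule.add_mem_sup (fun a b => by simp only [symPart]; ring) hB

theorem exists_con_eq {B : T2} (hB : J20 B = (-3 : ℝ) • skewPart B) :
    ∃ s, IsAlt4 s ∧ con s = B := by
  -- The coefficients invert con ∘ ι, which is 6 on trace-free symmetric tensors, 42 on δ and 24 on
  -- Λ²_7. The multiple x of δ solves 6x + 36x + (3/4) tr B = 0.
  refine ⟨iota ((1 / 6 : ℝ) • symPart B + (-(1 / 56) * tr0 B) • delta + (1 / 24 : ℝ) • skewPart B),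
    isAlt4_iota _, ?_⟩
  have hd : J20 delta = 0 := by
    funext i j
    simp only [J20, sum_mul_delta, Pi.zero_apply]
    rw [Finset.sum_eq_zero, mul_zero]
    intro a _
    have := cayley0_swap23 i j a a
    linarith
  have hs : J20 (symPart B) = 0 := by
    have e : B = symPart B + skewPart B := by
      funext a b; exact (symPart_add_skewPart B a b).symm
    have := congrArg J20 e
    rw [J20_add, J20_skewPart] at this
    simpa using this
  have ht : tr0 ((1 / 6 : ℝ) • symPart B + (-(1 / 56) * tr0 B) • delta + (1 / 24 : ℝ) • skewPart B)
      = (1 / 42) * tr0 B := by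
    simp only [tr0, Pi.add_apply, Pi.smul_apply, smul_eq_mul, Finset.sum_add_distrib,
      ← Finset.mul_sum, symPart, skewPart, delta, if_true, Finset.sum_const, Finset.card_univ,
      Fintype.card_fin, Finset.sum_sub_distrib, nsmul_eq_mul]
    push_cast
    ring
  funext a b
  rw [con_iota, ht, J20_add, J20_add, J20_smul, J20_smul, J20_smul, hs, hd, J20_skewPart, hB,
    ← symPart_add_skewPart B a b]
  simp only [Pi.add_apply, Pi.smul_apply, smul_eq_mul, Pi.zero_apply]
  ring

/-! ### Contraction and projection for an arbitrary Cayley form -/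

namespace IsFrame

variable {A E : Matrix (Fin 8) (Fin 8) ℝ} {φ : T4} {γ : T2} (h : IsFrame A E φ γ)
include h

theorem mem_valueSpace_iff {B : T2} : B ∈ valueSpace γ φ ↔
    J20 (pull2 E B) = (-3 : ℝ) • skewPart (pull2 E B) := by
  rw [Spin7.mem_valueSpace_iff, h.mem_Lambda2_7_iff, pull2_skewPart, J20_skewPart]
  exact ⟨fun hB => hB.2, fun hB => ⟨skewPart_skew _, hB⟩⟩

theorem contract_mem {s : T4} (hs : IsAlt4 s) : contract γ φ s ∈ valueSpace γ φ := by
  rw [h.mem_valueSpace_iff, h.pull_contract]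
  funext a b
  exact J20_con_alt (hs.pull E) a b

theorem projTangent_eq_zero_iff {s : T4} (hs : IsAlt4 s) :
    projTangent γ φ s = 0 ↔ contract γ φ s = 0 := by
  rw [← h.pull4_eq_zero_iff, ← h.pull2_eq_zero_iff, projTangent, pull4_sub, h.pull_proj27,
    h.pull_contract]
  exact sub_p27_eq_zero_iff (hs.pull E)

theorem proj1_add_proj35_eq_zero_iff {s : T4} (hs : IsAlt4 s) :
    proj1 γ φ s + proj35 γ φ s = 0 ↔ symPart (contract γ φ s) = 0 := by
  rw [← h.pull4_eq_zero_iff, ← h.pull2_eq_zero_iff, pull4_add, h.pull_proj1, h.pull_proj35,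
    pull2_symPart, h.pull_contract]
  exact Spin7.p1_add_p35_eq_zero_iff (hs.pull E)

theorem proj7_eq_zero_iff {s : T4} (hs : IsAlt4 s) :
    proj7 γ φ s = 0 ↔ skewPart (contract γ φ s) = 0 := by
  rw [← h.pull4_eq_zero_iff, ← h.pull2_eq_zero_iff, h.pull_proj7, pull2_skewPart,
    h.pull_contract]
  exact Spin7.p7_eq_zero_iff (hs.pull E)

theorem exists_contract_eq {B : T2} (hB : B ∈ valueSpace γ φ) :
    ∃ s, IsAlt4 s ∧ contract γ φ s = B := by
  obtain ⟨s, hs, e⟩ := exists_con_eq (h.mem_valueSpace_iff.1 hB)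
  refine ⟨pull4 A s, hs.pull A, h.pull2_inj ?_⟩
  rw [h.pull_contract, h.pull4_pull4_inv, e]

end IsFrame

/-- Otherwise elements of Λ²_7 would be both symmetric and antisymmetric, against its dimension
seven. -/
theorem exists_not_symm : ∃ B ∈ valueSpace delta cayley0, ∃ a b, B a b ≠ B b a := by
  by_contra! hc
  have h : Lambda2_7 delta cayley0 = ⊥ := by
    rw [eq_bot_iff, ← disjoint_symTensors delta cayley0]
    exact fun B hB => ⟨fun a b => hc B (Submodule.mem_sup_right hB) a b, hB⟩
  have := isFrame_one.finrank_Lambda2_7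
  rw [h, finrank_bot] at this
  norm_num at this

/-! ### The field equations at a point -/

/-- The three terms in which the free index is not the derivative index have the same contraction
with Φ. -/
theorem con_alt4_of_alt3 {D : T4} (hD : ∀ a, IsAlt3 (D a)) (a b : Fin 8) :
    con (alt4 D) a b = (1 / 4 : ℝ) * con D a b - (3 / 4 : ℝ) * conMid D a b := by
  have e1 : ∑ p, ∑ q, ∑ r, cayley0 b p q r * D q p a r = conMid D a b := by
    rw [conMid, Finset.sum_comm]
    exact Finset.sum_congr rfl fun p _ => Finset.sum_congr rfl fun q _ =>
      Finset.sum_congr rfl fun r _ => by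
        rw [cayley0_swap12 b p q r, (hD p).1 a q r]; ring
  have e2 : ∑ p, ∑ q, ∑ r, cayley0 b p q r * D r p q a = conMid D a b := by
    rw [conMid, (sum_rot (fun r p q => cayley0 b r p q * D r a p q)).trans (sum_rot _)]
    exact Finset.sum_congr rfl fun p _ => Finset.sum_congr rfl fun q _ =>
      Finset.sum_congr rfl fun r _ => by
        rw [cayley0_swap12 b p r q, cayley0_swap23 b p q r, ← alt3_rot (hD r) a p q]; ring
  simp only [con, alt4_of_alt3 hD]
  have : ∀ p q r, cayley0 b p q r * ((1 / 4 : ℝ) * (D a p q r - D p a q r - D q p a r - D r p q a))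
      = (1 / 4 : ℝ) * (cayley0 b p q r * D a p q r) - (1 / 4 : ℝ) * (cayley0 b p q r * D p a q r)
      - (1 / 4 : ℝ) * (cayley0 b p q r * D q p a r)
      - (1 / 4 : ℝ) * (cayley0 b p q r * D r p q a) := fun p q r => by ring
  simp only [this, Finset.sum_sub_distrib, ← Finset.mul_sum, e1, e2]
  simp only [conMid]
  ring

theorem quad0_swap01 {t : T3} (ht : IsAlt3 t) (a b c d : Fin 8) :
    quad0 t b a c d = -quad0 t a b c d := by
  simp only [quad0, ht.1 a b, neg_mul, Finset.sum_neg_distrib]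
theorem quad0_swap23 {t : T3} (ht : IsAlt3 t) (a b c d : Fin 8) :
    quad0 t a b d c = -quad0 t a b c d := by
  simp only [quad0, ht.1 c d, mul_neg, Finset.sum_neg_distrib]
theorem quad0_pair (t : T3) (a b c d : Fin 8) : quad0 t a b c d = quad0 t c d a b := by
  simp only [quad0, mul_comm]

/-- By its pair symmetry, the antisymmetrised square is the mean over cyclic permutations of the
last three indices. These permutations are even, so Φ does not distinguish them. -/
theorem con_alt4_quad0 {t : T3} (ht : IsAlt3 t) : con (alt4 (quad0 t)) = con (quad0 t) := by
  have e : ∀ a b c d, alt4 (quad0 t) a b c d =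
      (1 / 3 : ℝ) * (quad0 t a b c d + quad0 t a c d b + quad0 t a d b c) := fun a b c d => by
    rw [alt4_of_pair (quad0_swap01 ht) (quad0_swap23 ht), quad0_pair t c d a b,
      quad0_swap23 ht a c b d, quad0_pair t b d a c, quad0_pair t b c a d]
    ring
  funext a b
  have e1 : ∑ p, ∑ q, ∑ r, cayley0 b p q r * quad0 t a q r p = con (quad0 t) a b := by
    rw [con, sum_rot (fun p q r => cayley0 b p q r * quad0 t a p q r)]
    exact Finset.sum_congr rfl fun p _ => Finset.sum_congr rfl fun q _ =>
      Finset.sum_congr rfl fun r _ => by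
        rw [cayley0_swap23 b q p r, cayley0_swap12 b p q r, neg_neg]
  have e2 : ∑ p, ∑ q, ∑ r, cayley0 b p q r * quad0 t a r p q = con (quad0 t) a b := by
    rw [con, (sum_rot (fun p q r => cayley0 b p q r * quad0 t a p q r)).trans (sum_rot _)]
    exact Finset.sum_congr rfl fun p _ => Finset.sum_congr rfl fun q _ =>
      Finset.sum_congr rfl fun r _ => by
        rw [cayley0_swap12 b p r q, cayley0_swap23 b p q r, neg_neg]
  have e3 : con (alt4 (quad0 t)) a b = (1 / 3 : ℝ) * ((∑ p, ∑ q, ∑ r, cayley0 b p q r * quad0 t a p q r) + (∑ p, ∑ q, ∑ r, cayley0 b p q r * quad0 t a q r p)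
    + ∑ p, ∑ q, ∑ r, cayley0 b p q r * quad0 t a r p q) := by
    simp only [con, e, mul_left_comm _ (1 / 3 : ℝ), mul_add, Finset.sum_add_distrib, ← Finset.mul_sum]
  rw [e3, e1, e2, con]; ring

theorem sum4_pair (f : T4) : ∑ i, ∑ j, ∑ k, ∑ l, f i j k l = ∑ i, ∑ j, ∑ k, ∑ l, f k l i j := by
  calc _ = ∑ i, ∑ k, ∑ j, ∑ l, f i j k l :=
        Finset.sum_congr rfl fun _ _ => Finset.sum_comm
    _ = ∑ k, ∑ i, ∑ j, ∑ l, f i j k l := Finset.sum_comm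
    _ = ∑ k, ∑ i, ∑ l, ∑ j, f i j k l :=
        Finset.sum_congr rfl fun _ _ => Finset.sum_congr rfl fun _ _ => Finset.sum_comm
    _ = _ := Finset.sum_congr rfl fun _ _ => Finset.sum_comm

theorem quadSym0_comm (t : T3) (a b : Fin 8) : quadSym0 t a b = quadSym0 t b a := by
  rw [quadSym0, sum4_pair, quadSym0]
  exact Finset.sum_congr rfl fun i _ => Finset.sum_congr rfl fun j _ =>
      Finset.sum_congr rfl fun k _ => Finset.sum_congr rfl fun l _ => by
        rw [cayley0_pair k l i j]; ring

theorem J20_symm {B : T2} (hB : ∀ a b, B a b = B b a) : J20 B = 0 := by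
  rw [← J20_skewPart]
  have : skewPart B = 0 := by funext a b; simp [skewPart, hB a b]
  rw [this]; funext i j; simp [J20]

theorem tr0_quadSym0 (t : T3) : tr0 (quadSym0 t) = quadScalar0 t := by
  simp only [tr0, quadSym0, quadScalar0, quad0, Finset.mul_sum]
  rw [Finset.sum_comm]
  refine Finset.sum_congr rfl fun i _ => ?_
  rw [Finset.sum_comm]
  refine Finset.sum_congr rfl fun j _ => ?_
  rw [Finset.sum_comm]
  exact Finset.sum_congr rfl fun k _ => Finset.sum_comm

theorem cross0_eq {t : T3} (ht : IsAlt3 t) : cross0 t = quadSym0 t := by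
  funext a b
  exact Finset.sum_congr rfl fun i _ => Finset.sum_congr rfl fun j _ =>
      Finset.sum_congr rfl fun k _ => Finset.sum_congr rfl fun l _ => by
        rw [alt3_rot ht a i j, alt3_rot ht b k l]

/-- The field tensor in a standard frame. -/
def field0 (κ Λ : ℝ) (t : T3) (D : T4) : T2 := (1 / 4 : ℝ) • con D - (3 / 4 : ℝ) • conMid D
  - (3 / 2 : ℝ) • con (quad0 t) - (3 / 4 : ℝ) • cross0 t
  + ((1 / 4 : ℝ) * (Λ + κ * ip3 t t + (3 / 4 : ℝ) * quadScalar0 t)) • delta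

theorem con_cayley0 (x : ℝ) : con (x • cayley0) = (42 * x) • delta := by
  rw [con_smul]
  funext a b
  simp only [Pi.smul_apply, smul_eq_mul, con, cayley0_contract3, delta_comm b a]
  ring

/-- By `con_iota`, the term with −1/8 contributes −(3/4) of the quadratic tensor and −(9/16)Yδ. With
42/56 = 3/4 from the multiple of Φ this leaves (3/16)Yδ, while 42/168 = 1/4 gives the factor of Λ +
κ|C|². -/
theorem con_form0 {t : T3} (ht : IsAlt3 t) {D : T4} (hD : ∀ a, IsAlt3 (D a)) (κ Λ : ℝ) :
    con (alt4 D - (3 / 2 : ℝ) • alt4 (quad0 t) - (1 / 8 : ℝ) • iota (quadSym0 t) +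
      ((1 / 56 : ℝ) * quadScalar0 t + (1 / 168 : ℝ) * (Λ + κ * ip3 t t)) • cayley0) =
      field0 κ Λ t D := by
  rw [con_add, con_sub, con_sub, con_smul, con_smul, con_cayley0, con_alt4_quad0 ht, field0,
    cross0_eq ht]
  funext a b
  simp only [Pi.add_apply, Pi.sub_apply, Pi.smul_apply, smul_eq_mul, con_iota, tr0_quadSym0,
    J20_symm (quadSym0_comm t), con_alt4_of_alt3 hD, Pi.zero_apply]
  ring

theorem tr0_add (B C : T2) : tr0 (B + C) = tr0 B + tr0 C := by
  simp [tr0, Finset.sum_add_distrib]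
theorem tr0_sub (B C : T2) : tr0 (B - C) = tr0 B - tr0 C := by
  simp [tr0, Finset.sum_sub_distrib]
theorem tr0_smul (x : ℝ) (B : T2) : tr0 (x • B) = x * tr0 B := by
  simp [tr0, Finset.mul_sum]
theorem tr0_delta : tr0 delta = 8 := by simp [tr0, delta]

theorem tr0_con (s : T4) : tr0 (con s) = ∑ i, ∑ j, ∑ k, ∑ l, cayley0 i j k l * s i j k l := rfl

theorem tr0_conMid (D : T4) : tr0 (conMid D) = -tr0 (con D) := by
  rw [tr0, tr0]
  simp only [conMid, con]
  rw [Finset.sum_comm, ← Finset.sum_neg_distrib]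
  refine Finset.sum_congr rfl fun a _ => ?_
  simp only [← Finset.sum_neg_distrib]
  exact Finset.sum_congr rfl fun p _ => Finset.sum_congr rfl fun q _ =>
      Finset.sum_congr rfl fun r _ => by rw [cayley0_swap01]; ring

theorem tr0_field0 {t : T3} (ht : IsAlt3 t) (κ Λ : ℝ) (D : T4) : tr0 (field0 κ Λ t D) =
    tr0 (con D) - (3 / 2 : ℝ) * tr0 (con (quad0 t)) + 3 / 4 * quadScalar0 t +
      2 * (Λ + κ * ip3 t t) := by
  rw [field0, cross0_eq ht]
  simp only [tr0_add, tr0_sub, tr0_smul, tr0_delta, tr0_conMid, tr0_quadSym0]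
  ring

/-- Antisymmetrisation kills the symmetric lower index pair of the connection. -/
theorem alt4_connection {t : T3} (ht : IsAlt3 t) {G : T3} (hG : ∀ p a b, G p a b = G p b a) :
    alt4 (fun a b c d => ∑ p, (G p a b * t p c d + G p a c * t b p d + G p a d * t b c p)) = 0 := by
  funext a b c d
  rw [alt4_of_alt3]
  · simp only [← Finset.sum_sub_distrib, Pi.zero_apply]
    rw [Finset.sum_eq_zero, mul_zero]
    intro p _
    rw [hG p b a, hG p c a, hG p d a, hG p c b, hG p d b, hG p d c, ht.1 a p d,
      alt3_rot ht p c a, ht.1 a c p, ht.2 b a p]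
    ring
  · refine fun a => ⟨fun b c d => ?_, fun b c d => ?_⟩
    · rw [← Finset.sum_neg_distrib]
      exact Finset.sum_congr rfl fun p _ => by rw [ht.1 b p d, ht.1 p c d, ht.1 b c p]; ring
    · rw [← Finset.sum_neg_distrib]
      exact Finset.sum_congr rfl fun p _ => by rw [ht.2 p c d, ht.2 b p d, ht.2 b c p]; ring

/-- The terms of the field equations that are not multiples of the Cayley form. -/
def mainForm (γ : T2) (φ : T4) (C : T3) (D : T4) : T4 :=
  alt4 (fun a b c d => D a b c d - (3 / 2 : ℝ) * quad γ C a b c d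
      - (1 / 8 : ℝ) * ∑ e, quadSym γ φ C a e * phiU γ φ e b c d)

namespace IsFrame

variable {A E : Matrix (Fin 8) (Fin 8) ℝ} {φ : T4} {γ : T2} (h : IsFrame A E φ γ)
include h

theorem form_alt : IsAlt4 φ := by
  have := isAlt4_cayley0.pull A
  rwa [← h.form_eq, pull4_pull4, h.mul_eq_one', pull4_one] at this

theorem metric_symm (a b : Fin 8) : γ a b = γ b a := by
  have : γ = pull2 A delta := by rw [← h.metric_eq, pull2_pull2, h.mul_eq_one', pull2_one]
  have e : (fun i j => delta j i) = delta := by funext i j; exact delta_comm j i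
  rw [this, ← pull2_swap, e]

theorem pull_fieldTensor (κ Λ : ℝ) (C : T3) (D : T4) :
    pull2 E (fieldTensor κ Λ γ φ C D) = field0 κ Λ (pull3 E C) (pull4 E D) := by
  have : fieldTensor κ Λ γ φ C D = (1 / 4 : ℝ) • contract γ φ D
      - (3 / 4 : ℝ) • (fun a b => ∑ p, ∑ q, ∑ r, phiUUU γ φ b p q r * D r a p q)
      - (3 / 2 : ℝ) • contract γ φ (quad γ C)
      - (3 / 4 : ℝ) • (fun a b => ∑ p, ∑ q, ∑ r, ∑ s, phiUUUU γ φ p q r s * C a p q * C b r s)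
      + ((1 / 4 : ℝ) * (Λ + κ * normSq γ C + (3 / 4 : ℝ) * quadScalar γ φ C)) • γ := by
    funext a b
    simp only [fieldTensor, contract, Pi.add_apply, Pi.sub_apply, Pi.smul_apply, smul_eq_mul]
    ring
  rw [this, pull2_add, pull2_sub, pull2_sub, pull2_sub, pull2_smul, pull2_smul, pull2_smul,
    pull2_smul, pull2_smul, h.pull_contract, h.pull_mid, h.pull_contract, h.pull_quad,
    h.pull_cross, h.metric_eq, h.normSq_eq, h.quadScalar_eq]
  rfl

theorem pull_mainForm (C : T3) (D : T4) : pull4 E (mainForm γ φ C D) =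
    alt4 (pull4 E D) - (3 / 2 : ℝ) • alt4 (quad0 (pull3 E C))
      - (1 / 8 : ℝ) • iota (quadSym0 (pull3 E C)) := by
  have : mainForm γ φ C D = alt4 (D + (-(3 / 2) : ℝ) • quad γ C + (-(1 / 8) : ℝ) •
      fun a b c d => ∑ e, quadSym γ φ C a e * phiU γ φ e b c d) := by
    rw [mainForm]; congr 1; funext a b c d
    simp only [Pi.add_apply, Pi.smul_apply, smul_eq_mul]
    ring
  rw [this, pull4_alt4, pull4_add, pull4_add, pull4_smul, pull4_smul, h.pull_quad,
    h.pull_sum_phiU, h.pull_quadSym, alt4_add, alt4_add, alt4_smul, alt4_smul, iota]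
  module

theorem contract_mainForm {C : T3} (hC : IsAlt3 C) {D : T4} (hD : ∀ a, IsAlt3 (D a)) (κ Λ : ℝ) :
    contract γ φ (mainForm γ φ C D + ((1 / 56 : ℝ) * quadScalar γ φ C
      + (1 / 168 : ℝ) * (Λ + κ * normSq γ C)) • φ) = fieldTensor κ Λ γ φ C D := by
  apply h.pull2_inj
  rw [h.pull_contract, h.pull_fieldTensor, pull4_add, pull4_smul, h.pull_mainForm, h.form_eq,
    h.quadScalar_eq, h.normSq_eq, con_form0 (hC.pull E) (pull3_alt3 E hD)]

theorem isAlt4_mainForm (C : T3) (D : T4) (x : ℝ) : IsAlt4 (mainForm γ φ C D + x • φ) :=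
  (isAlt4_alt4 _).add (h.form_alt.smul x)

/-- As a contraction of a 4-form, the tensor depends on the derivative array only through its
antisymmetrisation. This is what makes ∂ and ∇ interchangeable. -/
theorem fieldTensor_congr {C : T3} (hC : IsAlt3 C) {D D' : T4} (hD : ∀ a, IsAlt3 (D a))
    (hD' : ∀ a, IsAlt3 (D' a)) (e : alt4 D = alt4 D') (κ Λ : ℝ) :
    fieldTensor κ Λ γ φ C D = fieldTensor κ Λ γ φ C D' := by
  rw [← h.contract_mainForm hC hD, ← h.contract_mainForm hC hD']
  suffices mainForm γ φ C D = mainForm γ φ C D' by rw [this]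
  apply h.pull4_inj
  rw [h.pull_mainForm, h.pull_mainForm, ← pull4_alt4, e, pull4_alt4]

theorem contract_smul_form (x : ℝ) : contract γ φ (x • φ) = (42 * x) • γ := by
  apply h.pull2_inj
  rw [h.pull_contract, pull4_smul, h.form_eq, con_cayley0, pull2_smul, h.metric_eq]

theorem contract_add (s t : T4) : contract γ φ (s + t) = contract γ φ s + contract γ φ t := by
  apply h.pull2_inj
  rw [pull2_add, h.pull_contract, h.pull_contract, h.pull_contract, pull4_add, con_add]

theorem trace_fieldTensor {C : T3} (hC : IsAlt3 C) (D : T4) (κ Λ : ℝ) :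
    trace γ (fieldTensor κ Λ γ φ C D) = (∑ i, ∑ j, ∑ k, ∑ l, phiUUUU γ φ i j k l *
          (D i j k l - (3 / 2 : ℝ) * quad γ C i j k l)) + 3 / 4 * quadScalar γ φ C
          + 2 * (Λ + κ * normSq γ C) := by
  rw [h.trace_eq, h.pull_fieldTensor, tr0_field0 (hC.pull E), h.quadScalar_eq, h.normSq_eq,
    h.sum_phiUUUU (fun i j k l => D i j k l - (3 / 2 : ℝ) * quad γ C i j k l)]
  have : (fun i j k l => D i j k l - (3 / 2 : ℝ) * quad γ C i j k l) =
      D - (3 / 2 : ℝ) • quad γ C := rfl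
  rw [this, pull4_sub, pull4_smul, h.pull_quad, ← tr0_con, con_sub, con_smul, tr0_sub, tr0_smul]

/-- Adding the trace part of the equations does not change their projection. -/
theorem projTangent_sub_trace {s : T4} (hs : IsAlt4 s) :
    projTangent γ φ (s + (-(1 / 168) * trace γ (contract γ φ s)) • φ) = 0 ↔
      projTangent γ φ s = 0 := by
  rw [h.projTangent_eq_zero_iff (hs.add (h.form_alt.smul _)), h.projTangent_eq_zero_iff hs,
    h.contract_add, h.contract_smul_form]
  constructor
  · intro e
    -- The added multiple of Φ contracts to −(1/4) tr · γ, whose trace is −2 tr. The whole trace is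
    -- therefore −tr, and it must vanish.
    have ht : trace γ (contract γ φ s) = 0 := by
      have := congrArg tr0 (congrArg (pull2 E) e)
      rw [pull2_add, pull2_smul, h.metric_eq, tr0_add, tr0_smul, tr0_delta, ← h.trace_eq,
        pull2_zero] at this
      have h0 : tr0 0 = 0 := by simp [tr0]
      rw [h0] at this
      linarith
    rw [ht] at e
    simpa using e
  · intro e
    rw [e]
    simp [trace]

theorem sum_metric_phiU (a b c d : Fin 8) : ∑ e, γ a e * phiU γ φ e b c d = φ a b c d := by
  have := h.pull_sum_phiU γ
  rw [h.metric_eq] at this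
  simp only [sum_delta_mul] at this
  have e : pull4 E (fun a b c d => ∑ e, γ a e * phiU γ φ e b c d) = pull4 E φ := by
    rw [this, h.form_eq]
  exact congrFun (congrFun (congrFun (congrFun (h.pull4_inj e) a) b) c) d

end IsFrame

/-! ### Partial derivatives -/

theorem pd_congr {f f' : E8 → ℝ} {x : E8} (h : f =ᶠ[nhds x] f') (a : Fin 8) :
    pd a f x = pd a f' x := by rw [pd, pd, h.fderiv_eq]
theorem pd_neg (f : E8 → ℝ) (x : E8) (a : Fin 8) : pd a (fun y => -f y) x = -pd a f x := by
  simp only [pd, fderiv_fun_neg, neg_apply]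

/-! ### Antisymmetrised covariant derivatives -/

section Nabla

variable {U : Set E8} (hU : IsOpen U) {x : E8} (hx : x ∈ U)
include hU hx

theorem eventually_of_mem {p : E8 → Prop} (h : ∀ y ∈ U, p y) : ∀ᶠ y in nhds x, p y :=
  Filter.eventually_of_mem (hU.mem_nhds hx) h

theorem partial3_alt {C : E8 → T3} (hC : ∀ y ∈ U, IsAlt3 (C y)) (a : Fin 8) :
    IsAlt3 (partial3 C x a) := by
  refine ⟨fun b c d => ?_, fun b c d => ?_⟩
  · rw [partial3, partial3, ← pd_neg]
    exact pd_congr (eventually_of_mem hU hx fun y hy => (hC y hy).1 b c d) a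
  · rw [partial3, partial3, ← pd_neg]
    exact pd_congr (eventually_of_mem hU hx fun y hy => (hC y hy).2 b c d) a

theorem christoffel_symm {g : E8 → T2} (hg : ∀ y ∈ U, ∀ a b, g y a b = g y b a)
    (k i j : Fin 8) : christoffel g x k i j = christoffel g x k j i := by
  have e : ∀ l, pd l (fun y => g y i j) x = pd l (fun y => g y j i) x := fun l =>
    pd_congr (eventually_of_mem hU hx fun y hy => hg y hy i j) l
  simp only [christoffel, e]
  refine congrArg _ (Finset.sum_congr rfl fun l _ => ?_)
  ring

omit hU hx in
theorem nabla3_eq (g : E8 → T2) (C : E8 → T3) (x : E8) : nabla3 g C x = partial3 C x -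
    fun a b c d => ∑ p, (christoffel g x p a b * C x p c d
    + christoffel g x p a c * C x b p d + christoffel g x p a d * C x b c p) := rfl

omit hU hx in
theorem connection_alt {t : T3} (ht : IsAlt3 t) (G : T3) (a : Fin 8) : IsAlt3 fun b c d =>
    ∑ p, (G p a b * t p c d + G p a c * t b p d + G p a d * t b c p) := by
  refine ⟨fun b c d => ?_, fun b c d => ?_⟩
  · rw [← Finset.sum_neg_distrib]
    exact Finset.sum_congr rfl fun p _ => by rw [ht.1 b p d, ht.1 p c d, ht.1 b c p]; ring
  · rw [← Finset.sum_neg_distrib]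
    exact Finset.sum_congr rfl fun p _ => by rw [ht.2 p c d, ht.2 b p d, ht.2 b c p]; ring

theorem nabla3_alt (g : E8 → T2) {C : E8 → T3} (hC : ∀ y ∈ U, IsAlt3 (C y)) (a : Fin 8) :
    IsAlt3 (nabla3 g C x a) := by
  have h1 := partial3_alt hU hx hC a
  have h2 := connection_alt (hC x hx) (christoffel g x) a
  rw [nabla3_eq]
  refine ⟨fun b c d => ?_, fun b c d => ?_⟩
  · have e1 := h1.1 b c d
    have e2 := h2.1 b c d
    simp only [Pi.sub_apply]; linarith
  · have e1 := h1.2 b c d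
    have e2 := h2.2 b c d
    simp only [Pi.sub_apply]; linarith

theorem alt4_nabla3 {g : E8 → T2} (hg : ∀ y ∈ U, ∀ a b, g y a b = g y b a) {C : E8 → T3}
    (hC : ∀ y ∈ U, IsAlt3 (C y)) : alt4 (nabla3 g C x) = alt4 (partial3 C x) := by
  have h2 := alt4_connection (hC x hx) (christoffel_symm hU hx hg)
  rw [nabla3_eq, sub_eq_add_neg, ← neg_one_smul ℝ, alt4_add, alt4_smul, h2]
  simp

end Nabla

theorem torsionFieldTensor_eq (lam : ℝ) (γ : T2) (φ : T4) (T : T3) (D : T4) :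
    torsionFieldTensor lam γ φ T D = fieldTensor 0 (2 * lam) γ φ T D := by
  funext a b
  simp only [torsionFieldTensor, fieldTensor]
  ring

/-! ### The projected field equations on a domain -/

section Field

variable {U : Set E8} (hU : IsOpen U) {Φ : E8 → T4} {g : E8 → T2} (hS : IsSpin7On U Φ g)

include hS in
theorem IsSpin7On.exists_isFrame {x : E8} (hx : x ∈ U) : ∃ A E, IsFrame A E (Φ x) (g x) := by
  obtain ⟨A, hA⟩ := hS.2.2 x hx
  exact ⟨A, A⁻¹, hA.isFrame⟩

include hS in
theorem IsSpin7On.metric_symm {x : E8} (hx : x ∈ U) (a b : Fin 8) : g x a b = g x b a := by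
  obtain ⟨A, E, h⟩ := hS.exists_isFrame hx
  exact h.metric_symm a b

include hS in
theorem torsionForm_eq (lam : ℝ) (T : E8 → T3) {x : E8} (hx : x ∈ U) :
    torsionForm lam Φ g T x = eulerForm' 0 (2 * lam) Φ g T x := by
  obtain ⟨A, E, h⟩ := hS.exists_isFrame hx
  have e : (fun a b c d => partial3 T x a b c d - (3 / 2 : ℝ) * quad (g x) (T x) a b c d
      - (1 / 8 : ℝ) * ∑ e, quadTT (g x) (Φ x) (T x) a e * phiU (g x) (Φ x) e b c d) =
      (fun a b c d => partial3 T x a b c d - (3 / 2 : ℝ) * quad (g x) (T x) a b c d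
      - (1 / 8 : ℝ) * ∑ e, quadSym (g x) (Φ x) (T x) a e * phiU (g x) (Φ x) e b c d) +
      ((1 / 56 : ℝ) * quadScalar (g x) (Φ x) (T x)) • Φ x := by
    funext a b c d
    simp only [quadTT, sub_mul, Finset.sum_sub_distrib, Pi.add_apply, Pi.smul_apply, smul_eq_mul]
    -- The trace removed in `quadTT` becomes (1/8)(1/7)YΦ, the term (1/56)YΦ of E'.
    have : ∑ e, 1 / 7 * g x a e * quadScalar (g x) (Φ x) (T x) * phiU (g x) (Φ x) e b c d =
        (1 / 7 * quadScalar (g x) (Φ x) (T x)) * Φ x a b c d := by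
      rw [← h.sum_metric_phiU, Finset.mul_sum]
      exact Finset.sum_congr rfl fun _ _ => by ring
    rw [this]; ring
  rw [torsionForm, e, alt4_add, alt4_smul, alt4_eq_self h.form_alt, eulerForm', add_assoc,
    ← add_smul]
  congr 2
  ring

include hU hS

theorem contract_eulerForm' (κ Λ : ℝ) {C : E8 → T3} (hC : ∀ y ∈ U, IsAlt3 (C y))
    {x : E8} (hx : x ∈ U) : contract (g x) (Φ x) (eulerForm' κ Λ Φ g C x) =
      fieldTensor κ Λ (g x) (Φ x) (C x) (partial3 C x) := by
  obtain ⟨A, E, h⟩ := hS.exists_isFrame hx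
  exact h.contract_mainForm (hC x hx) (partial3_alt hU hx hC) κ Λ

theorem fieldTensor_partial3 (κ Λ : ℝ) {C : E8 → T3} (hC : ∀ y ∈ U, IsAlt3 (C y))
    {x : E8} (hx : x ∈ U) : fieldTensor κ Λ (g x) (Φ x) (C x) (partial3 C x) =
      fieldTensor κ Λ (g x) (Φ x) (C x) (nabla3 g C x) := by
  obtain ⟨A, E, h⟩ := hS.exists_isFrame hx
  exact h.fieldTensor_congr (hC x hx) (partial3_alt hU hx hC) (nabla3_alt hU hx g hC)
    (alt4_nabla3 hU hx (fun y hy => hS.metric_symm hy) hC).symm κ Λ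

omit hU in
theorem isAlt4_eulerForm' (κ Λ : ℝ) (C : E8 → T3) {x : E8} (hx : x ∈ U) :
    IsAlt4 (eulerForm' κ Λ Φ g C x) := by
  obtain ⟨A, E, h⟩ := hS.exists_isFrame hx
  exact h.isAlt4_mainForm _ _ _

theorem projTangent_eulerForm' (κ Λ : ℝ) {C : E8 → T3} (hC : ∀ y ∈ U, IsAlt3 (C y))
    {x : E8} (hx : x ∈ U) : projTangent (g x) (Φ x) (eulerForm' κ Λ Φ g C x) = 0 ↔
      fieldTensor κ Λ (g x) (Φ x) (C x) (nabla3 g C x) = 0 := by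
  obtain ⟨A, E, h⟩ := hS.exists_isFrame hx
  rw [h.projTangent_eq_zero_iff (isAlt4_eulerForm' hS κ Λ C hx),
    contract_eulerForm' hU hS κ Λ hC hx, fieldTensor_partial3 hU hS κ Λ hC hx]

theorem projTangent_eulerForm (κ Λ : ℝ) {C : E8 → T3} (hC : ∀ y ∈ U, IsAlt3 (C y))
    {x : E8} (hx : x ∈ U) : projTangent (g x) (Φ x) (eulerForm κ Λ Φ g C x) = 0 ↔
      projTangent (g x) (Φ x) (eulerForm' κ Λ Φ g C x) = 0 := by
  obtain ⟨A, E, h⟩ := hS.exists_isFrame hx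
  -- E is E' minus 1/168 of the trace of the contracted equation times Φ.
  have e : eulerForm κ Λ Φ g C x = eulerForm' κ Λ Φ g C x + (-(1 / 168) *
      trace (g x) (contract (g x) (Φ x) (eulerForm' κ Λ Φ g C x))) • Φ x := by
    rw [contract_eulerForm' hU hS κ Λ hC hx, h.trace_fieldTensor (hC x hx), eulerForm, eulerForm',
      add_assoc (alt4 _), ← add_smul]
    congr 2
    ring
  rw [e, h.projTangent_sub_trace (isAlt4_eulerForm' hS κ Λ C hx)]

theorem fieldTensor_mem (κ Λ : ℝ) {C : E8 → T3} (hC : ∀ y ∈ U, IsAlt3 (C y))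
    {x : E8} (hx : x ∈ U) :
    fieldTensor κ Λ (g x) (Φ x) (C x) (nabla3 g C x) ∈ valueSpace (g x) (Φ x) := by
  obtain ⟨A, E, h⟩ := hS.exists_isFrame hx
  rw [← fieldTensor_partial3 hU hS κ Λ hC hx, ← contract_eulerForm' hU hS κ Λ hC hx]
  exact h.contract_mem (isAlt4_eulerForm' hS κ Λ C hx)

end Field

/-! ### Curvature of the connection with torsion, in a standard frame -/

/-- `D_{r,rab}` -/
def div0 (D : T4) : T2 := fun a b => ∑ r, D r r a b

theorem pair_symm {R : T4} (h1 : ∀ a b c d, R b a c d = -R a b c d)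
    (h2 : ∀ a b c d, R a b d c = -R a b c d)
    (h3 : ∀ a b c d, R a b c d + R b c a d + R c a b d = 0) (a b c d : Fin 8) :
    R a b c d = R c d a b := by
  linarith [h3 a b c d, h3 b c d a, h3 c d a b, h3 d a b c, h1 b c a d, h2 b c a d, h2 a c b d,
    h1 a c b d, h1 a c d b, h2 c d a b, h2 c d b a, h1 b d c a, h2 b d a c, h1 b d a c, h2 d b a c,
    h2 d a b c, h1 a d b c, h2 a d b c, h2 a b c d, h1 c d a b, h2 d a c b, h2 c a b d, h2 d b c a,
    h2 b c d a]

/-- After the pair symmetry, Φ is contracted with three indices whose cyclic sum vanishes by the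
first Bianchi identity. -/
theorem sum_cayley0_eq_zero {R : T4} (h1 : ∀ a b c d, R b a c d = -R a b c d)
    (h2 : ∀ a b c d, R a b d c = -R a b c d)
    (h3 : ∀ a b c d, R a b c d + R b c a d + R c a b d = 0) (a b : Fin 8) :
    conMid (fun f a p q => R f a p q) a b = 0 := by
  have e : conMid (fun f a p q => R f a p q) a b =
      ∑ r, ∑ p, ∑ q, cayley0 b r p q * R p q r a := by
    exact Finset.sum_congr rfl fun _ _ => Finset.sum_congr rfl fun _ _ =>
      Finset.sum_congr rfl fun _ _ => by rw [pair_symm h1 h2 h3]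
  have c1 : ∀ r p q, cayley0 b p q r = cayley0 b r p q := fun r p q => by
    rw [cayley0_swap23 b p r q, cayley0_swap12 b r p q, neg_neg]
  have s1 : ∑ r, ∑ p, ∑ q, cayley0 b r p q * R q r p a =
      ∑ r, ∑ p, ∑ q, cayley0 b r p q * R p q r a := by
    rw [sum_rot (fun r p q => cayley0 b r p q * R p q r a)]
    simp only [c1]
  have s2 : ∑ r, ∑ p, ∑ q, cayley0 b r p q * R r p q a =
      ∑ r, ∑ p, ∑ q, cayley0 b r p q * R q r p a := by
    rw [sum_rot (fun r p q => cayley0 b r p q * R q r p a)]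
    simp only [c1]
  have e3 : ∑ r, ∑ p, ∑ q, cayley0 b r p q * (R p q r a + R q r p a + R r p q a) = 0 := by
    simp only [h3, mul_zero, Finset.sum_const_zero]
  simp only [mul_add, Finset.sum_add_distrib] at e3
  linarith

section Curvature

variable {R D K : T4} {t : T3} (ht : IsAlt3 t) (hD : ∀ a, IsAlt3 (D a))
  (hR1 : ∀ a b c d, R b a c d = -R a b c d) (hR2 : ∀ a b c d, R a b d c = -R a b c d)
  (hR3 : ∀ a b c d, R a b c d + R b c a d + R c a b d = 0)
  (hK : ∀ f a b c, K f a b c = R f a b c + D f a b c - D a f b c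
    + ∑ q, (t a b q * t f q c - t f b q * t a q c))
  (hJ : ∀ f a, J20 (K f a) = K f a)
include ht hD hR1 hR2 hR3 hK hJ

/-- R stands for the Riemann tensor, D for ∇T and K for the curvature of Γ + T. The trace K_{fabf}
is expanded directly in `l1`. In `l2` and `l3` it is rewritten through K = J₂K, and the Riemann part
disappears by `sum_cayley0_eq_zero`. -/
theorem ricci_formula (a b : Fin 8) : ∑ k, R k a b k =
    (1 / 2 : ℝ) * (conMid D a b - con D a b) + con (quad0 t) a b + sq0 t a b - div0 D a b := by
  have l1 : ∑ f, K f a b f = ∑ k, R k a b k + div0 D a b - sq0 t a b := by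
    have e1 : ∀ f, D f a b f = D f f a b := fun f => (alt3_rot (hD f) f a b).symm
    have e2 : ∀ f, D a f b f = 0 := fun f => by
      rw [(hD a).2 f f b, alt3_eq_zero12 (hD a), neg_zero]
    have e3 : ∀ f q, t a b q * t f q f - t f b q * t a q f = -(t a q f * t b q f) := fun f q => by
      rw [ht.2 f f q, alt3_eq_zero12 ht, alt3_rot ht f b q]; ring
    simp only [hK, e1, e2, e3, Finset.sum_add_distrib,
      Finset.sum_neg_distrib, sub_zero, div0, sq0]
    rw [Finset.sum_comm (f := fun x y => t a y x * t b y x)]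
    ring
  have l2 : ∑ f, K f a b f = (1 / 2 : ℝ) * conMid (fun f a p q => K f a p q) a b := by
    have : ∀ f, K f a b f = (1 / 2 : ℝ) * ∑ p, ∑ q, cayley0 b f p q * K f a p q := fun f => by
      conv_lhs => rw [← hJ f a]
      rfl
    simp only [this, conMid, Finset.mul_sum]
  have l3 : conMid (fun f a p q => K f a p q) a b = conMid D a b - con D a b +
      2 * con (quad0 t) a b := by
    have q1 : ∑ f, ∑ p, ∑ q, cayley0 b f p q * ∑ s, t a p s * t f s q = con (quad0 t) a b := by
      rw [Finset.sum_comm]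
      simp only [con]
      exact Finset.sum_congr rfl fun p _ => Finset.sum_congr rfl fun f _ =>
        Finset.sum_congr rfl fun q _ => by
          rw [cayley0_swap12 b p f q, quad0, neg_mul, ← mul_neg, ← Finset.sum_neg_distrib]
          exact congrArg _ (Finset.sum_congr rfl fun s _ => by rw [ht.2 f q s]; ring)
    have q2 : ∑ f, ∑ p, ∑ q, cayley0 b f p q * ∑ s, t f p s * t a s q =
        -con (quad0 t) a b := by
      rw [con, sum_rot (fun p q r => cayley0 b p q r * quad0 t a p q r),
        sum_rot (fun a_1 b_1 c => cayley0 b b_1 c a_1 * quad0 t a b_1 c a_1)]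
      simp only [← Finset.sum_neg_distrib]
      exact Finset.sum_congr rfl fun f _ => Finset.sum_congr rfl fun p _ =>
        Finset.sum_congr rfl fun q _ => by
          rw [cayley0_swap12 b f q p, cayley0_swap23 b f p q, quad0, neg_neg, ← mul_neg,
            ← Finset.sum_neg_distrib]
          exact congrArg _ (Finset.sum_congr rfl fun s _ => by rw [ht.2 a q s]; ring)
    have r := sum_cayley0_eq_zero hR1 hR2 hR3 a b
    simp only [conMid] at r
    simp only [conMid, hK, mul_add, mul_sub, Finset.sum_add_distrib, Finset.sum_sub_distrib,
      r, q1, q2, con]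
    ring
  linarith

omit ht hD hK hJ in
theorem ricci_symm (a b : Fin 8) : ∑ k, R k a b k = ∑ k, R k b a k :=
  Finset.sum_congr rfl fun k _ => by
    rw [pair_symm hR1 hR2 hR3, hR1, hR2, neg_neg]

/-- The Ricci equation is equivalent to the symmetric part of the field equations. -/
theorem three_ricci (lam : ℝ) (a b : Fin 8) : 3 * (∑ k, R k a b k) -
    (-symPart (con D) a b + 3 * sq0 t a b - (3 / 2 : ℝ) * cross0 t a b
      + (3 / 8 : ℝ) * delta a b * quadScalar0 t + lam * delta a b) =
    -2 * symPart (field0 0 (2 * lam) t D) a b := by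
  have e1 := ricci_formula ht hD hR1 hR2 hR3 hK hJ a b
  have e2 := ricci_formula ht hD hR1 hR2 hR3 hK hJ b a
  have e3 := ricci_symm hR1 hR2 hR3 a b
  -- The divergence is antisymmetric and drops out on symmetrising `ricci_formula`.
  have z : div0 D b a = -div0 D a b := by
    simp only [div0, (hD _).2 _ a b, Finset.sum_neg_distrib]
  have s : sq0 t b a = sq0 t a b := by simp only [sq0, mul_comm]
  have c : cross0 t b a = cross0 t a b := by rw [cross0_eq ht, quadSym0_comm]
  simp only [field0, symPart, Pi.add_apply, Pi.sub_apply, Pi.smul_apply, smul_eq_mul,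
    delta_comm b a, c]
  linarith

/-- Linear algebra with the divergence Z and the antisymmetric parts X, Y, W of `con D`, `conMid D`
and the contracted square of t. Symmetry of the Ricci tensor gives W = Z + (X − Y)/2, and its image
under J₂ gives a second relation. They yield X = W − 2Z − J₂Z and Y = −W − J₂Z, to be inserted into
X/4 − 3Y/4 − 3W/2. -/
theorem skew_field0 (lam : ℝ) : skewPart (field0 0 (2 * lam) t D) =
    (-1 / 2 : ℝ) • (div0 D - J20 (div0 D) + skewPart (con (quad0 t))) := by
  have hz : ∀ a b, div0 D b a = -div0 D a b := fun a b => by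
    simp only [div0, (hD _).2 _ a b, Finset.sum_neg_distrib]
  have hzs : skewPart (div0 D) = div0 D := by
    funext a b; simp only [skewPart, hz a b]; ring
  have c : ∀ a b, cross0 t b a = cross0 t a b := fun a b => by rw [cross0_eq ht, quadSym0_comm]
  have s : ∀ a b, sq0 t b a = sq0 t a b := fun a b => by simp only [sq0, mul_comm]
  set X := skewPart (con D)
  set Y := skewPart (conMid D)
  set W := skewPart (con (quad0 t))
  set Z := div0 D
  have hX : J20 X = (-3 : ℝ) • Z + (3 : ℝ) • J20 Z + (3 : ℝ) • Y := by
    funext a b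
    rw [J20_skewPart, J20_con hD]
    simp only [Pi.add_apply, Pi.smul_apply, smul_eq_mul, Y, skewPart, Z]
    have e : div0 D = fun i j => ∑ r, D r r i j := rfl
    rw [← e, div0]
    ring
  have hW : J20 W = (-3 : ℝ) • W := by
    rw [J20_skewPart, ← con_alt4_quad0 ht]
    funext a b
    rw [J20_con_alt (isAlt4_alt4 _), con_alt4_quad0 ht]; rfl
  have hR : W = Z + (1 / 2 : ℝ) • X - (1 / 2 : ℝ) • Y := by
    funext a b
    have e1 := ricci_formula ht hD hR1 hR2 hR3 hK hJ a b
    have e2 := ricci_formula ht hD hR1 hR2 hR3 hK hJ b a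
    have e3 := ricci_symm hR1 hR2 hR3 a b
    have e4 := hz a b
    have e5 := s a b
    simp only [W, X, Y, Z, skewPart, Pi.add_apply, Pi.sub_apply, Pi.smul_apply, smul_eq_mul]
    linarith
  -- Applying J₂ to `hX` and using J₂² = 3 − 2 J₂ on 2-forms solves for J₂Y.
  have hY : J20 Y = X - (2 : ℝ) • Y - Z + J20 Z := by
    have := congrArg J20 hX
    rw [J20_add, J20_add, J20_smul, J20_smul, J20_smul] at this
    funext a b
    have h1 := congrFun (congrFun this a) b
    have h2 := congrFun (congrFun hX a) b
    rw [J20_J20 (skewPart_skew _)] at h1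
    simp only [Pi.add_apply, Pi.sub_apply, Pi.smul_apply, smul_eq_mul, J20_J20 hz] at h1 h2 ⊢
    linarith
  have hF : skewPart (field0 0 (2 * lam) t D) =
      (1 / 4 : ℝ) • X - (3 / 4 : ℝ) • Y - (3 / 2 : ℝ) • W := by
    funext a b
    simp only [field0, skewPart, Pi.add_apply, Pi.sub_apply, Pi.smul_apply, smul_eq_mul,
      delta_comm b a, c a b, X, Y, W]
    ring
  have hJR := congrArg J20 hR
  rw [J20_sub, J20_add, J20_smul, J20_smul, hW, hX, hY] at hJR
  rw [hF]
  funext a b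
  have h1 := congrFun (congrFun hJR a) b
  have h2 := congrFun (congrFun hR a) b
  simp only [Pi.add_apply, Pi.sub_apply, Pi.smul_apply, smul_eq_mul] at h1 h2 ⊢
  linarith

theorem trace_ricci : ∑ b, ∑ k, R k b b k =
    -tr0 (con D) + quadScalar0 t + ip3 t t := by
  have z : ∀ b, div0 D b b = 0 := fun b => by
    simp only [div0, alt3_eq_zero23 (hD _), Finset.sum_const_zero]
  have h1 : ∑ b, conMid D b b = -∑ b, con D b b := tr0_conMid D
  have h2 : ∑ b, con (quad0 t) b b = quadScalar0 t := tr0_con _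
  have h3 : ∑ b, sq0 t b b = ip3 t t := rfl
  simp only [fun b => ricci_formula ht hD hR1 hR2 hR3 hK hJ b b, Finset.sum_add_distrib,
    Finset.sum_sub_distrib, ← Finset.mul_sum, h1, h2, h3, z, Finset.sum_const_zero, tr0]
  ring

end Curvature

theorem ip3_J30_self {t : T3} (ht : IsAlt3 t) : ip3 t (J30 t) = (3 / 2 : ℝ) * quadScalar0 t := by
  rw [ip3_J30 ht]
  have e : quadScalar0 t = ∑ k, ∑ i, ∑ j, ∑ p, ∑ q, cayley0 i j p q * (t k i j * t k p q) := by
    rw [← tr0_quadSym0, ← cross0_eq ht]; rfl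
  rw [e]
  simp only [J20, Finset.mul_sum]
  exact Finset.sum_congr rfl fun k _ => Finset.sum_congr rfl fun i _ =>
    Finset.sum_congr rfl fun j _ => Finset.sum_congr rfl fun p _ =>
      Finset.sum_congr rfl fun q _ => by ring

theorem tr0_field0' {t : T3} (ht : IsAlt3 t) (lam : ℝ) (D : T4) :
    tr0 (field0 0 (2 * lam) t D) = tr0 (con D) - 3 / 4 * quadScalar0 t + 4 * lam := by
  rw [tr0_field0 ht]
  have : tr0 (con (quad0 t)) = quadScalar0 t := tr0_con _
  rw [this]; ring

/-! ### Calculus in coordinates -/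

section Pd

variable {x : E8} {f f' : E8 → ℝ} (a : Fin 8)

theorem pd_const (c : ℝ) : pd a (fun _ => c) x = 0 := by
  simp [pd]
theorem pd_add (hf : DifferentiableAt ℝ f x) (hf' : DifferentiableAt ℝ f' x) :
    pd a (fun y => f y + f' y) x = pd a f x + pd a f' x := by
  simp only [pd, fderiv_fun_add hf hf', add_apply]
theorem pd_sub (hf : DifferentiableAt ℝ f x) (hf' : DifferentiableAt ℝ f' x) :
    pd a (fun y => f y - f' y) x = pd a f x - pd a f' x := by
  simp only [pd, fderiv_fun_sub hf hf', sub_apply]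
theorem pd_mul (hf : DifferentiableAt ℝ f x) (hf' : DifferentiableAt ℝ f' x) :
    pd a (fun y => f y * f' y) x = pd a f x * f' x + f x * pd a f' x := by
  simp only [pd, fderiv_fun_mul hf hf', add_apply, smul_apply, smul_eq_mul]
  ring
theorem pd_const_mul (hf : DifferentiableAt ℝ f x) (c : ℝ) :
    pd a (fun y => c * f y) x = c * pd a f x := by
  rw [pd_mul a (differentiableAt_const c) hf, pd_const]; ring
theorem pd_sum {ι : Type*} {s : Finset ι} {F : ι → E8 → ℝ}
    (h : ∀ i ∈ s, DifferentiableAt ℝ (F i) x) :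
    pd a (fun y => ∑ i ∈ s, F i y) x = ∑ i ∈ s, pd a (F i) x := by
  simp only [pd, fderiv_fun_sum h, sum_apply]
theorem pd_coord (i : Fin 8) : pd a (fun y => y i) x = delta i a := by
  have : (fun y : E8 => y i) = EuclideanSpace.proj (𝕜 := ℝ) i := rfl
  rw [pd, this, ContinuousLinearMap.fderiv]
  simp [delta]

theorem _root_.ContDiffAt.pd (hf : ContDiffAt ℝ ∞ f x) : ContDiffAt ℝ ∞ (Spin7.pd a f) x :=
  (hf.fderiv_right (m := ∞) le_rfl).clm_apply contDiffAt_const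

theorem pd_comm (hf : ContDiffAt ℝ ∞ f x) (b : Fin 8) : pd a (pd b f) x = pd b (pd a f) x := by
  have h1 : DifferentiableAt ℝ (fderiv ℝ f) x :=
    (hf.fderiv_right (m := ∞) le_rfl).differentiableAt (by simp)
  have h2 : ∀ v w : E8, fderiv ℝ (fun y => fderiv ℝ f y v) x w = fderiv ℝ (fderiv ℝ f) x w v :=
    fun v w => by
      rw [fderiv_clm_apply h1 (differentiableAt_const v)]
      simp
  have h3 : IsSymmSndFDerivAt ℝ f x := hf.isSymmSndFDerivAt (by
    rw [minSmoothness_of_isRCLikeNormedField]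
    exact WithTop.coe_le_coe.2 (le_top : (2 : ℕ∞) ≤ ⊤))
  change fderiv ℝ (fun y => fderiv ℝ f y _) x _ = fderiv ℝ (fun y => fderiv ℝ f y _) x _
  rw [h2, h2]
  exact h3.eq _ _

end Pd

section Smooth

variable {x : E8} {n : WithTop ℕ∞}

theorem contDiffAt_det {ι : Type*} [Fintype ι] [DecidableEq ι] {M : E8 → Matrix ι ι ℝ}
    (h : ∀ i j, ContDiffAt ℝ n (fun y => M y i j) x) : ContDiffAt ℝ n (fun y => (M y).det) x := by
  simp only [Matrix.det_apply']
  exact ContDiffAt.sum fun σ _ => contDiffAt_const.mul (contDiffAt_prod fun i _ => h _ _)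

/-- Cramer's rule: the entries of the inverse are quotients of determinants. -/
theorem contDiffAt_ginv {γ : E8 → T2} (h : ∀ i j, ContDiffAt ℝ n (fun y => γ y i j) x)
    (hd : (Matrix.of (γ x)).det ≠ 0) (i j : Fin 8) :
    ContDiffAt ℝ n (fun y => ginv (γ y) i j) x := by
  have e : (fun y => ginv (γ y) i j) = fun y => ((Matrix.of (γ y)).det)⁻¹ *
      ((Matrix.of (γ y)).updateRow j (Pi.single i 1)).det := by
    funext y
    rw [ginv, Matrix.inv_def, Ring.inverse_eq_inv', Matrix.smul_apply, Matrix.adjugate_apply,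
      smul_eq_mul]
  rw [e]
  refine (ContDiffAt.inv (contDiffAt_det h) hd).mul (contDiffAt_det fun k l => ?_)
  by_cases hk : k = j
  · subst hk
    simp only [Matrix.updateRow_self]
    exact contDiffAt_const
  · simp only [Matrix.updateRow_ne hk]
    exact h k l

end Smooth

/-! ### Covariant derivatives -/

/-- The action of an endomorphism on covariant tensors. -/
def act1 (M : T2) (u : Fin 8 → ℝ) : Fin 8 → ℝ := fun b => ∑ p, M p b * u p
def act2 (M : T2) (t : T2) : T2 := fun b c => ∑ p, M p b * t p c + act1 M (t b) c
def act3 (M : T2) (t : T3) : T3 := fun b c d => ∑ p, M p b * t p c d + act2 M (t b) c d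
def act4 (M : T2) (t : T4) : T4 := fun b c d e => ∑ p, M p b * t p c d e + act3 M (t b) c d e

theorem nabla3_eq_act (g : E8 → T2) (t : E8 → T3) (x : E8) (a b c d : Fin 8) :
    nabla3 g t x a b c d = pd a (fun y => t y b c d) x -
      act3 (fun p b => christoffel g x p a b) (t x) b c d := by
  simp only [nabla3, act3, act2, act1, Finset.sum_add_distrib, add_assoc]

theorem nabla4_eq_act (g : E8 → T2) (φ : E8 → T4) (x : E8) (a b c d e : Fin 8) :
    nabla4 g φ x a b c d e = pd a (fun y => φ y b c d e) x -
      act4 (fun p b => christoffel g x p a b) (φ x) b c d e := by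
  simp only [nabla4, act4, act3, act2, act1, Finset.sum_add_distrib, add_assoc]

/-! ### Differentiating components in a moving frame -/

section Pull

variable {x : E8} {B : E8 → Matrix (Fin 8) (Fin 8) ℝ}
  (hB : ∀ i m, DifferentiableAt ℝ (fun y => B y i m) x)
include hB

theorem differentiableAt_pull1 {u : E8 → Fin 8 → ℝ}
    (hu : ∀ i, DifferentiableAt ℝ (fun y => u y i) x) (m : Fin 8) :
    DifferentiableAt ℝ (fun y => pull1 (B y) (u y) m) x :=
  DifferentiableAt.fun_sum fun i _ => (hB i m).fun_mul (hu i)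
theorem differentiableAt_pull2 {t : E8 → T2}
    (ht : ∀ i j, DifferentiableAt ℝ (fun y => t y i j) x) (m n : Fin 8) :
    DifferentiableAt ℝ (fun y => pull2 (B y) (t y) m n) x :=
  differentiableAt_pull1 hB (fun i => differentiableAt_pull1 hB (ht i) n) m
theorem differentiableAt_pull3 {t : E8 → T3}
    (ht : ∀ i j k, DifferentiableAt ℝ (fun y => t y i j k) x) (m n p : Fin 8) :
    DifferentiableAt ℝ (fun y => pull3 (B y) (t y) m n p) x :=
  differentiableAt_pull1 hB (fun i => differentiableAt_pull2 hB (ht i) n p) m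
theorem differentiableAt_pull4 {t : E8 → T4}
    (ht : ∀ i j k l, DifferentiableAt ℝ (fun y => t y i j k l) x) (m n p q : Fin 8) :
    DifferentiableAt ℝ (fun y => pull4 (B y) (t y) m n p q) x :=
  differentiableAt_pull1 hB (fun i => differentiableAt_pull3 hB (ht i) n p q) m

variable {M : T2} {a : Fin 8} (hB' : ∀ i m, pd a (fun y => B y i m) x = -∑ p, M i p * B x p m)
include hB'

/-- If the columns of B are parallel at x for the connection matrix M, then the derivative of the
components is the component of the covariant derivative. The higher ranks follow one index at a
time. -/
theorem pd_pull1 {u : E8 → Fin 8 → ℝ}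
    (hu : ∀ i, DifferentiableAt ℝ (fun y => u y i) x) (m : Fin 8) :
    pd a (fun y => pull1 (B y) (u y) m) x =
      pull1 (B x) (fun i => pd a (fun y => u y i) x - act1 M (u x) i) m := by
  simp only [pull1]
  rw [pd_sum a fun i _ => (hB i m).fun_mul (hu i)]
  simp only [pd_mul a (hB _ m) (hu _), hB', act1, mul_sub, Finset.sum_sub_distrib,
    Finset.sum_add_distrib, neg_mul, Finset.sum_neg_distrib, Finset.sum_mul, Finset.mul_sum]
  rw [neg_add_eq_sub, Finset.sum_comm]
  congr 1
  exact Finset.sum_congr rfl fun _ _ => Finset.sum_congr rfl fun _ _ => by ring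

theorem pd_pull2 {t : E8 → T2}
    (ht : ∀ i j, DifferentiableAt ℝ (fun y => t y i j) x) (m n : Fin 8) :
    pd a (fun y => pull2 (B y) (t y) m n) x =
      pull2 (B x) (fun i j => pd a (fun y => t y i j) x - act2 M (t x) i j) m n := by
  refine (pd_pull1 hB hB' (fun i => differentiableAt_pull1 hB (ht i) n) m).trans ?_
  simp only [pd_pull1 hB hB' (ht _)]
  refine Finset.sum_congr rfl fun i _ => congrArg _ ?_
  beta_reduce
  have : (fun j => pd a (fun y => t y i j) x - act2 M (t x) i j) =
      (fun j => pd a (fun y => t y i j) x - act1 M (t x i) j) +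
      (-1 : ℝ) • fun j => ∑ p, M p i * t x p j := by
    funext j
    simp only [act2, Pi.add_apply, Pi.smul_apply, smul_eq_mul]; ring
  rw [this, pull1_add, pull1_smul]
  simp only [Pi.add_apply, Pi.smul_apply, smul_eq_mul, pull1_sum, pull1_mul, act1]
  ring

theorem pd_pull3 {t : E8 → T3}
    (ht : ∀ i j k, DifferentiableAt ℝ (fun y => t y i j k) x) (m n p : Fin 8) :
    pd a (fun y => pull3 (B y) (t y) m n p) x =
      pull3 (B x) (fun i j k => pd a (fun y => t y i j k) x - act3 M (t x) i j k) m n p := by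
  refine (pd_pull1 hB hB' (fun i => differentiableAt_pull2 hB (ht i) n p) m).trans ?_
  simp only [pd_pull2 hB hB' (ht _)]
  refine Finset.sum_congr rfl fun i _ => congrArg _ ?_
  beta_reduce
  have : (fun j k => pd a (fun y => t y i j k) x - act3 M (t x) i j k) =
      (fun j k => pd a (fun y => t y i j k) x - act2 M (t x i) j k) +
      (-1 : ℝ) • fun j k => ∑ p, M p i * t x p j k := by
    funext j k
    simp only [act3, Pi.add_apply, Pi.smul_apply, smul_eq_mul]; ring
  rw [this, pull2_add, pull2_smul]
  simp only [Pi.add_apply, Pi.smul_apply, smul_eq_mul, pull2_sum, pull2_mul, act1]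
  ring

theorem pd_pull4 {t : E8 → T4}
    (ht : ∀ i j k l, DifferentiableAt ℝ (fun y => t y i j k l) x) (m n p q : Fin 8) :
    pd a (fun y => pull4 (B y) (t y) m n p q) x =
      pull4 (B x) (fun i j k l => pd a (fun y => t y i j k l) x - act4 M (t x) i j k l)
        m n p q := by
  refine (pd_pull1 hB hB' (fun i => differentiableAt_pull3 hB (ht i) n p q) m).trans ?_
  simp only [pd_pull3 hB hB' (ht _)]
  refine Finset.sum_congr rfl fun i _ => congrArg _ ?_
  beta_reduce
  have : (fun j k l => pd a (fun y => t y i j k l) x - act4 M (t x) i j k l) =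
      (fun j k l => pd a (fun y => t y i j k l) x - act3 M (t x i) j k l) +
      (-1 : ℝ) • fun j k l => ∑ p, M p i * t x p j k l := by
    funext j k l
    simp only [act4, Pi.add_apply, Pi.smul_apply, smul_eq_mul]; ring
  rw [this, pull3_add, pull3_smul]
  simp only [Pi.add_apply, Pi.smul_apply, smul_eq_mul, pull3_sum, pull3_mul', act1]
  ring

end Pull

/-- A frame field which is parallel at `x`, with value `E` there. -/
def parallelFrame (g : E8 → T2) (E : Matrix (Fin 8) (Fin 8) ℝ) (x y : E8) :
    Matrix (Fin 8) (Fin 8) ℝ := Matrix.of fun i m =>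
  E i m - ∑ a, (y a - x a) * ∑ p, christoffel g x i a p * E p m

theorem parallelFrame_self (g : E8 → T2) (E : Matrix (Fin 8) (Fin 8) ℝ) (x : E8) :
    parallelFrame g E x x = E := by
  funext i m; simp [parallelFrame]

theorem contDiff_parallelFrame (g : E8 → T2) (E : Matrix (Fin 8) (Fin 8) ℝ) (x : E8)
    (i m : Fin 8) : ContDiff ℝ ∞ (fun y => parallelFrame g E x y i m) := by
  refine contDiff_const.sub (ContDiff.sum fun a _ => ContDiff.mul ?_ contDiff_const)
  exact (EuclideanSpace.proj (𝕜 := ℝ) a).contDiff.sub contDiff_const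

theorem pd_parallelFrame (g : E8 → T2) (E : Matrix (Fin 8) (Fin 8) ℝ) (x : E8)
    (a i m : Fin 8) : pd a (fun y => parallelFrame g E x y i m) x =
      -∑ p, christoffel g x i a p * parallelFrame g E x x p m := by
  have hc : ∀ b, DifferentiableAt ℝ (fun y : E8 => y b) x := fun b =>
    (EuclideanSpace.proj (𝕜 := ℝ) b).differentiableAt
  simp only [parallelFrame_self]
  simp only [parallelFrame, Matrix.of_apply]
  rw [pd_sub a (differentiableAt_const _) (DifferentiableAt.fun_sum fun b _ =>
    ((hc b).fun_sub (differentiableAt_const _)).fun_mul (differentiableAt_const _)), pd_const, zero_sub,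
    pd_sum a fun b _ => ((hc b).fun_sub (differentiableAt_const _)).fun_mul (differentiableAt_const _)]
  congr 1
  rw [← sum_delta_mul a fun b => ∑ p, christoffel g x i b p * E p m]
  refine Finset.sum_congr rfl fun b _ => ?_
  rw [pd_mul a ((hc b).fun_sub (differentiableAt_const _)) (differentiableAt_const _),
    pd_sub a (hc b) (differentiableAt_const _), pd_const, pd_const, pd_coord, delta_comm b a]
  ring

theorem det_parallelFrame (g : E8 → T2) {E : Matrix (Fin 8) (Fin 8) ℝ} (hE : E.det ≠ 0) (x : E8) :
    ∀ᶠ y in nhds x, (parallelFrame g E x y).det ≠ 0 := by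
  have h : ContinuousAt (fun y => (parallelFrame g E x y).det) x :=
    (contDiffAt_det (n := ∞) fun i j =>
      (contDiff_parallelFrame g E x i j).contDiffAt).continuousAt
  exact h.eventually_ne (by rwa [parallelFrame_self])

/-! ### Existence of the torsion -/

/-- Since con Φ = 42δ and ι(δ) = Φ, the identity ι ∘ con = 6 − 3 J₄ reads 42Φ = 6Φ − 3 J₄Φ. -/
theorem J40_cayley0 : J40 cayley0 = (-12 : ℝ) • cayley0 := by
  have h1 := iota_con isAlt4_cayley0
  have h2 := con_cayley0 1
  rw [one_smul, mul_one] at h2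
  have h3 : iota delta = cayley0 := by
    rw [iota]
    simp only [sum_delta_mul]
    exact alt4_eq_self isAlt4_cayley0
  rw [h2, iota_smul, h3] at h1
  have : J40 cayley0 = (1 / 3 : ℝ) • ((6 : ℝ) • cayley0 - (42 : ℝ) • cayley0) := by
    rw [h1]; module
  rw [this]; module

namespace IsFrame

variable {A E : Matrix (Fin 8) (Fin 8) ℝ} {φ : T4} {γ : T2} (h : IsFrame A E φ γ)
include h

theorem J4_self : J4 γ φ φ = (-12 : ℝ) • φ := by
  apply h.pull4_inj
  rw [h.pull_J4, pull4_smul, h.form_eq, J40_cayley0]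

theorem metric_mul : Matrix.of γ = A.transpose * A := by
  have : γ = pull2 A delta := by rw [← h.metric_eq, pull2_pull2, h.mul_eq_one', pull2_one]
  ext i j
  conv_lhs => rw [this]
  simp only [Matrix.of_apply, pull2, pull1, sum_mul_delta]
  rfl

theorem det_ne_zero : E.det ≠ 0 := by
  have := congrArg Matrix.det h.mul_eq_one
  rw [Matrix.det_mul, Matrix.det_one] at this
  exact right_ne_zero_of_mul_eq_one this

theorem det_metric : (Matrix.of γ).det ≠ 0 := by
  have := congrArg Matrix.det h.mul_eq_one
  rw [Matrix.det_mul, Matrix.det_one] at this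
  have := left_ne_zero_of_mul_eq_one this
  rw [h.metric_mul, Matrix.det_mul, Matrix.det_transpose]
  exact mul_ne_zero this this

theorem sum_ginv_mul (p r : Fin 8) : ∑ q, ginv γ p q * γ q r = delta p r := by
  have := congrFun (congrFun (Matrix.nonsing_inv_mul _ (isUnit_iff_ne_zero.2 h.det_metric)) p) r
  rw [Matrix.mul_apply, Matrix.one_apply] at this
  exact this

theorem sum_mul_ginv (p r : Fin 8) : ∑ q, γ p q * ginv γ q r = delta p r := by
  rw [delta_comm, ← h.sum_ginv_mul]
  exact Finset.sum_congr rfl fun q _ => by rw [h.ginv_comm, h.metric_symm, mul_comm]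

theorem isAdapted : IsAdapted A φ γ := by
  refine isAdapted_iff.2 ⟨?_, ?_, ?_⟩
  · have := congrArg Matrix.det h.mul_eq_one
    rw [Matrix.det_mul, Matrix.det_one] at this
    exact left_ne_zero_of_mul_eq_one this
  · rw [← h.metric_eq, pull2_pull2, h.mul_eq_one', pull2_one]
  · rw [← h.form_eq, pull4_pull4, h.mul_eq_one', pull4_one]

theorem pull {B B' : Matrix (Fin 8) (Fin 8) ℝ} (hB : B * B' = 1) :
    IsFrame (A * B) (B' * E) (pull4 B φ) (pull2 B γ) := by
  have hd : B.det ≠ 0 := by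
    have := congrArg Matrix.det hB
    rw [Matrix.det_mul, Matrix.det_one] at this
    exact left_ne_zero_of_mul_eq_one this
  have h1 : (A * B) * (B' * E) = 1 := by
    rw [Matrix.mul_assoc, ← Matrix.mul_assoc B, hB, Matrix.one_mul, h.mul_eq_one]
  have := (h.isAdapted.pull B hd).isFrame
  rwa [Matrix.inv_eq_right_inv h1] at this

end IsFrame

theorem pd_alt4 {N : E8 → T4} {x : E8}
    (hN : ∀ i j k l, DifferentiableAt ℝ (fun y => N y i j k l) x) (a i j k l : Fin 8) :
    pd a (fun y => alt4 (N y) i j k l) x =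
      alt4 (fun i j k l => pd a (fun y => N y i j k l) x) i j k l := by
  simp only [alt4]
  rw [pd_const_mul a (DifferentiableAt.fun_sum fun σ _ => (hN _ _ _ _).const_mul _),
    pd_sum a fun σ _ => (hN _ _ _ _).const_mul _]
  refine congrArg _ (Finset.sum_congr rfl fun σ _ => ?_)
  rw [pd_const_mul a (hN _ _ _ _)]

/-! ### Metrics that are Euclidean to first order -/

section HatMetric

variable {x : E8} {γ : E8 → T2} {φ : E8 → T4} (h1 : γ x = delta)
  (hγ : ∀ i j, DifferentiableAt ℝ (fun y => γ y i j) x)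
  (h0 : ∀ a i j, pd a (fun y => γ y i j) x = 0)
  (hi : ∀ᶠ y in nhds x, ∀ p r, ∑ q, ginv (γ y) p q * γ y q r = delta p r)
  (hg : ∀ i j, DifferentiableAt ℝ (fun y => ginv (γ y) i j) x)
include h1

theorem ginv_delta (i j : Fin 8) : ginv (γ x) i j = delta i j := by
  rw [h1, ginv]
  have : Matrix.of delta = 1 := by
    ext i j; simp [delta, Matrix.one_apply]
  rw [this, inv_one]
  simp [delta, Matrix.one_apply]

include hγ h0 hi hg

theorem pd_ginv_eq_zero (a i j : Fin 8) : pd a (fun y => ginv (γ y) i j) x = 0 := by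
  have e : pd a (fun y => ∑ q, ginv (γ y) i q * γ y q j) x = 0 := by
    rw [pd_congr (f' := fun _ => delta i j) (hi.mono fun y hy => hy i j), pd_const]
  rw [pd_sum a fun q _ => (hg i q).fun_mul (hγ q j)] at e
  simp only [pd_mul a (hg i _) (hγ _ j), h0, h1, mul_zero, add_zero] at e
  rwa [sum_mul_delta'] at e

variable (hφ : ∀ i j k l, DifferentiableAt ℝ (fun y => φ y i j k l) x)
include hφ

omit h1 hγ h0 hi in
theorem differentiableAt_phiUU (i j k l : Fin 8) :
    DifferentiableAt ℝ (fun y => phiUU (γ y) (φ y) i j k l) x :=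
  DifferentiableAt.fun_sum fun p _ => DifferentiableAt.fun_sum fun q _ =>
    ((hg k p).fun_mul (hg l q)).fun_mul (hφ i j p q)

theorem pd_phiUU (a i j k l : Fin 8) : pd a (fun y => phiUU (γ y) (φ y) i j k l) x =
    pd a (fun y => φ y i j k l) x := by
  have z := pd_ginv_eq_zero h1 hγ h0 hi hg a
  simp only [phiUU]
  rw [pd_sum a fun p _ => DifferentiableAt.fun_sum fun q _ =>
    ((hg k p).fun_mul (hg l q)).fun_mul (hφ i j p q)]
  have : ∀ p, pd a (fun y => ∑ q, ginv (γ y) k p * ginv (γ y) l q * φ y i j p q) x =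
      delta k p * pd a (fun y => φ y i j p l) x := fun p => by
    rw [pd_sum a fun q _ => ((hg k p).fun_mul (hg l q)).fun_mul (hφ i j p q)]
    simp only [pd_mul a ((hg k p).fun_mul (hg l _)) (hφ i j p _), pd_mul a (hg k p) (hg l _), z,
      zero_mul, mul_zero, zero_add, ginv_delta h1, add_zero]
    simp only [mul_assoc, ← Finset.mul_sum, sum_delta_mul]
  simp only [this, sum_delta_mul]

omit hγ h0 hi hg hφ in
theorem phiUU_delta (i j k l : Fin 8) : phiUU (γ x) (φ x) i j k l = φ x i j k l := by
  simp only [phiUU, ginv_delta h1, mul_assoc, ← Finset.mul_sum, sum_delta_mul]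

/-- The derivative of the Cayley form lies in the eigenspace `Λ⁴_7`. -/
theorem J40_pd (hc : φ x = cayley0) (hJ : ∀ᶠ y in nhds x, J4 (γ y) (φ y) (φ y) = (-12 : ℝ) • φ y)
    (a : Fin 8) : J40 (fun i j k l => pd a (fun y => φ y i j k l) x) =
      (-6 : ℝ) • fun i j k l => pd a (fun y => φ y i j k l) x := by
  set ψ : T4 := fun i j k l => pd a (fun y => φ y i j k l) x with hψ
  have hU := differentiableAt_phiUU hg hφ
  have hd : ∀ i j k l, DifferentiableAt ℝ
      (fun y => 3 * ∑ p, ∑ q, phiUU (γ y) (φ y) i j p q * φ y k l p q) x := fun i j k l =>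
    (DifferentiableAt.fun_sum fun p _ => DifferentiableAt.fun_sum fun q _ =>
      (hU i j p q).fun_mul (hφ k l p q)).const_mul _
  have e1 : ∀ i j k l, pd a (fun y => 3 * ∑ p, ∑ q, phiUU (γ y) (φ y) i j p q * φ y k l p q) x =
      (3 * ∑ p, ∑ q, ψ i j p q * cayley0 k l p q) +
        3 * ∑ p, ∑ q, cayley0 i j p q * ψ k l p q := fun i j k l => by
    rw [pd_const_mul a (DifferentiableAt.fun_sum fun p _ => DifferentiableAt.fun_sum fun q _ =>
      (hU i j p q).fun_mul (hφ k l p q)), pd_sum a fun p _ => DifferentiableAt.fun_sum fun q _ =>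
      (hU i j p q).fun_mul (hφ k l p q)]
    have : ∀ p, pd a (fun y => ∑ q, phiUU (γ y) (φ y) i j p q * φ y k l p q) x =
        ∑ q, (ψ i j p q * cayley0 k l p q + cayley0 i j p q * ψ k l p q) := fun p => by
      rw [pd_sum a fun q _ => (hU i j p q).fun_mul (hφ k l p q)]
      exact Finset.sum_congr rfl fun q _ => by
        rw [pd_mul a (hU i j p q) (hφ k l p q), pd_phiUU h1 hγ h0 hi hg hφ, phiUU_delta h1, hc]
    simp only [this, Finset.sum_add_distrib, mul_add]
  have e2 : (fun i j k l => pd a (fun y => J4 (γ y) (φ y) (φ y) i j k l) x) =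
      alt4 (fun i j k l => 3 * ∑ p, ∑ q, ψ i j p q * cayley0 k l p q) + J40 ψ := by
    rw [J40, ← alt4_add]
    funext i j k l
    refine (pd_alt4 hd a i j k l).trans ?_
    simp only [e1]
    rfl
  have e3 : (fun i j k l => pd a (fun y => J4 (γ y) (φ y) (φ y) i j k l) x) = (-12 : ℝ) • ψ := by
    funext i j k l
    rw [pd_congr (f' := fun y => -12 * φ y i j k l) (hJ.mono fun y hy => by rw [hy]; rfl),
      pd_const_mul a (hφ i j k l)]
    rfl
  -- The two Leibniz terms agree after antisymmetrisation, so differentiating J₄Φ = −12Φ gives 2 J₄ψ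
  -- = −12ψ.
  have e4 : alt4 (fun i j k l => 3 * ∑ p, ∑ q, ψ i j p q * cayley0 k l p q) = J40 ψ := by
    funext i j k l
    simp only [J40, alt4_apply, mul_comm (ψ _ _ _ _)]
    ring
  rw [e4, e3] at e2
  have : J40 ψ = (1 / 2 : ℝ) • ((-12 : ℝ) • ψ) := by rw [e2]; module
  rw [this]; module

end HatMetric

theorem _root_.ContDiffAt.diffAt {f : E8 → ℝ} {x : E8} (h : ContDiffAt ℝ ∞ f x) : DifferentiableAt ℝ f x :=
  h.differentiableAt (by simp)

/-! ### The Levi-Civita connection and parallel frames of a Spin(7) structure -/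

section Structure

variable {U : Set E8} (hU : IsOpen U) {Φ : E8 → T4} {g : E8 → T2} (hS : IsSpin7On U Φ g)
  {x : E8} (hx : x ∈ U)
include hU hx

theorem contDiffAt_of_on {F : Type*} [NormedAddCommGroup F] [NormedSpace ℝ F] {f : E8 → F}
    (hf : ContDiffOn ℝ ∞ f U) : ContDiffAt ℝ ∞ f x := hf.contDiffAt (hU.mem_nhds hx)

theorem contDiffAt_comp3 {t : E8 → T3} (ht : ContDiffOn ℝ ∞ t U) (i j k : Fin 8) :
    ContDiffAt ℝ ∞ (fun y => t y i j k) x :=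
  contDiffAt_pi.1 (contDiffAt_pi.1 (contDiffAt_pi.1 (contDiffAt_of_on hU hx ht) i) j) k

include hS

theorem IsSpin7On.form_smooth (i j k l : Fin 8) : ContDiffAt ℝ ∞ (fun y => Φ y i j k l) x :=
  contDiffAt_pi.1 (contDiffAt_pi.1 (contDiffAt_pi.1 (contDiffAt_pi.1
    (contDiffAt_of_on hU hx hS.1) i) j) k) l
theorem IsSpin7On.metric_smooth (i j : Fin 8) : ContDiffAt ℝ ∞ (fun y => g y i j) x :=
  contDiffAt_pi.1 (contDiffAt_pi.1 (contDiffAt_of_on hU hx hS.2.1) i) j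
theorem IsSpin7On.ginv_smooth (i j : Fin 8) : ContDiffAt ℝ ∞ (fun y => ginv (g y) i j) x := by
  obtain ⟨A, E, h⟩ := hS.exists_isFrame hx
  exact contDiffAt_ginv (hS.metric_smooth hU hx) h.det_metric i j
theorem IsSpin7On.christoffel_smooth (k i j : Fin 8) :
    ContDiffAt ℝ ∞ (fun y => christoffel g y k i j) x := by
  refine contDiffAt_const.mul (ContDiffAt.sum fun l _ => (hS.ginv_smooth hU hx k l).mul ?_)
  have hm := hS.metric_smooth hU hx
  exact (((hm j l).pd i).add ((hm i l).pd j)).sub ((hm i j).pd l)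

omit hU in
theorem IsSpin7On.christoffel_lower (a b c : Fin 8) : ∑ p, g x p c * christoffel g x p a b =
    (1 / 2 : ℝ) * (pd a (fun y => g y b c) x + pd b (fun y => g y a c) x
      - pd c (fun y => g y a b) x) := by
  obtain ⟨A, E, h⟩ := hS.exists_isFrame hx
  simp only [christoffel, Finset.mul_sum]
  rw [Finset.sum_comm]
  have : ∀ l, ∑ p, g x p c * (1 / 2 * (ginv (g x) p l *
      (pd a (fun y => g y b l) x + pd b (fun y => g y a l) x - pd l (fun y => g y a b) x))) =
      (∑ p, g x c p * ginv (g x) p l) * (1 / 2 *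
      (pd a (fun y => g y b l) x + pd b (fun y => g y a l) x - pd l (fun y => g y a b) x)) :=
    fun l => by
      rw [Finset.sum_mul]
      exact Finset.sum_congr rfl fun p _ => by rw [h.metric_symm p c]; ring
  simp only [this, h.sum_mul_ginv, sum_delta_mul]

theorem IsSpin7On.pd_symm (a b c : Fin 8) :
    pd a (fun y => g y b c) x = pd a (fun y => g y c b) x :=
  pd_congr (eventually_of_mem hU hx fun _ hy => hS.metric_symm hy b c) a

/-- The Levi-Civita connection is metric. -/
theorem IsSpin7On.pd_metric (a b c : Fin 8) : pd a (fun y => g y b c) x =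
    act2 (fun p b => christoffel g x p a b) (g x) b c := by
  have e1 := hS.christoffel_lower hx a b c
  have e2 := hS.christoffel_lower hx a c b
  have e3 := hS.pd_symm hU hx a c b
  have e4 := hS.pd_symm hU hx b a c
  have e5 := hS.pd_symm hU hx c a b
  have e6 := hS.pd_symm hU hx b c a
  have e7 := hS.pd_symm hU hx c b a
  simp only [act2, act1, hS.metric_symm hx b, mul_comm (christoffel g x _ _ _), e1, e2]
  linarith

section Hat

variable {A E : Matrix (Fin 8) (Fin 8) ℝ} (h : IsFrame A E (Φ x) (g x))
include h

/-- The components in the parallel frame. -/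
theorem IsSpin7On.hat_isFrame : ∀ᶠ y in nhds x, ∃ A' E', IsFrame A' E'
    (pull4 (parallelFrame g E x y) (Φ y)) (pull2 (parallelFrame g E x y) (g y)) := by
  filter_upwards [det_parallelFrame g h.det_ne_zero x, hU.mem_nhds hx] with y hd hy
  obtain ⟨A', E', h'⟩ := hS.exists_isFrame hy
  exact ⟨_, _, h'.pull (Matrix.mul_nonsing_inv _ (isUnit_iff_ne_zero.2 hd))⟩

omit hU hS hx in
theorem IsFrame.hat_metric : pull2 (parallelFrame g E x x) (g x) = delta := by
  rw [parallelFrame_self, h.metric_eq]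
omit hU hS hx in
theorem IsFrame.hat_form : pull4 (parallelFrame g E x x) (Φ x) = cayley0 := by
  rw [parallelFrame_self, h.form_eq]

omit hU hS hx h in
theorem differentiableAt_parallelFrame (i m : Fin 8) :
    DifferentiableAt ℝ (fun y => parallelFrame g E x y i m) x :=
  (contDiff_parallelFrame g E x i m).contDiffAt.diffAt

omit h in
theorem IsSpin7On.pd_hat_metric (a m n : Fin 8) :
    pd a (fun y => pull2 (parallelFrame g E x y) (g y) m n) x = 0 := by
  rw [pd_pull2 differentiableAt_parallelFrame (fun i m => pd_parallelFrame g E x a i m)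
    fun i j => (hS.metric_smooth hU hx i j).diffAt]
  simp only [hS.pd_metric hU hx, sub_self]
  exact congrFun (congrFun (pull2_zero _) m) n

omit h in
theorem IsSpin7On.pd_hat_form (a m n p q : Fin 8) :
    pd a (fun y => pull4 (parallelFrame g E x y) (Φ y) m n p q) x =
      pull4 E (nabla4 g Φ x a) m n p q := by
  rw [pd_pull4 differentiableAt_parallelFrame (fun i m => pd_parallelFrame g E x a i m)
    fun i j k l => (hS.form_smooth hU hx i j k l).diffAt, parallelFrame_self]
  simp only [← nabla4_eq_act]

omit h in
theorem IsSpin7On.hat_form_diff (m n p q : Fin 8) : DifferentiableAt ℝ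
    (fun y => pull4 (parallelFrame g E x y) (Φ y) m n p q) x :=
  differentiableAt_pull4 differentiableAt_parallelFrame
    (fun i j k l => (hS.form_smooth hU hx i j k l).diffAt) m n p q

omit h in
theorem IsSpin7On.hat_metric_smooth (m n : Fin 8) : ContDiffAt ℝ ∞
    (fun y => pull2 (parallelFrame g E x y) (g y) m n) x :=
  ContDiffAt.sum fun i _ => (contDiff_parallelFrame g E x i m).contDiffAt.mul
    (ContDiffAt.sum fun j _ => (contDiff_parallelFrame g E x j n).contDiffAt.mul
      (hS.metric_smooth hU hx i j))

theorem IsSpin7On.hat_ginv_diff (m n : Fin 8) : DifferentiableAt ℝ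
    (fun y => ginv (pull2 (parallelFrame g E x y) (g y)) m n) x := by
  refine (contDiffAt_ginv (hS.hat_metric_smooth hU hx) ?_ m n).diffAt
  obtain ⟨A', E', h'⟩ := (hS.hat_isFrame hU hx h).self_of_nhds
  exact h'.det_metric

theorem IsSpin7On.hat_ginv_mul : ∀ᶠ y in nhds x, ∀ p r,
    ∑ q, ginv (pull2 (parallelFrame g E x y) (g y)) p q *
      pull2 (parallelFrame g E x y) (g y) q r = delta p r :=
  (hS.hat_isFrame hU hx h).mono fun _ ⟨_, _, h'⟩ => h'.sum_ginv_mul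

/-- In the parallel frame the metric is constant to first order and ∇Φ is the ordinary derivative of
the components, so `J40_pd` applies. -/
theorem IsSpin7On.J40_nabla4 (a : Fin 8) :
    J40 (pull4 E (nabla4 g Φ x a)) = (-6 : ℝ) • pull4 E (nabla4 g Φ x a) := by
  have := J40_pd (φ := fun y => pull4 (parallelFrame g E x y) (Φ y)) h.hat_metric
    (fun i j => (hS.hat_metric_smooth hU hx i j).diffAt) (hS.pd_hat_metric hU hx)
    (hS.hat_ginv_mul hU hx h) (hS.hat_ginv_diff hU hx h) (hS.hat_form_diff hU hx) h.hat_form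
    ((hS.hat_isFrame hU hx h).mono fun _ ⟨_, _, h'⟩ => h'.J4_self) a
  simpa only [hS.pd_hat_form hU hx] using this

theorem IsSpin7On.hat_nabla4_alt (a : Fin 8) : IsAlt4 (pull4 E (nabla4 g Φ x a)) := by
  have e : pull4 E (nabla4 g Φ x a) = fun m n p q =>
      pd a (fun y => pull4 (parallelFrame g E x y) (Φ y) m n p q) x := by
    funext m n p q; rw [hS.pd_hat_form hU hx]
  have hy := (hS.hat_isFrame hU hx h).mono fun _ ⟨_, _, h'⟩ => h'.form_alt
  rw [e]
  refine ⟨fun m n p q => ?_, fun m n p q => ?_, fun m n p q => ?_⟩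
  · rw [← pd_neg]; exact pd_congr (hy.mono fun y hy => hy.1 m n p q) a
  · rw [← pd_neg]; exact pd_congr (hy.mono fun y hy => hy.2.1 m n p q) a
  · rw [← pd_neg]; exact pd_congr (hy.mono fun y hy => hy.2.2 m n p q) a

end Hat
end Structure

/-! ### The torsion -/

theorem iota_sum {ι : Type*} (s : Finset ι) (c : ι → ℝ) (S : ι → T2) :
    iota (∑ i ∈ s, c i • S i) = ∑ i ∈ s, c i • iota (S i) := by
  classical
  induction s using Finset.induction_on with
  | empty => simp [iota_zero]
  | insert i s hi ih => rw [Finset.sum_insert hi, Finset.sum_insert hi, iota_add, iota_smul, ih]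
theorem con_sum {ι : Type*} (s : Finset ι) (c : ι → ℝ) (S : ι → T4) :
    con (∑ i ∈ s, c i • S i) = ∑ i ∈ s, c i • con (S i) := by
  classical
  induction s using Finset.induction_on with
  | empty => simp [con_zero]
  | insert i s hi ih => rw [Finset.sum_insert hi, Finset.sum_insert hi, con_add, con_smul, ih]
theorem J40_sum {ι : Type*} (s : Finset ι) (c : ι → ℝ) (S : ι → T4) :
    J40 (∑ i ∈ s, c i • S i) = ∑ i ∈ s, c i • J40 (S i) := by
  classical
  induction s using Finset.induction_on with
  | empty => simp [J40_zero]
  | insert i s hi ih => rw [Finset.sum_insert hi, Finset.sum_insert hi, J40_add, J40_smul, ih]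
theorem IsAlt4.sum {ι : Type*} (s : Finset ι) (c : ι → ℝ) {S : ι → T4} (hS : ∀ i, IsAlt4 (S i)) :
    IsAlt4 (∑ i ∈ s, c i • S i) := by
  classical
  induction s using Finset.induction_on with
  | empty => simp [IsAlt4]
  | insert i s hi ih => rw [Finset.sum_insert hi]; exact ((hS i).smul _).add ih

/-- The components in a frame of a tensor of rank 5. -/
def pull5 (E : Matrix (Fin 8) (Fin 8) ℝ) (s : Fin 8 → T4) : Fin 8 → T4 := fun m =>
  ∑ i, E i m • pull4 E (s i)

theorem pull3_eq_sum (E : Matrix (Fin 8) (Fin 8) ℝ) (t : T3) (m : Fin 8) :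
    pull3 E t m = ∑ i, E i m • pull2 E (t i) := by
  funext n p; simp [pull3, Finset.sum_apply]

namespace IsFrame

variable {A E : Matrix (Fin 8) (Fin 8) ℝ} {φ : T4} {γ : T2} (h : IsFrame A E φ γ)
include h

theorem pull5_inj {s t : Fin 8 → T4} (hst : pull5 E s = pull5 E t) : s = t := by
  have e : ∀ (s : Fin 8 → T4) a, ∑ m, A m a • pull5 E s m = pull4 E (s a) := fun s a => by
    simp only [pull5, Finset.smul_sum, smul_smul]
    rw [Finset.sum_comm]
    simp only [← Finset.sum_smul]
    have : ∀ i, ∑ m, A m a * E i m = delta i a := fun i => by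
      have := congrFun (congrFun h.mul_eq_one' i) a
      rw [Matrix.mul_apply, Matrix.one_apply] at this
      rw [delta, ← this]
      exact Finset.sum_congr rfl fun _ _ => mul_comm _ _
    simp only [this, delta, ite_smul, one_smul, zero_smul, Finset.sum_ite_eq', Finset.mem_univ,
      if_true]
  funext a
  apply h.pull4_inj
  rw [← e, ← e, hst]

theorem pull_torsion (S : T2) : pull4 E (alt4 fun b c d e => 4 * ∑ p, S b p * phiU γ φ p c d e) =
    (4 : ℝ) • iota (pull2 E S) := by
  have : (fun b c d e => 4 * ∑ p, S b p * phiU γ φ p c d e) =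
    (4 : ℝ) • fun b c d e => ∑ p, S b p * phiU γ φ p c d e := rfl
  rw [this, pull4_alt4, pull4_smul, h.pull_sum_phiU, alt4_smul, iota]

/-- In frame components the torsion equation becomes one algebraic equation ∇_mΦ = 4 ι(t_m) for each
direction m. -/
theorem isTorsion_iff (s : Fin 8 → T4) (t : T3) : (∀ a b c d e, s a b c d e =
      alt4 (fun b c d e => 4 * ∑ p, t a b p * phiU γ φ p c d e) b c d e) ↔
    ∀ m, pull5 E s m = (4 : ℝ) • iota (pull3 E t m) := by
  have e1 : pull5 E (fun a => alt4 fun b c d e => 4 * ∑ p, t a b p * phiU γ φ p c d e) =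
      fun m => (4 : ℝ) • iota (pull3 E t m) := by
    funext m
    rw [pull3_eq_sum, iota_sum, Finset.smul_sum, pull5]
    exact Finset.sum_congr rfl fun i _ => by rw [h.pull_torsion, smul_comm]
  constructor
  · intro hs m
    rw [← congrFun e1 m]
    congr 1
    funext a b c d e
    exact hs a b c d e
  · intro hs a b c d e
    have : s = fun a => alt4 fun b c d e => 4 * ∑ p, t a b p * phiU γ φ p c d e :=
      h.pull5_inj (by rw [e1]; funext m; exact hs m)
    conv_lhs => rw [this]

end IsFrame

/-- The torsion 3-form as an explicit function of the derivative of the Cayley form. -/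
def torsionField (Φ : E8 → T4) (g : E8 → T2) (x : E8) : T3 :=
  let C : T3 := fun a => contract (g x) (Φ x) (nabla4 g Φ x a)
  (1 / 54 : ℝ) • (C + (fun a b c => C b c a) + fun a b c => C c a b)
    + (1 / 432 : ℝ) • J3 (g x) (Φ x) (C + (fun a b c => C b c a) + fun a b c => C c a b)

theorem IsFrame.pull_torsionField {A E : Matrix (Fin 8) (Fin 8) ℝ} {Φ : E8 → T4} {g : E8 → T2}
    {x : E8} (h : IsFrame A E (Φ x) (g x)) : pull3 E (torsionField Φ g x) =
      torsionOf fun m => con (pull5 E (nabla4 g Φ x) m) := by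
  have e : pull3 E (fun a => contract (g x) (Φ x) (nabla4 g Φ x a)) =
      fun m => con (pull5 E (nabla4 g Φ x) m) := by
    funext m
    rw [pull3_eq_sum, pull5, con_sum]
    simp only [h.pull_contract]
  have e1 : ∀ C : T3, pull3 E (C + (fun a b c => C b c a) + fun a b c => C c a b) =
      fun a b c => pull3 E C a b c + pull3 E C b c a + pull3 E C c a b := fun C => by
    funext a b c
    rw [pull3_add, pull3_add, Pi.add_apply, Pi.add_apply, Pi.add_apply, Pi.add_apply, Pi.add_apply,
      Pi.add_apply, pull3_rot E C a b c]
    congr 2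
    exact (pull3_rot E (fun a b c => C b c a) b c a).symm
  rw [torsionField, pull3_add, pull3_smul, pull3_smul, h.pull_J3, e1, e]
  rfl

/-! ### Existence, uniqueness and smoothness of the torsion -/

section Torsion

variable {U : Set E8} (hU : IsOpen U) {Φ : E8 → T4} {g : E8 → T2} (hS : IsSpin7On U Φ g)
  {x : E8} (hx : x ∈ U)

include hU hS hx in
-- In a frame ∇Φ lies in Λ¹ ⊗ Λ⁴_7, where `iota_torsionOf` inverts the torsion equation.
theorem isTorsionAt_torsionField : IsTorsionAt Φ g x (torsionField Φ g x) := by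
  obtain ⟨A, E, h⟩ := hS.exists_isFrame hx
  have h1 : ∀ m, IsAlt4 (pull5 E (nabla4 g Φ x) m) := fun m =>
    IsAlt4.sum _ _ fun a => hS.hat_nabla4_alt hU hx h a
  have h2 : ∀ m, J40 (pull5 E (nabla4 g Φ x) m) = (-6 : ℝ) • pull5 E (nabla4 g Φ x) m := fun m => by
    rw [pull5, J40_sum, Finset.smul_sum]
    exact Finset.sum_congr rfl fun a _ => by rw [hS.J40_nabla4 hU hx h, smul_comm]
  refine ⟨?_, (h.isTorsion_iff _ _).2 fun m => ?_⟩
  · have h3 := (isAlt3_torsionOf fun a b c => con_skew_of_J40 (h1 a) (h2 a) b c).pull A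
    rwa [← h.pull_torsionField, pull3_pull3, h.mul_eq_one', pull3_one] at h3
  · rw [h.pull_torsionField]
    exact (iota_torsionOf h1 h2 m).symm

include hS hx in
theorem IsTorsionAt.unique {t t' : T3} (ht : IsTorsionAt Φ g x t) (ht' : IsTorsionAt Φ g x t') :
    t = t' := by
  obtain ⟨A, E, h⟩ := hS.exists_isFrame hx
  have e1 := (h.isTorsion_iff _ _).1 ht.2
  have e2 := (h.isTorsion_iff _ _).1 ht'.2
  apply h.pull3_inj
  rw [← sub_eq_zero]
  have hs : pull3 E t - pull3 E t' = pull3 E t + (-1 : ℝ) • pull3 E t' := by module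
  refine eq_zero_of_iota_eq_zero (hs ▸ (ht.1.pull E).add ((ht'.1.pull E).smul _)) fun a => ?_
  rw [Pi.sub_apply, iota_sub]
  have : (4 : ℝ) • (iota (pull3 E t a) - iota (pull3 E t' a)) = 0 := by
    rw [smul_sub, ← e1, ← e2, sub_self]
  exact (smul_eq_zero.1 this).resolve_left (by norm_num)

include hU hS hx in
theorem existsUnique_torsion : ∃! t : T3, IsTorsionAt Φ g x t :=
  ⟨_, isTorsionAt_torsionField hU hS hx, fun _ ht =>
    ht.unique hS hx (isTorsionAt_torsionField hU hS hx)⟩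

section Smooth

variable {γ : E8 → T2} {φ : E8 → T4} (hg : ∀ i j, ContDiffAt ℝ ∞ (fun y => ginv (γ y) i j) x)
  (hφ : ∀ i j k l, ContDiffAt ℝ ∞ (fun y => φ y i j k l) x)
include hg hφ

theorem contDiffAt_contract {s : E8 → T4} (hs : ∀ i j k l, ContDiffAt ℝ ∞ (fun y => s y i j k l) x)
    (i j : Fin 8) : ContDiffAt ℝ ∞ (fun y => contract (γ y) (φ y) (s y) i j) x :=
  ContDiffAt.sum fun p _ => ContDiffAt.sum fun q _ => ContDiffAt.sum fun r _ =>
    (ContDiffAt.sum fun p' _ => ContDiffAt.sum fun q' _ => ContDiffAt.sum fun r' _ =>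
      (((hg p p').mul (hg q q')).mul (hg r r')).mul (hφ j p' q' r')).mul (hs i p q r)

theorem contDiffAt_J3 {t : E8 → T3} (ht : ∀ i j k, ContDiffAt ℝ ∞ (fun y => t y i j k) x)
    (i j k : Fin 8) : ContDiffAt ℝ ∞ (fun y => J3 (γ y) (φ y) (t y) i j k) x := by
  have hp : ∀ i j p q, ContDiffAt ℝ ∞ (fun y => phiUU (γ y) (φ y) i j p q) x := fun i j p q =>
    ContDiffAt.sum fun p' _ => ContDiffAt.sum fun q' _ =>
      ((hg p p').mul (hg q q')).mul (hφ i j p' q')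
  exact contDiffAt_const.mul (ContDiffAt.sum fun p _ => ContDiffAt.sum fun q _ =>
    (((hp i j p q).mul (ht k p q)).add ((hp j k p q).mul (ht i p q))).add
      ((hp k i p q).mul (ht j p q)))

end Smooth

include hU hS hx in
theorem contDiffAt_nabla4 (a b c d e : Fin 8) :
    ContDiffAt ℝ ∞ (fun y => nabla4 g Φ y a b c d e) x := by
  have hc := hS.christoffel_smooth hU hx
  have hf := hS.form_smooth hU hx
  exact ((hf b c d e).pd a).sub (ContDiffAt.sum fun p _ =>
    ((((hc p a b).mul (hf p c d e)).add ((hc p a c).mul (hf b p d e))).add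
      ((hc p a d).mul (hf b c p e))).add ((hc p a e).mul (hf b c d p)))

include hU hS hx in
theorem contDiffAt_torsionField : ContDiffAt ℝ ∞ (torsionField Φ g) x := by
  have hc : ∀ a b c, ContDiffAt ℝ ∞ (fun y => contract (g y) (Φ y) (nabla4 g Φ y a) b c) x :=
    fun a b c => contDiffAt_contract (hS.ginv_smooth hU hx) (hS.form_smooth hU hx)
      (contDiffAt_nabla4 hU hS hx a) b c
  refine contDiffAt_pi.2 fun a => contDiffAt_pi.2 fun b => contDiffAt_pi.2 fun c => ?_
  exact (contDiffAt_const.mul (((hc a b c).add (hc b c a)).add (hc c a b))).add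
    (contDiffAt_const.mul (contDiffAt_J3 (hS.ginv_smooth hU hx) (hS.form_smooth hU hx)
      (fun a b c => ((hc a b c).add (hc b c a)).add (hc c a b)) a b c))

include hU hS in
-- By uniqueness T is the explicit `torsionField`, built from g⁻¹, Φ, ∂Φ and the Christoffel
-- symbols.
theorem contDiffOn_torsion {T : E8 → T3} (hT : ∀ x ∈ U, IsTorsionAt Φ g x (T x)) :
    ContDiffOn ℝ ∞ T U := fun x hx => by
  have : T =ᶠ[nhds x] torsionField Φ g := Filter.eventually_of_mem (hU.mem_nhds hx) fun y hy =>
    (hT y hy).unique hS hy (isTorsionAt_torsionField hU hS hy)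
  exact ((contDiffAt_torsionField hU hS hx).congr_of_eventuallyEq this).contDiffWithinAt

end Torsion

/-! ### Curvature -/

/-- The product of endomorphisms. -/
def mulT (M N : T2) : T2 := fun q b => ∑ p, M q p * N p b

/-! ### The action of endomorphisms on tensors -/

section Action

theorem act1_add (M N : T2) (u : Fin 8 → ℝ) : act1 (M + N) u = act1 M u + act1 N u := by
  funext b; simp [act1, add_mul, Finset.sum_add_distrib]
theorem act2_add (M N : T2) (t : T2) : act2 (M + N) t = act2 M t + act2 N t := by
  funext b c; simp [act2, act1_add, add_mul, Finset.sum_add_distrib]; ring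
theorem act3_add (M N : T2) (t : T3) : act3 (M + N) t = act3 M t + act3 N t := by
  funext b c d; simp [act3, act2_add, add_mul, Finset.sum_add_distrib]; ring
theorem act4_add (M N : T2) (t : T4) : act4 (M + N) t = act4 M t + act4 N t := by
  funext b c d e; simp [act4, act3_add, add_mul, Finset.sum_add_distrib]; ring

theorem act1_sub (M N : T2) (u : Fin 8 → ℝ) : act1 (M - N) u = act1 M u - act1 N u := by
  rw [eq_sub_iff_add_eq, ← act1_add, sub_add_cancel]
theorem act2_sub (M N : T2) (t : T2) : act2 (M - N) t = act2 M t - act2 N t := by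
  rw [eq_sub_iff_add_eq, ← act2_add, sub_add_cancel]
theorem act4_sub (M N : T2) (t : T4) : act4 (M - N) t = act4 M t - act4 N t := by
  rw [eq_sub_iff_add_eq, ← act4_add, sub_add_cancel]

theorem act1_sum (M : T2) (x : Fin 8 → ℝ) (t : Fin 8 → Fin 8 → ℝ) (u : Fin 8 → ℝ) (b : Fin 8) :
    act1 M (fun b => ∑ p, x p * t p b + u b) b = ∑ p, x p * act1 M (t p) b + act1 M u b := by
  simp only [act1, mul_add, Finset.sum_add_distrib, Finset.mul_sum]
  rw [Finset.sum_comm]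
  congr 1
  exact Finset.sum_congr rfl fun _ _ => Finset.sum_congr rfl fun _ _ => by ring
theorem act2_sum (M : T2) (x : Fin 8 → ℝ) (t : Fin 8 → T2) (u : T2) (b c : Fin 8) :
    act2 M (fun b c => ∑ p, x p * t p b c + u b c) b c =
      ∑ p, x p * act2 M (t p) b c + act2 M u b c := by
  have h := act1_sum M x (fun p b => t p b c) (fun b => u b c) b
  simp only [act1] at h
  simp only [mul_add, Finset.sum_add_distrib] at h
  simp only [act2, act1_sum, mul_add, Finset.sum_add_distrib]
  linarith
theorem act3_sum (M : T2) (x : Fin 8 → ℝ) (t : Fin 8 → T3) (u : T3) (b c d : Fin 8) :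
    act3 M (fun b c d => ∑ p, x p * t p b c d + u b c d) b c d =
      ∑ p, x p * act3 M (t p) b c d + act3 M u b c d := by
  have h := act1_sum M x (fun p b => t p b c d) (fun b => u b c d) b
  simp only [act1] at h
  simp only [mul_add, Finset.sum_add_distrib] at h
  simp only [act3, act2_sum, mul_add, Finset.sum_add_distrib]
  linarith

theorem act1_comm (M N : T2) (u : Fin 8 → ℝ) (b : Fin 8) :
    act1 N (act1 M u) b - act1 M (act1 N u) b = act1 (mulT M N - mulT N M) u b := by
  have h : ∀ M N : T2, act1 N (act1 M u) b = act1 (mulT M N) u b := fun M N => by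
    simp only [act1, mulT, Finset.mul_sum, Finset.sum_mul]
    rw [Finset.sum_comm]
    exact Finset.sum_congr rfl fun _ _ => Finset.sum_congr rfl fun _ _ => by ring
  rw [h, h, act1_sub]; rfl
-- The mixed terms, where M and N act on different indices, cancel. The terms acting twice on one
-- index reduce to the lower rank.
theorem act2_comm (M N : T2) (t : T2) (b c : Fin 8) :
    act2 N (act2 M t) b c - act2 M (act2 N t) b c = act2 (mulT M N - mulT N M) t b c := by
  have h : ∀ M N : T2, act2 N (act2 M t) b c = ∑ p, N p b * ∑ q, M q p * t q c +
      ∑ p, N p b * act1 M (t p) c + (∑ p, M p b * act1 N (t p) c + act1 N (act1 M (t b)) c) :=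
    fun M N => by
      rw [← act1_sum N (fun p => M p b) (fun p c => t p c)]
      simp only [act2, mul_add, Finset.sum_add_distrib]
      rfl
  have h1 := act1_comm M N (fun q => t q c) b
  have h2 := act1_comm M N (t b) c
  rw [h, h, act2]
  simp only [act1] at h1 ⊢
  simp only [act1] at h2
  linarith
theorem act3_comm (M N : T2) (t : T3) (b c d : Fin 8) :
    act3 N (act3 M t) b c d - act3 M (act3 N t) b c d =
      act3 (mulT M N - mulT N M) t b c d := by
  have h : ∀ M N : T2, act3 N (act3 M t) b c d = ∑ p, N p b * ∑ q, M q p * t q c d +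
      ∑ p, N p b * act2 M (t p) c d +
      (∑ p, M p b * act2 N (t p) c d + act2 N (act2 M (t b)) c d) :=
    fun M N => by
      rw [← act2_sum N (fun p => M p b) t]
      simp only [act3, mul_add, Finset.sum_add_distrib]
      rfl
  have h1 := act1_comm M N (fun q => t q c d) b
  have h2 := act2_comm M N (t b) c d
  rw [h, h, act3]
  simp only [act1] at h1 ⊢
  linarith
theorem act4_comm (M N : T2) (t : T4) (b c d e : Fin 8) :
    act4 N (act4 M t) b c d e - act4 M (act4 N t) b c d e =
      act4 (mulT M N - mulT N M) t b c d e := by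
  have h : ∀ M N : T2, act4 N (act4 M t) b c d e = ∑ p, N p b * ∑ q, M q p * t q c d e +
      ∑ p, N p b * act3 M (t p) c d e +
      (∑ p, M p b * act3 N (t p) c d e + act3 N (act3 M (t b)) c d e) :=
    fun M N => by
      rw [← act3_sum N (fun p => M p b) t]
      simp only [act4, mul_add, Finset.sum_add_distrib]
      rfl
  have h1 := act1_comm M N (fun q => t q c d e) b
  have h2 := act3_comm M N (t b) c d e
  rw [h, h, act4]
  simp only [act1] at h1 ⊢
  linarith

end Action

/-! ### The Leibniz rule for the action -/

section Leibniz

variable {x : E8} {M : E8 → T2} (hM : ∀ i j, DifferentiableAt ℝ (fun y => M y i j) x) (a : Fin 8)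
include hM

theorem differentiableAt_act1 {u : E8 → Fin 8 → ℝ}
    (hu : ∀ i, DifferentiableAt ℝ (fun y => u y i) x) (b : Fin 8) :
    DifferentiableAt ℝ (fun y => act1 (M y) (u y) b) x :=
  DifferentiableAt.fun_sum fun p _ => (hM p b).fun_mul (hu p)
theorem differentiableAt_act2 {t : E8 → T2}
    (ht : ∀ i j, DifferentiableAt ℝ (fun y => t y i j) x) (b c : Fin 8) :
    DifferentiableAt ℝ (fun y => act2 (M y) (t y) b c) x :=
  (differentiableAt_act1 hM (fun i => ht i c) b).fun_add (differentiableAt_act1 hM (ht b) c)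
theorem differentiableAt_act3 {t : E8 → T3}
    (ht : ∀ i j k, DifferentiableAt ℝ (fun y => t y i j k) x) (b c d : Fin 8) :
    DifferentiableAt ℝ (fun y => act3 (M y) (t y) b c d) x :=
  (differentiableAt_act1 hM (fun i => ht i c d) b).fun_add (differentiableAt_act2 hM (ht b) c d)

theorem pd_act1 {u : E8 → Fin 8 → ℝ}
    (hu : ∀ i, DifferentiableAt ℝ (fun y => u y i) x) (b : Fin 8) :
    pd a (fun y => act1 (M y) (u y) b) x = act1 (fun i j => pd a (fun y => M y i j) x) (u x) b +
      act1 (M x) (fun i => pd a (fun y => u y i) x) b := by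
  simp only [act1]
  rw [pd_sum a fun p _ => (hM p b).fun_mul (hu p), ← Finset.sum_add_distrib]
  exact Finset.sum_congr rfl fun p _ => pd_mul a (hM p b) (hu p)
theorem pd_act2 {t : E8 → T2}
    (ht : ∀ i j, DifferentiableAt ℝ (fun y => t y i j) x) (b c : Fin 8) :
    pd a (fun y => act2 (M y) (t y) b c) x =
      act2 (fun i j => pd a (fun y => M y i j) x) (t x) b c +
      act2 (M x) (fun i j => pd a (fun y => t y i j) x) b c := by
  have h1 := pd_act1 hM a (fun i => ht i c) b
  have h2 := pd_act1 hM a (ht b) c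
  have h3 := pd_add a (differentiableAt_act1 hM (fun i => ht i c) b)
    (differentiableAt_act1 hM (ht b) c)
  rw [h1, h2] at h3
  simp only [act2]
  refine h3.trans ?_
  simp only [act1]
  ring
theorem pd_act3 {t : E8 → T3}
    (ht : ∀ i j k, DifferentiableAt ℝ (fun y => t y i j k) x) (b c d : Fin 8) :
    pd a (fun y => act3 (M y) (t y) b c d) x =
      act3 (fun i j => pd a (fun y => M y i j) x) (t x) b c d +
      act3 (M x) (fun i j k => pd a (fun y => t y i j k) x) b c d := by
  have h1 := pd_act1 hM a (fun i => ht i c d) b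
  have h2 := pd_act2 hM a (ht b) c d
  have h3 := pd_add a (differentiableAt_act1 hM (fun i => ht i c d) b)
    (differentiableAt_act2 hM (ht b) c d)
  rw [h1, h2] at h3
  simp only [act3]
  refine h3.trans ?_
  simp only [act1]
  ring
theorem pd_act4 {t : E8 → T4}
    (ht : ∀ i j k l, DifferentiableAt ℝ (fun y => t y i j k l) x) (b c d e : Fin 8) :
    pd a (fun y => act4 (M y) (t y) b c d e) x =
      act4 (fun i j => pd a (fun y => M y i j) x) (t x) b c d e +
      act4 (M x) (fun i j k l => pd a (fun y => t y i j k l) x) b c d e := by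
  have h1 := pd_act1 hM a (fun i => ht i c d e) b
  have h2 := pd_act3 hM a (ht b) c d e
  have h3 := pd_add a (differentiableAt_act1 hM (fun i => ht i c d e) b)
    (differentiableAt_act3 hM (ht b) c d e)
  rw [h1, h2] at h3
  simp only [act4]
  refine h3.trans ?_
  simp only [act1]
  ring

end Leibniz

/-- The curvature of a connection with components `Ω^p_{ab}`. -/
def curv (Ω : E8 → T3) (x : E8) (f a : Fin 8) : T2 := fun p b =>
  pd f (fun y => Ω y p a b) x - pd a (fun y => Ω y p f b) x
    + ∑ q, (Ω x p f q * Ω x q a b - Ω x p a q * Ω x q f b)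

theorem curv_eq (Ω : E8 → T3) (x : E8) (f a : Fin 8) : curv Ω x f a =
    (fun p b => pd f (fun y => Ω y p a b) x) - (fun p b => pd a (fun y => Ω y p f b) x)
      + (mulT (fun p b => Ω x p f b) (fun p b => Ω x p a b)
        - mulT (fun p b => Ω x p a b) (fun p b => Ω x p f b)) := by
  funext p b
  simp only [curv, mulT, Finset.sum_sub_distrib, Pi.add_apply, Pi.sub_apply]

section Flat

variable {x : E8} {Ω : E8 → T3} (hΩ : ∀ p a b, DifferentiableAt ℝ (fun y => Ω y p a b) x)
include hΩ

/-- The curvature annihilates a parallel tensor. -/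
theorem act2_curv {t : E8 → T2} (ht : ∀ i j, ContDiffAt ℝ ∞ (fun y => t y i j) x)
    (hp : ∀ᶠ y in nhds x, ∀ a b c, pd a (fun y => t y b c) y =
      act2 (fun p b => Ω y p a b) (t y) b c) (f a b c : Fin 8) :
    act2 (curv Ω x f a) (t x) b c = 0 := by
  have e : ∀ f a, pd f (pd a fun y => t y b c) x =
      act2 (fun p b => pd f (fun y => Ω y p a b) x) (t x) b c +
      act2 (fun p b => Ω x p a b) (act2 (fun p b => Ω x p f b) (t x)) b c := fun f a => by
    have e1 : pd f (pd a fun y => t y b c) x =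
        pd f (fun y => act2 (fun p b => Ω y p a b) (t y) b c) x :=
      pd_congr (hp.mono fun y hy => hy a b c) f
    rw [e1, pd_act2 (M := fun y p b => Ω y p a b) (fun i j => hΩ i a j) f
      fun i j => (ht i j).diffAt]
    congr 2
    funext i j
    exact hp.self_of_nhds f i j
  -- Symmetry of second derivatives is the integrability condition of ∂t = Ω · t. The commutator of
  -- the two actions completes it to the curvature.
  have e3 := pd_comm f (ht b c) a
  rw [e, e] at e3
  have e4 := act2_comm (fun p b => Ω x p f b) (fun p b => Ω x p a b) (t x) b c
  rw [curv_eq, act2_add, act2_sub, Pi.add_apply, Pi.add_apply, Pi.sub_apply, Pi.sub_apply, ← e4]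
  linarith

theorem act4_curv {t : E8 → T4} (ht : ∀ i j k l, ContDiffAt ℝ ∞ (fun y => t y i j k l) x)
    (hp : ∀ᶠ y in nhds x, ∀ a b c d e, pd a (fun y => t y b c d e) y =
      act4 (fun p b => Ω y p a b) (t y) b c d e) (f a b c d e : Fin 8) :
    act4 (curv Ω x f a) (t x) b c d e = 0 := by
  have hd : ∀ f a, pd f (pd a fun y => t y b c d e) x =
      act4 (fun p b => pd f (fun y => Ω y p a b) x) (t x) b c d e +
      act4 (fun p b => Ω x p a b) (act4 (fun p b => Ω x p f b) (t x)) b c d e := fun f a => by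
    have e1 : pd f (pd a fun y => t y b c d e) x =
        pd f (fun y => act4 (fun p b => Ω y p a b) (t y) b c d e) x :=
      pd_congr (hp.mono fun y hy => hy a b c d e) f
    rw [e1, pd_act4 (M := fun y p b => Ω y p a b) (fun i j => hΩ i a j) f
      fun i j k l => (ht i j k l).diffAt]
    congr 2
    funext i j k l
    exact hp.self_of_nhds f i j k l
  have e3 := pd_comm f (ht b c d e) a
  rw [hd, hd] at e3
  have e4 := act4_comm (fun p b => Ω x p f b) (fun p b => Ω x p a b) (t x) b c d e
  rw [curv_eq, act4_add, act4_sub]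
  simp only [Pi.add_apply, Pi.sub_apply]
  rw [← e4]
  linarith

end Flat

/-- Lowering the upper index of an endomorphism. -/
def lower (γ : T2) (M : T2) : T2 := fun b c => ∑ p, γ p c * M p b

namespace IsFrame

variable {A E : Matrix (Fin 8) (Fin 8) ℝ} {φ : T4} {γ : T2} (h : IsFrame A E φ γ)
include h

theorem raise_lower (M : T2) (p b : Fin 8) : ∑ c, ginv γ p c * lower γ M b c = M p b := by
  simp only [lower, Finset.mul_sum]
  rw [Finset.sum_comm]
  have : ∀ q, ∑ c, ginv γ p c * (γ q c * M q b) = (∑ c, ginv γ p c * γ c q) * M q b := fun q => by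
    rw [Finset.sum_mul]
    exact Finset.sum_congr rfl fun c _ => by rw [h.metric_symm q c]; ring
  simp only [this, h.sum_ginv_mul, sum_delta_mul]

theorem lower_raise (S : T2) (b c : Fin 8) :
    lower γ (fun p b => ∑ c, ginv γ p c * S b c) b c = S b c := by
  simp only [lower, Finset.mul_sum]
  rw [Finset.sum_comm]
  have : ∀ q, ∑ p, γ p c * (ginv γ p q * S b q) = (∑ p, γ c p * ginv γ p q) * S b q := fun q => by
    rw [Finset.sum_mul]
    exact Finset.sum_congr rfl fun p _ => by rw [h.metric_symm p c]; ring
  simp only [this, h.sum_mul_ginv, sum_delta_mul]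

theorem lower_skew {M : T2} (hM : ∀ b c, act2 M γ b c = 0) (b c : Fin 8) :
    lower γ M c b = -lower γ M b c := by
  have := hM b c
  simp only [act2, act1, h.metric_symm b, mul_comm (M _ _)] at this
  simp only [lower]
  linarith

/-- The action of an endomorphism on the Cayley form. -/
theorem act4_form (M : T2) : act4 M φ =
    alt4 fun b c d e => 4 * ∑ p, lower γ M b p * phiU γ φ p c d e := by
  have e0 : ∀ b c d e, ∑ p, lower γ M b p * phiU γ φ p c d e = ∑ p, M p b * φ p c d e :=
    fun b c d e => by
      simp only [phiU, Finset.mul_sum]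
      rw [Finset.sum_comm]
      refine Finset.sum_congr rfl fun q _ => ?_
      rw [← h.raise_lower M q b, Finset.sum_mul]
      exact Finset.sum_congr rfl fun p _ => by rw [h.ginv_comm p q]; ring
  have hφ := h.form_alt
  funext b c d e
  rw [alt4_of_alt3]
  · have r1 : ∀ p, φ b p d e = -φ p b d e := fun p => hφ.1 p b d e
    have r2 : ∀ p, φ b c p e = -φ p c b e := fun p => by
      rw [hφ.2.1 b p c e, hφ.1 p b c e, hφ.2.1 p c b e, neg_neg]
    have r3 : ∀ p, φ b c d p = -φ p c d b := fun p => by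
      rw [hφ.2.2 b c p d, hφ.2.1 b p c d, hφ.1 p b c d, hφ.2.2 p c b d, hφ.2.1 p b c d]
    simp only [e0, act4, act3, act2, act1, r1, r2, r3, mul_neg, Finset.sum_neg_distrib]
    ring
  · refine fun a => ⟨fun b c d => ?_, fun b c d => ?_⟩
    · simp only [e0, hφ.2.1 _ b c d, mul_neg, Finset.sum_neg_distrib]
    · simp only [e0, hφ.2.2 _ b c d, mul_neg, Finset.sum_neg_distrib]

/-- Annihilating Φ means that ι of the lowered endomorphism S vanishes. For antisymmetric S, con
ι(S) = 6(S − J₂S), so S lies in Λ²_21, the Lie algebra of Spin(7). -/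
theorem J20_lower {M : T2} (hM : act4 M φ = 0) (hs : ∀ b c, lower γ M c b = -lower γ M b c) :
    J20 (pull2 E (lower γ M)) = pull2 E (lower γ M) := by
  rw [h.act4_form] at hM
  have h1 := h.pull_torsion (lower γ M)
  rw [hM, pull4_zero] at h1
  have h2 : iota (pull2 E (lower γ M)) = 0 := (smul_eq_zero.1 h1.symm).resolve_left (by norm_num)
  funext b c
  have h3 := con_iota (pull2 E (lower γ M)) b c
  rw [h2, con_zero, tr0_skew (pull2_skew E hs)] at h3
  simp only [Pi.zero_apply] at h3
  linarith

end IsFrame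

/-- The torsion as an endomorphism, `T_{ab}{}^p`. -/
def torsionUp (g : E8 → T2) (T : E8 → T3) (y : E8) : T3 := fun p a b =>
  ∑ c, ginv (g y) p c * T y a b c

/-- The connection with torsion, which preserves the Cayley form. -/
def spinConn (g : E8 → T2) (T : E8 → T3) (y : E8) : T3 := fun p a b =>
  christoffel g y p a b + torsionUp g T y p a b

/-! ### The connection with torsion and its curvature -/

section Curvature

variable {U : Set E8} (hU : IsOpen U) {Φ : E8 → T4} {g : E8 → T2} (hS : IsSpin7On U Φ g)
  {T : E8 → T3} (hT : ∀ x ∈ U, IsTorsionAt Φ g x (T x)) {x : E8} (hx : x ∈ U)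

include hU hS hx

theorem christoffel_comm (p a b : Fin 8) : christoffel g x p a b = christoffel g x p b a :=
  christoffel_symm hU hx (fun _ hy => hS.metric_symm hy) p a b

/-- The curvature tensor with all indices down. -/
theorem lower_curv_christoffel_skew (f a b c : Fin 8) :
    lower (g x) (curv (christoffel g) x f a) c b =
      -lower (g x) (curv (christoffel g) x f a) b c := by
  obtain ⟨A, E, h⟩ := hS.exists_isFrame hx
  exact h.lower_skew (act2_curv (fun p a b => (hS.christoffel_smooth hU hx p a b).diffAt)
    (hS.metric_smooth hU hx) (eventually_of_mem hU hx fun y hy a b c => hS.pd_metric hU hy a b c)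
    f a) b c

theorem curv_christoffel_cyc (f a b p : Fin 8) : curv (christoffel g) x f a p b +
    curv (christoffel g) x a b p f + curv (christoffel g) x b f p a = 0 := by
  have e : ∀ f a b, pd f (fun y => christoffel g y p a b) x =
      pd f (fun y => christoffel g y p b a) x := fun f a b =>
    pd_congr (eventually_of_mem hU hx fun y hy => christoffel_comm hU hS hy p a b) f
  have s : ∑ q, (christoffel g x p f q * christoffel g x q a b -
        christoffel g x p a q * christoffel g x q f b) +
      ∑ q, (christoffel g x p a q * christoffel g x q b f -
        christoffel g x p b q * christoffel g x q a f) +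
      ∑ q, (christoffel g x p b q * christoffel g x q f a -
        christoffel g x p f q * christoffel g x q b a) = 0 := by
    rw [← Finset.sum_add_distrib, ← Finset.sum_add_distrib]
    refine Finset.sum_eq_zero fun q _ => ?_
    rw [christoffel_comm hU hS hx q b a, christoffel_comm hU hS hx q b f,
      christoffel_comm hU hS hx q f a]
    ring
  simp only [curv]
  linarith [e f a b, e a b f, e b f a]

theorem lower_curv_christoffel_cyc (f a b c : Fin 8) :
    lower (g x) (curv (christoffel g) x f a) b c + lower (g x) (curv (christoffel g) x a b) f c +
      lower (g x) (curv (christoffel g) x b f) a c = 0 := by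
  simp only [lower, ← Finset.sum_add_distrib, ← mul_add, curv_christoffel_cyc hU hS hx, mul_zero,
    Finset.sum_const_zero]

include hT

theorem torsion_smooth (a b c : Fin 8) : ContDiffAt ℝ ∞ (fun y => T y a b c) x :=
  contDiffAt_comp3 hU hx (contDiffOn_torsion hU hS hT) a b c

theorem torsionUp_smooth (p a b : Fin 8) : ContDiffAt ℝ ∞ (fun y => torsionUp g T y p a b) x :=
  ContDiffAt.sum fun c _ => (hS.ginv_smooth hU hx p c).mul (torsion_smooth hU hS hT hx a b c)

theorem spinConn_smooth (p a b : Fin 8) : ContDiffAt ℝ ∞ (fun y => spinConn g T y p a b) x :=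
  (hS.christoffel_smooth hU hx p a b).add (torsionUp_smooth hU hS hT hx p a b)

omit hU hT in
theorem lower_torsionUp (a b c : Fin 8) :
    ∑ p, g x p c * torsionUp g T x p a b = T x a b c := by
  obtain ⟨A, E, h⟩ := hS.exists_isFrame hx
  exact h.lower_raise (T x a) b c

omit hU in
-- The defining equation of the torsion says exactly that Φ is parallel for Γ + T.
theorem pd_form_spinConn (a b c d e : Fin 8) : pd a (fun y => Φ y b c d e) x =
    act4 (fun p b => spinConn g T x p a b) (Φ x) b c d e := by
  obtain ⟨A, E, h⟩ := hS.exists_isFrame hx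
  have h1 := (hT x hx).2 a b c d e
  have h2 : (fun p b => spinConn g T x p a b) =
      (fun p b => christoffel g x p a b) + fun p b => torsionUp g T x p a b := rfl
  have h3 := h.act4_form (fun p b => torsionUp g T x p a b)
  have h4 : ∀ b c, lower (g x) (fun p b => torsionUp g T x p a b) b c = T x a b c := fun b c =>
    lower_torsionUp hS hx a b c
  simp only [h4] at h3
  rw [h2, act4_add, h3]
  simp only [Pi.add_apply]
  rw [← h1, nabla4_eq_act]
  ring

/-- Adding T keeps the connection metric because T is antisymmetric in its last two indices. -/
theorem pd_metric_spinConn (a b c : Fin 8) : pd a (fun y => g y b c) x =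
    act2 (fun p b => spinConn g T x p a b) (g x) b c := by
  have h2 : (fun p b => spinConn g T x p a b) =
      (fun p b => christoffel g x p a b) + fun p b => torsionUp g T x p a b := rfl
  rw [h2, act2_add, hS.pd_metric hU hx, Pi.add_apply, Pi.add_apply]
  have h3 : act2 (fun p b => torsionUp g T x p a b) (g x) b c = T x a b c + T x a c b := by
    simp only [act2, act1, hS.metric_symm hx b, mul_comm (torsionUp g T x _ _ _)]
    rw [lower_torsionUp hS hx, lower_torsionUp hS hx]
  rw [h3, (hT x hx).1.2 a b c]
  ring

theorem lower_spinCurv_skew (f a b c : Fin 8) :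
    lower (g x) (curv (spinConn g T) x f a) c b =
      -lower (g x) (curv (spinConn g T) x f a) b c := by
  obtain ⟨A, E, h⟩ := hS.exists_isFrame hx
  exact h.lower_skew (act2_curv (fun p a b => (spinConn_smooth hU hS hT hx p a b).diffAt)
    (hS.metric_smooth hU hx)
    (eventually_of_mem hU hx fun y hy a b c => pd_metric_spinConn hU hS hT hy a b c) f a) b c

theorem J20_spinCurv {A E : Matrix (Fin 8) (Fin 8) ℝ} (h : IsFrame A E (Φ x) (g x))
    (f a : Fin 8) : J20 (pull2 E (lower (g x) (curv (spinConn g T) x f a))) =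
      pull2 E (lower (g x) (curv (spinConn g T) x f a)) := by
  refine h.J20_lower ?_ fun b c => lower_spinCurv_skew hU hS hT hx f a b c
  funext b c d e
  exact act4_curv (fun p a b => (spinConn_smooth hU hS hT hx p a b).diffAt)
    (hS.form_smooth hU hx)
    (eventually_of_mem hU hx fun y hy a b c d e => pd_form_spinConn hS hT hy a b c d e)
    f a b c d e

/-- The covariant derivative of `T_{ab}{}^p`. -/
theorem lower_nabla_torsionUp (f a b c : Fin 8) : ∑ p, g x p c *
      (pd f (fun y => torsionUp g T y p a b) x + ∑ q, (christoffel g x p f q * torsionUp g T x q a b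
        - torsionUp g T x p a q * christoffel g x q f b)) =
    nabla3 g T x f a b c + ∑ q, christoffel g x q f a * T x q b c := by
  have hτ := fun p => (torsionUp_smooth hU hS hT hx p a b).diffAt
  have hm := fun p => (hS.metric_smooth hU hx p c).diffAt
  have e1 : pd f (fun y => T y a b c) x =
      ∑ p, (pd f (fun y => g y p c) x * torsionUp g T x p a b
        + g x p c * pd f (fun y => torsionUp g T y p a b) x) := by
    rw [pd_congr (eventually_of_mem hU hx fun y hy => (lower_torsionUp hS hy a b c).symm) f,
      pd_sum f fun p _ => (hm p).fun_mul (hτ p)]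
    exact Finset.sum_congr rfl fun p _ => pd_mul f (hm p) (hτ p)
  have e2 : ∑ p, pd f (fun y => g y p c) x * torsionUp g T x p a b =
      ∑ p, g x p c * ∑ q, christoffel g x p f q * torsionUp g T x q a b
        + ∑ q, christoffel g x q f c * T x a b q := by
    simp only [hS.pd_metric hU hx, act2, act1, add_mul, Finset.sum_add_distrib, Finset.sum_mul,
      Finset.mul_sum, ← lower_torsionUp (T := T) hS hx a b]
    congr 1
    · rw [Finset.sum_comm]
      exact Finset.sum_congr rfl fun _ _ => Finset.sum_congr rfl fun _ _ => by ring
    · rw [Finset.sum_comm]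
      exact Finset.sum_congr rfl fun _ _ => Finset.sum_congr rfl fun _ _ => by
        rw [hS.metric_symm hx]; ring
  have e3 : ∑ p, g x p c * ∑ q, torsionUp g T x p a q * christoffel g x q f b =
      ∑ q, christoffel g x q f b * T x a q c := by
    simp only [Finset.mul_sum, ← lower_torsionUp (T := T) hS hx a _ c]
    rw [Finset.sum_comm]
    exact Finset.sum_congr rfl fun _ _ => Finset.sum_congr rfl fun _ _ => by ring
  rw [Finset.sum_add_distrib] at e1
  simp only [Finset.sum_sub_distrib, mul_add, mul_sub, Finset.sum_add_distrib, nabla3, e1, e2, e3]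
  ring

/-- The curvature of the connection with torsion. -/
theorem lower_spinCurv (f a b c : Fin 8) : lower (g x) (curv (spinConn g T) x f a) b c =
    lower (g x) (curv (christoffel g) x f a) b c + nabla3 g T x f a b c - nabla3 g T x a f b c
      - quad (g x) (T x) a b f c + quad (g x) (T x) f b a c := by
  have e1 : curv (spinConn g T) x f a = curv (christoffel g) x f a
      + (fun p b => pd f (fun y => torsionUp g T y p a b) x +
        ∑ q, (christoffel g x p f q * torsionUp g T x q a b
        - torsionUp g T x p a q * christoffel g x q f b))
      + (-1 : ℝ) • (fun p b => pd a (fun y => torsionUp g T y p f b) x +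
        ∑ q, (christoffel g x p a q * torsionUp g T x q f b
        - torsionUp g T x p f q * christoffel g x q a b))
      + fun p b => ∑ q, (torsionUp g T x p f q * torsionUp g T x q a b
        - torsionUp g T x p a q * torsionUp g T x q f b) := by
    funext p b
    have d : ∀ f a, pd f (fun y => spinConn g T y p a b) x =
        pd f (fun y => christoffel g y p a b) x + pd f (fun y => torsionUp g T y p a b) x :=
      fun f a => pd_add f (hS.christoffel_smooth hU hx p a b).diffAt
        (torsionUp_smooth hU hS hT hx p a b).diffAt
    rw [curv, d, d]
    simp only [curv, Pi.add_apply, Pi.smul_apply, smul_eq_mul, spinConn, add_mul, mul_add,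
      Finset.sum_add_distrib, Finset.sum_sub_distrib]
    ring
  have e2 : ∀ f a b c, ∑ p, g x p c * ∑ q, torsionUp g T x p f q * torsionUp g T x q a b =
      -quad (g x) (T x) a b f c := fun f a b c => by
    have : ∑ p, g x p c * ∑ q, torsionUp g T x p f q * torsionUp g T x q a b =
        ∑ q, T x f q c * torsionUp g T x q a b := by
      simp only [Finset.mul_sum, ← lower_torsionUp (T := T) hS hx f _ c, Finset.sum_mul]
      rw [Finset.sum_comm]
      exact Finset.sum_congr rfl fun _ _ => Finset.sum_congr rfl fun _ _ => by ring
    rw [this]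
    obtain ⟨A, E, h⟩ := hS.exists_isFrame hx
    simp only [torsionUp, quad, Finset.mul_sum, ← Finset.sum_neg_distrib]
    rw [Finset.sum_comm]
    exact Finset.sum_congr rfl fun p _ => Finset.sum_congr rfl fun q _ => by
      rw [h.ginv_comm q p, (hT x hx).1.2 f c q]; ring
  have l1 := lower_nabla_torsionUp hU hS hT hx f a b c
  have l2 := lower_nabla_torsionUp hU hS hT hx a f b c
  have l3 := e2 f a b c
  have l4 := e2 a f b c
  -- The Christoffel terms on the form index of the connection cancel between the two derivatives
  -- since Γ is symmetric.
  have l5 : ∑ q, christoffel g x q f a * T x q b c = ∑ q, christoffel g x q a f * T x q b c := by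
    simp only [christoffel_comm hU hS hx _ f a]
  rw [e1]
  simp only [lower, Pi.add_apply, Pi.smul_apply, smul_eq_mul, mul_add (g x _ c),
    Finset.sum_add_distrib, Finset.sum_sub_distrib, mul_sub (g x _ c), mul_neg, neg_mul, one_mul,
    Finset.sum_neg_distrib] at l1 l2 l3 l4 ⊢
  linarith

end Curvature

theorem J20_sum {ι : Type*} (s : Finset ι) (c : ι → ℝ) (S : ι → T2) :
    J20 (∑ i ∈ s, c i • S i) = ∑ i ∈ s, c i • J20 (S i) := by
  classical
  induction s using Finset.induction_on with
  | empty => simp only [Finset.sum_empty]; funext i j; simp [J20]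
  | insert i s hi ih => rw [Finset.sum_insert hi, Finset.sum_insert hi, J20_add, J20_smul, ih]

theorem pull4_eq_sum (E : Matrix (Fin 8) (Fin 8) ℝ) (t : T4) (m n : Fin 8) :
    pull4 E t m n = ∑ i, E i m • ∑ j, E j n • pull2 E (t i j) := by
  funext p q
  simp [pull4, pull3, Finset.sum_apply]

/-- The tensor `¼ t_{aij} - ⅛ Φ_{ij}{}^{kl} t_{akl}`. -/
def part7 (γ : T2) (φ : T4) (t : T3) : T3 := fun a i j =>
  (1 / 4 : ℝ) * t a i j - (1 / 8 : ℝ) * ∑ k, ∑ l, phiUU γ φ i j k l * t a k l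

/-- The components of the curvature tensor, with the fourth index lowered. -/
def curvDown (g : E8 → T2) (Ω : E8 → T3) (x : E8) : T4 := fun f a =>
  lower (g x) (curv Ω x f a)

namespace IsFrame

variable {A E : Matrix (Fin 8) (Fin 8) ℝ} {φ : T4} {γ : T2} (h : IsFrame A E φ γ)
include h

theorem pull_part7 (t : T3) : pull3 E (part7 γ φ t) = fun a i j =>
    (1 / 4 : ℝ) * pull3 E t a i j - (1 / 4 : ℝ) * J20 (pull3 E t a) i j := by
  have e : part7 γ φ t = (1 / 4 : ℝ) • t + (-(1 / 4) : ℝ) • fun a => J2 γ φ (t a) := by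
    funext a i j
    simp only [part7, J2, Pi.add_apply, Pi.smul_apply, smul_eq_mul]
    ring
  have e1 : ∀ a, pull3 E (fun a => J2 γ φ (t a)) a = J20 (pull3 E t a) := fun a => by
    rw [pull3_eq_sum, pull3_eq_sum, J20_sum]
    simp only [h.pull_J2]
  funext a i j
  rw [e, pull3_add, pull3_smul, pull3_smul]
  simp only [Pi.add_apply, Pi.smul_apply, smul_eq_mul, e1]
  ring

theorem part7_pull {B B' : Matrix (Fin 8) (Fin 8) ℝ} (hB : B * B' = 1) (t : T3) :
    pull3 B (part7 γ φ t) = part7 (pull2 B γ) (pull4 B φ) (pull3 B t) := by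
  have h' := h.pull hB
  apply h'.pull3_inj
  rw [h'.pull_part7, pull3_pull3, pull3_pull3, ← Matrix.mul_assoc, hB, Matrix.one_mul,
    h.pull_part7]

theorem pull_ricci (S : T4) : pull2 E (fun b c => ∑ k, ∑ d, ginv γ k d * S k c b d) =
    fun b c => ∑ k, pull4 E S k c b k := by
  have e : (fun b c => ∑ k, ∑ d, ginv γ k d * S k c b d) =
      fun b c => ∑ m, ∑ k, E k m * pull1 E (S k c b) m := by
    funext b c
    simp only [h.ginv_eq, pull1, Finset.sum_mul, Finset.mul_sum]
    calc _ = ∑ k, ∑ m, ∑ d, E k m * E d m * S k c b d :=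
          Finset.sum_congr rfl fun _ _ => Finset.sum_comm
      _ = _ := by
        rw [Finset.sum_comm]
        exact Finset.sum_congr rfl fun _ _ => Finset.sum_congr rfl fun _ _ =>
          Finset.sum_congr rfl fun _ _ => by ring
  funext b c
  rw [e, pull2_sum]
  simp only [pull2_sum, pull2_mul]
  refine Finset.sum_congr rfl fun m _ => Finset.sum_congr rfl fun k _ => congrArg _ ?_
  exact pull2_swap E (fun c b => pull1 E (S k c b) m) b c

theorem pull_div (S : T4) : pull2 E (fun a b => ∑ r, ∑ s, ginv γ r s * S s r a b) =
    div0 (pull4 E S) := by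
  have e : (fun a b => ∑ r, ∑ s, ginv γ r s * S s r a b) =
      fun a b => ∑ m, ∑ s, ∑ r, E s m * (E r m * S s r a b) := by
    funext a b
    simp only [h.ginv_eq, Finset.sum_mul]
    calc _ = ∑ r, ∑ m, ∑ s, E r m * E s m * S s r a b :=
          Finset.sum_congr rfl fun _ _ => Finset.sum_comm
      _ = ∑ m, ∑ r, ∑ s, E r m * E s m * S s r a b := Finset.sum_comm
      _ = _ := Finset.sum_congr rfl fun m _ => by
        rw [Finset.sum_comm]
        exact Finset.sum_congr rfl fun _ _ => Finset.sum_congr rfl fun _ _ => by ring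
  funext a b
  rw [e, pull2_sum]
  simp only [pull2_sum, pull2_mul, div0, pull4, pull3, Finset.mul_sum]

end IsFrame

/-- The divergence of the torsion in terms of the derivative of the torsion 3-form. -/
theorem div_part7 {t : T3} (ht : IsAlt3 t) {D D' : T4} (hD : ∀ s r i j, D' s r i j =
    (1 / 4 : ℝ) * D s r i j - (1 / 8 : ℝ) * ∑ k, ∑ l, (((4 : ℝ) • iota (t s)) i j k l * t r k l
      + cayley0 i j k l * D s r k l)) :
    div0 D' = (1 / 4 : ℝ) • (div0 D - J20 (div0 D) + skewPart (con (quad0 t))) := by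
  have q1 : ∀ i j, ∑ r, ∑ k, ∑ l, (∑ e, t r i e * cayley0 e j k l) * t r k l =
      -con (quad0 t) i j := fun i j => by
    simp only [con, quad0, Finset.sum_mul, Finset.mul_sum, ← Finset.sum_neg_distrib]
    calc _ = ∑ r, ∑ k, ∑ e, ∑ l, t r i e * cayley0 e j k l * t r k l :=
          Finset.sum_congr rfl fun _ _ => Finset.sum_congr rfl fun _ _ => Finset.sum_comm
      _ = ∑ r, ∑ e, ∑ k, ∑ l, t r i e * cayley0 e j k l * t r k l :=
          Finset.sum_congr rfl fun _ _ => Finset.sum_comm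
      _ = ∑ e, ∑ r, ∑ k, ∑ l, t r i e * cayley0 e j k l * t r k l := Finset.sum_comm
      _ = ∑ e, ∑ k, ∑ r, ∑ l, t r i e * cayley0 e j k l * t r k l :=
          Finset.sum_congr rfl fun _ _ => Finset.sum_comm
      _ = ∑ e, ∑ k, ∑ l, ∑ r, t r i e * cayley0 e j k l * t r k l :=
          Finset.sum_congr rfl fun _ _ => Finset.sum_congr rfl fun _ _ => Finset.sum_comm
      _ = _ := Finset.sum_congr rfl fun e _ => Finset.sum_congr rfl fun k _ =>
          Finset.sum_congr rfl fun l _ => Finset.sum_congr rfl fun r _ => by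
        rw [cayley0_swap01 e j, alt3_rot ht r i e, alt3_rot ht r k l]; ring
  -- The product of the two components of t is symmetric in e and l, while Φ is antisymmetric in
  -- them.
  have q2 : ∀ i j, ∑ r, ∑ k, ∑ l, (∑ e, t r k e * cayley0 e j i l) * t r k l = 0 := fun i j => by
    refine Finset.sum_eq_zero fun r _ => Finset.sum_eq_zero fun k _ => ?_
    have : ∑ l, (∑ e, t r k e * cayley0 e j i l) * t r k l =
        -∑ l, (∑ e, t r k e * cayley0 e j i l) * t r k l := by
      simp only [Finset.sum_mul, ← Finset.sum_neg_distrib]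
      rw [Finset.sum_comm]
      refine Finset.sum_congr rfl fun l _ => Finset.sum_congr rfl fun e _ => ?_
      have : cayley0 l j i e = -cayley0 e j i l := by
        linarith [cayley0_swap01 l j i e, cayley0_swap12 j l i e, cayley0_swap23 j i l e,
          cayley0_swap12 j i e l, cayley0_swap01 j e i l]
      rw [this]; ring
    linarith
  -- This is the contribution of ∇Φ = 4ι(t). Of the four terms of ι, those with t on the summed
  -- indices k and l vanish.
  have q : ∀ i j, ∑ r, ∑ k, ∑ l, ((4 : ℝ) • iota (t r)) i j k l * t r k l =
      -2 * skewPart (con (quad0 t)) i j := fun i j => by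
    have q3 : ∑ r, ∑ k, ∑ l, (∑ e, t r l e * cayley0 e j k i) * t r k l = 0 := by
      rw [← q2 i j]
      refine Finset.sum_congr rfl fun r _ => ?_
      rw [Finset.sum_comm]
      refine Finset.sum_congr rfl fun k _ => Finset.sum_congr rfl fun l _ => ?_
      rw [ht.2 r k l]
      simp only [Finset.sum_mul, cayley0_swap23 _ j i l]
      exact Finset.sum_congr rfl fun e _ => by ring
    have : ∀ r k l, ((4 : ℝ) • iota (t r)) i j k l * t r k l =
        (∑ e, t r i e * cayley0 e j k l) * t r k l - (∑ e, t r j e * cayley0 e i k l) * t r k l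
        - (∑ e, t r k e * cayley0 e j i l) * t r k l
        - (∑ e, t r l e * cayley0 e j k i) * t r k l := fun r k l => by
      simp only [Pi.smul_apply, smul_eq_mul, iota_apply]; ring
    simp only [this, Finset.sum_sub_distrib, q1, q2, q3, skewPart]
    ring
  funext i j
  have e : J20 (div0 D) i j = ∑ r, (1 / 2 : ℝ) * ∑ k, ∑ l, cayley0 i j k l * D r r k l := by
    simp only [J20, div0, Finset.mul_sum]
    calc _ = ∑ k, ∑ r, ∑ l, (1 / 2 : ℝ) * (cayley0 i j k l * D r r k l) :=
          Finset.sum_congr rfl fun _ _ => Finset.sum_comm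
      _ = _ := Finset.sum_comm
  have := q i j
  simp only [div0, hD, Pi.smul_apply, Pi.add_apply, Pi.sub_apply, smul_eq_mul, e,
    Finset.sum_add_distrib, Finset.sum_sub_distrib, mul_add, ← Finset.mul_sum] at this ⊢
  rw [this]
  ring

/-! ### Frame components of the two curvature tensors -/

section Main

variable {U : Set E8} (hU : IsOpen U) {Φ : E8 → T4} {g : E8 → T2} (hS : IsSpin7On U Φ g)
  {T : E8 → T3} (hT : ∀ x ∈ U, IsTorsionAt Φ g x (T x)) {x : E8} (hx : x ∈ U)
  {A E : Matrix (Fin 8) (Fin 8) ℝ}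
include hU hS hx

omit hU hS hx in
theorem hat_curv_swap01 (a b c d : Fin 8) : pull4 E (curvDown g (christoffel g) x) b a c d =
    -pull4 E (curvDown g (christoffel g) x) a b c d := by
  have : sw01 (curvDown g (christoffel g) x) = (-1 : ℝ) • curvDown g (christoffel g) x := by
    funext a b c d
    simp only [sw01, curvDown, lower, curv, Pi.smul_apply, smul_eq_mul, Finset.mul_sum,
      Finset.sum_sub_distrib]
    exact Finset.sum_congr rfl fun p _ => by ring
  have := congrArg (pull4 E) this
  rw [pull4_sw01, pull4_smul] at this
  have := congrFun (congrFun (congrFun (congrFun this a) b) c) d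
  simpa [sw01] using this

theorem hat_curv_swap23 (a b c d : Fin 8) : pull4 E (curvDown g (christoffel g) x) a b d c =
    -pull4 E (curvDown g (christoffel g) x) a b c d := by
  have : sw23 (curvDown g (christoffel g) x) = (-1 : ℝ) • curvDown g (christoffel g) x := by
    funext a b c d
    simp only [sw23, curvDown, Pi.smul_apply, smul_eq_mul,
      lower_curv_christoffel_skew hU hS hx a b c d]
    ring
  have := congrArg (pull4 E) this
  rw [pull4_sw23, pull4_smul] at this
  have := congrFun (congrFun (congrFun (congrFun this a) b) c) d
  simpa [sw23] using this

theorem hat_curv_cyc (a b c d : Fin 8) : pull4 E (curvDown g (christoffel g) x) a b c d +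
    pull4 E (curvDown g (christoffel g) x) b c a d +
    pull4 E (curvDown g (christoffel g) x) c a b d = 0 := by
  have : curvDown g (christoffel g) x + sw01 (sw12 (curvDown g (christoffel g) x)) +
      sw12 (sw01 (curvDown g (christoffel g) x)) = 0 := by
    funext a b c d
    exact lower_curv_christoffel_cyc hU hS hx a b c d
  have := congrArg (pull4 E) this
  rw [pull4_add, pull4_add, pull4_sw01, pull4_sw12, pull4_sw12, pull4_sw01, pull4_zero] at this
  exact congrFun (congrFun (congrFun (congrFun this a) b) c) d

include hT

theorem hat_spinCurv (hh : IsFrame A E (Φ x) (g x)) (f a b c : Fin 8) :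
    pull4 E (curvDown g (spinConn g T) x) f a b c =
    pull4 E (curvDown g (christoffel g) x) f a b c + pull4 E (nabla3 g T x) f a b c
      - pull4 E (nabla3 g T x) a f b c
      + ∑ q, (pull3 E (T x) a b q * pull3 E (T x) f q c
        - pull3 E (T x) f b q * pull3 E (T x) a q c) := by
  have e : curvDown g (spinConn g T) x = curvDown g (christoffel g) x + nabla3 g T x +
      (-1 : ℝ) • sw01 (nabla3 g T x) + (-1 : ℝ) • sw01 (sw12 (quad (g x) (T x)))
        + sw12 (quad (g x) (T x)) := by
    funext f a b c
    have := lower_spinCurv hU hS hT hx f a b c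
    simp only [curvDown, sw01, sw12, Pi.add_apply, Pi.smul_apply, smul_eq_mul, this]
    ring
  have ht := (hT x hx).1.pull E
  rw [e, pull4_add, pull4_add, pull4_add, pull4_add, pull4_smul, pull4_smul, pull4_sw01,
    pull4_sw01, pull4_sw12, hh.pull_quad]
  simp only [Pi.add_apply, Pi.smul_apply, smul_eq_mul, sw01, sw12, quad0, Finset.sum_sub_distrib,
    ht.2 f _ c, ht.2 a _ c, mul_neg, Finset.sum_neg_distrib]
  have e1 : ∀ f c q, pull3 E (T x) f q c = -pull3 E (T x) f c q := fun f c q => ht.2 f c q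
  simp only [e1 f c, e1 a c, mul_neg, Finset.sum_neg_distrib]
  ring

theorem hat_J20_spinCurv (hh : IsFrame A E (Φ x) (g x)) (f a : Fin 8) :
    J20 (pull4 E (curvDown g (spinConn g T) x) f a) =
      pull4 E (curvDown g (spinConn g T) x) f a := by
  rw [pull4_eq_sum, J20_sum]
  refine Finset.sum_congr rfl fun i _ => ?_
  rw [J20_sum]
  congr 1
  exact Finset.sum_congr rfl fun j _ => by
    rw [curvDown, J20_spinCurv hU hS hT hx hh]

end Main

/-! ### The antisymmetric, trace and symmetric parts of the equation -/

section Main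

variable {U : Set E8} (hU : IsOpen U) {Φ : E8 → T4} {g : E8 → T2} (hS : IsSpin7On U Φ g)
  {T : E8 → T3} (hT : ∀ x ∈ U, IsTorsionAt Φ g x (T x)) {x : E8} (hx : x ∈ U)
  {A E : Matrix (Fin 8) (Fin 8) ℝ}

theorem pd_hat3 {t : E8 → T3} (ht : ∀ i j k, ContDiffAt ℝ ∞ (fun y => t y i j k) x)
    (a m n p : Fin 8) : pd a (fun y => pull3 (parallelFrame g E x y) (t y) m n p) x =
      pull3 E (nabla3 g t x a) m n p := by
  rw [pd_pull3 differentiableAt_parallelFrame (fun i m => pd_parallelFrame g E x a i m)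
    fun i j k => (ht i j k).diffAt, parallelFrame_self]
  simp only [← nabla3_eq_act]

theorem differentiableAt_hat3 {t : E8 → T3} (ht : ∀ i j k, ContDiffAt ℝ ∞ (fun y => t y i j k) x)
    (m n p : Fin 8) :
    DifferentiableAt ℝ (fun y => pull3 (parallelFrame g E x y) (t y) m n p) x :=
  differentiableAt_pull3 differentiableAt_parallelFrame (fun i j k => (ht i j k).diffAt) m n p

theorem pull_ricci_eq (h : IsFrame A E (Φ x) (g x)) : pull2 E (ricci g x) =
    fun b c => ∑ k, pull4 E (curvDown g (christoffel g) x) k c b k := by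
  rw [← h.pull_ricci]
  congr 1
  funext b c
  simp only [curvDown, h.raise_lower]
  simp only [ricci, curv]

theorem scalarCurvature_eq (h : IsFrame A E (Φ x) (g x)) : scalarCurvature g x =
    ∑ b, ∑ k, pull4 E (curvDown g (christoffel g) x) k b b k := by
  rw [scalarCurvature, h.trace_eq, pull_ricci_eq h]
  rfl

include hU hS hT hx

theorem torsion7_smooth (i j k : Fin 8) :
    ContDiffAt ℝ ∞ (fun y => torsion7 Φ g T y i j k) x :=
  (contDiffAt_const.mul (torsion_smooth hU hS hT hx i j k)).sub (contDiffAt_const.mul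
    (ContDiffAt.sum fun k _ => ContDiffAt.sum fun l _ => (ContDiffAt.sum fun _ _ =>
      ContDiffAt.sum fun _ _ => ((hS.ginv_smooth hU hx _ _).mul
        (hS.ginv_smooth hU hx _ _)).mul (hS.form_smooth hU hx _ _ _ _)).mul
          (torsion_smooth hU hS hT hx _ k l)))

/-- In the parallel frame the metric is constant to first order, so only Φ and T are differentiated
in T_{r;ij}. -/
theorem pull_nabla_torsion7 (h : IsFrame A E (Φ x) (g x)) (a r i j : Fin 8) :
    pull3 E (nabla3 g (torsion7 Φ g T) x a) r i j =
      (1 / 4 : ℝ) * pull3 E (nabla3 g T x a) r i j - (1 / 8 : ℝ) * ∑ k, ∑ l,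
        (pull4 E (nabla4 g Φ x a) i j k l * pull3 E (T x) r k l
          + cayley0 i j k l * pull3 E (nabla3 g T x a) r k l) := by
  have hs := torsion_smooth hU hS hT hx
  rw [← pd_hat3 (torsion7_smooth hU hS hT hx)]
  have e : ∀ᶠ y in nhds x, pull3 (parallelFrame g E x y) (torsion7 Φ g T y) r i j =
      part7 (pull2 (parallelFrame g E x y) (g y)) (pull4 (parallelFrame g E x y) (Φ y))
        (pull3 (parallelFrame g E x y) (T y)) r i j := by
    filter_upwards [det_parallelFrame g h.det_ne_zero x, hU.mem_nhds hx] with y hd hy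
    obtain ⟨A', E', h'⟩ := hS.exists_isFrame hy
    rw [← h'.part7_pull (Matrix.mul_nonsing_inv _ (isUnit_iff_ne_zero.2 hd))]
    rfl
  have dg := fun i j => (hS.hat_metric_smooth (E := E) hU hx i j).diffAt
  have dφ := hS.hat_form_diff (E := E) hU hx
  have dgi := hS.hat_ginv_diff hU hx h
  have dp := differentiableAt_phiUU dgi dφ
  have dT := differentiableAt_hat3 (g := g) (E := E) hs
  have ep := pd_phiUU h.hat_metric dg (hS.pd_hat_metric hU hx) (hS.hat_ginv_mul hU hx h) dgi dφ
  have eT := pd_hat3 (g := g) (E := E) hs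
  have e0 := phiUU_delta (γ := fun y => pull2 (parallelFrame g E x y) (g y))
    (φ := fun y => pull4 (parallelFrame g E x y) (Φ y)) h.hat_metric
  have eg := hS.pd_hat_form (E := E) hU hx
  rw [pd_congr e]
  simp only [part7]
  rw [pd_sub a ((dT _ _ _).const_mul _) (DifferentiableAt.const_mul (DifferentiableAt.fun_sum
    fun k _ => DifferentiableAt.fun_sum fun l _ => (dp i j k l).fun_mul (dT r k l)) _),
    pd_const_mul a (dT _ _ _), pd_const_mul a (DifferentiableAt.fun_sum
    fun k _ => DifferentiableAt.fun_sum fun l _ => (dp i j k l).fun_mul (dT r k l)),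
    pd_sum a fun k _ => DifferentiableAt.fun_sum fun l _ => (dp i j k l).fun_mul (dT r k l), eT]
  congr 2
  refine Finset.sum_congr rfl fun k _ => ?_
  rw [pd_sum a fun l _ => (dp i j k l).fun_mul (dT r k l)]
  refine Finset.sum_congr rfl fun l _ => ?_
  rw [pd_mul a (dp i j k l) (dT r k l), ep, eT, e0, eg, h.hat_form, parallelFrame_self]

theorem pull_divTorsion7 (h : IsFrame A E (Φ x) (g x)) : pull2 E (divTorsion7 Φ g T x) =
    (1 / 4 : ℝ) • (div0 (pull4 E (nabla3 g T x)) - J20 (div0 (pull4 E (nabla3 g T x)))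
      + skewPart (con (quad0 (pull3 E (T x))))) := by
  have ht := (hT x hx).1.pull E
  rw [← div_part7 ht (D' := pull4 E (nabla3 g (torsion7 Φ g T) x))]
  · exact h.pull_div _
  · intro s r i j
    have e := (h.isTorsion_iff (nabla4 g Φ x) (T x)).1 (hT x hx).2 s
    rw [← e]
    have e4 : ∀ t : T4, ∀ r i j, pull4 E t s r i j = ∑ a, E a s * pull3 E (t a) r i j :=
      fun t r i j => rfl
    have e5 : ∀ i j k l, pull5 E (nabla4 g Φ x) s i j k l =
        ∑ a, E a s * pull4 E (nabla4 g Φ x a) i j k l := fun i j k l => by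
      simp [pull5, Finset.sum_apply]
    simp only [e4, e5, pull_nabla_torsion7 hU hS hT hx h, mul_sub, Finset.sum_sub_distrib,
      Finset.mul_sum, Finset.sum_mul, mul_add, Finset.sum_add_distrib]
    congr 1
    · exact Finset.sum_congr rfl fun _ _ => by ring
    congr 1
    · rw [Finset.sum_comm]
      refine Finset.sum_congr rfl fun k _ => ?_
      rw [Finset.sum_comm]
      exact Finset.sum_congr rfl fun _ _ => Finset.sum_congr rfl fun _ _ => by ring
    · rw [Finset.sum_comm]
      refine Finset.sum_congr rfl fun k _ => ?_
      rw [Finset.sum_comm]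
      exact Finset.sum_congr rfl fun _ _ => Finset.sum_congr rfl fun _ _ => by ring

omit hU hS in
theorem pull_nabla3_alt (hU : IsOpen U) (a : Fin 8) : IsAlt3 (pull4 E (nabla3 g T x) a) :=
  pull3_alt3 E (nabla3_alt hU hx g fun y hy => (hT y hy).1) a

/-- The same combination appears with coefficient −1/2 in `skew_field0` and with 1/4 in
`pull_divTorsion7`. -/
theorem skewPart_torsionFieldTensor (lam : ℝ) :
    skewPart (torsionFieldTensor lam (g x) (Φ x) (T x) (nabla3 g T x)) =
      (-2 : ℝ) • divTorsion7 Φ g T x := by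
  obtain ⟨A, E, h⟩ := hS.exists_isFrame hx
  apply h.pull2_inj
  rw [pull2_skewPart, torsionFieldTensor_eq, h.pull_fieldTensor,
    skew_field0 ((hT x hx).1.pull E) (pull_nabla3_alt hT hx hU)
      (hat_curv_swap01) (hat_curv_swap23 hU hS hx) (hat_curv_cyc hU hS hx)
      (hat_spinCurv hU hS hT hx h) (hat_J20_spinCurv hU hS hT hx h),
    pull2_smul, pull_divTorsion7 hU hS hT hx h, smul_smul]
  norm_num

/-- The trace identity `trace_ricci` leaves |T|² + Y/4, which is (7/6)|π₄₈T|² by `ip3_proj48` and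
`ip3_J30_self`. -/
theorem trace_torsionFieldTensor (lam : ℝ) :
    trace (g x) (torsionFieldTensor lam (g x) (Φ x) (T x) (nabla3 g T x)) =
      (7 / 6) * normSq (g x) (proj48 (g x) (Φ x) (T x)) + 4 * lam - scalarCurvature g x := by
  obtain ⟨A, E, h⟩ := hS.exists_isFrame hx
  have ht := (hT x hx).1.pull E
  rw [h.trace_eq, torsionFieldTensor_eq, h.pull_fieldTensor, tr0_field0' ht,
    scalarCurvature_eq h,
    trace_ricci ht (pull_nabla3_alt hT hx hU)
      (hat_curv_swap01) (hat_curv_swap23 hU hS hx) (hat_curv_cyc hU hS hx)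
      (hat_spinCurv hU hS hT hx h) (hat_J20_spinCurv hU hS hT hx h),
    h.normSq_eq, h.pull_proj48, ip3_proj48 ht, ip3_J30_self ht]
  ring

theorem three_ricci_sub (lam : ℝ) : (3 : ℝ) • ricci g x - ricciSource lam Φ g T x =
    (-2 : ℝ) • symPart (torsionFieldTensor lam (g x) (Φ x) (T x) (nabla3 g T x)) := by
  obtain ⟨A, E, h⟩ := hS.exists_isFrame hx
  have ht := (hT x hx).1.pull E
  have e0 : symPart (fun a b => ∑ p, ∑ q, ∑ r, phiUUU (g x) (Φ x) a p q r * nabla3 g T x b p q r) =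
      symPart (contract (g x) (Φ x) (nabla3 g T x)) := by
    funext a b; simp only [symPart, contract]; ring
  have e : ricciSource lam Φ g T x = (-1 : ℝ) • symPart (contract (g x) (Φ x) (nabla3 g T x)) +
      (3 : ℝ) • sqTensor (g x) (T x) + (-(3 / 2) : ℝ) • (fun a b => ∑ p, ∑ q, ∑ r, ∑ s,
        phiUUUU (g x) (Φ x) p q r s * T x a p q * T x b r s) +
      ((3 / 8 : ℝ) * quadScalar (g x) (Φ x) (T x) + lam) • g x := by
    funext a b
    simp only [ricciSource, e0, Pi.add_apply, Pi.smul_apply, smul_eq_mul]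
    ring
  apply h.pull2_inj
  rw [pull2_sub, pull2_smul, pull2_smul, pull2_symPart, e, pull2_add, pull2_add, pull2_add,
    pull2_smul, pull2_smul, pull2_smul, pull2_smul, pull2_symPart, h.pull_contract,
    h.pull_sqTensor, h.pull_cross, h.metric_eq, h.quadScalar_eq, torsionFieldTensor_eq,
    h.pull_fieldTensor, pull_ricci_eq h]
  funext a b
  have h1 := three_ricci ht (pull_nabla3_alt hT hx hU)
      (hat_curv_swap01) (hat_curv_swap23 hU hS hx) (hat_curv_cyc hU hS hx)
      (hat_spinCurv hU hS hT hx h) (hat_J20_spinCurv hU hS hT hx h) lam a b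
  have h2 := ricci_symm (R := pull4 E (curvDown g (christoffel g) x))
      (hat_curv_swap01) (hat_curv_swap23 hU hS hx) (hat_curv_cyc hU hS hx) a b
  simp only [Pi.add_apply, Pi.sub_apply, Pi.smul_apply, smul_eq_mul, ← h2, ← h1]
  ring

end Main

/-! ### Structures given by a coframe field -/

section Coframe

variable (B : E8 → Matrix (Fin 8) (Fin 8) ℝ)

/-- The Cayley form of a coframe field. -/
def coframeForm (y : E8) : T4 := pull4 (B y) cayley0
/-- The metric of a coframe field. -/
def coframeMetric (y : E8) : T2 := pull2 (B y) delta

variable {B} (hB : ∀ i j, ContDiff ℝ ∞ (fun y => B y i j))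
include hB

theorem contDiff_pull1 {u : E8 → Fin 8 → ℝ} (hu : ∀ i, ContDiff ℝ ∞ fun y => u y i) (m : Fin 8) :
    ContDiff ℝ ∞ (fun y => pull1 (B y) (u y) m) :=
  ContDiff.sum fun i _ => (hB i m).mul (hu i)
theorem contDiff_pull2 {t : E8 → T2} (ht : ∀ i j, ContDiff ℝ ∞ fun y => t y i j) (m n : Fin 8) :
    ContDiff ℝ ∞ (fun y => pull2 (B y) (t y) m n) :=
  contDiff_pull1 hB (fun i => contDiff_pull1 hB (ht i) n) m
theorem contDiff_pull3 {t : E8 → T3} (ht : ∀ i j k, ContDiff ℝ ∞ fun y => t y i j k)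
    (m n p : Fin 8) : ContDiff ℝ ∞ (fun y => pull3 (B y) (t y) m n p) :=
  contDiff_pull1 hB (fun i => contDiff_pull2 hB (ht i) n p) m
theorem contDiff_pull4 {t : E8 → T4} (ht : ∀ i j k l, ContDiff ℝ ∞ fun y => t y i j k l)
    (m n p q : Fin 8) : ContDiff ℝ ∞ (fun y => pull4 (B y) (t y) m n p q) :=
  contDiff_pull1 hB (fun i => contDiff_pull3 hB (ht i) n p q) m

theorem isOpen_coframe : IsOpen {y | (B y).det ≠ 0} :=
  isOpen_ne_fun (continuous_iff_continuousAt.2 fun _ =>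
    (contDiffAt_det (n := ∞) fun i j => (hB i j).contDiffAt).continuousAt) continuous_const

theorem isSpin7On_coframe :
    IsSpin7On {y | (B y).det ≠ 0} (coframeForm B) (coframeMetric B) := by
  refine ⟨ContDiff.contDiffOn ?_, ContDiff.contDiffOn ?_, fun y hy => ⟨B y, ?_⟩⟩
  · exact contDiff_pi.2 fun i => contDiff_pi.2 fun j => contDiff_pi.2 fun k => contDiff_pi.2 fun l =>
      contDiff_pull4 hB (t := fun _ => cayley0) (fun _ _ _ _ => contDiff_const) i j k l
  · exact contDiff_pi.2 fun i => contDiff_pi.2 fun j =>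
      contDiff_pull2 hB (t := fun _ => delta) (fun _ _ => contDiff_const) i j
  · exact isAdapted_iff.2 ⟨hy, rfl, rfl⟩

section SecondOrder

variable {x : E8} (h1 : B x = 1) (h0 : ∀ a i j, pd a (fun y => B y i j) x = 0)
include h1 h0

omit hB h1 h0 in
-- The cross terms vanish because u is stationary at x. For a coframe that is the identity to first
-- order, second derivatives then act as endomorphisms.
theorem pd_pd_mul {u v : E8 → ℝ} (hu : ContDiff ℝ ∞ u) (hv : ContDiff ℝ ∞ v)
    (h : ∀ a, pd a u x = 0) (f a : Fin 8) : pd f (pd a (fun y => u y * v y)) x =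
      pd f (pd a u) x * v x + u x * pd f (pd a v) x := by
  have e : pd a (fun y => u y * v y) = fun y => pd a u y * v y + u y * pd a v y := by
    funext y; exact pd_mul a hu.contDiffAt.diffAt hv.contDiffAt.diffAt
  have du := hu.contDiffAt (x := x)
  have dv := hv.contDiffAt (x := x)
  rw [e, pd_add f ((du.pd a).mul dv).diffAt (du.mul (dv.pd a)).diffAt,
    pd_mul f (du.pd a).diffAt dv.diffAt, pd_mul f du.diffAt (dv.pd a).diffAt, h, h]
  ring

omit hB h1 h0 in
theorem pd_pd_sum {ι : Type*} {s : Finset ι} {F : ι → E8 → ℝ} (h : ∀ i ∈ s, ContDiff ℝ ∞ (F i))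
    (f a : Fin 8) :
    pd f (pd a (fun y => ∑ i ∈ s, F i y)) x = ∑ i ∈ s, pd f (pd a (F i)) x := by
  have e : pd a (fun y => ∑ i ∈ s, F i y) = fun y => ∑ i ∈ s, pd a (F i) y := by
    funext y; exact pd_sum a fun i hi => (h i hi).contDiffAt.diffAt
  rw [e, pd_sum f fun i hi => ((h i hi).contDiffAt.pd a).diffAt]

variable {M : T2} {f a : Fin 8} (hM : ∀ i j, pd f (pd a (fun y => B y i j)) x = M i j)
include hM

theorem pd_pd_pull1 {u : E8 → Fin 8 → ℝ} (hu : ∀ i, ContDiff ℝ ∞ fun y => u y i) (m : Fin 8) :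
    pd f (pd a (fun y => pull1 (B y) (u y) m)) x =
      pd f (pd a (fun y => u y m)) x + act1 M (u x) m := by
  simp only [pull1]
  rw [pd_pd_sum fun i _ => (hB i m).mul (hu i)]
  simp only [pd_pd_mul (hB _ m) (hu _) (fun a => h0 a _ m), hM, h1, Finset.sum_add_distrib]
  simp [act1, Matrix.one_apply, add_comm]
theorem pd_pd_pull2 {t : E8 → T2} (ht : ∀ i j, ContDiff ℝ ∞ fun y => t y i j) (m n : Fin 8) :
    pd f (pd a (fun y => pull2 (B y) (t y) m n)) x =
      pd f (pd a (fun y => t y m n)) x + act2 M (t x) m n := by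
  refine (pd_pd_pull1 hB h1 h0 hM (fun i => contDiff_pull1 hB (ht i) n) m).trans ?_
  rw [pd_pd_pull1 hB h1 h0 hM (ht m)]
  simp only [act2, act1, h1, pull1_one]
  ring
theorem pd_pd_pull3 {t : E8 → T3} (ht : ∀ i j k, ContDiff ℝ ∞ fun y => t y i j k)
    (m n p : Fin 8) : pd f (pd a (fun y => pull3 (B y) (t y) m n p)) x =
      pd f (pd a (fun y => t y m n p)) x + act3 M (t x) m n p := by
  refine (pd_pd_pull1 hB h1 h0 hM (fun i => contDiff_pull2 hB (ht i) n p) m).trans ?_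
  rw [pd_pd_pull2 hB h1 h0 hM (ht m)]
  simp only [act3, act1, h1, pull2_one]
  ring
theorem pd_pd_pull4 {t : E8 → T4} (ht : ∀ i j k l, ContDiff ℝ ∞ fun y => t y i j k l)
    (m n p q : Fin 8) : pd f (pd a (fun y => pull4 (B y) (t y) m n p q)) x =
      pd f (pd a (fun y => t y m n p q)) x + act4 M (t x) m n p q := by
  refine (pd_pd_pull1 hB h1 h0 hM (fun i => contDiff_pull3 hB (ht i) n p q) m).trans ?_
  rw [pd_pd_pull3 hB h1 h0 hM (ht m)]
  simp only [act4, act1, h1, pull3_one]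
  ring

omit hB h1 h0 hM in
theorem pd_pd_const (c : ℝ) : pd f (pd a (fun _ => c)) x = 0 := by
  have : pd a (fun _ : E8 => c) = fun _ => 0 := by funext y; exact pd_const a c
  rw [this, pd_const]

theorem pd_pd_coframeMetric (i j : Fin 8) : pd f (pd a (fun y => coframeMetric B y i j)) x =
    M i j + M j i := by
  have := pd_pd_pull2 hB h1 h0 hM (t := fun _ => delta) (fun _ _ => contDiff_const) i j
  rw [pd_pd_const, zero_add] at this
  refine this.trans ?_
  have e1 : ∑ p, M p i * delta p j = M j i := by simp [delta]
  have e2 : ∑ p, M p j * delta i p = M i j := by simp [delta]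
  simp only [act2, act1, e1, e2]
  ring

theorem pd_pd_coframeForm (i j k l : Fin 8) :
    pd f (pd a (fun y => coframeForm B y i j k l)) x = act4 M cayley0 i j k l := by
  have := pd_pd_pull4 hB h1 h0 hM (t := fun _ => cayley0) (fun _ _ _ _ => contDiff_const) i j k l
  rw [pd_pd_const, zero_add] at this
  exact this

end SecondOrder

section FirstOrder

variable {x : E8} (h0 : ∀ a i j, pd a (fun y => B y i j) x = 0)
include h0

theorem pd_pull1_eq_zero {u : E8 → Fin 8 → ℝ} (hu : ∀ i, ContDiff ℝ ∞ fun y => u y i)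
    (hu0 : ∀ a i, pd a (fun y => u y i) x = 0) (a m : Fin 8) :
    pd a (fun y => pull1 (B y) (u y) m) x = 0 := by
  simp only [pull1]
  rw [pd_sum a fun i _ => ((hB i m).mul (hu i)).contDiffAt.diffAt]
  simp only [pd_mul a (hB _ m).contDiffAt.diffAt (hu _).contDiffAt.diffAt, h0, hu0, zero_mul,
    mul_zero, add_zero, Finset.sum_const_zero]

theorem pd_coframeMetric (a i j : Fin 8) : pd a (fun y => coframeMetric B y i j) x = 0 :=
  pd_pull1_eq_zero hB h0 (fun k => contDiff_pull1 hB (u := fun _ => delta k)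
    (fun _ => contDiff_const) j) (fun a k => pd_pull1_eq_zero hB h0 (u := fun _ => delta k)
    (fun _ => contDiff_const) (fun a _ => pd_const a _) a j) a i

theorem pd_coframeForm (a i j k l : Fin 8) : pd a (fun y => coframeForm B y i j k l) x = 0 :=
  pd_pull1_eq_zero hB h0 (fun m => contDiff_pull3 hB (t := fun _ => cayley0 m)
    (fun _ _ _ => contDiff_const) j k l) (fun a m => pd_pull1_eq_zero hB h0
    (fun n => contDiff_pull2 hB (t := fun _ => cayley0 m n) (fun _ _ => contDiff_const) k l)
    (fun a n => pd_pull1_eq_zero hB h0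
    (fun p => contDiff_pull1 hB (u := fun _ => cayley0 m n p) (fun _ => contDiff_const) l)
    (fun a p => pd_pull1_eq_zero hB h0 (u := fun _ => cayley0 m n p)
    (fun _ => contDiff_const) (fun a _ => pd_const a _) a l) a k) a j) a i

end FirstOrder

end Coframe

/-! ### Coframes with prescribed second derivatives at the origin -/

/-- A coframe field with quadratic components. -/
def quadCoframe (c : T4) (y : E8) : Matrix (Fin 8) (Fin 8) ℝ := Matrix.of fun i j =>
  delta i j + ∑ k, ∑ l, c i j k l * (y k * y l)

theorem contDiff_coord (k : Fin 8) : ContDiff ℝ ∞ (fun y : E8 => y k) :=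
  (EuclideanSpace.proj (𝕜 := ℝ) k).contDiff

theorem contDiff_quadCoframe (c : T4) (i j : Fin 8) :
    ContDiff ℝ ∞ (fun y => quadCoframe c y i j) :=
  contDiff_const.add (ContDiff.sum fun k _ => ContDiff.sum fun l _ =>
    contDiff_const.mul ((contDiff_coord k).mul (contDiff_coord l)))

theorem quadCoframe_zero (c : T4) : quadCoframe c 0 = 1 := by
  ext i j; simp [quadCoframe, delta, Matrix.one_apply]

theorem pd_quadCoframe (c : T4) (a i j : Fin 8) :
    pd a (fun y => quadCoframe c y i j) = fun y => ∑ l, (c i j a l + c i j l a) * y l := by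
  funext y
  have d : ∀ k : Fin 8, DifferentiableAt ℝ (fun y : E8 => y k) y := fun k =>
    (contDiff_coord k).contDiffAt.diffAt
  have d2 : ∀ k l : Fin 8, DifferentiableAt ℝ (fun y : E8 => c i j k l * (y k * y l)) y :=
    fun k l => ((d k).fun_mul (d l)).const_mul _
  simp only [quadCoframe, Matrix.of_apply]
  rw [pd_add a (differentiableAt_const _) (DifferentiableAt.fun_sum fun k _ =>
    DifferentiableAt.fun_sum fun l _ => d2 k l), pd_const, zero_add,
    pd_sum a fun k _ => DifferentiableAt.fun_sum fun l _ => d2 k l]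
  have e : ∀ k, pd a (fun y => ∑ l, c i j k l * (y k * y l)) y =
      delta a k * ∑ l, c i j k l * y l + c i j k a * y k := fun k => by
    rw [pd_sum a fun l _ => d2 k l]
    simp only [pd_const_mul a ((d _).fun_mul (d _)), pd_mul a (d _) (d _), pd_coord,
      delta_comm _ a, mul_add, Finset.sum_add_distrib, Finset.mul_sum]
    congr 1
    · exact Finset.sum_congr rfl fun _ _ => by ring
    · simp [delta]
  simp only [e, Finset.sum_add_distrib, sum_delta_mul, add_mul]

theorem pd_quadCoframe_zero (c : T4) (a i j : Fin 8) :
    pd a (fun y => quadCoframe c y i j) 0 = 0 := by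
  rw [pd_quadCoframe]; simp

theorem pd_pd_quadCoframe (c : T4) (f a i j : Fin 8) :
    pd f (pd a (fun y => quadCoframe c y i j)) 0 = c i j a f + c i j f a := by
  have d : ∀ k : Fin 8, DifferentiableAt ℝ (fun y : E8 => y k) 0 := fun k =>
    (contDiff_coord k).contDiffAt.diffAt
  rw [pd_quadCoframe, pd_sum f fun l _ => (d l).const_mul _]
  simp only [pd_const_mul f (d _), pd_coord, sum_mul_delta']

/-! ### Torsion and curvature of a prescribed second-order jet -/

section Jet

variable {h N : T2} (hh : ∀ a b, h b a = h a b) (hN : ∀ a b, N b a = -N a b)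

/-- The coframe field `1 + ½ h(y,y) + ½ |y|² N`. -/
def jetCoframe (h N : T2) : E8 → Matrix (Fin 8) (Fin 8) ℝ := quadCoframe fun i j k l =>
  (1 / 2 : ℝ) * (h k l * delta i j + delta k l * N i j)

theorem contDiff_jetCoframe (i j : Fin 8) : ContDiff ℝ ∞ (fun y => jetCoframe h N y i j) :=
  contDiff_quadCoframe _ i j
theorem jetCoframe_zero : jetCoframe h N 0 = 1 := quadCoframe_zero _
theorem pd_jetCoframe (a i j : Fin 8) : pd a (fun y => jetCoframe h N y i j) 0 = 0 :=
  pd_quadCoframe_zero _ a i j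

theorem zero_mem_jetCoframe : (0 : E8) ∈ {y | (jetCoframe h N y).det ≠ 0} := by
  simp [jetCoframe_zero]

theorem coframeForm_jet : coframeForm (jetCoframe h N) 0 = cayley0 := by
  rw [coframeForm, jetCoframe_zero, pull4_one]
theorem coframeMetric_jet : coframeMetric (jetCoframe h N) 0 = delta := by
  rw [coframeMetric, jetCoframe_zero, pull2_one]

theorem christoffel_jet : christoffel (coframeMetric (jetCoframe h N)) 0 = 0 := by
  funext k i j
  simp [christoffel, pd_coframeMetric contDiff_jetCoframe pd_jetCoframe]

theorem nabla4_jet :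
    nabla4 (coframeMetric (jetCoframe h N)) (coframeForm (jetCoframe h N)) 0 = 0 := by
  funext a b c d e
  simp [nabla4, christoffel_jet, pd_coframeForm contDiff_jetCoframe pd_jetCoframe]

include hh

theorem pd_pd_jetCoframe (f a i j : Fin 8) : pd f (pd a (fun y => jetCoframe h N y i j)) 0 =
    h f a * delta i j + delta f a * N i j := by
  rw [jetCoframe, pd_pd_quadCoframe, hh, delta_comm a f]
  ring

include hN

/-- To second order the metric is (1 + h(y,y))δ. The antisymmetric N does not enter it and moves
only Φ. -/
theorem pd_christoffel_jet (f p a b : Fin 8) :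
    pd f (fun y => christoffel (coframeMetric (jetCoframe h N)) y p a b) 0 =
      h f a * delta p b + h f b * delta p a - h f p * delta a b := by
  have hS := isSpin7On_coframe (contDiff_jetCoframe (h := h) (N := N))
  have hU := isOpen_coframe (contDiff_jetCoframe (h := h) (N := N))
  have hx := zero_mem_jetCoframe (h := h) (N := N)
  have gi := fun i j => (hS.ginv_smooth hU hx i j).diffAt
  have dd := fun i j k => ((hS.metric_smooth hU hx j k).pd i)
  have dl := fun l => (((dd a b l).add (dd b a l)).sub (dd l a b)).diffAt
  have e2 : ∀ f a i j, pd f (pd a (fun y => coframeMetric (jetCoframe h N) y i j)) 0 =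
      2 * h f a * delta i j := fun f a i j => by
    rw [pd_pd_coframeMetric contDiff_jetCoframe jetCoframe_zero pd_jetCoframe
      (pd_pd_jetCoframe hh f a), hN i j, delta_comm j i]
    ring
  simp only [christoffel]
  rw [pd_const_mul f (DifferentiableAt.fun_sum fun l _ => (gi p l).fun_mul (dl l)),
    pd_sum f fun l _ => (gi p l).fun_mul (dl l)]
  have e3 : ∀ l, pd f (fun y => ginv (coframeMetric (jetCoframe h N) y) p l *
      (pd a (fun y => coframeMetric (jetCoframe h N) y b l) y +
        pd b (fun y => coframeMetric (jetCoframe h N) y a l) y -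
        pd l (fun y => coframeMetric (jetCoframe h N) y a b) y)) 0 =
      delta p l * (2 * h f a * delta b l + 2 * h f b * delta a l - 2 * h f l * delta a b) :=
    fun l => by
      rw [pd_mul f (gi p l) (dl l), pd_sub f ((dd a b l).add (dd b a l)).diffAt (dd l a b).diffAt,
        pd_add f (dd a b l).diffAt (dd b a l).diffAt]
      simp only [pd_coframeMetric contDiff_jetCoframe pd_jetCoframe, e2,
        ginv_delta coframeMetric_jet]
      ring
  simp only [e3, sum_delta_mul, delta_comm _ p]
  ring

theorem ricci_jet (b c : Fin 8) : ricci (coframeMetric (jetCoframe h N)) 0 b c =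
    -6 * h b c - tr0 h * delta b c := by
  simp only [ricci, christoffel_jet, pd_christoffel_jet hh hN, Pi.zero_apply, mul_zero, sub_zero,
    Finset.sum_const_zero, add_zero]
  have e1 : ∑ k, h k c * delta k b = h c b := by rw [sum_mul_delta', hh]
  have e2 : ∑ k, h k b * delta k c = h b c := by rw [sum_mul_delta', hh]
  have e3 : ∑ k, h c k * delta k b = h c b := by rw [sum_mul_delta']
  have e4 : ∑ k : Fin 8, delta k k = 8 := by simp [delta]
  have e5 : ∑ k, h k k * delta c b = tr0 h * delta b c := by
    rw [tr0, Finset.sum_mul, delta_comm]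
  simp only [Finset.sum_sub_distrib, Finset.sum_add_distrib, e1, e2, e3, e5, ← Finset.mul_sum, e4,
    hh b c]
  ring

/-- The derivative of the torsion at the origin, up to the kernel of `ι`. -/
def jetTorsion (h N : T2) : T4 := fun f a b p =>
  delta f a * N p b - h f b * delta p a + h f p * delta a b

variable {T : E8 → T3} (hT : ∀ y ∈ {y | (jetCoframe h N y).det ≠ 0},
  IsTorsionAt (coframeForm (jetCoframe h N)) (coframeMetric (jetCoframe h N)) y (T y))
include hT

omit hh hN in
theorem torsion_jet : T 0 = 0 := by
  have hS := isSpin7On_coframe (contDiff_jetCoframe (h := h) (N := N))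
  refine (hT 0 zero_mem_jetCoframe).unique hS zero_mem_jetCoframe ⟨⟨by simp, by simp⟩, ?_⟩
  intro a b c d e
  simp [nabla4_jet, alt4]

/-- The torsion equation is differentiated at the origin, where T and Γ vanish. One side becomes
4ι(∂T), the other the action on Φ of the second derivative of the coframe minus ∂Γ. -/
theorem iota_pd_torsion_jet (f a : Fin 8) :
    iota (partial3 T 0 f a) = iota (jetTorsion h N f a) := by
  have hS := isSpin7On_coframe (contDiff_jetCoframe (h := h) (N := N))
  have hU := isOpen_coframe (contDiff_jetCoframe (h := h) (N := N))
  have hx := zero_mem_jetCoframe (h := h) (N := N)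
  set Φ := coframeForm (jetCoframe h N)
  set g := coframeMetric (jetCoframe h N)
  have sT := torsion_smooth hU hS hT hx
  have sP : ∀ i j k l, ContDiffAt ℝ ∞ (fun y => phiU (g y) (Φ y) i j k l) 0 := fun i j k l =>
    ContDiffAt.sum fun p _ => (hS.ginv_smooth hU hx i p).mul (hS.form_smooth hU hx p j k l)
  have s1 : ∀ b c d e, DifferentiableAt ℝ
      (fun y => 4 * ∑ p, T y a b p * phiU (g y) (Φ y) p c d e) 0 := fun b c d e =>
    (DifferentiableAt.fun_sum fun p _ =>
      ((sT a b p).diffAt.fun_mul (sP p c d e).diffAt)).const_mul _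
  have eP : ∀ i j k l, phiU (g 0) (Φ 0) i j k l = cayley0 i j k l := fun i j k l => by
    simp only [phiU, ginv_delta (coframeMetric_jet (h := h) (N := N)), Φ, g, coframeForm_jet,
      sum_delta_mul]
  have e1 : ∀ b c d e, pd f (fun y => 4 * ∑ p, T y a b p * phiU (g y) (Φ y) p c d e) 0 =
      4 * ∑ p, pd f (fun y => T y a b p) 0 * cayley0 p c d e := fun b c d e => by
    have ds := fun p => (sT a b p).diffAt.fun_mul (sP p c d e).diffAt
    rw [pd_const_mul f (DifferentiableAt.fun_sum fun p _ => ds p), pd_sum f fun p _ => ds p]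
    simp only [pd_mul f (sT a b _).diffAt (sP _ c d e).diffAt, torsion_jet hT, eP, Pi.zero_apply,
      zero_mul, add_zero]
  have e2 : ∀ b c d e, pd f (fun y => nabla4 g Φ y a b c d e) 0 =
      ((4 : ℝ) • iota (fun b c => pd f (fun y => T y a b c) 0)) b c d e := fun b c d e => by
    rw [pd_congr (eventually_of_mem hU hx fun y hy => (hT y hy).2 a b c d e) f, pd_alt4 s1]
    simp only [e1]
    rw [iota, ← alt4_smul]
    rfl
  have e3 : ∀ b c d e, pd f (fun y => nabla4 g Φ y a b c d e) 0 =
      act4 ((fun i j => h f a * delta i j + delta f a * N i j) -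
        fun p b => h f a * delta p b + h f b * delta p a - h f p * delta a b)
        cayley0 b c d e := fun b c d e => by
    have dΓ := fun p b => (hS.christoffel_smooth hU hx p a b).diffAt
    have dΦ := fun i j k l => (hS.form_smooth hU hx i j k l).diffAt
    have e0 : act4 (fun p b => christoffel g 0 p a b) = 0 := by
      rw [show christoffel g 0 = 0 from christoffel_jet]
      funext t b c d e
      simp [act4, act3, act2, act1]
    simp only [nabla4_eq_act]
    have d4 : DifferentiableAt ℝ (fun y => act4 (fun p b => christoffel g y p a b) (Φ y) b c d e) 0 :=
      (differentiableAt_act1 dΓ (fun i => dΦ i c d e) b).fun_add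
        (differentiableAt_act3 dΓ (dΦ b) c d e)
    rw [pd_sub f ((hS.form_smooth hU hx b c d e).pd a).diffAt
      d4, pd_act4 dΓ f dΦ, e0,
      pd_pd_coframeForm contDiff_jetCoframe jetCoframe_zero pd_jetCoframe
      (pd_pd_jetCoframe hh f a), show Φ 0 = cayley0 from coframeForm_jet, act4_sub]
    simp only [pd_christoffel_jet hh hN, g]
    simp
  have e4 : act4 ((fun i j => h f a * delta i j + delta f a * N i j) -
        fun p b => h f a * delta p b + h f b * delta p a - h f p * delta a b) cayley0 =
      (4 : ℝ) • iota (jetTorsion h N f a) := by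
    rw [isFrame_one.act4_form]
    have := isFrame_one.pull_torsion (jetTorsion h N f a)
    rw [pull4_one, pull2_one] at this
    rw [← this]
    congr 1
    funext b c d e
    refine congrArg _ (Finset.sum_congr rfl fun p _ => congrArg (· * _) ?_)
    simp only [lower, sum_delta_mul', jetTorsion, Pi.sub_apply]
    ring
  have : (4 : ℝ) • iota (partial3 T 0 f a) =
      (4 : ℝ) • iota (jetTorsion h N f a) := by
    rw [← e4]
    funext b c d e
    exact (e2 b c d e).symm.trans (e3 b c d e)
  exact smul_right_injective _ (four_ne_zero) this

omit hh hN hT in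
theorem jetTorsion_skew (hN : ∀ a b, N b a = -N a b) (f a b c : Fin 8) :
    jetTorsion h N f a c b = -jetTorsion h N f a b c := by
  simp only [jetTorsion, hN b c, delta_comm b a, delta_comm c a]
  ring

/-- Contracting recovers S − J₂S from ι(S), by `con_iota`; this is all that ι remembers of a 2-form.
-/
theorem pd_torsion_jet (f a : Fin 8) : partial3 T 0 f a - J20 (partial3 T 0 f a) =
    jetTorsion h N f a - J20 (jetTorsion h N f a) := by
  have hU := isOpen_coframe (contDiff_jetCoframe (h := h) (N := N))
  have hx := zero_mem_jetCoframe (h := h) (N := N)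
  have sk := (partial3_alt hU hx (C := T) fun y hy => (hT y hy).1) f
  have key : ∀ S : T2, (∀ b c, S c b = -S b c) →
      con (iota S) = (6 : ℝ) • (S - J20 S) := fun S hS => by
    funext b c
    rw [con_iota, tr0_skew hS]
    simp only [Pi.smul_apply, Pi.sub_apply, smul_eq_mul]
    ring
  have e := congrArg con (iota_pd_torsion_jet hh hN hT f a)
  rw [key _ fun b c => sk.2 a b c, key _ (jetTorsion_skew hN f a)] at e
  exact smul_right_injective _ (by norm_num) e

omit hh hN hT in
theorem J20_jetTorsion (f a b c : Fin 8) : J20 (jetTorsion h N f a) b c =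
    delta f a * J20 (fun i j => N j i) b c - ∑ p, cayley0 b c p a * h f p := by
  have e1 : ∑ i, ∑ j, cayley0 b c i j * (h f i * delta j a) = ∑ p, cayley0 b c p a * h f p :=
    Finset.sum_congr rfl fun i _ => by
      simp only [← mul_assoc, sum_mul_delta']
  have e2 : ∑ i, ∑ j, cayley0 b c i j * (h f j * delta a i) =
      -∑ p, cayley0 b c p a * h f p := by
    rw [Finset.sum_comm, ← Finset.sum_neg_distrib]
    refine Finset.sum_congr rfl fun j _ => ?_
    simp only [← mul_assoc, sum_mul_delta]
    rw [cayley0_swap23 b c j a]; ring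
  simp only [J20, jetTorsion, mul_add, mul_sub, Finset.sum_add_distrib, Finset.sum_sub_distrib,
    e1, e2, Finset.mul_sum]
  have e3 : ∀ i j, 1 / 2 * (cayley0 b c i j * (delta f a * N j i)) =
    delta f a * (1 / 2 * (cayley0 b c i j * N j i)) := fun i j => by ring
  simp only [e3, ← Finset.mul_sum]
  ring

variable (hJ : J20 N = (-3 : ℝ) • N)
include hJ

omit hh hN hT in
theorem J20_jetTorsion' (f a b c : Fin 8) : J20 (jetTorsion h N f a) b c =
    3 * (delta f a * N b c) - ∑ p, cayley0 b c p a * h f p := by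
  rw [J20_jetTorsion, J20_transpose, hJ]
  simp only [Pi.smul_apply, smul_eq_mul]
  ring

theorem con_pd_torsion_jet (a b : Fin 8) : con (partial3 T 0) a b = 14 * h a b - 8 * N a b := by
  have hU := isOpen_coframe (contDiff_jetCoframe (h := h) (N := N))
  have hx := zero_mem_jetCoframe (h := h) (N := N)
  have sk := (partial3_alt hU hx (C := T) fun y hy => (hT y hy).1) a
  have e1 : con (partial3 T 0) a b = 2 * ∑ p, J20 (partial3 T 0 a p) b p := by
    simp only [con, J20, Finset.mul_sum]
    refine Finset.sum_congr rfl fun p _ => Finset.sum_congr rfl fun q _ =>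
      Finset.sum_congr rfl fun r _ => by ring
  -- Here ∂_aT_{pbp} = 0 by antisymmetry, so knowing ∂T − J₂∂T determines the required trace.
  have e2 : ∀ p, J20 (partial3 T 0 a p) b p = J20 (jetTorsion h N a p) b p -
      jetTorsion h N a p b p := fun p => by
    have := congrFun (congrFun (pd_torsion_jet hh hN hT a p) b) p
    have h0 : partial3 T 0 a p b p = 0 := by
      have h1 := sk.1 p b p
      rw [alt3_eq_zero23 sk] at h1
      linarith
    simp only [Pi.sub_apply, h0] at this
    linarith
  have e3 : ∀ p, ∑ q, cayley0 b p q p * h a q = 0 := fun p =>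
    Finset.sum_eq_zero fun q _ => by
      have h1 := cayley0_swap12 b p q p
      have h2 := cayley0_swap23 b q p p
      have : cayley0 b q p p = 0 := by linarith
      rw [this] at h1
      have : cayley0 b p q p = 0 := by linarith
      rw [this, zero_mul]
  have e4 : ∑ p, delta a p * N b p = N b a := by rw [sum_delta_mul]
  have e5 : ∑ p, delta a p * N p b = N a b := by rw [sum_delta_mul]
  have e6 : ∑ p : Fin 8, h a b * delta p p = 8 * h a b := by simp [delta]
  have e7 : ∑ p, h a p * delta p b = h a b := by rw [sum_mul_delta']
  rw [e1]
  simp only [e2, J20_jetTorsion' hJ, e3, jetTorsion, Finset.sum_add_distrib,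
    Finset.sum_sub_distrib, ← Finset.mul_sum, e4, e5, e7, Finset.sum_const_zero]
  rw [Finset.mul_sum, e6, hN a b]
  ring

theorem div_pd_torsion_jet :
    div0 (partial3 T 0) - J20 (div0 (partial3 T 0)) = (-32 : ℝ) • N := by
  have e1 : div0 (partial3 T 0) = ∑ r, (1 : ℝ) • partial3 T 0 r r := by
    funext b c; simp [div0, Finset.sum_apply]
  rw [e1, J20_sum, ← Finset.sum_sub_distrib]
  simp only [← smul_sub, pd_torsion_jet hh hN hT]
  funext b c
  have e2 : ∑ r, ∑ p, cayley0 b c p r * h r p = 0 := by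
    have : ∑ r, ∑ p, cayley0 b c p r * h r p = -∑ r, ∑ p, cayley0 b c p r * h r p := by
      refine Finset.sum_comm.trans ?_
      simp only [← Finset.sum_neg_distrib]
      exact Finset.sum_congr rfl fun r _ => Finset.sum_congr rfl fun p _ => by
        rw [cayley0_swap23 b c r p, hh r p]; ring
    linarith
  have e3 : ∑ r : Fin 8, delta r r = 8 := by simp [delta]
  have e4 : ∑ r, h r b * delta c r = h c b := by rw [sum_mul_delta]
  have e5 : ∑ r, h r c * delta r b = h b c := by rw [sum_mul_delta']
  simp only [Finset.sum_apply, Pi.smul_apply, Pi.sub_apply, smul_eq_mul, one_mul,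
    J20_jetTorsion' hJ, jetTorsion, Finset.sum_add_distrib, Finset.sum_sub_distrib, e2, e4, e5,
    ← Finset.mul_sum, ← Finset.sum_mul, e3, hN b c, hh b c]
  ring

/-- The symmetric part is read off the Ricci equation and the antisymmetric part off the divergence,
so the second contraction of ∂T need not be computed. -/
theorem torsionFieldTensor_jet (lam : ℝ) : torsionFieldTensor lam delta cayley0 (T 0)
      (nabla3 (coframeMetric (jetCoframe h N)) T 0) =
    (2 : ℝ) • h + (3 / 2 * tr0 h + 1 / 2 * lam) • delta + (16 : ℝ) • N := by
  have hS := isSpin7On_coframe (contDiff_jetCoframe (h := h) (N := N))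
  have hU := isOpen_coframe (contDiff_jetCoframe (h := h) (N := N))
  have hx := zero_mem_jetCoframe (h := h) (N := N)
  have hΦ := coframeForm_jet (h := h) (N := N)
  have hg := coframeMetric_jet (h := h) (N := N)
  have h0 := torsion_jet hT
  have e0 : nabla3 (coframeMetric (jetCoframe h N)) T 0 = partial3 T 0 := by
    funext a b c d
    simp [nabla3, partial3, christoffel_jet]
  have hF : IsFrame 1 1 (coframeForm (jetCoframe h N) 0) (coframeMetric (jetCoframe h N) 0) := by
    rw [hΦ, hg]; exact isFrame_one
  have k1 := skewPart_torsionFieldTensor hU hS hT hx lam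
  have k2 := pull_divTorsion7 hU hS hT hx hF
  have k3 := three_ricci_sub hU hS hT hx lam
  have q0 : con (quad0 (0 : T3)) = 0 := by
    funext a b; simp [con, quad0]
  have q1 : skewPart (0 : T2) = 0 := by funext a b; simp [skewPart]
  rw [e0] at k1 k3 ⊢
  rw [pull2_one, e0, pull4_one, pull3_one, h0, q0, q1, div_pd_torsion_jet hh hN hT hJ, add_zero]
    at k2
  rw [k2, hΦ, hg] at k1
  rw [hΦ, hg] at k3
  have c1 : ∀ a b, ∑ p, ∑ q, ∑ r, phiUUU delta cayley0 a p q r * partial3 T 0 b p q r =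
      14 * h b a - 8 * N b a := fun a b => by
    have := isFrame_one.pull_contract (partial3 T 0)
    rw [pull2_one, pull4_one] at this
    rw [← con_pd_torsion_jet hh hN hT hJ, ← this]
    rfl
  rw [h0] at k1 k3 ⊢
  funext a b
  have k1' := congrFun (congrFun k1 a) b
  have k3' := congrFun (congrFun k3 a) b
  simp only [Pi.sub_apply, Pi.smul_apply, smul_eq_mul, ricci_jet hh hN, ricciSource, e0, c1, h0,
    hg, hΦ, sqTensor, quadScalar, quad, Pi.zero_apply, mul_zero, Finset.sum_const_zero] at k3'
  simp only [symPart, skewPart, Pi.smul_apply, smul_eq_mul] at k1' k3'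
  simp only [Pi.add_apply, Pi.smul_apply, smul_eq_mul]
  rw [hN a b, hh a b] at k3'
  linarith

end Jet

/-- The field equations are independent. -/
theorem exists_torsionFieldTensor_eq (lam : ℝ) (B : T2) (hB : B ∈ valueSpace delta cayley0) :
    ∃ (U : Set E8) (Φ : E8 → T4) (g : E8 → T2) (T : E8 → T3), IsOpen U ∧ 0 ∈ U ∧
      IsSpin7On U Φ g ∧ (∀ x ∈ U, IsTorsionAt Φ g x (T x)) ∧ Φ 0 = cayley0 ∧ g 0 = delta ∧
      torsionFieldTensor lam (g 0) (Φ 0) (T 0) (nabla3 g T 0) = B := by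
  have hJ := (isFrame_one.mem_valueSpace_iff).1 hB
  rw [pull2_one] at hJ
  -- Solves F(0) = B for h and N. The trace of the equation is tr B = 14 tr h + 4λ, which fixes the
  -- multiple of δ.
  set h : T2 := (1 / 2 : ℝ) • symPart B -
    (1 / 2 * (3 / 2 * ((tr0 B - 4 * lam) / 14) + 1 / 2 * lam)) • delta with hdef
  set N : T2 := (1 / 16 : ℝ) • skewPart B with Ndef
  have hh : ∀ a b, h b a = h a b := fun a b => by
    simp only [hdef, symPart, Pi.sub_apply, Pi.smul_apply, smul_eq_mul, delta_comm b a]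
    ring
  have hN : ∀ a b, N b a = -N a b := fun a b => by
    simp only [Ndef, skewPart, Pi.smul_apply, smul_eq_mul]
    ring
  have hJN : J20 N = (-3 : ℝ) • N := by
    rw [Ndef, J20_smul, J20_skewPart, hJ, smul_comm]
  have ht : tr0 h = (tr0 B - 4 * lam) / 14 := by
    have : tr0 (symPart B) = tr0 B := by
      simp only [tr0, symPart]; exact Finset.sum_congr rfl fun _ _ => by ring
    rw [hdef, tr0_sub, tr0_smul, tr0_smul, this, tr0_delta]
    ring
  have hS := isSpin7On_coframe (contDiff_jetCoframe (h := h) (N := N))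
  have hU := isOpen_coframe (contDiff_jetCoframe (h := h) (N := N))
  have hT := fun x hx => isTorsionAt_torsionField (x := x) hU hS hx
  refine ⟨_, _, _, _, hU, zero_mem_jetCoframe, hS, hT, coframeForm_jet, coframeMetric_jet, ?_⟩
  rw [coframeForm_jet, coframeMetric_jet, torsionFieldTensor_jet hh hN hT hJN, ht]
  funext a b
  simp only [hdef, Ndef, symPart, skewPart, Pi.add_apply, Pi.sub_apply, Pi.smul_apply, smul_eq_mul]
  ring

/-! ### Coframes with constant structure coefficients -/

section Flat

variable {B : E8 → Matrix (Fin 8) (Fin 8) ℝ} (hB : ∀ i j, ContDiff ℝ ∞ (fun y => B y i j))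
  {t : T3} (ht : IsAlt3 t) (hd : ∀ x m a b, pd a (fun y => B y m b) x - pd b (fun y => B y m a) x =
    2 * pull2 (B x) (fun j k => t j k m) a b)
  {x : E8} (hx : x ∈ {y | (B y).det ≠ 0})

theorem isFrame_coframe (hx : x ∈ {y | (B y).det ≠ 0}) :
    IsFrame (B x) (B x)⁻¹ (coframeForm B x) (coframeMetric B x) :=
  IsAdapted.isFrame (isAdapted_iff.2 ⟨hx, rfl, rfl⟩)

/-- The transition matrix between a coframe field and a frame field parallel at `x`. -/
def transition (B : E8 → Matrix (Fin 8) (Fin 8) ℝ) (x y : E8) : Matrix (Fin 8) (Fin 8) ℝ :=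
  B y * parallelFrame (coframeMetric B) (B x)⁻¹ x y

include hx in
theorem transition_self : transition B x x = 1 := by
  rw [transition, parallelFrame_self]
  exact Matrix.mul_nonsing_inv _ (isUnit_iff_ne_zero.2 hx)

include hB

theorem transition_diff (i m : Fin 8) : DifferentiableAt ℝ (fun y => transition B x y i m) x := by
  simp only [transition, Matrix.mul_apply]
  exact DifferentiableAt.fun_sum fun p _ =>
    (hB i p).contDiffAt.diffAt.fun_mul (differentiableAt_parallelFrame p m)

theorem pd_transition (a m n : Fin 8) : pd a (fun y => transition B x y m n) x =
    pull1 (B x)⁻¹ (fun p => pd a (fun y => B y m p) x -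
      ∑ r, B x m r * christoffel (coframeMetric B) x r a p) n := by
  simp only [transition, Matrix.mul_apply]
  rw [pd_sum a fun p _ => (hB m p).contDiffAt.diffAt.fun_mul (differentiableAt_parallelFrame p n)]
  have e : ∑ p, (B x)⁻¹ p n * ∑ r, B x m r * christoffel (coframeMetric B) x r a p =
      ∑ r, B x m r * ∑ p, christoffel (coframeMetric B) x r a p * (B x)⁻¹ p n := by
    simp only [Finset.mul_sum]
    rw [Finset.sum_comm]
    exact Finset.sum_congr rfl fun r _ => Finset.sum_congr rfl fun p _ => by ring
  simp only [pd_mul a (hB m _).contDiffAt.diffAt (differentiableAt_parallelFrame _ n),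
    pd_parallelFrame, parallelFrame_self, Finset.sum_add_distrib, pull1, mul_sub,
    Finset.sum_sub_distrib, mul_neg, Finset.sum_neg_distrib, e]
  rw [← sub_eq_add_neg]
  exact congrArg (· - _) (Finset.sum_congr rfl fun p _ => mul_comm _ _)

include hx

omit hB in
theorem transition_pd (a i m : Fin 8) : pd a (fun y => transition B x y i m) x =
    -∑ p, (-pd a (fun y => transition B x y i p) x) * transition B x x p m := by
  rw [transition_self hx]
  simp [Matrix.one_apply]

/-- The transition matrix pulls δ back to the metric in the parallel frame, which is constant to
first order. -/
theorem pd_transition_skew (a m n : Fin 8) : pd a (fun y => transition B x y n m) x =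
    -pd a (fun y => transition B x y m n) x := by
  have hS := isSpin7On_coframe hB
  have hU := isOpen_coframe hB
  have e := hS.pd_hat_metric (E := (B x)⁻¹) hU hx a m n
  simp only [coframeMetric, pull2_pull2] at e
  have e1 := pd_pull2 (transition_diff hB) (transition_pd hx a) (t := fun _ => delta)
    (fun i j => differentiableAt_const _) m n
  rw [transition_self hx, pull2_one] at e1
  have e2 := e1.symm.trans e
  simp only [pd_const, act2, act1, neg_mul, Finset.sum_neg_distrib, sum_mul_delta,
    sum_mul_delta'] at e2
  linarith

include ht hd

/-- Koszul's argument: the frame derivative V_{fmn} is antisymmetric in m, n, and its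
antisymmetrisation in f, n is given by the structure coefficients. The two conditions determine V.
-/
theorem pd_transition_eq (a m n : Fin 8) : pd a (fun y => transition B x y m n) x =
    ∑ f, B x f a * t f n m := by
  have hS := isSpin7On_coframe hB
  have hU := isOpen_coframe hB
  have hF := isFrame_coframe hx
  set E := (B x)⁻¹
  have i1 : B x * E = 1 := hF.mul_eq_one
  have i2 : E * B x = 1 := hF.mul_eq_one'
  set Z : T3 := fun m a p => pd a (fun y => B y m p) x -
      ∑ r, B x m r * christoffel (coframeMetric B) x r a p
  set V : T3 := fun f m n => pull2 E (Z m) f n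
  have hV : ∀ f m n, V f m n = ∑ a, E a f * pd a (fun y => transition B x y m n) x := fun f m n =>
    Finset.sum_congr rfl fun a _ => by rw [pd_transition hB]
  have v1 : ∀ f m n, V f n m = -V f m n := fun f m n => by
    simp only [hV, pd_transition_skew hB hx _ m n, mul_neg, Finset.sum_neg_distrib]
  have v2 : ∀ f m n, V f m n - V n m f = 2 * t f n m := fun f m n => by
    have e : Z m - (fun a p => Z m p a) = (2 : ℝ) • pull2 (B x) (fun j k => t j k m) := by
      funext a p
      simp only [Z, Pi.sub_apply, Pi.smul_apply, smul_eq_mul, ← hd,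
        christoffel_comm hU hS hx _ p a]
      ring
    have e1 := congrArg (fun s => pull2 E s f n) e
    simp only [pull2_sub, pull2_smul, pull2_pull2, i1, pull2_one, Pi.sub_apply, Pi.smul_apply,
      smul_eq_mul] at e1
    rw [← e1]
    congr 1
    exact (pull2_swap E (Z m) f n).symm
  have v3 : ∀ f m n, V f m n = t f n m := fun f m n => by
    linarith [v1 f m n, v1 m f n, v1 n m f, v2 f m n, v2 f n m, v2 m f n, ht.1 f n m, ht.2 f n m,
      ht.1 f m n, ht.2 m n f, ht.2 m f n, ht.1 m n f]
  have v4 : pd a (fun y => transition B x y m n) x = ∑ f, B x f a * V f m n := by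
    have : pull1 (B x) (pull1 E fun a => pd a (fun y => transition B x y m n) x) a =
        pd a (fun y => transition B x y m n) x := by
      rw [pull1_pull1, i2, pull1_one]
    rw [← this, pull1]
    exact Finset.sum_congr rfl fun f _ => by rw [hV]; rfl
  rw [v4]
  simp only [v3]

/-- Φ has constant components in the coframe, so ∇Φ comes only from the transition matrix, whose
derivative is t by `pd_transition_eq`. -/
theorem isTorsionAt_coframe : IsTorsionAt (coframeForm B) (coframeMetric B) x (pull3 (B x) t) := by
  have hS := isSpin7On_coframe hB
  have hU := isOpen_coframe hB
  have hF := isFrame_coframe hx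
  refine ⟨ht.pull _, fun a => ?_⟩
  suffices nabla4 (coframeMetric B) (coframeForm B) x a = alt4 (fun b c d e => 4 * ∑ p,
      pull3 (B x) t a b p * phiU (coframeMetric B x) (coframeForm B x) p c d e) from
    fun b c d e => congrFun (congrFun (congrFun (congrFun this b) c) d) e
  apply hF.pull4_inj
  rw [hF.pull_torsion]
  have e1 : pull2 (B x)⁻¹ (pull3 (B x) t a) = ∑ f, B x f a • t f := by
    rw [show pull3 (B x) t a = fun n p => ∑ j, B x j a * pull2 (B x) (t j) n p from rfl]
    funext b c
    rw [pull2_sum]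
    simp only [pull2_mul', pull2_pull2, hF.mul_eq_one, pull2_one, Finset.sum_apply,
      Pi.smul_apply, smul_eq_mul]
  have e2 : pull4 (B x)⁻¹ (nabla4 (coframeMetric B) (coframeForm B) x a) =
      act4 (fun p b => pd a (fun y => transition B x y p b) x) cayley0 := by
    funext m n p q
    rw [← hS.pd_hat_form hU hx]
    simp only [coframeForm, pull4_pull4]
    have := pd_pull4 (transition_diff hB) (transition_pd hx a) (t := fun _ => cayley0)
      (fun i j k l => differentiableAt_const _) m n p q
    rw [transition_self hx, pull4_one] at this
    refine this.trans ?_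
    simp [pd_const, act4, act3, act2, act1]
    ring
  rw [e2, isFrame_one.act4_form]
  have e3 := isFrame_one.pull_torsion (pull2 (B x)⁻¹ (pull3 (B x) t a))
  rw [pull4_one, pull2_one] at e3
  rw [← e3, e1]
  congr 1
  funext b c d e
  refine congrArg _ (Finset.sum_congr rfl fun p _ => congrArg (· * _) ?_)
  simp only [lower, sum_delta_mul', pd_transition_eq hB ht hd hx, Finset.sum_apply, Pi.smul_apply,
    smul_eq_mul]

/-- With constant components, ∇T is the action of t on itself, which the Jacobi identity `hJ`
annihilates. -/
theorem nabla3_coframe (hJ : ∀ f a b c, ∑ p, (t f a p * t p b c + t f b p * t a p c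
    + t f c p * t a b p) = 0) : nabla3 (coframeMetric B) (fun y => pull3 (B y) t) x = 0 := by
  have hF := isFrame_coframe hx
  funext a
  apply hF.pull3_inj
  funext m n p
  rw [← pd_hat3 fun i j k => (contDiff_pull3 hB (t := fun _ => t)
    (fun _ _ _ => contDiff_const) i j k).contDiffAt]
  simp only [pull3_pull3]
  have := pd_pull3 (transition_diff hB) (transition_pd hx a) (t := fun _ => t)
      (fun i j k => differentiableAt_const _) m n p
  rw [transition_self hx, pull3_one] at this
  refine this.trans ?_
  have z : ∀ b c d, act3 (fun i p => -pd a (fun y => transition B x y i p) x) t b c d =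
      -∑ f, B x f a * ∑ p, (t f b p * t p c d + t f c p * t b p d + t f d p * t b c p) :=
    fun b c d => by
      have e : ∀ b (u : Fin 8 → ℝ), ∑ p, (∑ f, B x f a * t f b p) * u p =
          ∑ f, B x f a * ∑ p, t f b p * u p := fun b u => by
        simp only [Finset.sum_mul, Finset.mul_sum]
        rw [Finset.sum_comm]
        exact Finset.sum_congr rfl fun _ _ => Finset.sum_congr rfl fun _ _ => by ring
      simp only [pd_transition_eq hB ht hd hx, act3, act2, act1, neg_mul, Finset.sum_neg_distrib,
        e, mul_add, Finset.sum_add_distrib, neg_add, add_assoc]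
  simp only [z, hJ, pd_const, mul_zero, Finset.sum_const_zero, neg_zero, sub_zero, Pi.zero_apply,
    pull3_zero]

omit hB hx ht hd in
/-- The Ricci tensor when the torsion is parallel. -/
theorem ricci_of_nabla3_eq_zero {U : Set E8} (hU : IsOpen U) {Φ : E8 → T4} {g : E8 → T2}
    (hS : IsSpin7On U Φ g) {T : E8 → T3} (hT : ∀ x ∈ U, IsTorsionAt Φ g x (T x)) {x : E8}
    (hx : x ∈ U) {A E : Matrix (Fin 8) (Fin 8) ℝ} (h : IsFrame A E (Φ x) (g x))
    (h0 : nabla3 g T x = 0) : pull2 E (ricci g x) = fun b c =>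
      con (quad0 (pull3 E (T x))) c b + sq0 (pull3 E (T x)) c b := by
  rw [pull_ricci_eq h]
  funext b c
  rw [ricci_formula ((hT x hx).1.pull E) (pull_nabla3_alt hT hx hU)
      (hat_curv_swap01) (hat_curv_swap23 hU hS hx) (hat_curv_cyc hU hS hx)
      (hat_spinCurv hU hS hT hx h) (hat_J20_spinCurv hU hS hT hx h), h0, pull4_zero]
  simp [conMid, con, div0]

end Flat

/-! ### The product of a round 3-sphere and a flat space -/

theorem delta_self (i : Fin 8) : delta i i = 1 := by simp [delta]
theorem delta_of_ne {i j : Fin 8} (h : i ≠ j) : delta i j = 0 := by simp [delta, h]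

/-- The volume form of the first three directions. -/
def eps3 : T3 := fun i j k =>
  delta 0 i * (delta 1 j * delta 2 k - delta 2 j * delta 1 k)
    + delta 1 i * (delta 2 j * delta 0 k - delta 0 j * delta 2 k)
    + delta 2 i * (delta 0 j * delta 1 k - delta 1 j * delta 0 k)

theorem isAlt3_eps3 : IsAlt3 eps3 :=
  ⟨fun a b c => by simp only [eps3]; ring, fun a b c => by simp only [eps3]; ring⟩

theorem eps3_pair (X : T2) (m : Fin 8) : ∑ j, ∑ k, X j k * eps3 m j k =
    delta 0 m * (X 1 2 - X 2 1) + delta 1 m * (X 2 0 - X 0 2) + delta 2 m * (X 0 1 - X 1 0) := by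
  have e : ∀ i l : Fin 8, ∑ j, ∑ k, X j k * (delta i j * delta l k) = X i l := fun i l => by
    have : ∀ j k, X j k * (delta i j * delta l k) = delta i j * (delta l k * X j k) :=
      fun j k => by ring
    simp only [this, ← Finset.mul_sum, sum_delta_mul]
  have : ∀ j k, X j k * eps3 m j k =
      delta 0 m * (X j k * (delta 1 j * delta 2 k)) - delta 0 m * (X j k * (delta 2 j * delta 1 k))
      + delta 1 m * (X j k * (delta 2 j * delta 0 k)) - delta 1 m * (X j k * (delta 0 j * delta 2 k))
      + delta 2 m * (X j k * (delta 0 j * delta 1 k)) - delta 2 m * (X j k * (delta 1 j * delta 0 k))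
      := fun j k => by simp only [eps3]; ring
  simp only [this, Finset.sum_add_distrib, Finset.sum_sub_distrib, ← Finset.mul_sum, e]
  ring

/-- The projection to the first three directions. -/
def proj3 : T2 := fun a b => delta 0 a * delta 0 b + delta 1 a * delta 1 b + delta 2 a * delta 2 b

theorem proj3_comm (a b : Fin 8) : proj3 b a = proj3 a b := by simp only [proj3]; ring

theorem eps3_contract (a b c d : Fin 8) : ∑ p, eps3 a b p * eps3 c d p =
    proj3 a c * proj3 b d - proj3 a d * proj3 b c := by
  simp only [Fin.sum_univ_eight, eps3, proj3]
  simp [delta_self, delta_of_ne]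
  ring

theorem eps3_jacobi (f a b c : Fin 8) : ∑ p, (eps3 f a p * eps3 p b c + eps3 f b p * eps3 a p c
    + eps3 f c p * eps3 a b p) = 0 := by
  have h := isAlt3_eps3
  have e1 : ∀ p, eps3 p b c = eps3 b c p := fun p => alt3_rot h p b c
  have e2 : ∀ p, eps3 a p c = eps3 c a p := fun p => (alt3_rot h c a p).symm
  simp only [e1, e2, Finset.sum_add_distrib, eps3_contract]
  rw [proj3_comm a b, proj3_comm b c, proj3_comm a c]
  ring

/-- Each term of the square puts the symmetric `proj3` on two contracted indices of Φ. -/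
theorem con_quad0_eps3 : con (quad0 eps3) = 0 := by
  funext a b
  have z1 : ∀ u : Fin 8 → ℝ, ∑ p, ∑ q, ∑ r, cayley0 b p q r * (u q * proj3 p r) = 0 := fun u => by
    have : ∑ p, ∑ q, ∑ r, cayley0 b p q r * (u q * proj3 p r) =
        -∑ p, ∑ q, ∑ r, cayley0 b p q r * (u q * proj3 p r) := by
      calc _ = ∑ q, ∑ p, ∑ r, cayley0 b p q r * (u q * proj3 p r) := Finset.sum_comm
        _ = ∑ q, ∑ p, ∑ r, -(cayley0 b p q r * (u q * proj3 p r)) := by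
          refine Finset.sum_congr rfl fun q _ => Finset.sum_comm.trans ?_
          refine Finset.sum_congr rfl fun p _ => Finset.sum_congr rfl fun r _ => ?_
          rw [proj3_comm]
          linear_combination u q * proj3 p r * (cayley0_swap12 b r q p - cayley0_swap23 b q r p
            + cayley0_swap12 b q p r)
        _ = ∑ p, ∑ q, ∑ r, -(cayley0 b p q r * (u q * proj3 p r)) := Finset.sum_comm
        _ = _ := by simp only [Finset.sum_neg_distrib]
    linarith
  have z2 : ∀ u : Fin 8 → ℝ, ∑ p, ∑ q, ∑ r, cayley0 b p q r * (u r * proj3 p q) = 0 := fun u => by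
    rw [← neg_eq_zero, ← z1 u]
    simp only [← Finset.sum_neg_distrib]
    refine Finset.sum_congr rfl fun p _ => Finset.sum_comm.trans ?_
    exact Finset.sum_congr rfl fun q _ => Finset.sum_congr rfl fun r _ => by
      rw [cayley0_swap23 b p q r]; ring
  simp only [con, quad0, eps3_contract, mul_sub, Finset.sum_sub_distrib, z1, z2, sub_zero,
    Pi.zero_apply]

/-- All four contracted indices lie among three directions, so Φ always has a repeated index. -/
theorem cross0_eps3 : cross0 eps3 = 0 := by
  have z01 : ∀ a b c, cayley0 a a b c = 0 := fun a b c => by linarith [cayley0_swap01 a a b c]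
  have z12 : ∀ a b c, cayley0 a b b c = 0 := fun a b c => by linarith [cayley0_swap12 a b b c]
  have z02 : ∀ a b c, cayley0 a b a c = 0 := fun a b c => by
    linarith [cayley0_swap12 a a b c, z01 a b c]
  have z13 : ∀ a b c, cayley0 a b c b = 0 := fun a b c => by
    linarith [cayley0_swap23 a b b c, z12 a b c]
  have z03 : ∀ a b c, cayley0 a b c a = 0 := fun a b c => by
    linarith [cayley0_swap23 a b a c, z02 a b c]
  funext a b
  have e : cross0 eps3 a b = ∑ p, ∑ q, (∑ r, ∑ s, cayley0 p q r s * eps3 b r s) * eps3 a p q := by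
    simp only [cross0, Finset.sum_mul]
    exact Finset.sum_congr rfl fun _ _ => Finset.sum_congr rfl fun _ _ =>
      Finset.sum_congr rfl fun _ _ => Finset.sum_congr rfl fun _ _ => by ring
  rw [e, eps3_pair]
  simp only [eps3_pair, z12, z02, z13, z03]
  simp

theorem sq0_eps3 (a b : Fin 8) : sq0 eps3 a b = 2 * proj3 a b := by
  simp only [sq0, mul_comm (eps3 a _ _)]
  rw [eps3_pair]
  simp [eps3, delta_self, delta_of_ne, proj3]
  ring

/-- The Euler coframe of the 3-sphere. -/
def eulerCoframe (y : E8) : Matrix (Fin 8) (Fin 8) ℝ := Matrix.of fun i j =>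
  -- The first three rows are cos y₂ dy₀ + sin y₀ sin y₂ dy₁, −sin y₂ dy₀ + sin y₀ cos y₂ dy₁ and
  -- dy₂ + cos y₀ dy₁. The others are coordinate differentials.
  delta i j + (Real.cos (y 2) - 1) * (delta 0 i * delta 0 j)
    + Real.sin (y 0) * Real.sin (y 2) * (delta 0 i * delta 1 j)
    - Real.sin (y 2) * (delta 1 i * delta 0 j)
    + (Real.sin (y 0) * Real.cos (y 2) - 1) * (delta 1 i * delta 1 j)
    + Real.cos (y 0) * (delta 2 i * delta 1 j)

theorem contDiff_eulerCoframe (i j : Fin 8) : ContDiff ℝ ∞ (fun y => eulerCoframe y i j) := by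
  have c := fun k => Real.contDiff_cos.comp (contDiff_coord k) (n := ∞)
  have s := fun k => Real.contDiff_sin.comp (contDiff_coord k) (n := ∞)
  exact ((((contDiff_const.add (((c 2).sub contDiff_const).mul contDiff_const)).add
    (((s 0).mul (s 2)).mul contDiff_const)).sub ((s 2).mul contDiff_const)).add
    ((((s 0).mul (c 2)).sub contDiff_const).mul contDiff_const)).add ((c 0).mul contDiff_const)

theorem pd_eulerCoframe (x : E8) (a i j : Fin 8) : pd a (fun y => eulerCoframe y i j) x =
    -(Real.sin (x 2) * delta 2 a) * (delta 0 i * delta 0 j)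
    + (Real.cos (x 0) * delta 0 a * Real.sin (x 2) + Real.sin (x 0) * (Real.cos (x 2) * delta 2 a))
      * (delta 0 i * delta 1 j)
    - Real.cos (x 2) * delta 2 a * (delta 1 i * delta 0 j)
    + (Real.cos (x 0) * delta 0 a * Real.cos (x 2) - Real.sin (x 0) * (Real.sin (x 2) * delta 2 a))
      * (delta 1 i * delta 1 j)
    - Real.sin (x 0) * delta 0 a * (delta 2 i * delta 1 j) := by
  have hk : ∀ k : Fin 8, HasFDerivAt (fun y : E8 => y k) (EuclideanSpace.proj (𝕜 := ℝ) k) x :=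
    fun k => (EuclideanSpace.proj (𝕜 := ℝ) k).hasFDerivAt
  have hc := fun k => (hk k).cos
  have hs := fun k => (hk k).sin
  have h := (((((hasFDerivAt_const (delta i j) x).add
    (((hc 2).sub_const 1).mul_const (delta 0 i * delta 0 j))).add
    (((hs 0).mul (hs 2)).mul_const (delta 0 i * delta 1 j))).sub
    ((hs 2).mul_const (delta 1 i * delta 0 j))).add
    ((((hs 0).mul (hc 2)).sub_const 1).mul_const (delta 1 i * delta 1 j))).add
    ((hc 0).mul_const (delta 2 i * delta 1 j))
  have e : ∀ k : Fin 8, (EuclideanSpace.single a (1 : ℝ)) k = delta k a := fun k => by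
    simp [delta]
  rw [pd]
  erw [h.fderiv]
  simp [e, -PiLp.single_apply]
  ring

/-- The Maurer–Cartan equation of the 3-sphere. The structure coefficients −ε are twice the torsion,
whence −1/2. -/
theorem eulerCoframe_structure (x : E8) (m a b : Fin 8) :
    pd a (fun y => eulerCoframe y m b) x - pd b (fun y => eulerCoframe y m a) x =
    2 * pull2 (eulerCoframe x) (fun j k => ((-1 / 2 : ℝ) • eps3) j k m) a b := by
  have e : pull2 (eulerCoframe x) (fun j k => ((-1 / 2 : ℝ) • eps3) j k m) a b =
      -1 / 2 * ∑ j, ∑ k, (eulerCoframe x j a * eulerCoframe x k b) * eps3 m j k := by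
    simp only [pull2, pull1, Finset.mul_sum, Pi.smul_apply, smul_eq_mul]
    exact Finset.sum_congr rfl fun j _ => Finset.sum_congr rfl fun k _ => by
      rw [alt3_rot isAlt3_eps3 m j k]; ring
  rw [e, eps3_pair]
  have r0 : ∀ c, eulerCoframe x 0 c = Real.cos (x 2) * delta 0 c
      + Real.sin (x 0) * Real.sin (x 2) * delta 1 c := fun c => by
    simp [eulerCoframe, delta_self, delta_of_ne]; ring
  have r1 : ∀ c, eulerCoframe x 1 c = -Real.sin (x 2) * delta 0 c
      + Real.sin (x 0) * Real.cos (x 2) * delta 1 c := fun c => by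
    simp [eulerCoframe, delta_self, delta_of_ne]; ring
  have r2 : ∀ c, eulerCoframe x 2 c = delta 2 c + Real.cos (x 0) * delta 1 c := fun c => by
    simp [eulerCoframe, delta_self, delta_of_ne]
  simp only [r0, r1, r2, pd_eulerCoframe]
  linear_combination (Real.sin (x 0) * delta 2 m * (delta 0 a * delta 1 b - delta 0 b * delta 1 a))
    * Real.sin_sq_add_cos_sq (x 2)

theorem eulerCoframe_det : ∃ x, (eulerCoframe x).det ≠ 0 := by
  -- At this point of the Euler chart the coframe is the identity.
  refine ⟨EuclideanSpace.single 0 (Real.pi / 2), ?_⟩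
  have : eulerCoframe (EuclideanSpace.single 0 (Real.pi / 2)) = 1 := by
    ext i j
    simp [eulerCoframe, delta, Matrix.one_apply]
  rw [this, Matrix.det_one]
  exact one_ne_zero

/-- There are solutions of the field equations which are nowhere Einstein. -/
theorem exists_solution_not_einstein :
    ∃ (U : Set E8) (Φ : E8 → T4) (g : E8 → T2) (T : E8 → T3), IsOpen U ∧ U.Nonempty ∧
      IsSpin7On U Φ g ∧ (∀ x ∈ U, IsTorsionAt Φ g x (T x)) ∧
      (∀ x ∈ U, projTangent (g x) (Φ x) (torsionForm 0 Φ g T x) = 0) ∧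
      ∀ x ∈ U, ¬ ∃ c : ℝ, ricci g x = c • g x := by
  have hB := contDiff_eulerCoframe
  have ht : IsAlt3 ((-1 / 2 : ℝ) • eps3) := isAlt3_eps3.smul _
  have hd := eulerCoframe_structure
  have hU := isOpen_coframe hB
  have hS := isSpin7On_coframe hB
  have hT : ∀ x ∈ {y | (eulerCoframe y).det ≠ 0},
      IsTorsionAt (coframeForm eulerCoframe) (coframeMetric eulerCoframe) x
        (pull3 (eulerCoframe x) ((-1 / 2 : ℝ) • eps3)) := fun x hx =>
    isTorsionAt_coframe hB ht hd hx
  have h0 : ∀ x ∈ {y | (eulerCoframe y).det ≠ 0}, nabla3 (coframeMetric eulerCoframe)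
      (fun y => pull3 (eulerCoframe y) ((-1 / 2 : ℝ) • eps3)) x = 0 := fun x hx =>
    nabla3_coframe hB ht hd hx fun f a b c => by
      have := eps3_jacobi f a b c
      simp only [Finset.sum_add_distrib, Pi.smul_apply, smul_eq_mul, mul_mul_mul_comm (-1 / 2 : ℝ),
        ← Finset.mul_sum] at this ⊢
      linear_combination (1 / 4 : ℝ) * this
  have q : quad0 ((-1 / 2 : ℝ) • eps3) = (1 / 4 : ℝ) • quad0 eps3 := by
    funext a b c d
    simp only [quad0, Pi.smul_apply, smul_eq_mul, Finset.mul_sum]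
    exact Finset.sum_congr rfl fun _ _ => by ring
  have s : sq0 ((-1 / 2 : ℝ) • eps3) = (1 / 4 : ℝ) • sq0 eps3 := by
    funext a b
    simp only [sq0, Pi.smul_apply, smul_eq_mul, Finset.mul_sum]
    exact Finset.sum_congr rfl fun _ _ => Finset.sum_congr rfl fun _ _ => by ring
  have c : cross0 ((-1 / 2 : ℝ) • eps3) = (1 / 4 : ℝ) • cross0 eps3 := by
    funext a b
    simp only [cross0, Pi.smul_apply, smul_eq_mul, Finset.mul_sum]
    exact Finset.sum_congr rfl fun _ _ => Finset.sum_congr rfl fun _ _ =>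
      Finset.sum_congr rfl fun _ _ => Finset.sum_congr rfl fun _ _ => by ring
  have cq : con (quad0 ((-1 / 2 : ℝ) • eps3)) = 0 := by
    rw [q, con_smul, con_quad0_eps3, smul_zero]
  have qs : quadScalar0 ((-1 / 2 : ℝ) • eps3) = 0 := by
    refine (tr0_con (quad0 ((-1 / 2 : ℝ) • eps3))).symm.trans ?_
    rw [cq]; simp [tr0]
  refine ⟨_, _, _, _, hU, eulerCoframe_det, hS, hT, fun x hx => ?_, fun x hx ⟨r, hr⟩ => ?_⟩
  · have hF := isFrame_coframe hx
    rw [torsionForm_eq hS 0 _ hx, projTangent_eulerForm' hU hS _ _ (fun y hy => (hT y hy).1) hx,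
      h0 x hx]
    apply hF.pull2_inj
    rw [hF.pull_fieldTensor, pull3_pull3, hF.mul_eq_one, pull3_one, pull4_zero, pull2_zero]
    funext a b
    simp [field0, cq, c, cross0_eps3, qs, con, conMid]
  · have hF := isFrame_coframe hx
    have e := ricci_of_nabla3_eq_zero hU hS hT hx hF (h0 x hx)
    rw [hr, pull2_smul, hF.metric_eq, pull3_pull3, hF.mul_eq_one, pull3_one, cq, s] at e
    -- In the frame the Ricci tensor is half of `proj3`: its entry is 1/2 in a sphere direction and
    -- 0 in a flat one.
    have e0 := congrFun (congrFun e 0) 0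
    have e7 := congrFun (congrFun e 7) 7
    simp [sq0_eps3, proj3, delta_self, delta_of_ne] at e0 e7
    rw [e7] at e0
    norm_num at e0

end Spin7
end

/-! ### The results in an arbitrary chart -/

open Spin7
theorem mainTheorem2 {M : Type*} [TopologicalSpace M] [ChartedSpace E8 M] [IsManifold (𝓡 8) ∞ M]
    (S : Spin7Structure M) :
    -- all statements are about an arbitrary chart of the given manifold
    (∀ e ∈ atlas E8 M, ∀ (Φ : E8 → T4) (g : E8 → T2),
      Φ = chart4 e S.form → g = chart2 e S.metric →
      -- the intrinsic torsion is given by a unique 3-form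
      (∀ x ∈ e.target, ∃! t : T3, IsTorsionAt Φ g x t) ∧
      -- projecting a 4-form onto `Λ⁴_{1+7+35}` amounts to a contraction with `Φ`, which takes
      -- values in a space of dimension `36 + 7 = 43` and is onto it
      (∀ x ∈ e.target,
        Module.finrank ℝ symTensors = 36 ∧ Module.finrank ℝ (Lambda2_7 (g x) (Φ x)) = 7 ∧
        Module.finrank ℝ (valueSpace (g x) (Φ x)) = 43 ∧
        (∀ σ : T4, IsAlt4 σ →
          contract (g x) (Φ x) σ ∈ valueSpace (g x) (Φ x) ∧
          (projTangent (g x) (Φ x) σ = 0 ↔ contract (g x) (Φ x) σ = 0) ∧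
          (proj1 (g x) (Φ x) σ + proj35 (g x) (Φ x) σ = 0 ↔
            symPart (contract (g x) (Φ x) σ) = 0) ∧
          (proj7 (g x) (Φ x) σ = 0 ↔ skewPart (contract (g x) (Φ x) σ) = 0)) ∧
        (∀ B ∈ valueSpace (g x) (Φ x), ∃ σ : T4, IsAlt4 σ ∧ contract (g x) (Φ x) σ = B)) ∧
      -- the projected field equations for general `κ`
      (∀ (κ Λ : ℝ) (C : E8 → T3), ContDiffOn ℝ ∞ C e.target →
        (∀ x ∈ e.target, IsAlt3 (C x)) → ∀ x ∈ e.target,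
        contract (g x) (Φ x) (eulerForm' κ Λ Φ g C x) =
          fieldTensor κ Λ (g x) (Φ x) (C x) (nabla3 g C x) ∧
        (projTangent (g x) (Φ x) (eulerForm κ Λ Φ g C x) = 0 ↔
          projTangent (g x) (Φ x) (eulerForm' κ Λ Φ g C x) = 0) ∧
        (projTangent (g x) (Φ x) (eulerForm κ Λ Φ g C x) = 0 ↔
          fieldTensor κ Λ (g x) (Φ x) (C x) (nabla3 g C x) = 0) ∧
        fieldTensor κ Λ (g x) (Φ x) (C x) (partial3 C x) =
          fieldTensor κ Λ (g x) (Φ x) (C x) (nabla3 g C x) ∧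
        fieldTensor κ Λ (g x) (Φ x) (C x) (nabla3 g C x) ∈ valueSpace (g x) (Φ x)) ∧
      -- the case `κ = 0`, `C = T`
      (∀ (lam : ℝ) (T : E8 → T3), (∀ x ∈ e.target, IsTorsionAt Φ g x (T x)) →
        ContDiffOn ℝ ∞ T e.target ∧ ∀ x ∈ e.target,
        torsionForm lam Φ g T x = eulerForm' 0 (2 * lam) Φ g T x ∧
        contract (g x) (Φ x) (torsionForm lam Φ g T x) =
          torsionFieldTensor lam (g x) (Φ x) (T x) (nabla3 g T x) ∧
        (projTangent (g x) (Φ x) (torsionForm lam Φ g T x) = 0 ↔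
          torsionFieldTensor lam (g x) (Φ x) (T x) (nabla3 g T x) = 0) ∧
        torsionFieldTensor lam (g x) (Φ x) (T x) (partial3 T x) =
          torsionFieldTensor lam (g x) (Φ x) (T x) (nabla3 g T x) ∧
        -- antisymmetric part
        skewPart (torsionFieldTensor lam (g x) (Φ x) (T x) (nabla3 g T x)) ∈
          Lambda2_7 (g x) (Φ x) ∧
        (skewPart (torsionFieldTensor lam (g x) (Φ x) (T x) (nabla3 g T x)) = 0 ↔
          divTorsion7 Φ g T x = 0) ∧
        -- trace part
        (trace (g x) (torsionFieldTensor lam (g x) (Φ x) (T x) (nabla3 g T x)) = 0 ↔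
          scalarCurvature g x = (7 / 6) * normSq (g x) (proj48 (g x) (Φ x) (T x)) + 4 * lam) ∧
        -- symmetric part
        (symPart (torsionFieldTensor lam (g x) (Φ x) (T x) (nabla3 g T x)) = 0 ↔
          (3 : ℝ) • ricci g x = ricciSource lam Φ g T x))) ∧
    -- the 43 equations are independent: at a point, their left-hand side takes every value in the
    -- 43-dimensional space; in particular it is not automatically symmetric
    (∀ (lam : ℝ), ∀ B ∈ valueSpace delta cayley0,
      ∃ (U : Set E8) (Φ : E8 → T4) (g : E8 → T2) (T : E8 → T3), IsOpen U ∧ 0 ∈ U ∧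
        IsSpin7On U Φ g ∧ (∀ x ∈ U, IsTorsionAt Φ g x (T x)) ∧ Φ 0 = cayley0 ∧ g 0 = delta ∧
        torsionFieldTensor lam (g 0) (Φ 0) (T 0) (nabla3 g T 0) = B) ∧
    (∃ B ∈ valueSpace delta cayley0, ∃ a b, B a b ≠ B b a) ∧
    -- there are solutions (here with `λ = 0`) that are nowhere Einstein
    (∃ (U : Set E8) (Φ : E8 → T4) (g : E8 → T2) (T : E8 → T3), IsOpen U ∧ U.Nonempty ∧
      IsSpin7On U Φ g ∧ (∀ x ∈ U, IsTorsionAt Φ g x (T x)) ∧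
      (∀ x ∈ U, projTangent (g x) (Φ x) (torsionForm 0 Φ g T x) = 0) ∧
      ∀ x ∈ U, ¬ ∃ c : ℝ, ricci g x = c • g x) := by
  refine ⟨?_, exists_torsionFieldTensor_eq, exists_not_symm, exists_solution_not_einstein⟩
  -- The manifold enters only here: chart components form a Spin(7) structure on an open subset of
  -- ℝ⁸.
  rintro e he Φ g rfl rfl
  have hU : IsOpen e.target := e.open_target
  have hS := S.isSpin7 e he
  refine ⟨fun x hx => existsUnique_torsion hU hS hx, fun x hx => ?_, fun κ Λ C hC hA x hx => ?_,
    fun lam T hT => ⟨contDiffOn_torsion hU hS hT, fun x hx => ?_⟩⟩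
  · obtain ⟨A, E, h⟩ := hS.exists_isFrame hx
    exact ⟨finrank_symTensors, h.finrank_Lambda2_7, h.finrank_valueSpace,
      fun σ hσ => ⟨h.contract_mem hσ, h.projTangent_eq_zero_iff hσ,
        h.proj1_add_proj35_eq_zero_iff hσ, h.proj7_eq_zero_iff hσ⟩,
      fun B hB => h.exists_contract_eq hB⟩
  · exact ⟨(contract_eulerForm' hU hS κ Λ hA hx).trans (fieldTensor_partial3 hU hS κ Λ hA hx),
      projTangent_eulerForm hU hS κ Λ hA hx,
      (projTangent_eulerForm hU hS κ Λ hA hx).trans (projTangent_eulerForm' hU hS κ Λ hA hx),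
      fieldTensor_partial3 hU hS κ Λ hA hx, fieldTensor_mem hU hS κ Λ hA hx⟩
  · have hA := fun y hy => (hT y hy).1
    have h1 := torsionForm_eq hS lam T hx
    have h2 := fieldTensor_mem hU hS 0 (2 * lam) hA hx
    rw [← torsionFieldTensor_eq] at h2
    refine ⟨h1, ?_, ?_, ?_, mem_valueSpace_iff.1 h2, ?_, ?_, ?_⟩
    · rw [h1, torsionFieldTensor_eq]
      exact (contract_eulerForm' hU hS 0 _ hA hx).trans (fieldTensor_partial3 hU hS 0 _ hA hx)
    · rw [h1, torsionFieldTensor_eq]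
      exact projTangent_eulerForm' hU hS 0 _ hA hx
    · rw [torsionFieldTensor_eq, torsionFieldTensor_eq]
      exact fieldTensor_partial3 hU hS 0 _ hA hx
    · rw [skewPart_torsionFieldTensor hU hS hT hx lam, smul_eq_zero]
      norm_num
    · rw [trace_torsionFieldTensor hU hS hT hx lam, sub_eq_zero, eq_comm]
    · rw [← sub_eq_zero (b := ricciSource _ _ _ _ _), three_ricci_sub hU hS hT hx lam, smul_eq_zero]
      norm_num
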